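/- A connected graph $\Gamma$ of diameter $D$ is distance-regular with intersection array $\{b_0,\dots,b_{D-1};c_1,\dots,c_D\}$ if, for all vertices $u,v$ at distance $i$, the vertex $v$ has exactly $b_i$ neighbours at distance $i+1$ from $u$ and exactly $c_i$ neighbours at distance $i-1$ from $u$ (with $b_D=c_0=0$). An additive code over a finite field $\mathbb{F}_q$ is a subgroup $C$ of the additive group of $\mathbb{F}_q^n$ (linear codes are a special case); its coset graph has the cosets of $C$ as vertices, two cosets being adjacent if their difference is a coset whose minimum Hamming weight is $1$. The code $C$ is completely regular with intersection array $\{b_0,\dots,b_{\rho-1};c_1,\dots,c_\rho\}$ if it has covering radius $\rho$ and the partition of $\mathbb{F}_q^n$ by the Hamming distance to $C$ is equitable in the Hamming graph $H(n,q)$, where each vertex at distance $i$ from $C$ has $b_i$ neighbours at distance $i+1$ from $C$ if $i<\rho$, and $c_i$ neighbours at distance $i-1$ from $C$ if $i\ge 1$. Consider the following intersection arrays, which are the arrays of prime-power order listed as unsolved in the tables of Chapter 14 of Brouwer, Cohen and Neumaier, *Distance-Regular Graphs* (1989), apart from the two arrays $\{31,30,17;1,2,15\}$ and $\{33,30,15;1,2,15\}$,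 for which a graph is known: $$\{140,126,20,1;1,10,126,140\},\ \{22,16,5;1,2,20\},\ \{25,24,3;1,3,20\},\ \{26,24,19;1,3,8\},$$ $$\{32,28,9;1,2,28\},\ \{36,28,4;1,2,24\},\ \{42,30,12;1,6,28\},\ \{44,36,5;1,9,40\},\ \{48,35,9;1,7,40\},$$ $$\{52,42,16;1,6,28\},\ \{56,42,20;1,6,28\},\ \{63,48,10;1,8,54\},\ \{80,63,11;1,9,70\},\ \{104,66,8;1,12,88\}.$$ For every array $A$ in this list: 1. no Cayley graph on a finite elementary abelian group (of any prime exponent $p$, with an inverse-closed connection set not containing the identity) is distance-regular with intersection array $A$; 2. no coset graph of an additive code over a finite field, of any length, is distance-regular with intersection array $A$; in particular, none of an additive or linear completely regular code is; 3. no additive code over a finite field, of any length, is completely regular with intersection array $A$ in its Hamming graph. -/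

import Mathlib

namespace DRG

/-- An intersection array `{b₀, …, b_{D-1}; c₁, …, c_D}`, written as two lists. -/
structure IntersectionArray where
  b : List ℕ
  c : List ℕ

/-- The intersection number `b_i`, with `b_i = 0` for `i ≥ D`. -/
def IntersectionArray.bNum (A : IntersectionArray) (i : ℕ) : ℕ := A.b.getD i 0

/-- The intersection number `c_i`, with `c_0 = 0`. -/
def IntersectionArray.cNum (A : IntersectionArray) (i : ℕ) : ℕ := (0 :: A.c).getD i 0

/-- `Γ` is a distance-regular graph with intersection array `A`: it is connected, its diameter is
the length of the array, and for any two vertices `u`, `v` at distance `i`, the vertex `v` has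
exactly `b_i` neighbours at distance `i + 1` from `u` and exactly `c_i` neighbours at distance
`i - 1` from `u`. -/
def IsDistanceRegularWith {V : Type*} (Γ : SimpleGraph V) (A : IntersectionArray) : Prop :=
  Γ.Connected ∧ A.c.length = A.b.length ∧ Γ.diam = A.b.length ∧
    ∀ u v : V,
      {w | Γ.Adj v w ∧ Γ.dist u w = Γ.dist u v + 1}.ncard = A.bNum (Γ.dist u v) ∧
      {w | Γ.Adj v w ∧ Γ.dist u w + 1 = Γ.dist u v}.ncard = A.cNum (Γ.dist u v)

/-- The Hamming graph `H(n, q)` on `F ^ n`, where `q` is the order of `F`. -/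
def hammingGraph (n : ℕ) (F : Type*) [DecidableEq F] : SimpleGraph (Fin n → F) where
  Adj x y := hammingDist x y = 1
  symm := ⟨fun x y h => by rw [hammingDist_comm]; exact h⟩
  loopless := ⟨fun x h => by simp at h⟩

/-- The distance from a vertex to a (nonempty) set of vertices. -/
noncomputable def distToSet {V : Type*} (Γ : SimpleGraph V) (C : Set V) (v : V) : ℕ :=
  sInf ((fun c => Γ.dist v c) '' C)

/-- The partition of the vertices into the fibres of `P` is equitable, with quotient matrix `S`. -/
def IsEquitable {V : Type*} (Γ : SimpleGraph V) (P : V → ℕ) (S : ℕ → ℕ → ℕ) : Prop :=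
  ∀ (v : V) (j : ℕ), {w | Γ.Adj v w ∧ P w = j}.ncard = S (P v) j

/-- `C` is a completely regular code in `Γ` with intersection array `A`: the covering radius of
`C` is the length of the array, and the distance partition with respect to `C` is equitable with
quotient matrix `S` such that `S_{i,i+1} = b_i` and `S_{i+1,i} = c_{i+1}`. -/
def IsCompletelyRegularWith {V : Type*} (Γ : SimpleGraph V) (C : Set V)
    (A : IntersectionArray) : Prop :=
  C.Nonempty ∧ A.c.length = A.b.length ∧
    (∀ v, distToSet Γ C v ≤ A.b.length) ∧ (∃ v, distToSet Γ C v = A.b.length) ∧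
    ∃ S : ℕ → ℕ → ℕ, IsEquitable Γ (distToSet Γ C) S ∧
      ∀ i < A.b.length, S i (i + 1) = A.bNum i ∧ S (i + 1) i = A.cNum (i + 1)

/-- The weight of a coset of an additive code: the least Hamming weight of its elements. -/
noncomputable def cosetWeight {n : ℕ} {F : Type*} [Field F] [DecidableEq F]
    (C : AddSubgroup (Fin n → F)) (a : (Fin n → F) ⧸ C) : ℕ :=
  sInf {k | ∃ x : Fin n → F, (x : (Fin n → F) ⧸ C) = a ∧ hammingNorm x = k}

theorem cosetWeight_neg {n : ℕ} {F : Type*} [Field F] [DecidableEq F]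
    (C : AddSubgroup (Fin n → F)) (a : (Fin n → F) ⧸ C) :
    cosetWeight C (-a) = cosetWeight C a := by
  have hn : ∀ x : Fin n → F, hammingNorm (-x) = hammingNorm x := fun x => by
    simp [hammingNorm]
  unfold cosetWeight
  congr 1
  ext k
  constructor
  · rintro ⟨x, hx, rfl⟩
    exact ⟨-x, by rw [QuotientAddGroup.mk_neg, hx, neg_neg], hn x⟩
  · rintro ⟨x, hx, rfl⟩
    exact ⟨-x, by rw [QuotientAddGroup.mk_neg, hx], hn x⟩

theorem cosetWeight_zero {n : ℕ} {F : Type*} [Field F] [DecidableEq F]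
    (C : AddSubgroup (Fin n → F)) : cosetWeight C 0 = 0 :=
  Nat.sInf_eq_zero.mpr (Or.inl ⟨0, rfl, hammingNorm_zero⟩)

/-- The coset graph of an additive code `C`: the vertices are the cosets of `C`, and two cosets
are adjacent if their difference is a coset of weight one. -/
def cosetGraph {n : ℕ} {F : Type*} [Field F] [DecidableEq F]
    (C : AddSubgroup (Fin n → F)) : SimpleGraph ((Fin n → F) ⧸ C) where
  Adj a b := cosetWeight C (a - b) = 1
  symm := ⟨fun a b h => by rw [← neg_sub, cosetWeight_neg]; exact h⟩
  loopless := ⟨fun a h => by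
    rw [sub_self, cosetWeight_zero] at h
    exact zero_ne_one h⟩

/-- The arrays of prime-power order listed as unsolved in Chapter 14 of Brouwer, Cohen and
Neumaier, "Distance-Regular Graphs", other than the two, `{31,30,17;1,2,15}` and
`{33,30,15;1,2,15}`, for which a graph is known. -/
def openArrays : List IntersectionArray :=
  [ ⟨[140, 126, 20, 1], [1, 10, 126, 140]⟩,
    ⟨[22, 16, 5], [1, 2, 20]⟩,
    ⟨[25, 24, 3], [1, 3, 20]⟩,
    ⟨[26, 24, 19], [1, 3, 8]⟩,
    ⟨[32, 28, 9], [1, 2, 28]⟩,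
    ⟨[36, 28, 4], [1, 2, 24]⟩,
    ⟨[42, 30, 12], [1, 6, 28]⟩,
    ⟨[44, 36, 5], [1, 9, 40]⟩,
    ⟨[48, 35, 9], [1, 7, 40]⟩,
    ⟨[52, 42, 16], [1, 6, 28]⟩,
    ⟨[56, 42, 20], [1, 6, 28]⟩,
    ⟨[63, 48, 10], [1, 8, 54]⟩,
    ⟨[80, 63, 11], [1, 9, 70]⟩,
    ⟨[104, 66, 8], [1, 12, 88]⟩ ]

end DRG

/-! All three kinds of objects reduce to one: a function `d` on a finite abelian group V of prime
exponent that behaves like the distance from 0 in a translation-invariant distance-regular graph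
(`TranslationDistance`). For Cayley graphs and coset graphs this is invariance under translation.
For a completely regular additive code, the distance to the code descends to the quotient by the
code; since c_1 = 1, the weight-one vectors outside the code lie in distinct cosets, so that the
quotient inherits the array.

Let S be the connection set, the set of vectors with d = 1. Nine arrays fall to a symmetry of
representations. Exchanging the summands in v = s + t is an involution, so if the number of
representations is odd then v = 2s for some s in S (`exists_add_self_eq`). Rotating v = s + t + u
has order three, so if the number of triples is not divisible by 3 then v = 3s (`exists_three_eq`).
Either way a whole distance class has at most |S| vectors, which is false.

In the other five arrays the order is 5^4, 7^3, 3^6, 3^6, 3^7, and S is closed under nonzero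
scalars, so it is a set of points of a projective space. A functional f is a sum of characters and
gives an integral eigenvalue; this leaves few values for |S ∩ ker f| (`exists_eigenvalue`).
Averaging over the functionals that vanish on a subspace counts S inside that subspace
(`sum_dualSlice_kerSum`).

{52,42,16;1,6,28}: the count for the span of two points of S has no integral solution.
{42,30,12;1,6,28}: S is a set of seven points of PG(2,7) that every line meets in 0, 1 or 3 points,
thus a Fano plane, which needs characteristic two.

{104,66,8;1,12,88}: a three-dimensional subspace rich in vectors at distance three (`card_plane`)
leads to a functional o with few zeros in that class; the pencils through o then have forced types,
which do not fit together.

{56,42,20;1,6,28}: every point of S lies on a line contained in S (`Array56.exists_mem_triples`).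
Otherwise six collinear triples through a point describe all of S, and some hyperplane is met
wrongly. On the other hand, S is not a union of lines (`Array56.not_forall_exists_line`): any two
disjoint lines span a third one, and three lines in general position determine all 56 vectors, with
a contradiction.

{140,126,20,1;1,10,126,140}: the quotient by the antipodal class has array {140,126;1,30} and order
3^6. For a point s of S, the functionals through s with eigenvalue -22 are unique up to coordinate
permutations (`Array140.IsLocalSystem.exists_perm`), and they give the number of vectors of S in
each coset of the line of s. What remains unknown is the position of these vectors in their cosets,
a labelling of 63 linear forms by elements of F_3. A search with stored certificates, checked by the
kernel, excludes it (`Array140.not_isLabelling`). -/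

namespace DRG

open Finset

/-- The distance function `d x = dist 0 x` of a translation-invariant distance-regular graph with
intersection array `A` on a finite abelian group. -/
structure TranslationDistance {V : Type*} [AddCommGroup V] [Fintype V]
    (A : IntersectionArray) (d : V → ℕ) : Prop where
  eq_zero_iff : ∀ x, d x = 0 ↔ x = 0
  neg : ∀ x, d (-x) = d x
  le : ∀ x, d x ≤ A.b.length
  exists_eq : ∃ x, d x = A.b.length
  add_le : ∀ v s, d s = 1 → d (v + s) ≤ d v + 1
  card_b : ∀ v, #{s | d s = 1 ∧ d (v + s) = d v + 1} = A.bNum (d v)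
  card_c : ∀ v, #{s | d s = 1 ∧ d (v + s) + 1 = d v} = A.cNum (d v)

/-! ### From graphs and codes to distance functions on groups -/

section Reduction

theorem dist_le_dist_of_hom {V W : Type*} {G : SimpleGraph V} {H : SimpleGraph W} (f : G →g H)
    (hG : G.Connected) (u v : V) : H.dist (f u) (f v) ≤ G.dist u v := by
  obtain ⟨w, hw⟩ := hG.exists_walk_length_eq_dist u v
  rw [← hw, ← SimpleGraph.Walk.length_map f w]
  exact SimpleGraph.dist_le _

/-- Homomorphisms do not increase distances; `f` gives one inequality and its left inverse `g` the
other. -/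
theorem dist_eq_dist_of_adj_iff {V : Type*} {G : SimpleGraph V} (hG : G.Connected) (f g : V → V)
    (hf : ∀ u v, G.Adj u v → G.Adj (f u) (f v)) (hg : ∀ u v, G.Adj u v → G.Adj (g u) (g v))
    (hgf : ∀ u, g (f u) = u) (u v : V) : G.dist (f u) (f v) = G.dist u v := by
  refine le_antisymm (dist_le_dist_of_hom ⟨f, fun {a b} h => hf a b h⟩ hG u v) ?_
  have := dist_le_dist_of_hom (G := G) (H := G) ⟨g, fun {a b} h => hg a b h⟩ hG (f u) (f v)
  simpa [hgf] using this

theorem dist_add_left {V : Type*} [AddCommGroup V] {G : SimpleGraph V} (hG : G.Connected)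
    (hadj : ∀ g u v, G.Adj u v → G.Adj (g + u) (g + v)) (g u v : V) :
    G.dist (g + u) (g + v) = G.dist u v :=
  dist_eq_dist_of_adj_iff hG (g + ·) (-g + ·) (hadj g) (hadj (-g)) (by simp) u v

theorem translationDistance_of_isDistanceRegularWith {V : Type*} [AddCommGroup V] [Fintype V]
    {G : SimpleGraph V} {A : IntersectionArray} (hadj : ∀ g u v, G.Adj u v → G.Adj (g + u) (g + v))
    (h : IsDistanceRegularWith G A) : TranslationDistance A (G.dist 0) := by
  obtain ⟨hc, -, hdiam, hreg⟩ := h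
  have htr := dist_add_left hc hadj
  have hone : ∀ v s, G.Adj v (v + s) ↔ G.dist 0 s = 1 := fun v s => by
    rw [SimpleGraph.dist_eq_one_iff_adj]
    exact ⟨fun h => by simpa using hadj (-v) _ _ h, fun h => by simpa using hadj v _ _ h⟩
  -- The neighbours of v are the v + s with s in the connection set, so counts of neighbours become
  -- counts of s.
  have hcard : ∀ (v : V) (P : V → Prop) [DecidablePred P],
      #{s | G.dist 0 s = 1 ∧ P (v + s)} = {w | G.Adj v w ∧ P w}.ncard := fun v P _ => by
    rw [← Set.ncard_coe_finset]
    have : {w | G.Adj v w ∧ P w} =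
        (v + ·) '' ((({s | G.dist 0 s = 1 ∧ P (v + s)} : Finset V) : Set V)) := by
      ext w
      simp only [Set.mem_ofPred_eq, coe_filter, mem_univ, true_and, Set.mem_image]
      constructor
      · intro hw
        exact ⟨-v + w, by rw [← hone v]; simpa using hw, by simp⟩
      · rintro ⟨s, hs, rfl⟩
        rwa [hone]
    rw [this, Set.ncard_image_of_injective _ (add_right_injective v)]
  have hne : G.ediam ≠ ⊤ := SimpleGraph.connected_iff_ediam_ne_top.mp hc
  refine ⟨fun x => ?_, fun x => ?_, fun x => ?_, ?_, fun v s hs => ?_, fun v => ?_, fun v => ?_⟩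
  · rw [hc.dist_eq_zero_iff, eq_comm]
  · have := htr x 0 (-x)
    rw [← this, add_zero, add_neg_cancel, SimpleGraph.dist_comm]
  · rw [← hdiam]
    exact SimpleGraph.dist_le_diam hne
  · obtain ⟨u, v, huv⟩ := G.exists_dist_eq_diam
    refine ⟨-u + v, ?_⟩
    rw [← hdiam, ← huv, ← htr (-u) u v, neg_add_cancel]
  · rw [← hone v, ← SimpleGraph.dist_eq_one_iff_adj] at hs
    rw [← hs]
    exact hc.dist_triangle
  · rw [hcard v fun w => G.dist 0 w = G.dist 0 v + 1]
    exact (hreg 0 v).1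
  · rw [hcard v fun w => G.dist 0 w + 1 = G.dist 0 v]
    exact (hreg 0 v).2

theorem cosetGraph_adj_add {n : ℕ} {F : Type*} [Field F] [DecidableEq F]
    (C : AddSubgroup (Fin n → F)) (g u v : (Fin n → F) ⧸ C) (h : (cosetGraph C).Adj u v) :
    (cosetGraph C).Adj (g + u) (g + v) := by
  change cosetWeight C _ = 1
  rw [add_sub_add_left_eq_sub]
  exact h

theorem hammingGraph_connected (n : ℕ) (F : Type*) [Field F] [DecidableEq F] :
    (hammingGraph n F).Connected := by
  have : ∀ (k : ℕ) (x y : Fin n → F), hammingDist x y = k → (hammingGraph n F).Reachable x y := by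
    intro k
    induction k using Nat.strong_induction_on with
    | _ k ih =>
      intro x y hk
      by_cases hxy : x = y
      · rw [hxy]
      obtain ⟨i, hi⟩ := Function.ne_iff.mp hxy
      have hadj : (hammingGraph n F).Adj x (Function.update x i (y i)) := by
        change hammingDist _ _ = 1
        rw [hammingDist, card_eq_one]
        refine ⟨i, ?_⟩
        ext l
        by_cases hl : l = i
        · subst hl; simp [hi]
        · simp [hl]
      refine hadj.reachable.trans (ih _ ?_ _ _ rfl)
      rw [← hk]
      refine card_lt_card (ssubset_iff_of_subset ?_ |>.mpr ⟨i, by simp [hi], by simp⟩)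
      intro l
      by_cases hl : l = i
      · subst hl; simp
      · simp [hl]
  exact ⟨fun x y => this _ x y rfl⟩

theorem hammingGraph_adj_iff {n : ℕ} {F : Type*} [Field F] [DecidableEq F] {x y : Fin n → F} :
    (hammingGraph n F).Adj x y ↔ (hammingGraph n F).Adj 0 (y - x) := by
  change hammingDist x y = 1 ↔ hammingDist 0 (y - x) = 1
  simp only [hammingDist, Pi.zero_apply, Pi.sub_apply, ne_eq, eq_comm (a := (0 : F)), sub_eq_zero,
    eq_comm (a := x _)]

theorem hammingGraph_adj_neg {n : ℕ} {F : Type*} [Field F] [DecidableEq F] {x y : Fin n → F}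
    (h : (hammingGraph n F).Adj x y) : (hammingGraph n F).Adj (-x) (-y) := by
  rw [SimpleGraph.adj_comm, hammingGraph_adj_iff] at h
  rw [hammingGraph_adj_iff]
  rwa [← neg_sub_neg] at h

theorem hammingGraph_adj_add {n : ℕ} {F : Type*} [Field F] [DecidableEq F] (g x y : Fin n → F)
    (h : (hammingGraph n F).Adj x y) : (hammingGraph n F).Adj (g + x) (g + y) := by
  rw [hammingGraph_adj_iff] at h ⊢
  rwa [add_sub_add_left_eq_sub]

theorem distToSet_image {V : Type*} {G : SimpleGraph V} (hG : G.Connected) (C : Set V)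
    (f g : V → V) (hf : ∀ u v, G.Adj u v → G.Adj (f u) (f v))
    (hg : ∀ u v, G.Adj u v → G.Adj (g u) (g v)) (hgf : ∀ u, g (f u) = u) (hC : f '' C = C) (v : V) :
    distToSet G C (f v) = distToSet G C v := by
  unfold distToSet
  conv_lhs => rw [← hC, Set.image_image]
  simp only [dist_eq_dist_of_adj_iff hG f g hf hg hgf]

theorem exists_dist_eq_distToSet {V : Type*} (G : SimpleGraph V) {C : Set V} (hC : C.Nonempty)
    (v : V) : ∃ c ∈ C, G.dist v c = distToSet G C v :=
  Nat.sInf_mem (hC.image fun c => G.dist v c)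

theorem distToSet_le {V : Type*} (G : SimpleGraph V) {C : Set V} {c : V} (hc : c ∈ C) (v : V) :
    distToSet G C v ≤ G.dist v c :=
  Nat.sInf_le ⟨c, hc, rfl⟩

theorem distToSet_le_add_one {V : Type*} {G : SimpleGraph V} (hG : G.Connected) {C : Set V}
    (hC : C.Nonempty) {v w : V} (h : G.Adj v w) : distToSet G C w ≤ distToSet G C v + 1 := by
  obtain ⟨c, hc, hcv⟩ := exists_dist_eq_distToSet G hC v
  have h1 := distToSet_le G hc w
  have h2 : G.dist w c ≤ G.dist w v + G.dist v c := hG.dist_triangle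
  rw [SimpleGraph.dist_eq_one_iff_adj.mpr h.symm, hcv] at h2
  omega

theorem distToSet_eq_zero_iff {V : Type*} {G : SimpleGraph V} (hG : G.Connected) {C : Set V}
    (hC : C.Nonempty) {v : V} : distToSet G C v = 0 ↔ v ∈ C := by
  constructor
  · intro h
    obtain ⟨c, hc, hcv⟩ := exists_dist_eq_distToSet G hC v
    rw [h, hG.dist_eq_zero_iff] at hcv
    exact hcv ▸ hc
  · intro h
    simpa using distToSet_le G h v

/-- The distance to C is invariant under C, hence a function on the cosets. The condition c_1 = 1
makes the weight-one vectors outside C inequivalent modulo C, so that counting steps in the Hamming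
graph and counting steps in the quotient agree. -/
theorem translationDistance_of_isCompletelyRegularWith {n : ℕ} {F : Type*} [Field F]
    [DecidableEq F] (C : AddSubgroup (Fin n → F)) [Fintype ((Fin n → F) ⧸ C)]
    {A : IntersectionArray} (hb : A.b ≠ []) (hc : A.cNum 1 = 1)
    (h : IsCompletelyRegularWith (hammingGraph n F) (C : Set (Fin n → F)) A) :
    ∃ d : (Fin n → F) ⧸ C → ℕ, TranslationDistance A d := by
  obtain ⟨hne, -, hle, htop, S, hS, hSA⟩ := h
  set G := hammingGraph n F with hGdef
  have hG : G.Connected := hammingGraph_connected n F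
  set P := distToSet G (C : Set (Fin n → F)) with hP
  have hlen : 0 < A.b.length := List.length_pos_iff.mpr hb
  have hadd : ∀ c ∈ C, ∀ v, P (c + v) = P v := fun c hc v => by
    refine distToSet_image hG _ (c + ·) (-c + ·) (hammingGraph_adj_add c)
      (hammingGraph_adj_add (-c)) (by simp) ?_ v
    ext x
    simp only [Set.mem_image, SetLike.mem_coe]
    exact ⟨fun ⟨y, hy, hyx⟩ => hyx ▸ C.add_mem hc hy,
      fun hx => ⟨-c + x, C.add_mem (C.neg_mem hc) hx, by simp⟩⟩
  have hneg : ∀ v, P (-v) = P v := fun v => by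
    refine distToSet_image hG _ (- ·) (- ·) (fun _ _ => hammingGraph_adj_neg)
      (fun _ _ => hammingGraph_adj_neg) (by simp) ?_ v
    ext x
    simp
  let d : (Fin n → F) ⧸ C → ℕ := Quotient.lift P fun x y hxy => by
    have hm : -x + y ∈ C := QuotientAddGroup.leftRel_apply.mp hxy
    rw [← hadd _ hm x]
    congr 1
    abel
  have hd : ∀ x : Fin n → F, d (x : (Fin n → F) ⧸ C) = P x := fun x => rfl
  have hP0 : ∀ v, P v = 0 ↔ v ∈ C := fun v => distToSet_eq_zero_iff hG hne
  have hP1 : ∀ e, G.Adj 0 e → e ∉ C → P e = 1 := fun e he heC => by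
    have h1 := distToSet_le_add_one hG hne he
    have h2 := (hP0 0).mpr C.zero_mem
    have h3 := mt (hP0 e).mp heC
    simp only [← hP] at h1
    omega
  -- Both 0 and e - e' are codewords adjacent to e, and c_1 = 1 allows only one.
  have huniq : ∀ e e', G.Adj 0 e → G.Adj 0 e' → e ∉ C → e - e' ∈ C → e = e' := by
    intro e e' he he' heC hee
    have hcard : {w | G.Adj e w ∧ P w = 0}.ncard = 1 := by
      rw [hS e 0]
      rw [hP1 e he heC]
      exact (hSA 0 hlen).2.trans hc
    obtain ⟨w, hw⟩ := Set.ncard_eq_one.mp hcard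
    have h0 : (0 : Fin n → F) ∈ {w | G.Adj e w ∧ P w = 0} := ⟨he.symm, (hP0 0).mpr C.zero_mem⟩
    have h1 : e - e' ∈ {w | G.Adj e w ∧ P w = 0} := by
      refine ⟨?_, (hP0 _).mpr hee⟩
      rw [SimpleGraph.adj_comm, hGdef, hammingGraph_adj_iff]
      simpa using he'
    rw [hw] at h0 h1
    exact sub_eq_zero.mp (h1.trans h0.symm)
  have hrep : ∀ s, d s = 1 → ∃ e, G.Adj 0 e ∧ e ∉ C ∧ (e : (Fin n → F) ⧸ C) = s := by
    intro s
    induction s using QuotientAddGroup.induction_on with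
    | H x =>
      intro hx
      rw [hd] at hx
      obtain ⟨c, hcC, hcx⟩ := exists_dist_eq_distToSet G hne x
      rw [← hP, hx, SimpleGraph.dist_eq_one_iff_adj, SimpleGraph.adj_comm, hGdef,
        hammingGraph_adj_iff] at hcx
      refine ⟨x - c, hcx, fun hmem => ?_, ?_⟩
      · have : x ∈ C := by simpa using C.add_mem hmem hcC
        rw [← hP0, hx] at this
        exact one_ne_zero this
      · rw [QuotientAddGroup.eq]
        simpa using hcC
  -- A step by a weight-one codeword does not change the distance to C. Such steps have no
  -- counterpart in the quotient, and `j ≠ P v` excludes them.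
  have hcard : ∀ (v : Fin n → F) (j : ℕ), j ≠ P v →
      #{s | d s = 1 ∧ d ((v : (Fin n → F) ⧸ C) + s) = j} = S (P v) j := by
    intro v j hj
    rw [← hS v j, ← Set.ncard_coe_finset]
    have himg : (({s | d s = 1 ∧ d ((v : (Fin n → F) ⧸ C) + s) = j} :
        Finset ((Fin n → F) ⧸ C)) : Set ((Fin n → F) ⧸ C)) =
        (fun w => ((w - v : Fin n → F) : (Fin n → F) ⧸ C)) '' {w | G.Adj v w ∧ P w = j} := by
      ext s
      simp only [coe_filter, mem_univ, true_and, Set.mem_ofPred_eq, Set.mem_image]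
      constructor
      · rintro ⟨hs, hvs⟩
        obtain ⟨e, he, heC, rfl⟩ := hrep s hs
        refine ⟨v + e, ⟨?_, ?_⟩, by simp⟩
        · rw [hGdef, hammingGraph_adj_iff]
          simpa using he
        · rw [← hvs, ← QuotientAddGroup.mk_add, hd]
      · rintro ⟨w, ⟨hw, hPw⟩, rfl⟩
        rw [hGdef, hammingGraph_adj_iff] at hw
        have hwC : w - v ∉ C := fun hmem => hj <| by
          rw [← hPw, ← hadd _ hmem v, sub_add_cancel]
        refine ⟨hP1 _ hw hwC, ?_⟩
        rw [← QuotientAddGroup.mk_add, hd, add_sub_cancel, hPw]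
    rw [himg, Set.InjOn.ncard_image]
    rintro w ⟨hw, hPw⟩ w' ⟨hw', hPw'⟩ hww
    rw [hGdef, hammingGraph_adj_iff] at hw hw'
    have hwC : w - v ∉ C := fun hmem => hj <| by
      rw [← hPw, ← hadd _ hmem v, sub_add_cancel]
    have hmem : (w - v) - (w' - v) ∈ C := by
      have := QuotientAddGroup.eq.mp hww.symm
      rwa [neg_add_eq_sub] at this
    exact sub_left_injective (huniq _ _ hw hw' hwC hmem)
  refine ⟨d, fun x => ?_, fun x => ?_, fun x => ?_, ?_, fun v s hs => ?_, fun v => ?_, fun v => ?_⟩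
  · induction x using QuotientAddGroup.induction_on with
    | H x => rw [hd, hP0, QuotientAddGroup.eq_zero_iff]
  · induction x using QuotientAddGroup.induction_on with
    | H x => rw [← QuotientAddGroup.mk_neg, hd, hd, hneg]
  · induction x using QuotientAddGroup.induction_on with
    | H x => exact hle x
  · obtain ⟨v, hv⟩ := htop
    exact ⟨v, hv⟩
  · obtain ⟨e, he, -, rfl⟩ := hrep s hs
    induction v using QuotientAddGroup.induction_on with
    | H v =>
      rw [← QuotientAddGroup.mk_add, hd, hd]
      refine distToSet_le_add_one hG hne ?_
      rw [hGdef, hammingGraph_adj_iff]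
      simpa using he
  · induction v using QuotientAddGroup.induction_on with
    | H v =>
      rw [hd, hcard v (P v + 1) (by omega)]
      rcases (hle v).lt_or_eq with hlt | heq
      · exact (hSA _ hlt).1
      -- At the covering radius the array prescribes no entry of the quotient matrix; there are
      -- simply no vectors farther away, and `bNum` has default value 0.
      · rw [← hS v (P v + 1)]
        have hempty : {w | G.Adj v w ∧ P w = P v + 1} = ∅ := by
          ext w
          simp only [Set.mem_ofPred_eq, Set.mem_empty_iff_false, iff_false, not_and]
          intro _ hw
          have := hle w
          change P w ≤ _ at this
          change P v = _ at heq
          omega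
        change {w | G.Adj v w ∧ P w = P v + 1}.ncard = _
        rw [hempty, Set.ncard_empty]
        change P v = _ at heq
        simp [IntersectionArray.bNum, heq]
  · induction v using QuotientAddGroup.induction_on with
    | H v =>
      rw [hd]
      rcases Nat.eq_zero_or_pos (P v) with h0 | hpos
      · simp [h0, IntersectionArray.cNum]
      · have hlt : P v - 1 < A.b.length := by
          have := hle v
          change P v ≤ _ at this
          omega
        have h1 := (hSA _ hlt).2
        rw [Nat.sub_add_cancel hpos] at h1
        rw [← h1, ← hcard v (P v - 1) (by omega)]
        congr 1
        ext s
        simp only [mem_filter, mem_univ, true_and]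
        refine and_congr_right fun _ => ?_
        omega

end Reduction

/-! ### Nonexistence on groups of prime exponent, transferred to graphs and codes -/

/-- No translation-invariant distance-regular graph on a group of prime exponent has intersection
array `A`. -/
def NoTranslationDistance.{u} (A : IntersectionArray) : Prop :=
  ∀ p : ℕ, p.Prime → ∀ (V : Type u) [AddCommGroup V] [Fintype V], (∀ x : V, p • x = 0) →
    ∀ d : V → ℕ, ¬ TranslationDistance A d

theorem not_isDistanceRegularWith_addCayley.{u} {A : IntersectionArray} {V : Type u} [AddCommGroup V]
    [Finite V] (hA : NoTranslationDistance.{u} A) {p : ℕ} (hp : p.Prime) (hV : ∀ x : V, p • x = 0)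
    (S : Set V) : ¬ IsDistanceRegularWith (SimpleGraph.addCayley S) A := fun h => by
  have := Fintype.ofFinite V
  refine hA p hp V hV _ (translationDistance_of_isDistanceRegularWith (fun g u v huv => ?_) h)
  exact SimpleGraph.addCayley_adj_add_iff_right.mpr huv

/-- The prime is the characteristic of F. -/
theorem exists_prime_nsmul_eq_zero {F : Type*} [Field F] [Finite F] {n : ℕ}
    (C : AddSubgroup (Fin n → F)) : ∃ p : ℕ, p.Prime ∧ ∀ x : (Fin n → F) ⧸ C, p • x = 0 := by
  have := Fintype.ofFinite F
  obtain ⟨p, hp⟩ := CharP.exists F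
  refine ⟨p, CharP.char_is_prime F p, fun x => ?_⟩
  induction x using QuotientAddGroup.induction_on with
  | H x =>
    rw [← QuotientAddGroup.mk_nsmul, QuotientAddGroup.eq_zero_iff]
    convert C.zero_mem
    ext i
    simp

theorem not_isDistanceRegularWith_cosetGraph.{u} {A : IntersectionArray} {F : Type u} [Field F]
    [Finite F] [DecidableEq F] (hA : NoTranslationDistance.{u} A) {n : ℕ}
    (C : AddSubgroup (Fin n → F)) : ¬ IsDistanceRegularWith (cosetGraph C) A := fun h => by
  have := Fintype.ofFinite ((Fin n → F) ⧸ C)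
  obtain ⟨p, hp, hV⟩ := exists_prime_nsmul_eq_zero C
  exact hA p hp _ hV _ (translationDistance_of_isDistanceRegularWith (cosetGraph_adj_add C) h)

theorem not_isCompletelyRegularWith_hammingGraph.{u} {A : IntersectionArray} {F : Type u} [Field F]
    [Finite F] [DecidableEq F] (hb : A.b ≠ []) (hc : A.cNum 1 = 1) (hA : NoTranslationDistance.{u} A)
    {n : ℕ} (C : AddSubgroup (Fin n → F)) :
    ¬ IsCompletelyRegularWith (hammingGraph n F) (C : Set (Fin n → F)) A := fun h => by
  have := Fintype.ofFinite ((Fin n → F) ⧸ C)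
  obtain ⟨p, hp, hV⟩ := exists_prime_nsmul_eq_zero C
  obtain ⟨d, hd⟩ := translationDistance_of_isCompletelyRegularWith C hb hc h
  exact hA p hp _ hV d hd

/-! ### Counting with a translation-invariant distance -/

/-- The intersection number `a_i = b_0 - b_i - c_i`. -/
def IntersectionArray.aNum (A : IntersectionArray) (i : ℕ) : ℕ := A.bNum 0 - A.bNum i - A.cNum i

/-- The number of neighbours at distance `i` from the origin of a vertex at distance `j`. -/
def IntersectionArray.stepNum (A : IntersectionArray) (j i : ℕ) : ℕ :=
  if i = j + 1 then A.bNum j else if i = j then A.aNum j else if i + 1 = j then A.cNum j else 0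

namespace TranslationDistance

variable {V : Type*} [AddCommGroup V] [Fintype V] {A : IntersectionArray} {d : V → ℕ}

theorem map_zero (h : TranslationDistance A d) : d 0 = 0 := (h.eq_zero_iff 0).mpr rfl

theorem card_one (h : TranslationDistance A d) : #{s | d s = 1} = A.bNum 0 := by
  have := h.card_b 0
  simpa [h.map_zero] using this

theorem le_add_one (h : TranslationDistance A d) {v s : V} (hs : d s = 1) :
    d v ≤ d (v + s) + 1 := by
  have := h.add_le (v + s) (-s) (by rw [h.neg, hs])
  simpa using this

theorem card_same (h : TranslationDistance A d) (v : V) :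
    #{s | d s = 1 ∧ d (v + s) = d v} = A.aNum (d v) := by
  classical
  have hsum : #{s | d s = 1} = #{s | d s = 1 ∧ d (v + s) = d v + 1} +
      #{s | d s = 1 ∧ d (v + s) = d v} + #{s | d s = 1 ∧ d (v + s) + 1 = d v} := by
    rw [← card_union_of_disjoint, ← card_union_of_disjoint]
    · congr 1
      ext s
      simp only [mem_filter, mem_univ, true_and, mem_union]
      constructor
      · intro hs
        have h1 := h.add_le v s hs
        have h2 := h.le_add_one (v := v) hs
        omega
      · tauto
    · rw [disjoint_left]
      simp only [mem_filter, mem_univ, true_and, mem_union]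
      intro s
      omega
    · rw [disjoint_left]
      simp only [mem_filter, mem_univ, true_and]
      intro s
      omega
  rw [h.card_one, h.card_b, h.card_c] at hsum
  rw [IntersectionArray.aNum]
  omega

theorem card_step (h : TranslationDistance A d) (v : V) (i : ℕ) :
    #{s | d s = 1 ∧ d (v + s) = i} = A.stepNum (d v) i := by
  unfold IntersectionArray.stepNum
  split_ifs with h1 h2 h3
  · rw [h1, h.card_b]
  · rw [h2, h.card_same]
  · rw [← h.card_c]
    congr 1
    ext s
    simp only [mem_filter, mem_univ, true_and]
    omega
  · rw [card_eq_zero, filter_eq_empty_iff]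
    rintro s - ⟨hs, hi⟩
    have := h.add_le v s hs
    have := h.le_add_one (v := v) hs
    omega

/-- Double counting of the edges between classes i and i + 1: reversing a step sends (v, s) to (v +
s, -s). -/
theorem card_class_mul (h : TranslationDistance A d) (i : ℕ) :
    #{v | d v = i} * A.bNum i = #{v | d v = i + 1} * A.cNum (i + 1) := by
  classical
  have e : ∀ j k : ℕ, #{q : V × V | d q.1 = j ∧ d q.2 = 1 ∧ d (q.1 + q.2) = k} =
      #{v | d v = j} * A.stepNum j k := by
    intro j k
    rw [card_eq_sum_card_fiberwise (f := Prod.fst) (t := ({v | d v = j} : Finset V))]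
    · rw [← smul_eq_mul, ← sum_const]
      refine sum_congr rfl fun v hv => ?_
      simp only [mem_filter, mem_univ, true_and] at hv
      rw [← hv, ← h.card_step v k]
      refine card_bij (fun q _ => q.2) ?_ ?_ ?_
      · rintro ⟨a, b⟩ hq
        simp only [mem_filter, mem_univ, true_and] at hq ⊢
        obtain ⟨⟨-, h2⟩, rfl⟩ := hq
        exact h2
      · rintro ⟨a, b⟩ hq ⟨a', b'⟩ hq' hbb
        simp only [mem_filter, mem_univ, true_and] at hq hq'
        simp_all
      · intro s hs
        simp only [mem_filter, mem_univ, true_and] at hs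
        exact ⟨(v, s), by simp [hs], rfl⟩
    · intro q hq
      simp only [coe_filter, mem_univ, true_and, Set.mem_ofPred_eq] at hq ⊢
      exact hq.1
  have e1 := e i (i + 1)
  have e2 := e (i + 1) i
  simp only [IntersectionArray.stepNum, if_true] at e1
  rw [IntersectionArray.stepNum, if_neg (by omega), if_neg (by omega), if_pos rfl] at e2
  rw [← e1, ← e2]
  refine card_bij (fun q _ => (q.1 + q.2, -q.2)) ?_ ?_ ?_
  · rintro ⟨a, b⟩ hq
    simp only [mem_filter, mem_univ, true_and] at hq ⊢
    simp [h.neg, hq]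
  · rintro ⟨a, b⟩ _ ⟨a', b'⟩ _ hqq
    simp only [Prod.mk.injEq, neg_inj] at hqq
    obtain ⟨h1, rfl⟩ := hqq
    simpa using h1
  · rintro ⟨a, b⟩ hq
    simp only [mem_filter, mem_univ, true_and] at hq
    exact ⟨(a + b, -b), by simp [h.neg, hq], by simp⟩

theorem card_eq_sum (h : TranslationDistance A d) :
    Fintype.card V = ∑ i ∈ range (A.b.length + 1), #{v | d v = i} := by
  rw [← card_univ]
  exact card_eq_sum_card_fiberwise fun v _ => by
    simpa [Nat.lt_succ_iff] using h.le v

theorem card_class_zero (h : TranslationDistance A d) : #{v | d v = 0} = 1 := by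
  rw [card_eq_one]
  exact ⟨0, by ext; simp [h.eq_zero_iff]⟩

/-- Cauchy's theorem gives an element of order q, and p annihilates it. -/
theorem eq_of_card_eq_prime_pow {p q m : ℕ} (hp : p.Prime) (hq : q.Prime) (hm : m ≠ 0)
    (hV : ∀ x : V, p • x = 0) (hc : Fintype.card V = q ^ m) : p = q := by
  have := Fact.mk hq
  obtain ⟨x, hx⟩ := exists_prime_addOrderOf_dvd_card q (hc ▸ dvd_pow_self q hm)
  have : q ∣ p := hx ▸ addOrderOf_dvd_of_nsmul_eq_zero (hV x)
  exact ((Nat.prime_dvd_prime_iff_eq hq hp).mp this).symm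

/-- If the number of representations of `v` as a sum of two elements of the connection set is odd,
then `v` is twice an element of the connection set. -/
theorem exists_add_self_eq (h : TranslationDistance A d) {v : V}
    (hodd : Odd (A.stepNum (d v) 1)) : ∃ s, d s = 1 ∧ s + s = v := by
  by_contra! hno
  rw [← h.card_step v 1, ← Nat.not_even_iff_odd] at hodd
  refine hodd ?_
  rw [even_iff_two_dvd, ← ZMod.natCast_eq_zero_iff, card_eq_sum_ones, Nat.cast_sum]
  -- The map interchanges the summands of v = (-s) + (v + s). Without fixed points the number of
  -- representations would vanish modulo 2; a fixed point means v = (-s) + (-s).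
  refine sum_involution (fun s _ => -(v + s)) (fun s _ => by decide) (fun s hs _ hfix => ?_)
    (fun s hs => ?_) (fun s _ => by abel)
  · simp only [mem_filter, mem_univ, true_and] at hs
    refine hno (-s) (by rw [h.neg, hs.1]) ?_
    have h2 : v = -s - s := by
      rw [eq_sub_iff_add_eq, ← neg_eq_iff_eq_neg]; exact hfix
    rw [h2]
    abel
  · simp only [mem_filter, mem_univ, true_and] at hs ⊢
    rw [h.neg, show v + -(v + s) = -s by abel, h.neg]
    exact hs.symm

/-- The number of ordered triples from the connection set with sum `v`, when `d v = j`. -/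
def _root_.DRG.IntersectionArray.tripleNum (A : IntersectionArray) (j : ℕ) : ℕ :=
  ∑ i ∈ range (j + 2), A.stepNum j i * A.stepNum i 1

/-- The triple in question is (-a, -b, v + a + b) for `q = (a, b)`. The distance of the intermediate
vertex v + a decides how many b are possible. -/
theorem card_triple (h : TranslationDistance A d) (v : V) :
    #{q : V × V | d q.1 = 1 ∧ d q.2 = 1 ∧ d (v + q.1 + q.2) = 1} = A.tripleNum (d v) := by
  classical
  rw [card_eq_sum_card_fiberwise (f := fun q : V × V => d (v + q.1)) (t := range (d v + 2))]
  · refine sum_congr rfl fun i _ => ?_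
    rw [filter_filter, ← h.card_step v i, ← smul_eq_mul, ← sum_const,
      card_eq_sum_card_fiberwise (f := Prod.fst) (t := ({s | d s = 1 ∧ d (v + s) = i} : Finset V))]
    · refine sum_congr rfl fun s hs => ?_
      simp only [mem_filter, mem_univ, true_and] at hs
      rw [← hs.2, ← h.card_step (v + s) 1]
      refine card_bij (fun q _ => q.2) ?_ ?_ ?_
      · rintro ⟨a, b⟩ hq
        simp only [mem_filter, mem_univ, true_and] at hq ⊢
        obtain ⟨⟨⟨-, h2⟩, -⟩, rfl⟩ := hq
        exact h2
      · rintro ⟨a, b⟩ hq ⟨a', b'⟩ hq' hbb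
        simp only [mem_filter, mem_univ, true_and] at hq hq'
        simp_all
      · intro t ht
        simp only [mem_filter, mem_univ, true_and] at ht
        exact ⟨(s, t), by simp [hs, ht], rfl⟩
    · intro q hq
      simp only [coe_filter, mem_univ, true_and, Set.mem_ofPred_eq] at hq ⊢
      exact ⟨hq.1.1, hq.2⟩
  · intro q hq
    simp only [coe_filter, mem_univ, true_and, Set.mem_ofPred_eq, coe_range, Set.mem_Iio] at hq ⊢
    have := h.add_le v q.1 hq.1
    omega

/-- Rotation of the triples with sum v is a permutation of order dividing three. If their number is
not divisible by 3 there is a fixed triple, and its three members coincide. -/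
theorem exists_three_eq (h : TranslationDistance A d) {v : V}
    (hmod : ¬ 3 ∣ A.tripleNum (d v)) : ∃ s, d s = 1 ∧ s + s + s = v := by
  classical
  by_contra! hno
  apply hmod
  rw [← h.card_triple v]
  let T := {q : V × V // d q.1 = 1 ∧ d q.2 = 1 ∧ d (v + q.1 + q.2) = 1}
  let f : T → T := fun q => ⟨(q.1.2, -(v + q.1.1 + q.1.2)), q.2.2.1,
    by rw [h.neg]; exact q.2.2.2, by
      rw [show v + q.1.2 + -(v + q.1.1 + q.1.2) = -q.1.1 by abel, h.neg]; exact q.2.1⟩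
  have hf : ∀ q, f (f (f q)) = q := fun q => by
    apply Subtype.ext
    ext
    · change -(v + q.1.2 + -(v + q.1.1 + q.1.2)) = q.1.1
      abel
    · change -(v + -(v + q.1.1 + q.1.2) + -(v + q.1.2 + -(v + q.1.1 + q.1.2))) = q.1.2
      abel
  let σ : Equiv.Perm T := ⟨f, fun q => f (f q), hf, hf⟩
  have hσ : σ ^ 3 ^ 1 = 1 := Equiv.ext hf
  have := Fact.mk Nat.prime_three
  by_contra hdvd
  obtain ⟨q, hq⟩ := Equiv.Perm.exists_fixed_point_of_prime (α := T)
    (by rwa [Fintype.card_subtype]) hσ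
  have h1 : q.1.2 = q.1.1 := congrArg (fun x : T => x.1.1) hq
  have h2 : -(v + q.1.1 + q.1.2) = q.1.2 := congrArg (fun x : T => x.1.2) hq
  refine hno (-q.1.1) (by rw [h.neg, q.2.1]) ?_
  rw [h1, neg_eq_iff_add_eq_zero] at h2
  rw [← add_right_inj (q.1.1 + q.1.1 + q.1.1)]
  trans 0
  · abel
  · rw [← h2]
    abel

end TranslationDistance
-- Parity and residues modulo three: nine of the arrays
namespace TranslationDistance

variable {V : Type*} [AddCommGroup V] [Fintype V] {A : IntersectionArray} {d : V → ℕ}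

/-- Applied to doubling and tripling of the connection set; a class larger than b_0 then gives a
contradiction. -/
theorem card_class_le (h : TranslationDistance A d) {j : ℕ} (g : V → V)
    (hg : ∀ v, d v = j → ∃ s, d s = 1 ∧ g s = v) : #{v | d v = j} ≤ A.bNum 0 := by
  classical
  rw [← h.card_one]
  refine (card_le_card (t := ({s | d s = 1} : Finset V).image g) fun v hv => ?_).trans
    card_image_le
  simp only [mem_filter, mem_univ, true_and] at hv
  simpa using hg v hv

/-- The cardinalities of the distance classes, for diameter three. -/
theorem card_classes_three {b₀ b₁ b₂ c₁ c₂ c₃ : ℕ}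
    (h : TranslationDistance ⟨[b₀, b₁, b₂], [c₁, c₂, c₃]⟩ d) :
    #{v | d v = 1} = b₀ ∧ b₀ * b₁ = #{v | d v = 2} * c₂ ∧
      #{v | d v = 2} * b₂ = #{v | d v = 3} * c₃ ∧
      Fintype.card V = 1 + b₀ + #{v | d v = 2} + #{v | d v = 3} := by
  have h0 : #{v | d v = 1} = b₀ := h.card_one
  have h1 : #{v | d v = 1} * b₁ = #{v | d v = 2} * c₂ := h.card_class_mul 1
  have h2 : #{v | d v = 2} * b₂ = #{v | d v = 3} * c₃ := h.card_class_mul 2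
  refine ⟨h0, by rw [← h1, h0], h2, ?_⟩
  rw [h.card_eq_sum]
  simp [sum_range_succ, h.card_class_zero, h0]

/-- If the number of representations of the vertices at distance two as a sum of two elements of
the connection set is odd, then there are at most `b₀` of them. -/
theorem mul_le_of_odd {b₀ b₁ b₂ c₁ c₂ c₃ : ℕ}
    (h : TranslationDistance ⟨[b₀, b₁, b₂], [c₁, c₂, c₃]⟩ d) (hc : Odd c₂) :
    b₀ * b₁ ≤ b₀ * c₂ := by
  have hle : #{v | d v = 2} ≤ b₀ := h.card_class_le (fun s => s + s) fun v hv =>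
    h.exists_add_self_eq <| by rw [hv]; exact hc
  rw [h.card_classes_three.2.1]
  exact Nat.mul_le_mul_right _ hle

theorem card_class_le_of_not_three_dvd (h : TranslationDistance A d) {j : ℕ}
    (hj : ¬ 3 ∣ A.tripleNum j) : #{v | d v = j} ≤ A.bNum 0 :=
  h.card_class_le (fun s => s + s + s) fun v hv => h.exists_three_eq (by rwa [hv])

end TranslationDistance

/-- A vertex at distance two is a sum of 2·5 + 15·2 = 40 triples, but k_2 = 176. -/
theorem noTranslationDistance_22_16_5 : NoTranslationDistance ⟨[22, 16, 5], [1, 2, 20]⟩ := by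
  intro p _ V _ _ _ d h
  have h1 := h.card_class_le_of_not_three_dvd (j := 2) (by decide)
  have h2 := h.card_classes_three
  change _ ≤ 22 at h1
  omega

/-- Here c_2 = 3 is odd and smaller than b_1, so k_2 exceeds b_0. -/
theorem noTranslationDistance_25_24_3 : NoTranslationDistance ⟨[25, 24, 3], [1, 3, 20]⟩ :=
  fun _ _ _ _ _ _ _ h => absurd (h.mul_le_of_odd (by decide)) (by decide)

theorem noTranslationDistance_26_24_19 : NoTranslationDistance ⟨[26, 24, 19], [1, 3, 8]⟩ :=
  fun _ _ _ _ _ _ _ h => absurd (h.mul_le_of_odd (by decide)) (by decide)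

/-- A vertex at distance three is a sum of 28·2 = 56 triples, but k_3 = 144. -/
theorem noTranslationDistance_32_28_9 : NoTranslationDistance ⟨[32, 28, 9], [1, 2, 28]⟩ := by
  intro p _ V _ _ _ d h
  have h1 := h.card_class_le_of_not_three_dvd (j := 3) (by decide)
  have h2 := h.card_classes_three
  change _ ≤ 32 at h1
  omega

theorem noTranslationDistance_36_28_4 : NoTranslationDistance ⟨[36, 28, 4], [1, 2, 24]⟩ := by
  intro p _ V _ _ _ d h
  have h1 := h.card_class_le_of_not_three_dvd (j := 2) (by decide)
  have h2 := h.card_classes_three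
  change _ ≤ 36 at h1
  omega

theorem noTranslationDistance_44_36_5 : NoTranslationDistance ⟨[44, 36, 5], [1, 9, 40]⟩ :=
  fun _ _ _ _ _ _ _ h => absurd (h.mul_le_of_odd (by decide)) (by decide)

theorem noTranslationDistance_48_35_9 : NoTranslationDistance ⟨[48, 35, 9], [1, 7, 40]⟩ :=
  fun _ _ _ _ _ _ _ h => absurd (h.mul_le_of_odd (by decide)) (by decide)

/-- A vertex at distance two is a sum of 8·14 + 45·8 = 472 triples, but k_2 = 378. -/
theorem noTranslationDistance_63_48_10 : NoTranslationDistance ⟨[63, 48, 10], [1, 8, 54]⟩ := by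
  intro p _ V _ _ _ d h
  have h1 := h.card_class_le_of_not_three_dvd (j := 2) (by decide)
  have h2 := h.card_classes_three
  change _ ≤ 63 at h1
  omega

theorem noTranslationDistance_80_63_11 : NoTranslationDistance ⟨[80, 63, 11], [1, 9, 70]⟩ :=
  fun _ _ _ _ _ _ _ h => absurd (h.mul_le_of_odd (by decide)) (by decide)

/-! ### Functionals with prescribed values, and averages of their zeros -/

section Functionals

variable {p : ℕ} [Fact p.Prime] {V : Type*} [AddCommGroup V] [Module (ZMod p) V] [Fintype V]

noncomputable instance instFintypeDual : Fintype (Module.Dual (ZMod p) V) :=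
  have : Finite (Module.Dual (ZMod p) V) := DFunLike.finite _
  Fintype.ofFinite _

/-- The sum over `X` of the function with value `p - 1` on the kernel of `f` and `-1` elsewhere. -/
def kerSum (X : Finset V) (f : Module.Dual (ZMod p) V) : ℤ :=
  ∑ x ∈ X, if f x = 0 then (p : ℤ) - 1 else -1

-- The summand of `kerSum` at x is the sum of the p - 1 characters ω^(a f(x)), a ≠ 0. Working with
-- this sum keeps everything in the integers and turns it into a count of zeros.
omit [Fintype V] in
theorem kerSum_eq (X : Finset V) (f : Module.Dual (ZMod p) V) :
    kerSum X f = p * #{x ∈ X | f x = 0} - #X := by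
  rw [kerSum, card_filter, card_eq_sum_ones, Nat.cast_sum, Nat.cast_sum, mul_sum, ← sum_sub_distrib]
  refine sum_congr rfl fun x _ => ?_
  split_ifs <;> simp

omit [Fintype V] in
theorem kerSum_zero (X : Finset V) : kerSum X (0 : Module.Dual (ZMod p) V) = (p - 1) * #X := by
  simp [kerSum]
  ring

/-- The functionals with prescribed values on a family of vectors. -/
noncomputable def dualSlice {ι : Type*} [Fintype ι] (x : ι → V) (c : ι → ZMod p) :
    Finset (Module.Dual (ZMod p) V) :=
  {f | ∀ i, f (x i) = c i}

variable {ι : Type*} [Fintype ι] {x : ι → V}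

@[simp]
theorem mem_dualSlice {c : ι → ZMod p} {f : Module.Dual (ZMod p) V} :
    f ∈ dualSlice x c ↔ ∀ i, f (x i) = c i := by
  simp [dualSlice]

omit [Fintype V] [Fintype ι] in
theorem exists_dual_apply_eq (hx : LinearIndependent (ZMod p) x) (c : ι → ZMod p) :
    ∃ f : Module.Dual (ZMod p) V, ∀ i, f (x i) = c i := by
  obtain ⟨f, hf⟩ := LinearMap.exists_extend ((Module.Basis.span hx).constr (ZMod p) c)
  refine ⟨f, fun i => ?_⟩
  have h1 := LinearMap.congr_fun hf ((Module.Basis.span hx) i)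
  rw [Module.Basis.constr_basis, LinearMap.comp_apply, Submodule.subtype_apply,
    Module.Basis.span_apply] at h1
  exact h1

theorem card_dualSlice_eq (hx : LinearIndependent (ZMod p) x) (c c' : ι → ZMod p) :
    #(dualSlice x c) = #(dualSlice x c') := by
  obtain ⟨g, hg⟩ := exists_dual_apply_eq hx (c' - c)
  refine card_bij (fun f _ => f + g) (fun f hf => ?_) (fun f _ f' _ h => add_left_injective g h)
    fun f hf => ⟨f - g, ?_, sub_add_cancel f g⟩
  · simp only [mem_dualSlice, LinearMap.add_apply] at hf ⊢
    intro i
    simp [hf, hg]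
  · simp only [mem_dualSlice, LinearMap.sub_apply] at hf ⊢
    intro i
    simp [hf, hg]

/-- The slices for the different value vectors partition the dual space, and they are translates of
each other. -/
theorem card_dualSlice_mul (hx : LinearIndependent (ZMod p) x) (c : ι → ZMod p) :
    #(dualSlice x c) * p ^ Fintype.card ι = Fintype.card V := by
  classical
  have h1 : Fintype.card (Module.Dual (ZMod p) V) = Fintype.card V := by
    rw [Module.card_eq_pow_finrank (K := ZMod p), Subspace.dual_finrank_eq,
      ← Module.card_eq_pow_finrank]
  have h2 : Fintype.card (Module.Dual (ZMod p) V) =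
      ∑ c' : ι → ZMod p, #(dualSlice x c') := by
    rw [← card_univ, card_eq_sum_card_fiberwise (f := fun f i => f (x i)) (t := univ)
      fun _ _ => mem_coe.mpr (mem_univ _)]
    refine sum_congr rfl fun c' _ => congrArg card ?_
    ext f
    simp [funext_iff]
  rw [← h1, h2, sum_congr rfl fun c' _ => card_dualSlice_eq hx c' c, sum_const, card_univ,
    Fintype.card_fun, ZMod.card, smul_eq_mul, mul_comm]

/-- Some functional vanishes on the family but not at s. Adding its multiples shows that f s takes
every value equally often on the slice, and the weights p - 1, -1, ..., -1 add up to zero. -/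
theorem sum_dualSlice_ite_of_notMem {c : ι → ZMod p} {s : V}
    (hs : s ∉ Submodule.span (ZMod p) (Set.range x)) :
    ∑ f ∈ dualSlice x c, (if f s = 0 then (p : ℤ) - 1 else -1) = 0 := by
  classical
  obtain ⟨g₀, hg₀, hker⟩ := Submodule.exists_le_ker_of_notMem hs
  have hg : ∀ i, g₀ (x i) = 0 := fun i => hker (Submodule.subset_span ⟨i, rfl⟩)
  have hcard : ∀ a, #{f ∈ dualSlice x c | f s = a} = #{f ∈ dualSlice x c | f s = 0} := by
    intro a
    refine card_bij (fun f _ => f - (a * (g₀ s)⁻¹) • g₀) (fun f hf => ?_)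
      (fun f _ f' _ h => sub_left_injective h)
      fun f hf => ⟨f + (a * (g₀ s)⁻¹) • g₀, ?_, add_sub_cancel_right f _⟩
    · simp only [mem_filter, mem_dualSlice, LinearMap.sub_apply, LinearMap.smul_apply] at hf ⊢
      refine ⟨fun i => by simp [hf.1 i, hg], ?_⟩
      rw [hf.2, smul_eq_mul, mul_assoc, inv_mul_cancel₀ hg₀, mul_one, sub_self]
    · simp only [mem_filter, mem_dualSlice, LinearMap.add_apply, LinearMap.smul_apply] at hf ⊢
      refine ⟨fun i => by simp [hf.1 i, hg], ?_⟩
      rw [hf.2, smul_eq_mul, mul_assoc, inv_mul_cancel₀ hg₀, mul_one, zero_add]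
  have htot : #(dualSlice x c) = p * #{f ∈ dualSlice x c | f s = 0} := by
    rw [card_eq_sum_card_fiberwise (f := fun f => f s) (t := univ)
      fun _ _ => mem_coe.mpr (mem_univ _), sum_congr rfl fun a _ => hcard a, sum_const, card_univ,
      ZMod.card, smul_eq_mul]
  have hsum : ∑ f ∈ dualSlice x c, (if f s = 0 then (p : ℤ) - 1 else -1) =
      p * #{f ∈ dualSlice x c | f s = 0} - #(dualSlice x c) := by
    rw [card_filter, card_eq_sum_ones, Nat.cast_sum, Nat.cast_sum, mul_sum, ← sum_sub_distrib]
    refine sum_congr rfl fun f _ => ?_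
    split_ifs <;> simp
  rw [hsum, htot]
  push_cast
  ring

/-- The sum of `kerSum X f` over the functionals with prescribed values on independent vectors
depends only on the part of `X` in their span. -/
theorem sum_dualSlice_kerSum [DecidableEq ι] [DecidableEq V] (hx : LinearIndependent (ZMod p) x)
    (c : ι → ZMod p) (X : Finset V) :
    ∑ f ∈ dualSlice x c, kerSum X f = #(dualSlice x c) *
      ∑ t : ι → ZMod p, if ∑ i, t i • x i ∈ X then
        (if ∑ i, t i * c i = 0 then (p : ℤ) - 1 else -1) else 0 := by
  have hinj : Function.Injective fun t : ι → ZMod p => ∑ i, t i • x i := by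
    intro t t' h
    have := Fintype.linearIndependent_iff.mp hx (t - t') (by
      simp only [Pi.sub_apply, sub_smul, sum_sub_distrib]
      exact sub_eq_zero.mpr h)
    funext i
    exact sub_eq_zero.mp (this i)
  simp only [kerSum]
  rw [sum_comm, ← sum_filter, mul_sum]
  have hsub : ({t : ι → ZMod p | ∑ i, t i • x i ∈ X} : Finset _).image
      (fun t => ∑ i, t i • x i) ⊆ X := by
    intro y hy
    obtain ⟨t, ht, rfl⟩ := mem_image.mp hy
    exact (mem_filter.mp ht).2
  rw [← sum_subset hsub, sum_image fun t _ t' _ h => hinj h]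
  · refine sum_congr rfl fun t _ => ?_
    rw [← nsmul_eq_mul, ← sum_const]
    refine sum_congr rfl fun f hf => ?_
    rw [mem_dualSlice] at hf
    have : f (∑ i, t i • x i) = ∑ i, t i * c i := by simp [hf]
    rw [this]
  · intro s hs hns
    refine sum_dualSlice_ite_of_notMem fun hmem => hns ?_
    obtain ⟨t, rfl⟩ := (Submodule.mem_span_range_iff_exists_fun _).mp hmem
    exact mem_image.mpr ⟨t, by simpa using hs, rfl⟩

end Functionals

/-! ### Eigenvalues attached to functionals, and sets closed under scalars -/

section Eigenvalue

variable {p : ℕ} [Fact p.Prime] {V : Type*} [AddCommGroup V] [Module (ZMod p) V] [Fintype V]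
  {A : IntersectionArray} {d : V → ℕ}

/-- For a connection set closed under nonzero scalars, a functional gives an integral
eigenvalue `θ`, and the sums over the distance classes satisfy the three-term recurrence. -/
theorem TranslationDistance.exists_eigenvalue (h : TranslationDistance A d)
    (hsmul : ∀ (a : ZMod p) (s : V), a ≠ 0 → d s = 1 → d (a • s) = 1)
    (f : Module.Dual (ZMod p) V) :
    ∃ θ : ℤ, kerSum {s | d s = 1} f = (p - 1) * θ ∧ ∀ i,
      θ * kerSum {v | d v = i} f =
        ∑ j ∈ range (A.b.length + 1), (A.stepNum j i : ℤ) * kerSum {v | d v = j} f := by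
  classical
  set S : Finset V := {s | d s = 1} with hS
  set z := #{s ∈ S | f s = 0} with hz
  set n := #{s ∈ S | f s = 1} with hn
  -- Scalars permute the fibres of f over the nonzero values, so each of them is taken n times on S.
  have hcard : ∀ a : ZMod p, a ≠ 0 → #{s ∈ S | f s = a} = n := by
    intro a ha
    refine card_bij (fun s _ => a⁻¹ • s) (fun s hs => ?_)
      (fun s _ s' _ hss => smul_right_injective V (inv_ne_zero ha) hss)
      fun s hs => ⟨a • s, ?_, inv_smul_smul₀ ha s⟩
    · simp only [hS, mem_filter, mem_univ, true_and] at hs ⊢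
      exact ⟨hsmul _ _ (inv_ne_zero ha) hs.1, by simp [hs.2, ha]⟩
    · simp only [hS, mem_filter, mem_univ, true_and] at hs ⊢
      exact ⟨hsmul _ _ ha hs.1, by simp [hs.2]⟩
  have hk : (#S : ℤ) = z + (p - 1) * n := by
    have h1 : #S = ∑ a : ZMod p, #{s ∈ S | f s = a} :=
      card_eq_sum_card_fiberwise fun _ _ => mem_coe.mpr (mem_univ _)
    rw [h1, ← add_sum_erase _ _ (mem_univ 0), sum_congr rfl fun a ha => hcard a (ne_of_mem_erase ha),
      sum_const, card_erase_of_mem (mem_univ _), card_univ, ZMod.card, smul_eq_mul]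
    have := (Fact.out : p.Prime).one_le
    push_cast [Nat.cast_sub this]
    rfl
  -- The function with value p - 1 on ker f and -1 elsewhere is an eigenfunction of the graph with
  -- eigenvalue z - n.
  have hshift : ∀ v, ∑ s ∈ S, (if f (v + s) = 0 then (p : ℤ) - 1 else -1) =
      (z - n) * (if f v = 0 then (p : ℤ) - 1 else -1) := by
    intro v
    have h1 : ∑ s ∈ S, (if f (v + s) = 0 then (p : ℤ) - 1 else -1) =
        p * #{s ∈ S | f s = -f v} - #S := by
      rw [card_filter, card_eq_sum_ones, Nat.cast_sum, Nat.cast_sum, mul_sum, ← sum_sub_distrib]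
      refine sum_congr rfl fun s _ => ?_
      have hiff : f (v + s) = 0 ↔ f s = -f v := by
        rw [map_add, add_comm, add_eq_zero_iff_eq_neg]
      simp only [hiff]
      split_ifs <;> simp
    rw [h1, hk]
    split_ifs with h0
    · rw [h0, neg_zero]
      ring
    · rw [hcard _ (neg_ne_zero.mpr h0)]
      ring
  refine ⟨z - n, ?_, fun i => ?_⟩
  · rw [kerSum_eq, hk]
    ring
  · have h1 : (z - n : ℤ) * kerSum {v | d v = i} f =
        ∑ v ∈ ({v | d v = i} : Finset V), ∑ s ∈ S, if f (v + s) = 0 then (p : ℤ) - 1 else -1 := by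
      rw [kerSum, mul_sum]
      exact sum_congr rfl fun v _ => (hshift v).symm
    -- The same edges, counted from their other end; the sign of s may be changed because S = -S.
    have h2 : ∑ v ∈ ({v | d v = i} : Finset V), ∑ s ∈ S,
        (if f (v + s) = 0 then (p : ℤ) - 1 else -1) =
        ∑ w, ∑ s ∈ S, if d (w + s) = i then (if f w = 0 then (p : ℤ) - 1 else -1) else 0 := by
      rw [sum_comm, sum_comm (s := univ)]
      refine sum_nbij' (fun s => -s) (fun s => -s) (fun s hs => ?_) (fun s hs => ?_)
        (fun s _ => neg_neg s) (fun s _ => neg_neg s) fun s _ => ?_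
      · simpa [hS, h.neg] using hs
      · simpa [hS, h.neg] using hs
      · rw [sum_filter]
        refine Fintype.sum_equiv (Equiv.addRight s) _ _ fun v => ?_
        simp
    rw [h1, h2, ← sum_fiberwise_of_maps_to (s := univ) (t := range (A.b.length + 1)) (g := d)
      fun w _ => by simpa [Nat.lt_succ_iff] using h.le w]
    refine sum_congr rfl fun j _ => ?_
    rw [kerSum, mul_sum]
    refine sum_congr rfl fun w hw => ?_
    rw [← sum_filter, sum_const, hS, filter_filter, h.card_step, (mem_filter.mp hw).2, nsmul_eq_mul]

end Eigenvalue

section Eigenvalue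

variable {p : ℕ} [Fact p.Prime] {V : Type*} [AddCommGroup V] [Module (ZMod p) V] [Fintype V]
  {A : IntersectionArray} {d : V → ℕ}

theorem TranslationDistance.kerSum_class_zero (h : TranslationDistance A d)
    (f : Module.Dual (ZMod p) V) : kerSum {v | d v = 0} f = p - 1 := by
  have : ({v | d v = 0} : Finset V) = {0} := by ext; simp [h.eq_zero_iff]
  rw [this]
  simp [kerSum]

/-- The eigenvalue equation for diameter three. -/
theorem TranslationDistance.exists_eigenvalue_three {b₀ b₁ b₂ c₂ c₃ : ℕ}
    (h : TranslationDistance ⟨[b₀, b₁, b₂], [1, c₂, c₃]⟩ d)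
    (hsmul : ∀ (a : ZMod p) (s : V), a ≠ 0 → d s = 1 → d (a • s) = 1)
    (f : Module.Dual (ZMod p) V) :
    ∃ θ : ℤ, kerSum {s | d s = 1} f = (p - 1) * θ ∧
      c₂ * kerSum {v | d v = 2} f = (p - 1) * (θ ^ 2 - (b₀ - b₁ - 1 : ℕ) * θ - b₀) ∧
      c₃ * kerSum {v | d v = 3} f = (θ - (b₀ - b₂ - c₂ : ℕ)) * kerSum {v | d v = 2} f -
        b₁ * ((p - 1) * θ) ∧
      (p - 1) * ((θ - (b₀ - c₃ : ℕ)) *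
        ((θ - (b₀ - b₂ - c₂ : ℕ)) * (θ ^ 2 - (b₀ - b₁ - 1 : ℕ) * θ - b₀) - c₂ * b₁ * θ) -
        c₃ * b₂ * (θ ^ 2 - (b₀ - b₁ - 1 : ℕ) * θ - b₀)) = (0 : ℤ) := by
  obtain ⟨θ, h1, hrec⟩ := h.exists_eigenvalue hsmul f
  have e1 := hrec 1
  have e2 := hrec 2
  have e3 := hrec 3
  simp only [List.length_cons, List.length_nil, sum_range_succ, range_zero, sum_empty,
    IntersectionArray.stepNum, IntersectionArray.aNum, IntersectionArray.bNum,
    IntersectionArray.cNum, h.kerSum_class_zero, h1] at e1 e2 e3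
  norm_num at e1 e2 e3
  refine ⟨θ, h1, ?_, ?_, ?_⟩
  · linear_combination (-1) * e1
  · linear_combination (-1) * e2
  -- Elimination of the sums over classes two and three leaves the characteristic polynomial of the
  -- tridiagonal matrix of the array.
  · linear_combination ((c₂ : ℤ) * c₃) * e3 + (c₂ * (θ - (b₀ - c₃ : ℕ))) * e2 +
      ((θ - (b₀ - b₂ - c₂ : ℕ)) * (θ - (b₀ - c₃ : ℕ)) - c₃ * b₂) * e1

/-- If a_1 is odd, every vector of S is twice a vector of S. So S is contained in its double, and
both have the same size by finiteness. -/
theorem TranslationDistance.add_self_of_odd (h : TranslationDistance A d)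
    (hodd : Odd (A.stepNum 1 1)) {s : V} (hs : d s = 1) : d (s + s) = 1 := by
  classical
  set S : Finset V := {s | d s = 1} with hS
  have hsub : S ⊆ S.image fun s => s + s := fun v hv => by
    have hv' : d v = 1 := by simpa [hS] using hv
    obtain ⟨t, ht, rfl⟩ := h.exists_add_self_eq (v := v) (by rwa [hv'])
    exact mem_image.mpr ⟨t, by simpa [hS] using ht, rfl⟩
  have heq := eq_of_subset_of_card_le hsub card_image_le
  have : s + s ∈ S := heq ▸ mem_image.mpr ⟨s, by simpa [hS] using hs, rfl⟩
  simpa [hS] using this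

omit [Fintype V] in
/-- A set of nonzero vectors closed under nonzero scalars which has the size of a union of `m`
punctured lines is exhausted by any `m` of its vectors that are pairwise non-proportional. -/
theorem exists_eq_smul_of_card {X : Finset V} {m : ℕ} {v : Fin m → V}
    (hX : ∀ (a : ZMod p) (s : V), a ≠ 0 → s ∈ X → a • s ∈ X) (h0 : (0 : V) ∉ X)
    (hv : ∀ i, v i ∈ X) (hne : ∀ i j, i ≠ j → ∀ a : ZMod p, a • v i ≠ v j)
    (hm : #X ≤ (p - 1) * m) {s : V} (hs : s ∈ X) : ∃ i, ∃ a : ZMod p, s = a • v i := by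
  classical
  have hinj : Function.Injective fun q : (ZMod p)ˣ × Fin m => (q.1 : ZMod p) • v q.2 := by
    rintro ⟨a, i⟩ ⟨b, j⟩ hab
    simp only at hab
    have hij : i = j := by
      by_contra hij
      refine hne i j hij ((b : ZMod p)⁻¹ * a) ?_
      rw [mul_smul, hab, inv_smul_smul₀ b.ne_zero]
    subst hij
    have hvi : v i ≠ 0 := fun h => h0 (h ▸ hv i)
    simpa [Units.ext_iff] using smul_left_injective _ hvi hab
  have hsub : univ.image (fun q : (ZMod p)ˣ × Fin m => (q.1 : ZMod p) • v q.2) ⊆ X := by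
    intro y hy
    obtain ⟨q, -, rfl⟩ := mem_image.mp hy
    exact hX _ _ q.1.ne_zero (hv _)
  have heq := eq_of_subset_of_card_le hsub (by
    rw [card_image_of_injective _ hinj, card_univ, Fintype.card_prod, ZMod.card_units_eq_totient,
      Nat.totient_prime Fact.out, Fintype.card_fin]
    exact hm)
  rw [← heq] at hs
  obtain ⟨q, -, rfl⟩ := mem_image.mp hs
  exact ⟨q.2, q.1, rfl⟩

-- X is a disjoint union of punctured lines; they are removed one at a time.
omit [Fintype V] in
theorem sub_one_dvd_card {X : Finset V}
    (hX : ∀ (a : ZMod p) (s : V), a ≠ 0 → s ∈ X → a • s ∈ X) (h0 : (0 : V) ∉ X) :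
    p - 1 ∣ #X := by
  classical
  induction hn : #X using Nat.strong_induction_on generalizing X with
  | _ n ih =>
    subst hn
    rcases X.eq_empty_or_nonempty with rfl | ⟨x, hx⟩
    · simp
    have hx0 : x ≠ 0 := fun h => h0 (h ▸ hx)
    set O := univ.image (fun a : (ZMod p)ˣ => (a : ZMod p) • x) with hO
    have hOX : O ⊆ X := fun y hy => by
      obtain ⟨a, -, rfl⟩ := mem_image.mp hy
      exact hX _ _ a.ne_zero hx
    have hOc : #O = p - 1 := by
      rw [card_image_of_injective, card_univ, ZMod.card_units_eq_totient,
        Nat.totient_prime Fact.out]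
      intro a b hab
      exact Units.ext (smul_left_injective _ hx0 hab)
    have hpos : 0 < #O := card_pos.mpr ⟨x, mem_image.mpr ⟨1, mem_univ _, by simp⟩⟩
    have hcard := card_sdiff_add_card_eq_card hOX
    have := ih #(X \ O) (by omega) (X := X \ O) (fun a s ha hs => ?_)
      (fun h => h0 (mem_sdiff.mp h).1) rfl
    · rw [← hcard]
      exact dvd_add this (by rw [hOc])
    · rw [mem_sdiff] at hs ⊢
      refine ⟨hX a s ha hs.1, fun hmem => hs.2 ?_⟩
      obtain ⟨b, -, hb⟩ := mem_image.mp hmem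
      refine mem_image.mpr ⟨(Units.mk0 a ha)⁻¹ * b, mem_univ _, ?_⟩
      rw [Units.val_mul, mul_smul]
      rw [hb, Units.val_inv_eq_inv_val, Units.val_mk0, inv_smul_smul₀ ha]

theorem apply_eq_zero_of_mem_span {ι : Type*} [Fintype ι] {x : ι → V} {f : Module.Dual (ZMod p) V}
    (hf : f ∈ dualSlice x (0 : ι → ZMod p)) {s : V}
    (hs : s ∈ Submodule.span (ZMod p) (Set.range x)) : f s = 0 := by
  have hle : Submodule.span (ZMod p) (Set.range x) ≤ f.ker := by
    rw [Submodule.span_le]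
    rintro _ ⟨i, rfl⟩
    exact (mem_dualSlice.mp hf i)
  exact hle hs

-- Vectors of the span are zeros of every functional in the slice, and the other vectors average to
-- zero; independence of the family is not needed for this.
open scoped Classical in
theorem sum_dualSlice_zero_kerSum {ι : Type*} [Fintype ι] (x : ι → V) (X : Finset V) :
    ∑ f ∈ dualSlice x (0 : ι → ZMod p), kerSum X f = #(dualSlice x (0 : ι → ZMod p)) *
      ((p - 1) * #{s ∈ X | s ∈ Submodule.span (ZMod p) (Set.range x)}) := by
  simp only [kerSum]
  rw [sum_comm, card_filter, Nat.cast_sum, mul_sum, mul_sum]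
  refine sum_congr rfl fun s _ => ?_
  split_ifs with hs
  · rw [sum_congr rfl fun f hf => if_pos (apply_eq_zero_of_mem_span hf hs), sum_const,
      nsmul_eq_mul, Nat.cast_one, mul_one]
  · rw [sum_dualSlice_ite_of_notMem hs]
    simp

/-- As c_i ≠ 0, every vector can be brought to 0 by steps from the connection set, so the connection
set spans V. -/
theorem TranslationDistance.dual_eq_zero (h : TranslationDistance A d)
    (hc : ∀ i < A.b.length, A.cNum (i + 1) ≠ 0) {f : Module.Dual (ZMod p) V}
    (hf : ∀ s, d s = 1 → f s = 0) : f = 0 := by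
  have : ∀ n v, d v = n → f v = 0 := by
    intro n
    induction n with
    | zero => intro v hv; rw [(h.eq_zero_iff v).mp hv, _root_.map_zero]
    | succ n ih =>
      intro v hv
      have hpos : 0 < #{s | d s = 1 ∧ d (v + s) + 1 = d v} := by
        rw [h.card_c, hv]
        have := h.le v
        exact Nat.pos_of_ne_zero (hc n (by omega))
      obtain ⟨s, hs⟩ := card_pos.mp hpos
      simp only [mem_filter, mem_univ, true_and] at hs
      have h1 := ih (v + s) (by omega)
      rwa [map_add, hf s hs.1, add_zero] at h1
  exact LinearMap.ext fun v => this _ v rfl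

theorem exists_ne_zero_mem_dualSlice {ι : Type*} [Fintype ι] {x : ι → V}
    (hx : LinearIndependent (ZMod p) x) (hc : p ^ Fintype.card ι < Fintype.card V) :
    ∃ f ∈ dualSlice x (0 : ι → ZMod p), f ≠ 0 := by
  have h1 := card_dualSlice_mul hx 0
  have h2 : 1 < #(dualSlice x (0 : ι → ZMod p)) := by
    by_contra hle
    have := Nat.mul_le_mul_right (p ^ Fintype.card ι) (not_lt.mp hle)
    omega
  obtain ⟨f, hf, hne⟩ := exists_mem_ne h2 0
  exact ⟨f, hf, hne⟩

end Eigenvalue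

/-! ### The arrays of order 5^4 and 7^3 -/

section

variable {p : ℕ} [Fact p.Prime] {V : Type*} [AddCommGroup V] [Module (ZMod p) V]

theorem exists_linearIndependent_pair {X : Finset V} {x : V} (hx : x ≠ 0) (hX : p < #X) :
    ∃ y ∈ X, LinearIndependent (ZMod p) ![x, y] := by
  classical
  by_contra! hno
  have hsub : X ⊆ univ.image fun a : ZMod p => a • x := fun y hy => by
    have := hno y hy
    rw [LinearIndependent.pair_iff' hx] at this
    push Not at this
    obtain ⟨a, ha⟩ := this
    exact mem_image.mpr ⟨a, mem_univ _, ha⟩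
  have := (card_le_card hsub).trans card_image_le
  rw [card_univ, ZMod.card] at this
  omega

variable [Fintype V]

omit [Fintype V] in
/-- The nonzero multiples of two independent vectors in a set closed under nonzero scalars. -/
theorem two_mul_sub_one_le_card {X : Finset V} {x y : V}
    (hX : ∀ (a : ZMod p) (s : V), a ≠ 0 → s ∈ X → a • s ∈ X) (hx : x ∈ X) (hy : y ∈ X)
    (h : LinearIndependent (ZMod p) ![x, y]) : 2 * (p - 1) ≤ #X := by
  classical
  have hx0 : x ≠ 0 := by simpa using h.ne_zero 0
  have hy0 : y ≠ 0 := by simpa using h.ne_zero 1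
  have hinj : Function.Injective fun q : (ZMod p)ˣ × Bool => (q.1 : ZMod p) • (if q.2 then x else y) := by
    rw [LinearIndependent.pair_iff] at h
    rintro ⟨a, i⟩ ⟨b, j⟩ hab
    cases i <;> cases j <;> simp only [if_true, Bool.false_eq_true, if_false] at hab
    · rw [Units.ext (smul_left_injective _ hy0 hab)]
    · have := h b (-a) (by rw [neg_smul, hab]; simp)
      exact absurd this.1 b.ne_zero
    · have := h a (-b) (by rw [neg_smul, hab]; simp)
      exact absurd this.1 a.ne_zero
    · rw [Units.ext (smul_left_injective _ hx0 hab)]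
  have hsub : univ.image (fun q : (ZMod p)ˣ × Bool => (q.1 : ZMod p) • (if q.2 then x else y)) ⊆ X := by
    intro s hs
    obtain ⟨q, -, rfl⟩ := mem_image.mp hs
    refine hX _ _ q.1.ne_zero ?_
    split_ifs <;> assumption
  have := card_le_card hsub
  rw [card_image_of_injective _ hinj, card_univ, Fintype.card_prod, ZMod.card_units_eq_totient,
    Nat.totient_prime Fact.out, Fintype.card_bool] at this
  omega

end

/-- S is a set of 13 points of PG(3,5), and planes meet it in 6, 3 or 1 points. The planes through a
line that joins two points of S cannot have consistent intersection numbers. -/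
theorem noTranslationDistance_52_42_16 : NoTranslationDistance ⟨[52, 42, 16], [1, 6, 28]⟩ := by
  classical
  intro p hp V _ _ hV d h
  have hcl := h.card_classes_three
  have hcV : Fintype.card V = 5 ^ 4 := by omega
  obtain rfl : p = 5 := TranslationDistance.eq_of_card_eq_prime_pow hp Nat.prime_five (by norm_num) hV hcV
  have := Fact.mk hp
  let _ : Module (ZMod 5) V := AddCommGroup.zmodModule hV
  -- As a_1 = 9 is odd, doubling preserves S, and 2 generates the units modulo 5.
  have h2 : ∀ s, d s = 1 → d ((2 : ZMod 5) • s) = 1 := fun s hs => by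
    rw [two_smul]
    exact h.add_self_of_odd (by decide) hs
  have hsmul : ∀ (a : ZMod 5) (s : V), a ≠ 0 → d s = 1 → d (a • s) = 1 := by
    intro a s ha hs
    have h4 := h2 _ (h2 s hs)
    have h3 := h2 _ h4
    rw [smul_smul] at h4
    rw [smul_smul, smul_smul] at h3
    fin_cases a
    · exact absurd rfl ha
    · exact (one_smul (ZMod 5) s).symm ▸ hs
    · exact h2 s hs
    · exact h3
    · exact h4
  set S : Finset V := {s | d s = 1} with hS
  have hSX : ∀ (a : ZMod 5) (s : V), a ≠ 0 → s ∈ S → a • s ∈ S := fun a s ha hs => by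
    simp only [hS, mem_filter, mem_univ, true_and] at hs ⊢
    exact hsmul a s ha hs
  have hS0 : (0 : V) ∉ S := by simp [hS, h.map_zero]
  have hSc : #S = 52 := h.card_one
  -- The eigenvalues 17, 2, -8 belong to 24, 12, 4 zeros, since 5z - 52 = 4θ. The value 52 is
  -- excluded by f ≠ 0.
  have hz : ∀ f : Module.Dual (ZMod 5) V, f ≠ 0 →
      #{s ∈ S | f s = 0} = 24 ∧ kerSum S f = 68 ∨ #{s ∈ S | f s = 0} = 12 ∧ kerSum S f = 8 ∨
        #{s ∈ S | f s = 0} < 8 := by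
    intro f hf
    have hlt : #{s ∈ S | f s = 0} < #S := by
      refine card_lt_card (filter_ssubset.mpr ?_)
      by_contra! hall
      exact hf (h.dual_eq_zero (by decide) fun s hs => hall s (by simpa [hS] using hs))
    obtain ⟨θ, h1, -, -, h3⟩ := h.exists_eigenvalue_three hsmul f
    have hk := kerSum_eq S f
    rw [hSc] at hk
    push_cast at h1 h3
    have h4 : (θ - 52) * ((θ - 17) * ((θ - 2) * (θ + 8))) = 0 := by
      norm_num at h3
      linear_combination h3
    simp only [mul_eq_zero, sub_eq_zero] at h4
    rw [hk] at h1 ⊢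
    push_cast at h1 ⊢
    rcases h4 with h4 | h4 | h4 | h4 <;> omega
  obtain ⟨x, hx⟩ : S.Nonempty := card_pos.mp (by omega)
  have hx0 : x ≠ 0 := fun h => hS0 (h ▸ hx)
  obtain ⟨y, hy, hxy⟩ := exists_linearIndependent_pair (p := 5) hx0 (X := S) (by omega)
  set W := Submodule.span (ZMod 5) (Set.range ![x, y]) with hW
  set X : Finset V := {s ∈ S | s ∈ W} with hX
  have hXX : ∀ (a : ZMod 5) (s : V), a ≠ 0 → s ∈ X → a • s ∈ X := fun a s ha hs => by
    rw [hX, mem_filter] at hs ⊢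
    exact ⟨hSX a s ha hs.1, W.smul_mem a hs.2⟩
  have hX4 : 4 ∣ #X := sub_one_dvd_card hXX fun h0 => hS0 (mem_filter.mp h0).1
  have hX8 : 8 ≤ #X := two_mul_sub_one_le_card hXX
    (mem_filter.mpr ⟨hx, Submodule.subset_span ⟨0, rfl⟩⟩)
    (mem_filter.mpr ⟨hy, Submodule.subset_span ⟨1, rfl⟩⟩) hxy
  set Φ := dualSlice ![x, y] (0 : Fin 2 → ZMod 5) with hΦ
  have hΦc : #Φ = 25 := by
    have := card_dualSlice_mul hxy (0 : Fin 2 → ZMod 5)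
    rw [hcV, Fintype.card_fin, ← hΦ] at this
    omega
  have hle : ∀ f ∈ Φ, #X ≤ #{s ∈ S | f s = 0} := fun f hf => card_le_card fun s hs => by
    rw [hX, mem_filter] at hs
    exact mem_filter.mpr ⟨hs.1, apply_eq_zero_of_mem_span hf hs.2⟩
  have h0Φ : 0 ∈ Φ := by simp [hΦ]
  have hsum := sum_dualSlice_zero_kerSum (p := 5) ![x, y] S
  rw [← hΦ, hΦc, ← add_sum_erase _ _ h0Φ, kerSum_zero, hSc] at hsum
  -- Every f in Φ vanishes on X, which has at least eight vectors; so the third type does not occur.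
  have hval : ∀ f ∈ Φ.erase 0, kerSum S f = 8 + 60 * if #{s ∈ S | f s = 0} = 24 then 1 else 0 := by
    intro f hf
    rw [mem_erase] at hf
    have h1 := hz f hf.1
    have h2 := hle f hf.2
    split_ifs with h3 <;> omega
  rw [sum_congr rfl hval, sum_add_distrib, sum_const, card_erase_of_mem h0Φ, hΦc, ← mul_sum,
    sum_boole] at hsum
  have hnle : #{f ∈ Φ.erase 0 | #{s ∈ S | f s = 0} = 24} ≤ 24 := by
    refine (card_filter_le _ _).trans ?_
    rw [card_erase_of_mem h0Φ, hΦc]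
  have hbig : 12 < #X → #{f ∈ Φ.erase 0 | #{s ∈ S | f s = 0} = 24} = 24 := fun hlt => by
    rw [filter_true_of_mem, card_erase_of_mem h0Φ, hΦc]
    intro f hf
    rw [mem_erase] at hf
    have h1 := hz f hf.1
    have h2 := hle f hf.2
    omega
  have hXle : #X ≤ 52 := hSc ▸ card_le_card (filter_subset _ _)
  -- With N functionals of the first type the sum reads 20 + 3N = 5#X. Here 4 divides #X and N ≤ 24,
  -- with N = 24 as soon as #X > 12; there is no solution.
  rw [← hW, ← hX] at hsum
  norm_num at hsum
  omega

/-- The units modulo 7 are generated by 2, of order three, and -1. -/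
theorem smul_mem_of_two_smul_mem {V : Type*} [AddCommGroup V] [Module (ZMod 7) V] {P : V → Prop}
    (h2 : ∀ s, P s → P ((2 : ZMod 7) • s)) (hneg : ∀ s, P s → P (-s)) (a : ZMod 7) (s : V)
    (ha : a ≠ 0) (hs : P s) : P (a • s) := by
  have h4 := h2 _ (h2 s hs)
  have h3 := hneg _ h4
  have h5 := hneg _ (h2 s hs)
  have h6 := hneg _ hs
  rw [smul_smul] at h4 h3
  rw [← neg_smul] at h3 h5
  rw [← neg_one_smul (ZMod 7)] at h6
  fin_cases a
  · exact absurd rfl ha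
  · exact (one_smul (ZMod 7) s).symm ▸ hs
  · exact h2 s hs
  · exact h3
  · exact h4
  · exact h5
  · exact h6

/-- Representatives of the seven points obtained by completing the lines on three points of a set
that meets every line in at most one or in exactly three points. -/
def fanoVec (g e : ZMod 7) : Fin 7 → ZMod 7 × ZMod 7 × ZMod 7 :=
  ![(1, 0, 0), (0, 1, 0), (0, 0, 1), (1, 1, 0), (1, 0, 1), (0, 1, g), (1, e, e * g)]

/-- The seven vectors lie on different lines through the origin, hence account for all 7·6 = 42
vectors of S. -/
theorem fanoVec_smul_ne : ∀ g e : ZMod 7, g ≠ 0 → e ≠ 0 → ∀ i j, i ≠ j → ∀ k : ZMod 7,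
    (k * (fanoVec g e i).1, k * (fanoVec g e i).2.1, k * (fanoVec g e i).2.2) ≠ fanoVec g e j := by
  decide +kernel

/-- For the third point on the line through x + y and w. All its coordinates are nonzero, so only
the last of the seven vectors can be proportional to it. -/
theorem fanoVec_eq_left : ∀ g e a : ZMod 7, g ≠ 0 → e ≠ 0 → a ≠ 0 → ∀ i, ∀ k : ZMod 7,
    (1, 1, a) = (k * (fanoVec g e i).1, k * (fanoVec g e i).2.1, k * (fanoVec g e i).2.2) →
    1 = e := by
  decide +kernel

/-- The same for the line through x + w and y, once e = 1 is known. -/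
theorem fanoVec_eq_right : ∀ g a : ZMod 7, g ≠ 0 → a ≠ 0 → ∀ i, ∀ k : ZMod 7,
    (1, a, 1) = (k * (fanoVec g 1 i).1, k * (fanoVec g 1 i).2.1, k * (fanoVec g 1 i).2.2) →
    1 = g := by
  decide +kernel

/-- For the line through x + y and x + w. Its third point would have to be that of y + w, which
requires 2 = 0: a Fano plane lives in characteristic two only. -/
theorem fanoVec_ne : ∀ a : ZMod 7, a ≠ 0 → ∀ i, ∀ k : ZMod 7,
    (1 + a, 1, a) ≠ (k * (fanoVec 1 1 i).1, k * (fanoVec 1 1 i).2.1, k * (fanoVec 1 1 i).2.2) := by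
  decide +kernel

/-- S is a set of seven points of PG(2,7), and the eigenvalues say that a line meets it in 0, 1 or 3
points. Two points determine a third one, so the seven points form a Fano plane, which does not
embed. -/
theorem noTranslationDistance_42_30_12 : NoTranslationDistance ⟨[42, 30, 12], [1, 6, 28]⟩ := by
  classical
  intro p hp V _ _ hV d h
  have hcl := h.card_classes_three
  have hcV : Fintype.card V = 7 ^ 3 := by omega
  have hp7 : Nat.Prime 7 := by norm_num
  obtain rfl : p = 7 :=
    TranslationDistance.eq_of_card_eq_prime_pow hp hp7 (by norm_num) hV hcV
  have := Fact.mk hp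
  let _ : Module (ZMod 7) V := AddCommGroup.zmodModule hV
  have hsmul : ∀ (a : ZMod 7) (s : V), a ≠ 0 → d s = 1 → d (a • s) = 1 :=
    smul_mem_of_two_smul_mem (fun s hs => by
      rw [two_smul]
      exact h.add_self_of_odd (by decide) hs) fun s hs => by rw [h.neg, hs]
  set S : Finset V := {s | d s = 1} with hS
  have hSX : ∀ (a : ZMod 7) (s : V), a ≠ 0 → s ∈ S → a • s ∈ S := fun a s ha hs => by
    simp only [hS, mem_filter, mem_univ, true_and] at hs ⊢
    exact hsmul a s ha hs
  have hS0 : (0 : V) ∉ S := by simp [hS, h.map_zero]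
  have hSc : #S = 42 := h.card_one
  -- The eigenvalues 14, 0, -7 belong to 18, 6, 0 zeros, since 7z - 42 = 6θ.
  have hz : ∀ f : Module.Dual (ZMod 7) V, f ≠ 0 →
      #{s ∈ S | f s = 0} = 18 ∨ #{s ∈ S | f s = 0} < 12 := by
    intro f hf
    have hlt : #{s ∈ S | f s = 0} < #S := by
      refine card_lt_card (filter_ssubset.mpr ?_)
      by_contra! hall
      exact hf (h.dual_eq_zero (by decide) fun s hs => hall s (by simpa [hS] using hs))
    obtain ⟨θ, h1, -, -, h3⟩ := h.exists_eigenvalue_three hsmul f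
    have hk := kerSum_eq S f
    rw [hSc] at hk
    push_cast at h1 h3
    have h4 : (θ - 42) * ((θ - 14) * (θ * (θ + 7))) = 0 := by
      norm_num at h3
      linear_combination h3
    simp only [mul_eq_zero, sub_eq_zero] at h4
    rw [hk] at h1
    push_cast at h1
    rcases h4 with h4 | h4 | h4 | h4 <;> omega
  -- The line through x and y contains at least 12 vectors of S, hence 18. The third point is
  -- written as x + a y.
  have hthird : ∀ x ∈ S, ∀ y ∈ S, LinearIndependent (ZMod 7) ![x, y] →
      ∃ a : ZMod 7, a ≠ 0 ∧ x + a • y ∈ S := by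
    intro x hx y hy hxy
    obtain ⟨f, hf, hf0⟩ := exists_ne_zero_mem_dualSlice hxy (by rw [hcV]; norm_num)
    have hfx : f x = 0 := by simpa using mem_dualSlice.mp hf 0
    have hfy : f y = 0 := by simpa using mem_dualSlice.mp hf 1
    set X : Finset V := {s ∈ S | f s = 0} with hX
    have hXX : ∀ (a : ZMod 7) (s : V), a ≠ 0 → s ∈ X → a • s ∈ X := fun a s ha hs => by
      rw [hX, mem_filter] at hs ⊢
      exact ⟨hSX a s ha hs.1, by simp [hs.2]⟩
    have h12 := two_mul_sub_one_le_card hXX (mem_filter.mpr ⟨hx, hfx⟩) (mem_filter.mpr ⟨hy, hfy⟩) hxy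
    have h18 := hz f hf0
    rw [← hX] at h18
    have hcover : ¬ X ⊆ univ.image (fun a : ZMod 7 => a • x) ∪ univ.image fun a : ZMod 7 => a • y := by
      intro hsub
      have h1 := (card_le_card hsub).trans (card_union_le _ _)
      have h2 : #(univ.image fun a : ZMod 7 => a • x) ≤ 7 := card_image_le
      have h3 : #(univ.image fun a : ZMod 7 => a • y) ≤ 7 := card_image_le
      omega
    obtain ⟨s, hsX, hs⟩ := not_subset.mp hcover
    rw [hX, mem_filter] at hsX
    -- Otherwise f vanishes at three independent vectors of a three-dimensional space.
    have hspan : s ∈ Submodule.span (ZMod 7) (Set.range ![x, y]) := by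
      by_contra hns
      have hli : LinearIndependent (ZMod 7) (Fin.cons s ![x, y] : Fin 3 → V) :=
        linearIndependent_finCons.mpr ⟨hxy, hns⟩
      have hc := card_dualSlice_mul hli 0
      rw [hcV, Fintype.card_fin] at hc
      have hc1 : #(dualSlice (Fin.cons s ![x, y] : Fin 3 → V) (0 : Fin 3 → ZMod 7)) ≤ 1 := by omega
      refine hf0 (card_le_one.mp hc1 f ?_ 0 (by simp))
      rw [mem_dualSlice]
      intro i
      refine Fin.cases ?_ (fun j => ?_) i
      · simpa using hsX.2
      · simpa using mem_dualSlice.mp hf j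
    rw [Matrix.range_cons_cons_empty, Submodule.mem_span_pair] at hspan
    obtain ⟨a, b, rfl⟩ := hspan
    have ha : a ≠ 0 := by
      rintro rfl
      exact hs (mem_union_right _ (mem_image.mpr ⟨b, mem_univ _, by simp⟩))
    have hb : b ≠ 0 := by
      rintro rfl
      exact hs (mem_union_left _ (mem_image.mpr ⟨a, mem_univ _, by simp⟩))
    refine ⟨a⁻¹ * b, mul_ne_zero (inv_ne_zero ha) hb, ?_⟩
    have := hSX a⁻¹ _ (inv_ne_zero ha) hsX.1
    rwa [smul_add, smul_smul, smul_smul, inv_mul_cancel₀ ha, one_smul] at this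
  obtain ⟨x, hx⟩ : S.Nonempty := card_pos.mp (by omega)
  have hx0 : x ≠ 0 := fun h => hS0 (h ▸ hx)
  obtain ⟨y₀, hy₀, hxy₀⟩ := exists_linearIndependent_pair (p := 7) hx0 (X := S) (by omega)
  obtain ⟨f, hf, hf0⟩ := exists_ne_zero_mem_dualSlice hxy₀ (by rw [hcV]; norm_num)
  obtain ⟨w₀, hw₀, hfw⟩ : ∃ w ∈ S, f w ≠ 0 := by
    by_contra! hall
    exact hf0 (h.dual_eq_zero (by decide) fun s hs => hall s (by simpa [hS] using hs))
  have hfx : f x = 0 := by simpa using mem_dualSlice.mp hf 0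
  have hxw₀ : LinearIndependent (ZMod 7) ![x, w₀] := by
    rw [LinearIndependent.pair_iff' hx0]
    rintro a rfl
    simp [hfx] at hfw
  obtain ⟨a, ha, hy'⟩ := hthird x hx y₀ hy₀ hxy₀
  obtain ⟨b, hb, hw'⟩ := hthird x hx w₀ hw₀ hxw₀
  -- Rescaling makes x + y and x + w the third points on the lines from x; y and w then serve as
  -- coordinates together with x.
  set y := a • y₀ with hy_def
  set w := b • w₀ with hw_def
  have hy : y ∈ S := hSX a _ ha hy₀
  have hw : w ∈ S := hSX b _ hb hw₀
  have hcoord : ∀ r s t : ZMod 7, r • x + s • y + t • w = 0 → r = 0 ∧ s = 0 ∧ t = 0 := by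
    intro r s t hrst
    have hfy : f y₀ = 0 := by simpa using mem_dualSlice.mp hf 1
    have h1 := congrArg f hrst
    have h1 : t = 0 := by simpa [hfx, hy_def, hfy, hw_def, hb, hfw] using h1
    subst h1
    rw [LinearIndependent.pair_iff] at hxy₀
    have h2 := hxy₀ r (s * a) (by rw [mul_smul]; simpa using hrst)
    exact ⟨h2.1, by simpa [ha] using h2.2, rfl⟩
  have hpair : ∀ r s t r' s' t' : ZMod 7, (∀ k l : ZMod 7, k * r + l * r' = 0 →
      k * s + l * s' = 0 → k * t + l * t' = 0 → k = 0 ∧ l = 0) →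
      LinearIndependent (ZMod 7) ![r • x + s • y + t • w, r' • x + s' • y + t' • w] := by
    intro r s t r' s' t' hk
    rw [LinearIndependent.pair_iff]
    intro k l hkl
    obtain ⟨h1, h2, h3⟩ := hcoord (k * r + l * r') (k * s + l * s') (k * t + l * t') (by
      rw [← hkl]
      module)
    exact hk k l h1 h2 h3
  -- The third point on the line of y and w is the sixth point, and its line to x supplies the
  -- seventh; g and e are the free parameters of `fanoVec`.
  obtain ⟨g, hg, hyw⟩ := hthird y hy w hw (by
    simpa using hpair 0 1 0 0 0 1 fun k l _ h2 h3 => ⟨by simpa using h2, by simpa using h3⟩)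
  obtain ⟨e, he, hxyw⟩ := hthird x hx _ hyw (by
    have := hpair 1 0 0 0 1 g fun k l h1 h2 _ => ⟨by simpa using h1, by simpa using h2⟩
    simpa using this)
  let v := fanoVec g e
  let φ : ZMod 7 × ZMod 7 × ZMod 7 → V := fun q => q.1 • x + q.2.1 • y + q.2.2 • w
  have hφinj : ∀ q q', φ q = φ q' → q = q' := by
    rintro ⟨r, s, t⟩ ⟨r', s', t'⟩ hqq
    obtain ⟨h1, h2, h3⟩ := hcoord (r - r') (s - s') (t - t') (by
      rw [← sub_eq_zero] at hqq
      rw [← hqq]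
      simp only [φ]
      module)
    simp only [sub_eq_zero] at h1 h2 h3
    rw [h1, h2, h3]
  have hex : ∀ q, φ q ∈ S → ∃ i, ∃ k : ZMod 7, q = (k * (v i).1, k * (v i).2.1, k * (v i).2.2) := by
    intro q hq
    have hφs : ∀ (k : ZMod 7) q, k • φ q = φ (k * q.1, k * q.2.1, k * q.2.2) := fun k q => by
      simp only [φ]
      module
    have hmem : ∀ i, φ (v i) ∈ S := by
      intro i
      fin_cases i
      · simpa [φ, v, fanoVec] using hx
      · simpa [φ, v, fanoVec] using hy
      · simpa [φ, v, fanoVec] using hw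
      · simpa [φ, v, fanoVec] using hy'
      · simpa [φ, v, fanoVec] using hw'
      · simpa [φ, v, fanoVec] using hyw
      · have : φ (v 6) = x + e • (y + g • w) := by
          change (1 : ZMod 7) • x + e • y + (e * g) • w = _
          module
        exact this ▸ hxyw
    obtain ⟨i, k, hk⟩ := exists_eq_smul_of_card hSX hS0 hmem (fun i j hij k hk =>
      fanoVec_smul_ne g e hg he i j hij k (hφinj _ _ (hφs k _ ▸ hk))) (by rw [hSc]) hq
    exact ⟨i, k, hφinj _ _ (by rw [hk, hφs])⟩
  obtain ⟨a₁, ha₁, h₁⟩ := hthird _ hy' w hw (by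
    have := hpair 1 1 0 0 0 1 fun k l h1 _ h3 => ⟨by simpa using h1, by simpa using h3⟩
    simpa using this)
  obtain ⟨i₁, k₁, hk₁⟩ := hex (1, 1, a₁) (by simpa [φ] using h₁)
  obtain ⟨a₂, ha₂, h₂⟩ := hthird _ hw' y hy (by
    have := hpair 1 0 1 0 1 0 fun k l h1 h2 _ => ⟨by simpa using h1, by simpa using h2⟩
    simpa using this)
  obtain ⟨i₂, k₂, hk₂⟩ := hex (1, a₂, 1) (by
    have : φ (1, a₂, 1) = x + w + a₂ • y := by
      simp only [φ]
      module
    exact this ▸ h₂)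
  obtain ⟨a₃, ha₃, h₃⟩ := hthird _ hy' _ hw' (by
    have := hpair 1 1 0 1 0 1 fun k l _ h2 h3 => ⟨by simpa using h2, by simpa using h3⟩
    simpa using this)
  obtain ⟨i₃, k₃, hk₃⟩ := hex (1 + a₃, 1, a₃) (by
    have : φ (1 + a₃, 1, a₃) = x + y + a₃ • (x + w) := by
      simp only [φ]
      module
    exact this ▸ h₃)
  obtain rfl := fanoVec_eq_left g e a₁ hg he ha₁ i₁ k₁ hk₁
  obtain rfl := fanoVec_eq_right g a₂ hg ha₂ i₂ k₂ hk₂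
  exact fanoVec_ne a₃ ha₃ i₃ k₃ hk₃

/-! ### Intersection numbers, pencils, and the array {104,66,8;1,12,88} -/

section PairCount

variable {V : Type*} [AddCommGroup V] [Fintype V] {A : IntersectionArray} {d : V → ℕ}

/-- The recurrence for the numbers of `x` at distance `i` from `0` and `j` from `-v`. -/
theorem TranslationDistance.sum_step_mul_card_pair (h : TranslationDistance A d) (i j : ℕ) (v : V) :
    ∑ m ∈ range (A.b.length + 1), A.stepNum m i * #{x | d x = m ∧ d (v + x) = j} =
      ∑ s with d s = 1, #{x | d x = i ∧ d (v + s + x) = j} := by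
  classical
  have h1 : ∑ m ∈ range (A.b.length + 1), A.stepNum m i * #{x | d x = m ∧ d (v + x) = j} =
      ∑ x with d (v + x) = j, #{s | d s = 1 ∧ d (x + s) = i} := by
    rw [← sum_fiberwise_of_maps_to (t := range (A.b.length + 1)) (g := d)
      fun w _ => by simpa [Nat.lt_succ_iff] using h.le w]
    refine sum_congr rfl fun m _ => ?_
    rw [filter_filter, sum_congr rfl (g := fun _ => A.stepNum m i) fun x hx => ?_, sum_const,
      smul_eq_mul, mul_comm]
    · congr 2
      ext x
      simp [and_comm]
    · rw [h.card_step, (mem_filter.mp hx).2.2]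
  have h2 : ∑ x with d (v + x) = j, #{s | d s = 1 ∧ d (x + s) = i} =
      ∑ s with d s = 1, #{x | d (v + x) = j ∧ d (x + s) = i} := by
    simp only [← filter_filter]
    exact sum_card_bipartiteAbove_eq_sum_card_bipartiteBelow fun x s => d (x + s) = i
  rw [h1, h2]
  refine sum_nbij' (fun s => -s) (fun s => -s) (fun s hs => ?_) (fun s hs => ?_)
    (fun s _ => neg_neg s) (fun s _ => neg_neg s) fun s _ => ?_
  · simpa [h.neg] using hs
  · simpa [h.neg] using hs
  · refine card_bij (fun x _ => x + s) (fun x hx => ?_) (fun x _ y _ hxy => add_left_injective s hxy)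
      fun y hy => ⟨y - s, ?_, sub_add_cancel y s⟩
    · simp only [mem_filter, mem_univ, true_and] at hx ⊢
      exact ⟨hx.2, by rw [← hx.1]; congr 1; abel⟩
    · simp only [mem_filter, mem_univ, true_and] at hy ⊢
      exact ⟨by rw [← hy.2]; congr 1; abel, by simpa using hy.1⟩

/-- The number of paths of length two between given distance classes. -/
theorem TranslationDistance.sum_step_step (h : TranslationDistance A d) (j : ℕ) (v : V) :
    ∑ m ∈ range (A.b.length + 1), A.stepNum m 1 * #{x | d x = m ∧ d (v + x) = j} =
      ∑ m ∈ range (A.b.length + 1), A.stepNum (d v) m * A.stepNum m j := by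
  classical
  rw [h.sum_step_mul_card_pair, ← sum_fiberwise_of_maps_to (t := range (A.b.length + 1))
    (g := fun s => d (v + s)) fun s _ => by simpa [Nat.lt_succ_iff] using h.le (v + s)]
  refine sum_congr rfl fun m _ => ?_
  rw [filter_filter, ← h.card_step v m, ← smul_eq_mul, ← sum_const]
  refine sum_congr rfl fun s hs => ?_
  rw [h.card_step, (mem_filter.mp hs).2.2]

theorem TranslationDistance.sum_card_pair (h : TranslationDistance A d) (j : ℕ) (v : V) :
    ∑ m ∈ range (A.b.length + 1), #{x | d x = m ∧ d (v + x) = j} = #{x | d x = j} := by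
  classical
  have h1 : #{x | d x = j} = #{x | d (v + x) = j} := by
    refine card_bij (fun x _ => x - v) (fun x hx => ?_)
      (fun x _ y _ hxy => sub_left_injective hxy) fun y hy => ⟨v + y, ?_, by abel⟩
    · simpa using hx
    · simpa using hy
  rw [h1, card_eq_sum_card_fiberwise (f := d) (t := range (A.b.length + 1))
    fun w _ => by simpa [Nat.lt_succ_iff] using h.le w]
  refine sum_congr rfl fun m _ => congrArg card ?_
  ext x
  simp [and_comm]

end PairCount

section Ternary

variable {V : Type*} [AddCommGroup V] [Module (ZMod 3) V]

theorem smul_eq_or_neg {a : ZMod 3} (ha : a ≠ 0) (s : V) : a • s = s ∨ a • s = -s := by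
  have : a = 1 ∨ a = -1 := by revert a; decide
  rcases this with rfl | rfl
  · exact Or.inl (one_smul _ s)
  · exact Or.inr (neg_one_smul _ s)

theorem neg_sub_self_eq (x : V) : -x - x = x := by
  have h3 : (3 : ZMod 3) = 0 := rfl
  have : (3 : ZMod 3) • x = 0 := by rw [h3, zero_smul]
  have h2 : -x - x = x - (3 : ZMod 3) • x := by module
  rw [h2, this, sub_zero]

theorem kerSum_neg (X : Finset V) (f : Module.Dual (ZMod 3) V) : kerSum X (-f) = kerSum X f := by
  simp [kerSum]

/-- The sum over the pencil spanned by two functionals counts the common zeros. -/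
theorem kerSum_pair (X : Finset V) (f g : Module.Dual (ZMod 3) V) :
    kerSum X f + kerSum X g + kerSum X (f + g) + kerSum X (f - g) + #X =
      9 * #{x ∈ X | f x = 0 ∧ g x = 0} := by
  simp only [kerSum]
  rw [card_filter, card_eq_sum_ones, Nat.cast_sum, Nat.cast_sum, mul_sum, ← sum_add_distrib,
    ← sum_add_distrib, ← sum_add_distrib, ← sum_add_distrib]
  refine sum_congr rfl fun x _ => ?_
  have : ∀ a b : ZMod 3, (if a = 0 then ((3 : ℕ) : ℤ) - 1 else -1) +
      (if b = 0 then ((3 : ℕ) : ℤ) - 1 else -1) + (if a + b = 0 then ((3 : ℕ) : ℤ) - 1 else -1) +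
      (if a - b = 0 then ((3 : ℕ) : ℤ) - 1 else -1) + ((1 : ℕ) : ℤ) =
      9 * ((if a = 0 ∧ b = 0 then 1 else 0 : ℕ) : ℤ) := by decide
  exact this (f x) (g x)

end Ternary

/-- The vectors on the lines through the given ones. -/
def signed (L : List (Fin 3 → ZMod 3)) : Finset (Fin 3 → ZMod 3) := {t | t ∈ L ∨ -t ∈ L}

section

variable {P : (Fin 3 → ZMod 3) → ℕ}

theorem eq_of_mem_signed (hneg : ∀ t, P (-t) = P t) {k : ℕ} {L : List (Fin 3 → ZMod 3)}
    (hL : ∀ t ∈ L, P t = k) {t : Fin 3 → ZMod 3} (ht : t ∈ signed L) : P t = k := by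
  simp only [signed, mem_filter, mem_univ, true_and] at ht
  rcases ht with ht | ht
  · exact hL t ht
  · rw [← hneg, hL _ ht]

/-- The part of the outer class in a plane spanned by two of its collinear triples with a common
vector. -/
theorem card_plane (hneg : ∀ t, P (-t) = P t) (h0 : ∀ t, P t = 0 ↔ t = 0) (hle : ∀ t, P t ≤ 3)
    (hadd : ∀ t t', P t = 1 → P t' = 1 → P (t + t') ≠ 3)
    (h2 : ∀ v, P v = 2 → #{t | P t = 3 ∧ P (v - t) = 3} ≤ 2)
    (h8 : ∀ v, P v = 1 → #{t | P t = 3 ∧ P (v - t) = 3} ≤ 8)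
    (hs : P ![1, 0, 0] = 3) (hu : P ![0, 1, 0] = 3) (hsu : P ![1, 1, 0] = 3)
    (hw : P ![0, 0, 1] = 3) (hsw : P ![1, 0, 1] = 3) :
    #{t | P t = 1} + #{t | P t = 3} = 26 ∨
      8 ≤ #{t | P t = 1} ∧ 10 ≤ #{t | P t = 3} ∧ #{t | P t = 3} ≤ 12 := by
  have hrep : ∀ L : List (Fin 3 → ZMod 3), (∀ t ∈ L, P t = 3) → ∀ v,
      #{t ∈ signed L | v - t ∈ signed L} ≤ #{t | P t = 3 ∧ P (v - t) = 3} := by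
    intro L hL v
    refine card_le_card fun t ht => ?_
    rw [mem_filter] at ht
    simp only [mem_filter, mem_univ, true_and]
    exact ⟨eq_of_mem_signed hneg hL ht.1, eq_of_mem_signed hneg hL ht.2⟩
  -- A vector at distance two has at most two representations as a sum of two vectors of the outer
  -- class. More than two representations leave distances 1 and 3.
  have hor : ∀ L : List (Fin 3 → ZMod 3), (∀ t ∈ L, P t = 3) → ∀ v, v ≠ 0 →
      2 < #{t ∈ signed L | v - t ∈ signed L} → P v = 1 ∨ P v = 3 := by
    intro L hL v hv hlt
    have h1 := hrep L hL v
    have h3 := hle v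
    have h4 : P v ≠ 0 := fun h => hv ((h0 v).mp h)
    have h5 : P v ≠ 2 := fun h => by
      have := h2 v h
      omega
    omega
  have four : ∀ L : List (Fin 3 → ZMod 3), (∀ t ∈ L, P t = 3) →
      (∀ v, v ≠ 0 → v ∉ signed L → 2 < #{t ∈ signed L | v - t ∈ signed L}) →
      #{t | P t = 1} + #{t | P t = 3} = 26 := by
    intro L hL hall
    have hv : ∀ v, v ≠ 0 ↔ P v = 1 ∨ P v = 3 := fun v => by
      refine ⟨fun hv => ?_, ?_⟩
      · by_cases hmem : v ∈ signed L
        · exact Or.inr (eq_of_mem_signed hneg hL hmem)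
        · exact hor L hL v hv (hall v hv hmem)
      · rintro h rfl
        rw [(h0 0).mpr rfl] at h
        omega
    rw [← card_union_of_disjoint (disjoint_filter.mpr fun t _ h => by omega), ← filter_or,
      filter_congr fun v _ => (hv v).symm]
    decide +kernel
  let L₀ : List (Fin 3 → ZMod 3) := [![1, 0, 0], ![0, 1, 0], ![1, 1, 0], ![0, 0, 1], ![1, 0, 1]]
  have hL₀ : ∀ t ∈ L₀, P t = 3 := by simp [L₀, hs, hu, hsu, hw, hsw]
  -- If one of the two triples extends to a full line of the outer class, every remaining nonzero
  -- vector has more than two representations, and no vector is at distance two.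
  by_cases h4 : P ![1, -1, 0] = 3
  · refine Or.inl (four (![1, -1, 0] :: L₀) (List.forall_mem_cons.mpr ⟨h4, hL₀⟩) ?_)
    decide +kernel
  by_cases h4' : P ![1, 0, -1] = 3
  · refine Or.inl (four (![1, 0, -1] :: L₀) (List.forall_mem_cons.mpr ⟨h4', hL₀⟩) ?_)
    decide +kernel
  right
  have hx : P ![1, -1, 0] = 1 := (hor L₀ hL₀ _ (by decide) (by decide +kernel)).resolve_right h4
  have hy : P ![1, 0, -1] = 1 := (hor L₀ hL₀ _ (by decide) (by decide +kernel)).resolve_right h4'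
  -- This vector and the next one have more than two representations, and they are sums of two
  -- vectors at distance one, which excludes distance three.
  have hz : P ![0, 1, -1] = 1 := (hor L₀ hL₀ _ (by decide) (by decide +kernel)).resolve_right (by
    have := hadd ![1, 0, -1] (-![1, -1, 0]) hy (by rw [hneg, hx])
    convert this using 3
    decide)
  have hq : P ![1, 1, 1] = 1 := (hor L₀ hL₀ _ (by decide) (by decide +kernel)).resolve_right (by
    have := hadd (-![1, 0, -1]) (-![1, -1, 0]) (by rw [hneg, hy]) (by rw [hneg, hx])
    convert this using 3
    decide)
  let L₁ : List (Fin 3 → ZMod 3) := [![1, -1, 0], ![1, 0, -1], ![0, 1, -1], ![1, 1, 1]]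
  have hL₁ : ∀ t ∈ L₁, P t = 1 := by simp [L₁, hx, hy, hz, hq]
  -- The four remaining lines. Two of them in the outer class would give ![1, -1, 0], which is at
  -- distance one, more than eight representations.
  let E : Fin 4 → Fin 3 → ZMod 3 := ![![0, 1, 1], ![-1, 1, 1], ![1, -1, 1], ![1, 1, -1]]
  have hE : ∀ i j, i ≠ j → P (E i) = 3 → P (E j) ≠ 3 := by
    intro i j hij hi hj
    have h1 := hrep (E i :: E j :: L₀) (by
      simp only [List.forall_mem_cons]
      exact ⟨hi, hj, hL₀⟩) ![1, -1, 0]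
    have h3 := h8 _ hx
    have : ∀ i j, i ≠ j → 8 < #{t ∈ signed (E i :: E j :: L₀) |
      ![1, -1, 0] - t ∈ signed (E i :: E j :: L₀)} := by decide +kernel
    have := this i j hij
    omega
  refine ⟨?_, ?_, ?_⟩
  · refine le_trans ?_ (card_le_card (s := signed L₁) fun t ht =>
      mem_filter.mpr ⟨mem_univ _, eq_of_mem_signed hneg hL₁ ht⟩)
    decide +kernel
  · refine le_trans ?_ (card_le_card (s := signed L₀) fun t ht =>
      mem_filter.mpr ⟨mem_univ _, eq_of_mem_signed hneg hL₀ ht⟩)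
    decide +kernel
  · have hcov : ∀ t : Fin 3 → ZMod 3, t = 0 ∨ t ∈ signed L₁ ∨ t ∈ signed L₀ ∨
        ∃ i, t = E i ∨ t = -E i := by decide +kernel
    obtain ⟨i, hi⟩ : ∃ i, ∀ j, P (E j) = 3 → j = i := by
      by_cases hex : ∃ i, P (E i) = 3
      · obtain ⟨i, hi⟩ := hex
        exact ⟨i, fun j hj => by_contra fun hji => hE j i hji hj hi⟩
      · exact ⟨0, fun j hj => absurd ⟨j, hj⟩ hex⟩
    have hsub : ({t | P t = 3} : Finset (Fin 3 → ZMod 3)) ⊆ signed (E i :: L₀) := by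
      intro t ht
      have ht : P t = 3 := by simpa using ht
      have hmem : ∀ i, (∀ t ∈ signed L₀, t ∈ signed (E i :: L₀)) ∧ E i ∈ signed (E i :: L₀) ∧
        -E i ∈ signed (E i :: L₀) := by decide +kernel
      rcases hcov t with rfl | h | h | ⟨j, rfl | rfl⟩
      · rw [(h0 0).mpr rfl] at ht
        omega
      · rw [eq_of_mem_signed hneg hL₁ h] at ht
        omega
      · exact (hmem i).1 t h
      · exact hi j ht ▸ (hmem j).2.1
      · exact hi j (hneg (E j) ▸ ht) ▸ (hmem j).2.2
    refine (card_le_card hsub).trans ?_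
    have : ∀ i, #(signed (E i :: L₀)) ≤ 12 := by decide +kernel
    exact this i

end

section

variable {V : Type*} [AddCommGroup V] [Module (ZMod 3) V]

/-- A vector of `X` outside the span of two given vectors. -/
theorem exists_linearIndependent_triple {X : Finset V} {x y : V}
    (hxy : LinearIndependent (ZMod 3) ![x, y]) (hX : 9 < #X) :
    ∃ z ∈ X, LinearIndependent (ZMod 3) ![x, y, z] := by
  classical
  by_contra! hno
  have hsub : X ⊆ univ.image fun a : ZMod 3 × ZMod 3 => a.1 • x + a.2 • y := fun z hz => by
    by_contra hmem
    refine hno z hz ?_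
    rw [LinearIndependent.pair_iff] at hxy
    rw [Fintype.linearIndependent_iff]
    intro g hg
    simp only [Fin.sum_univ_three, Matrix.cons_val_zero, Matrix.cons_val_one, Matrix.cons_val] at hg
    have h2 : g 2 = 0 := by
      by_contra h2
      refine hmem (mem_image.mpr ⟨(-(g 2)⁻¹ * g 0, -(g 2)⁻¹ * g 1), mem_univ _, ?_⟩)
      have : z = (g 2)⁻¹ • g 2 • z := (inv_smul_smul₀ h2 z).symm
      rw [this, eq_neg_of_add_eq_zero_right hg]
      module
    rw [h2, zero_smul, add_zero] at hg
    obtain ⟨h0, h1⟩ := hxy _ _ hg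
    intro i
    fin_cases i <;> assumption
  have := (card_le_card hsub).trans card_image_le
  rw [card_univ, Fintype.card_prod, ZMod.card] at this
  omega

end

/-- Let U be the class at distance three, |U| = 52. A three-dimensional subspace W spanned by two
collinear triples of U contains 10 or 12 vectors of U. Some functional o vanishing on W has just 10
zeros in U, so W contains all of them. Then the pencils through o in the annihilator of W have types
32, 32, -4 on U, and four such pencils contradict the bound 10 for common zeros. -/
theorem noTranslationDistance_104_66_8 : NoTranslationDistance ⟨[104, 66, 8], [1, 12, 88]⟩ := by
  classical
  intro p hp V _ _ hV d h
  have hcl := h.card_classes_three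
  have hcV : Fintype.card V = 3 ^ 6 := by omega
  obtain rfl : p = 3 := TranslationDistance.eq_of_card_eq_prime_pow hp Nat.prime_three (by norm_num) hV hcV
  have := Fact.mk hp
  let _ : Module (ZMod 3) V := AddCommGroup.zmodModule hV
  have hsmul : ∀ (a : ZMod 3) (s : V), a ≠ 0 → d s = 1 → d (a • s) = 1 := fun a s ha hs => by
    rcases smul_eq_or_neg ha s with h1 | h1 <;> rw [h1]
    · exact hs
    · rw [h.neg, hs]
  set S : Finset V := {s | d s = 1} with hS
  set U : Finset V := {s | d s = 3} with hU
  have hSc : #S = 104 := h.card_one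
  have hUc : #U = 52 := by omega
  -- The eigenvalues 32, 5, -4, with the corresponding values on the class at distance three.
  have htype : ∀ f : Module.Dual (ZMod 3) V, f ≠ 0 → kerSum S f = 64 ∧ kerSum U f = -22 ∨
      kerSum S f = 10 ∧ kerSum U f = 32 ∨ kerSum S f = -8 ∧ kerSum U f = -4 := by
    intro f hf
    have hlt : #{s ∈ S | f s = 0} < #S := by
      refine card_lt_card (filter_ssubset.mpr ?_)
      by_contra! hall
      exact hf (h.dual_eq_zero (by decide) fun s hs => hall s (by simpa [hS] using hs))
    obtain ⟨θ, h1, h2, h3, h4⟩ := h.exists_eigenvalue_three hsmul f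
    have hk := kerSum_eq S f
    rw [hSc] at hk
    push_cast at h1 h2 h3 h4 hk
    have h5 : (θ - 104) * ((θ - 32) * ((θ - 5) * (θ + 4))) = 0 := by
      norm_num at h4
      linear_combination h4
    simp only [mul_eq_zero, sub_eq_zero] at h5
    rw [← hS] at h1
    rw [← hU] at h3
    rcases h5 with h5 | h5 | h5 | h5
    · omega
    · subst h5
      omega
    · subst h5
      omega
    · obtain rfl : θ = -4 := by omega
      omega
  -- The numbers p^i_33 are 8, 2, 13. In the two recurrences the terms for x at distance 0 and 1 are
  -- known, which determines the other two.
  have hpair : ∀ v, d v ≠ 0 → #{x | d x = 3 ∧ d (v + x) = 3} =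
      if d v = 1 then 8 else if d v = 2 then 2 else 13 := by
    intro v hv
    have e1 := h.sum_step_step 3 v
    have e2 := h.sum_card_pair 3 v
    have e3 := h.card_step v 3
    have e4 : #{x | d x = 0 ∧ d (v + x) = 3} = if d v = 3 then 1 else 0 := by
      split_ifs with h3
      · rw [card_eq_one]
        refine ⟨0, ?_⟩
        ext x
        simp only [mem_filter, mem_univ, true_and, mem_singleton, h.eq_zero_iff]
        constructor
        · exact fun hx => hx.1
        · rintro rfl
          exact ⟨rfl, by rw [add_zero, h3]⟩
      · rw [card_eq_zero, filter_eq_empty_iff]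
        rintro x -
        rw [h.eq_zero_iff]
        rintro ⟨rfl, h4⟩
        rw [add_zero] at h4
        exact h3 h4
    have hle : d v ≤ 3 := h.le v
    rw [← hU, hUc] at e2
    simp only [List.length_cons, List.length_nil, sum_range_succ, range_zero, sum_empty,
      zero_add, e3, e4] at e1 e2
    obtain hd | hd | hd : d v = 1 ∨ d v = 2 ∨ d v = 3 := by omega
    all_goals
      rw [hd] at e1 e2 ⊢
      simp [IntersectionArray.stepNum, IntersectionArray.aNum, IntersectionArray.bNum,
        IntersectionArray.cNum] at e1 e2 ⊢
      omega
  obtain ⟨s, hsU⟩ : U.Nonempty := card_pos.mp (by omega)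
  have hs3 : d s = 3 := by simpa [hU] using hsU
  have hs0 : s ≠ 0 := fun hs => by
    rw [hs, h.map_zero] at hs3
    omega
  -- T contains the second points of the collinear triples through s, as well as s itself, since s +
  -- s = -s. Its 13 vectors are not in one plane, so there are two triples that span three
  -- dimensions.
  set T : Finset V := {u | d u = 3 ∧ d (s + u) = 3} with hT
  have hTc : #T = 13 := by
    rw [hT, hpair s (by omega), hs3]
    rfl
  obtain ⟨u, huT, hsu⟩ := exists_linearIndependent_pair (p := 3) hs0 (X := T) (by omega)
  obtain ⟨w, hwT, hx⟩ := exists_linearIndependent_triple hsu (X := T) (by omega)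
  set x : Fin 3 → V := ![s, u, w] with hxdef
  let P : (Fin 3 → ZMod 3) → ℕ := fun t => d (∑ i, t i • x i)
  have hinj : Function.Injective fun t : Fin 3 → ZMod 3 => ∑ i, t i • x i := by
    intro t t' htt
    have := Fintype.linearIndependent_iff.mp hx (t - t') (by
      simp only [Pi.sub_apply, sub_smul, sum_sub_distrib]
      exact sub_eq_zero.mpr htt)
    funext i
    exact sub_eq_zero.mp (this i)
  have hrep : ∀ v, #{t | P t = 3 ∧ P (v - t) = 3} ≤
      #{y | d y = 3 ∧ d (-(∑ i, v i • x i) + y) = 3} := by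
    intro v
    refine card_le_card_of_injOn (fun t => ∑ i, t i • x i) (fun t ht => ?_) hinj.injOn
    simp only [coe_filter, Set.mem_ofPred_eq, mem_univ, true_and, P] at ht ⊢
    refine ⟨ht.1, ?_⟩
    refine Eq.trans ?_ ht.2
    rw [← h.neg]
    congr 1
    simp only [Pi.sub_apply, sub_smul, sum_sub_distrib]
    abel
  simp only [hT, mem_filter, mem_univ, true_and] at huT hwT
  have hplane := card_plane (P := P) (fun t => by
      simp only [P, Pi.neg_apply, neg_smul, sum_neg_distrib, h.neg])
    (fun t => by
      simp only [P, h.eq_zero_iff]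
      constructor
      · exact fun ht => hinj (by simpa using ht)
      · rintro rfl
        simp)
    (fun t => h.le _)
    (fun t t' h1 h2 h3 => by
      simp only [P, Pi.add_apply, add_smul, sum_add_distrib] at h1 h2 h3
      have := h.add_le (∑ i, t i • x i) _ h2
      omega)
    (fun v hv => (hrep v).trans (by
      simp only [P] at hv
      rw [hpair _ (by rw [h.neg]; omega), h.neg, hv]
      rfl))
    (fun v hv => (hrep v).trans (by
      simp only [P] at hv
      rw [hpair _ (by rw [h.neg]; omega), h.neg, hv]
      rfl))
    (by simpa [P, Fin.sum_univ_three, hxdef] using hs3)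
    (by simpa [P, Fin.sum_univ_three, hxdef] using huT.1)
    (by simpa [P, Fin.sum_univ_three, hxdef] using huT.2)
    (by simpa [P, Fin.sum_univ_three, hxdef] using hwT.1)
    (by simpa [P, Fin.sum_univ_three, hxdef] using hwT.2)
  set Φ := dualSlice x (0 : Fin 3 → ZMod 3) with hΦ
  have hΦc : #Φ = 27 := by
    have := card_dualSlice_mul hx (0 : Fin 3 → ZMod 3)
    rw [hcV, Fintype.card_fin, ← hΦ] at this
    omega
  have hmoment : ∀ k, ∑ f ∈ Φ, kerSum ({v | d v = k} : Finset V) f = 54 * #{t | P t = k} := by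
    intro k
    rw [hΦ, sum_dualSlice_kerSum hx, ← hΦ, hΦc, card_filter, Nat.cast_sum, mul_sum, mul_sum]
    refine sum_congr rfl fun t _ => ?_
    simp only [mem_filter, mem_univ, true_and, P, Pi.zero_apply, mul_zero, sum_const_zero, if_true]
    split_ifs <;> norm_num
  have h0Φ : 0 ∈ Φ := by simp [hΦ]
  -- The combination 2K_1 - K_3 + 12 vanishes on the second and third types of functionals and
  -- equals 162 on the first.
  have hsum : ∑ f ∈ Φ.erase 0, (2 * kerSum S f - kerSum U f + 12) =
      108 * #{t | P t = 1} - 54 * #{t | P t = 3} := by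
    have hall : ∑ f ∈ Φ, (2 * kerSum S f - kerSum U f + 12) =
        2 * ∑ f ∈ Φ, kerSum S f - ∑ f ∈ Φ, kerSum U f + 27 * 12 := by
      rw [sum_add_distrib, sum_sub_distrib, sum_const, hΦc, mul_sum]
      norm_num
    rw [hS, hU, hmoment, hmoment, ← hS, ← hU, ← add_sum_erase _ _ h0Φ, kerSum_zero, kerSum_zero,
      hSc, hUc] at hall
    push_cast at hall
    linarith
  rcases hplane with h26 | ⟨hS2, hU2, hU2'⟩
  -- With 26 vectors at distances 1 and 3 the sum would be 2808 - 162·#U, which is not divisible by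
  -- 162.
  · have hdvd : (162 : ℤ) ∣ ∑ f ∈ Φ.erase 0, (2 * kerSum S f - kerSum U f + 12) := by
      refine dvd_sum fun f hf => ?_
      have := htype f (ne_of_mem_erase hf)
      omega
    omega
  -- The sum is at least 108·8 - 54·12 > 0, so a functional of the first type occurs.
  obtain ⟨o, hoΦ, hpos⟩ : ∃ o ∈ Φ.erase 0, 0 < 2 * kerSum S o - kerSum U o + 12 := by
    by_contra! hno
    have := sum_nonpos hno
    omega
  rw [mem_erase] at hoΦ
  have hoU : kerSum U o = -22 := by
    have := htype o hoΦ.1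
    omega
  have hcommon : ∀ f ∈ Φ, ∀ g ∈ Φ, 10 ≤ #{y ∈ U | f y = 0 ∧ g y = 0} := by
    intro f hf g hg
    refine hU2.trans (card_le_card_of_injOn (fun t => ∑ i, t i • x i) (fun t ht => ?_) hinj.injOn)
    simp only [coe_filter, Set.mem_ofPred_eq, mem_univ, true_and, P] at ht
    rw [hΦ, mem_dualSlice] at hf hg
    simp only [coe_filter, Set.mem_ofPred_eq, hU, mem_filter, mem_univ, true_and]
    exact ⟨ht, by simp [hf], by simp [hg]⟩
  -- Since 3z - 52 = -22, o has exactly 10 zeros in U. The subspace supplies 10 common zeros with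
  -- every g, so the pencil sum is 9·10 - 52 = 38.
  have hpo : ∀ g ∈ Φ, kerSum U g + kerSum U (o + g) + kerSum U (o - g) = 60 := by
    intro g hg
    have e1 := kerSum_pair U o g
    have e2 := kerSum_eq U o
    have e3 := hcommon o hoΦ.2 g hg
    have e4 : #{y ∈ U | o y = 0 ∧ g y = 0} ≤ #{y ∈ U | o y = 0} :=
      card_le_card (monotone_filter_right _ fun y _ hy => hy.1)
    push_cast at e2
    omega
  have hpq : ∀ f ∈ Φ, ∀ g ∈ Φ,
      38 ≤ kerSum U f + kerSum U g + kerSum U (f + g) + kerSum U (f - g) := by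
    intro f hf g hg
    have e1 := kerSum_pair U f g
    have e3 := hcommon f hf g hg
    omega
  have hadd : ∀ f ∈ Φ, ∀ g ∈ Φ, f + g ∈ Φ := fun f hf g hg => by
    rw [hΦ, mem_dualSlice] at hf hg ⊢
    intro i
    simp [hf, hg]
  have hsm : ∀ (c : ZMod 3), ∀ f ∈ Φ, c • f ∈ Φ := fun c f hf => by
    rw [hΦ, mem_dualSlice] at hf ⊢
    intro i
    simp [hf]
  obtain ⟨g₁, hg₁, ho₁⟩ := exists_linearIndependent_pair (p := 3) hoΦ.1 (X := Φ) (by omega)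
  obtain ⟨g₂, hg₂, ho₂⟩ := exists_linearIndependent_triple ho₁ (X := Φ) (by omega)
  have hind : ∀ i j k : ZMod 3, i • o + j • g₁ + k • g₂ = 0 → j = 0 ∧ k = 0 := by
    intro i j k hijk
    have := Fintype.linearIndependent_iff.mp ho₂ ![i, j, k] (by simpa [Fin.sum_univ_three] using hijk)
    exact ⟨this 1, this 2⟩
  -- Three of the values -22, 32, -4 add up to 60 only as 32 + 32 - 4.
  have hclass : ∀ g ∈ Φ, (∀ c : ZMod 3, g + c • o ≠ 0) → ∃ c : ZMod 3, kerSum U (g + c • o) = -4 := by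
    intro g hg hne
    have e := hpo g hg
    have e1 : o + g = g + (1 : ZMod 3) • o := by module
    have e2 : kerSum U (o - g) = kerSum U (g + (-1 : ZMod 3) • o) := by
      rw [← kerSum_neg]
      congr 1
      module
    have e3 : g = g + (0 : ZMod 3) • o := by module
    rw [e1, e2, e3, ← e3] at e
    have t1 := htype _ (hne 1)
    have t2 := htype _ (hne (-1))
    have t3 := htype _ (hne 0)
    by_contra! hno
    have n1 := hno 1
    have n2 := hno (-1)
    have n3 := hno 0
    rw [← e3] at n3 t3
    omega
  obtain ⟨c₁, hc₁⟩ := hclass g₁ hg₁ fun c hc => by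
    have := hind c 1 0 (by rw [← hc]; module)
    exact one_ne_zero this.1
  obtain ⟨c₂, hc₂⟩ := hclass g₂ hg₂ fun c hc => by
    have := hind c 0 1 (by rw [← hc]; module)
    exact one_ne_zero this.2
  set e₁ := g₁ + c₁ • o with he₁
  set e₂ := g₂ + c₂ • o with he₂
  have he₁Φ : e₁ ∈ Φ := hadd _ hg₁ _ (hsm _ _ hoΦ.2)
  have he₂Φ : e₂ ∈ Φ := hadd _ hg₂ _ (hsm _ _ hoΦ.2)
  have hmΦ : e₁ - e₂ ∈ Φ := by
    have : e₁ - e₂ = e₁ + (-1 : ZMod 3) • e₂ := by module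
    exact this ▸ hadd _ he₁Φ _ (hsm _ _ he₂Φ)
  have hle : ∀ f, f ≠ 0 → kerSum U f ≤ 32 := fun f hf => by
    have := htype f hf
    omega
  have hnp : ∀ c : ZMod 3, e₁ + e₂ + c • o ≠ 0 := fun c hc => by
    have := hind (c₁ + c₂ + c) 1 1 (by rw [← hc, he₁, he₂]; module)
    exact one_ne_zero this.1
  have hnm : ∀ c : ZMod 3, e₁ - e₂ + c • o ≠ 0 := fun c hc => by
    have := hind (c₁ - c₂ + c) 1 (-1) (by rw [← hc, he₁, he₂]; module)
    exact one_ne_zero this.1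
  have hnp0 : e₁ + e₂ ≠ 0 := by simpa using hnp 0
  have hnm0 : e₁ - e₂ ≠ 0 := by simpa using hnm 0
  have h12 := hpq e₁ he₁Φ e₂ he₂Φ
  obtain ⟨c, hc⟩ := hclass (e₁ + e₂) (hadd _ he₁Φ _ he₂Φ) hnp
  obtain ⟨c', hc'⟩ := hclass (e₁ - e₂) hmΦ hnm
  have l1 := hle _ hnp0
  have l2 := hle _ hnm0
  -- By `h12` the values at e₁ + e₂ and e₁ - e₂ are both 32, so the functionals of value -4 in their
  -- classes are proper shifts by o.
  have hc0 : c ≠ 0 := by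
    rintro rfl
    rw [zero_smul, add_zero] at hc
    omega
  have hc0' : c' ≠ 0 := by
    rintro rfl
    rw [zero_smul, add_zero] at hc'
    omega
  have h34 := hpq _ (hadd _ (hadd _ he₁Φ _ he₂Φ) _ (hsm c _ hoΦ.2)) _
    (hadd _ hmΦ _ (hsm c' _ hoΦ.2))
  have hz1 : ∀ a : ZMod 3, e₁ + a • o ≠ 0 := fun a ha => by
    have := hind (c₁ + a) 1 0 (by rw [← ha, he₁]; module)
    exact one_ne_zero this.1
  have hz2 : ∀ a : ZMod 3, e₂ + a • o ≠ 0 := fun a ha => by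
    have := hind (c₂ + a) 0 1 (by rw [← ha, he₂]; module)
    exact one_ne_zero this.2
  have hm1 : kerSum U (e₁ + e₂ + c • o + (e₁ - e₂ + c' • o)) = kerSum U (e₁ + (-(c + c')) • o) := by
    rw [← kerSum_neg]
    congr 1
    have := neg_sub_self_eq e₁
    rw [← sub_eq_zero] at this ⊢
    rw [← this]
    module
  have hm2 : kerSum U (e₁ + e₂ + c • o - (e₁ - e₂ + c' • o)) = kerSum U (e₂ + (c' - c) • o) := by
    rw [← kerSum_neg]
    congr 1
    have := neg_sub_self_eq e₂
    rw [← sub_eq_zero] at this ⊢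
    rw [← this]
    module
  rw [hm1, hm2] at h34
  have l3 := hle _ (hz1 (-(c + c')))
  have l4 := hle _ (hz2 (c' - c))
  -- For nonzero c and c', either c + c' = 0 or c = c'. So the pencil of the two shifted functionals
  -- contains e₁ or e₂ up to sign; three values -4 and a fourth of at most 32 stay below 38.
  have hcc : ∀ a b : ZMod 3, a ≠ 0 → b ≠ 0 → -(a + b) = 0 ∨ b - a = 0 := by
    have h3 : ∀ a b : Fin 3, a ≠ 0 → b ≠ 0 → -(a + b) = 0 ∨ b - a = 0 := by decide
    exact h3
  rcases hcc c c' hc0 hc0' with h0 | h0 <;> rw [h0, zero_smul, add_zero] at h34 <;> omega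

section

variable {V : Type*} [AddCommGroup V] [Module (ZMod 3) V]

theorem linearIndependent_sum_injective {ι : Type*} [Fintype ι] {x : ι → V}
    (hx : LinearIndependent (ZMod 3) x) :
    Function.Injective fun t : ι → ZMod 3 => ∑ i, t i • x i := by
  intro t t' htt
  have := Fintype.linearIndependent_iff.mp hx (t - t') (by
    simp only [Pi.sub_apply, sub_smul, sum_sub_distrib]
    exact sub_eq_zero.mpr htt)
  funext i
  exact sub_eq_zero.mp (this i)

theorem TranslationDistance.smul_of_ternary {A : IntersectionArray} {d : V → ℕ} [Fintype V]
    (h : TranslationDistance A d) {k : ℕ} (a : ZMod 3) (s : V) (ha : a ≠ 0) (hs : d s = k) :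
    d (a • s) = k := by
  rcases smul_eq_or_neg ha s with h1 | h1 <;> rw [h1]
  · exact hs
  · rw [h.neg, hs]

/-- The moments over the functionals vanishing on independent vectors. -/
theorem sum_dualSlice_kerSum_class [Fintype V] {ι : Type*} [Fintype ι] [DecidableEq ι] {x : ι → V}
    (hx : LinearIndependent (ZMod 3) x) (d : V → ℕ) (k : ℕ) :
    ∑ f ∈ dualSlice x (0 : ι → ZMod 3), kerSum ({v | d v = k} : Finset V) f =
      #(dualSlice x (0 : ι → ZMod 3)) * (2 * #{t : ι → ZMod 3 | d (∑ i, t i • x i) = k}) := by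
  classical
  rw [sum_dualSlice_kerSum hx, card_filter, Nat.cast_sum]
  congr 1
  rw [mul_sum]
  refine sum_congr rfl fun t _ => ?_
  simp only [mem_filter, mem_univ, true_and, Pi.zero_apply, mul_zero, sum_const_zero, if_true]
  split_ifs <;> norm_num

end

/-! ### The array {56,42,20;1,6,28}: connection sets that are unions of lines -/

namespace Array56

theorem card_eq {V : Type*} [AddCommGroup V] [Fintype V] {d : V → ℕ}
    (h : TranslationDistance ⟨[56, 42, 20], [1, 6, 28]⟩ d) :
    Fintype.card V = 3 ^ 6 ∧ #{v | d v = 1} = 56 ∧ #{v | d v = 2} = 392 := by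
  have := h.card_classes_three
  omega

variable {V : Type*} [AddCommGroup V] [Module (ZMod 3) V] [Fintype V] {d : V → ℕ}

/-- The eigenvalues 20, 2, -7, with the corresponding values on the class at distance two. -/
theorem kerSum_cases (h : TranslationDistance ⟨[56, 42, 20], [1, 6, 28]⟩ d)
    (f : Module.Dual (ZMod 3) V) (hf : f ≠ 0) :
    kerSum {v | d v = 1} f = 40 ∧ kerSum {v | d v = 2} f = 28 ∨
      kerSum {v | d v = 1} f = 4 ∧ kerSum {v | d v = 2} f = -26 ∨
      kerSum {v | d v = 1} f = -14 ∧ kerSum {v | d v = 2} f = 28 := by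
  classical
  set S : Finset V := {v | d v = 1} with hS
  have hSc : #S = 56 := (card_eq h).2.1
  have hlt : #{s ∈ S | f s = 0} < #S := by
    refine card_lt_card (filter_ssubset.mpr ?_)
    by_contra! hall
    exact hf (h.dual_eq_zero (by decide) fun s hs => hall s (by simpa [hS] using hs))
  obtain ⟨θ, h1, h2, h3, h4⟩ := h.exists_eigenvalue_three (fun a s => h.smul_of_ternary a s) f
  have hk := kerSum_eq S f
  rw [hSc] at hk
  push_cast at h1 h2 h3 h4 hk
  have h5 : (θ - 56) * ((θ - 20) * ((θ - 2) * (θ + 7))) = 0 := by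
    norm_num at h4
    linear_combination h4
  simp only [mul_eq_zero, sub_eq_zero] at h5
  rw [← hS] at h1
  rcases h5 with h5 | h5 | h5 | h5
  · omega
  · subst h5
    omega
  · subst h5
    omega
  · obtain rfl : θ = -7 := by omega
    omega

/-- The number of vectors of the connection set in a plane without vectors at distance three. -/
theorem card_plane (h : TranslationDistance ⟨[56, 42, 20], [1, 6, 28]⟩ d) {x : Fin 3 → V}
    (hx : LinearIndependent (ZMod 3) x) (hle : ∀ t : Fin 3 → ZMod 3, d (∑ i, t i • x i) ≤ 2) :
    3 ∣ #{t : Fin 3 → ZMod 3 | d (∑ i, t i • x i) = 1} ∧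
      #{t : Fin 3 → ZMod 3 | d (∑ i, t i • x i) = 1} ≤ 12 := by
  classical
  have h1 := sum_dualSlice_kerSum_class hx d 1
  have h2 := sum_dualSlice_kerSum_class hx d 2
  have hc := card_dualSlice_mul hx (0 : Fin 3 → ZMod 3)
  rw [(card_eq h).1, Fintype.card_fin] at hc
  set Φ := dualSlice x (0 : Fin 3 → ZMod 3) with hΦ
  have hΦc : #Φ = 27 := by omega
  have h0Φ : 0 ∈ Φ := by simp [hΦ]
  have hα : #{t : Fin 3 → ZMod 3 | d (∑ i, t i • x i) = 1} +
      #{t : Fin 3 → ZMod 3 | d (∑ i, t i • x i) = 2} = 26 := by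
    have hv : ∀ t : Fin 3 → ZMod 3, t ≠ 0 ↔
        d (∑ i, t i • x i) = 1 ∨ d (∑ i, t i • x i) = 2 := fun t => by
      constructor
      · intro ht
        have h3 := hle t
        have h4 : d (∑ i, t i • x i) ≠ 0 := fun h0 => ht (by
          rw [h.eq_zero_iff] at h0
          exact linearIndependent_sum_injective hx (by simpa using h0))
        omega
      · rintro h3 rfl
        simp [h.map_zero] at h3
    rw [← card_union_of_disjoint (disjoint_filter.mpr fun t _ h => by omega), ← filter_or,
      filter_congr fun v _ => (hv v).symm]
    decide +kernel
  -- The combination 64 - 3K_1 + 2K_2 vanishes on the first two types of functionals and equals 162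
  -- on the third. So 3240 - 270α is nonnegative and divisible by 162, where α is the number of
  -- vectors of the connection set in the subspace.
  have hsum : ∑ f ∈ Φ.erase 0, (64 - 3 * kerSum ({v | d v = 1} : Finset V) f +
      2 * kerSum ({v | d v = 2} : Finset V) f) =
      3240 - 270 * #{t : Fin 3 → ZMod 3 | d (∑ i, t i • x i) = 1} := by
    have hall : ∑ f ∈ Φ, (64 - 3 * kerSum ({v | d v = 1} : Finset V) f +
        2 * kerSum ({v | d v = 2} : Finset V) f) =
        27 * 64 - 3 * ∑ f ∈ Φ, kerSum ({v | d v = 1} : Finset V) f +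
        2 * ∑ f ∈ Φ, kerSum ({v | d v = 2} : Finset V) f := by
      rw [sum_add_distrib, sum_sub_distrib, sum_const, hΦc, mul_sum, mul_sum]
      norm_num
    rw [h1, h2, hΦc, ← add_sum_erase _ _ h0Φ, kerSum_zero, kerSum_zero, (card_eq h).2.1,
      (card_eq h).2.2] at hall
    push_cast at hall
    omega
  have hdvd : (162 : ℤ) ∣ ∑ f ∈ Φ.erase 0, (64 - 3 * kerSum ({v | d v = 1} : Finset V) f +
      2 * kerSum ({v | d v = 2} : Finset V) f) := by
    refine dvd_sum fun f hf => ?_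
    have := kerSum_cases h f (ne_of_mem_erase hf)
    omega
  have hnn : 0 ≤ ∑ f ∈ Φ.erase 0, (64 - 3 * kerSum ({v | d v = 1} : Finset V) f +
      2 * kerSum ({v | d v = 2} : Finset V) f) := by
    refine sum_nonneg fun f hf => ?_
    have := kerSum_cases h f (ne_of_mem_erase hf)
    omega
  omega

section Spread

variable {ι κ : ZMod 3 × ZMod 3 →ₗ[ZMod 3] V}

theorem injective_of_forall (h : TranslationDistance ⟨[56, 42, 20], [1, 6, 28]⟩ d)
    (hι : ∀ x ≠ 0, d (ι x) = 1) : Function.Injective ι := by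
  rw [injective_iff_map_eq_zero]
  intro x hx
  by_contra h0
  have := hι x h0
  rw [hx, h.map_zero] at this
  omega

/-- A vector of the connection set outside a line contained in the connection set. -/
theorem card_coset (h : TranslationDistance ⟨[56, 42, 20], [1, 6, 28]⟩ d)
    (hι : ∀ x ≠ 0, d (ι x) = 1) {w : V} (hw : d w = 1) (hwι : ∀ x, w ≠ ι x) :
    #{y | d (w + ι y) = 1} = 2 := by
  classical
  have hsum : ∀ t : Fin 3 → ZMod 3,
      ∑ i, t i • (![w, ι (1, 0), ι (0, 1)] : Fin 3 → V) i = t 0 • w + ι (t 1, t 2) := by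
    intro t
    simp only [Fin.sum_univ_three, Matrix.cons_val_zero, Matrix.cons_val_one, Matrix.cons_val]
    rw [add_assoc, ← map_smul, ← map_smul, ← map_add]
    simp
  have hx : LinearIndependent (ZMod 3) ![w, ι (1, 0), ι (0, 1)] := by
    rw [Fintype.linearIndependent_iff]
    intro t ht
    rw [hsum] at ht
    have h0 : t 0 = 0 := by
      by_contra h0
      refine hwι (-((t 0)⁻¹ • (t 1, t 2))) ?_
      rw [map_neg, map_smul, eq_neg_of_add_eq_zero_right ht, smul_neg, neg_neg, inv_smul_smul₀ h0]
    rw [h0, zero_smul, zero_add] at ht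
    have h1 := injective_of_forall h hι (ht.trans (map_zero ι).symm)
    simp only [Prod.mk_eq_zero] at h1
    intro i
    fin_cases i
    exacts [h0, h1.1, h1.2]
  have hcount : #{t : Fin 3 → ZMod 3 |
      d (∑ i, t i • (![w, ι (1, 0), ι (0, 1)] : Fin 3 → V) i) = 1} =
      8 + 2 * #{y | d (w + ι y) = 1} := by
    have e1 : #{t : Fin 3 → ZMod 3 |
        d (∑ i, t i • (![w, ι (1, 0), ι (0, 1)] : Fin 3 → V) i) = 1} =
        #{q : ZMod 3 × ZMod 3 × ZMod 3 | d (q.1 • w + ι q.2) = 1} := by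
      refine card_bij (fun t _ => (t 0, t 1, t 2)) (fun t ht => ?_) (fun t _ t' _ htt => ?_)
        fun q hq => ⟨![q.1, q.2.1, q.2.2], ?_, rfl⟩
      · simpa [hsum] using ht
      · simp only [Prod.mk.injEq] at htt
        funext i
        fin_cases i
        exacts [htt.1, htt.2.1, htt.2.2]
      · simpa [hsum] using hq
    rw [e1, card_filter, Fintype.sum_prod_type]
    simp only [← card_filter]
    have e2 : ∀ F : ZMod 3 → ℕ, ∑ c, F c = F 0 + F 1 + F (-1) := fun F => Fin.sum_univ_three F
    rw [e2]
    have e3 : #{y | d ((0 : ZMod 3) • w + ι y) = 1} = 8 := by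
      have : ∀ y, d ((0 : ZMod 3) • w + ι y) = 1 ↔ y ≠ 0 := fun y => by
        rw [zero_smul, zero_add]
        refine ⟨?_, hι y⟩
        rintro hy rfl
        simp [h.map_zero] at hy
      rw [filter_congr fun y _ => this y]
      decide +kernel
    have e4 : #{y | d ((-1 : ZMod 3) • w + ι y) = 1} = #{y | d ((1 : ZMod 3) • w + ι y) = 1} := by
      refine card_bij (fun y _ => -y) (fun y hy => ?_) (fun y _ y' _ hyy => neg_injective hyy)
        fun y hy => ⟨-y, ?_, neg_neg y⟩
      · simp only [mem_filter, mem_univ, true_and] at hy ⊢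
        rw [← hy, ← h.neg, map_neg]
        congr 1
        module
      · simp only [mem_filter, mem_univ, true_and] at hy ⊢
        rw [← hy, ← h.neg, map_neg]
        congr 1
        module
    rw [e3, e4]
    simp only [one_smul]
    omega
  -- Every vector of the span is a multiple of w plus a vector of the line, so its distance is at
  -- most two. Then 8 + 2c is a multiple of 3 and at most 12, with c > 0, whence c = 2.
  have hpl := card_plane h hx fun t => by
    rw [hsum]
    by_cases ht : t 0 = 0
    · rw [ht, zero_smul, zero_add]
      by_cases h0 : (t 1, t 2) = (0 : ZMod 3 × ZMod 3)
      · rw [h0, map_zero, h.map_zero]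
        omega
      · rw [hι _ h0]
        omega
    · have h1 := h.smul_of_ternary (t 0) w ht hw
      by_cases h0 : (t 1, t 2) = (0 : ZMod 3 × ZMod 3)
      · rw [h0, map_zero, add_zero, h1]
        omega
      · have := h.add_le (t 0 • w) _ (hι _ h0)
        omega
  have hpos : 0 < #{y | d (w + ι y) = 1} := card_pos.mpr ⟨0, by simp [hw]⟩
  rw [hcount] at hpl
  omega

/-- Of the two vectors in the coset, one is w; the other defines a partner of w on the line. -/
theorem exists_partner (h : TranslationDistance ⟨[56, 42, 20], [1, 6, 28]⟩ d)
    (hι : ∀ x ≠ 0, d (ι x) = 1) {w : V} (hw : d w = 1) (hwι : ∀ x, w ≠ ι x) :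
    ∃ y ≠ 0, d (w + ι y) = 1 ∧ ∀ y' ≠ 0, d (w + ι y') = 1 → y' = y := by
  classical
  have hc := card_coset h hι hw hwι
  have h0 : (0 : ZMod 3 × ZMod 3) ∈ ({y | d (w + ι y) = 1} : Finset _) := by simp [hw]
  have h1 := card_erase_of_mem h0
  rw [hc] at h1
  obtain ⟨y, hy⟩ := card_eq_one.mp h1
  have hmem : ∀ y', y' ∈ (({y | d (w + ι y) = 1} : Finset _).erase 0) ↔
    y' ≠ 0 ∧ d (w + ι y') = 1 := fun y' => by simp
  rw [hy] at hmem
  simp only [mem_singleton] at hmem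
  exact ⟨y, ((hmem y).mp rfl).1, ((hmem y).mp rfl).2, fun _ h1 h2 => (hmem _).mpr ⟨h1, h2⟩⟩

/-- The graph of the odd map fixing two basis vectors with values `p`, `q` at their sum and
difference, together with the two coordinate lines. -/
def InGraph (p q : ZMod 3 × ZMod 3) (t : (ZMod 3 × ZMod 3) × ZMod 3 × ZMod 3) : Prop :=
  t.1 = 0 ∧ t.2 ≠ 0 ∨ t.1 ≠ 0 ∧ t.2 = 0 ∨ t = ((1, 0), (1, 0)) ∨ t = ((-1, 0), (-1, 0)) ∨
    t = ((0, 1), (0, 1)) ∨ t = ((0, -1), (0, -1)) ∨ t = ((1, 1), p) ∨ t = ((-1, -1), -p) ∨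
    t = ((1, -1), q) ∨ t = ((-1, 1), -q)

instance (p q : ZMod 3 × ZMod 3) : DecidablePred (InGraph p q) := fun t => by
  unfold InGraph
  infer_instance

/-- The vector found is at distance two, where c_2 = 6 allows only six representations. So the
partner map between two lines has to be linear. -/
theorem exists_many_inGraph : ∀ p q : ZMod 3 × ZMod 3, p ≠ 0 → q ≠ 0 →
    (p, q) ≠ ((1, 1), (1, -1)) → ∃ v : (ZMod 3 × ZMod 3) × ZMod 3 × ZMod 3, v.1 ≠ 0 ∧ v.2 ≠ 0 ∧
      ¬ InGraph p q v ∧ 6 < #{t | InGraph p q t ∧ InGraph p q (v - t)} := by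
  decide +kernel

end Spread

end Array56

namespace Array56

variable {V : Type*} [AddCommGroup V] [Module (ZMod 3) V] [Fintype V] {d : V → ℕ}

section Spread

variable {ι κ : ZMod 3 × ZMod 3 →ₗ[ZMod 3] V}

theorem ne_neg_of_ne_zero : ∀ x : ZMod 3 × ZMod 3, x ≠ 0 → x ≠ -x := by decide

/-- Two lines in the connection set that are not equal are disjoint. -/
theorem ne_of_exists_notMem (h : TranslationDistance ⟨[56, 42, 20], [1, 6, 28]⟩ d)
    (hι : ∀ x ≠ 0, d (ι x) = 1) (hκ : ∀ x ≠ 0, d (κ x) = 1) {z : ZMod 3 × ZMod 3}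
    (hz : ∀ x, κ z ≠ ι x) : ∀ x ≠ 0, ∀ y, ι x ≠ κ y := by
  intro x hx y hxy
  have hz0 : z ≠ 0 := by
    rintro rfl
    exact hz 0 (by simp)
  -- A common point ι x = κ y would make both x and -x partners of κ z.
  obtain ⟨y₀, -, -, huniq⟩ := exists_partner h hι (hκ z hz0) hz
  have h1 : d (κ z + ι x) = 1 := by
    rw [hxy, ← map_add]
    refine hκ _ fun h0 => hz (-x) ?_
    rw [map_neg, hxy, ← map_neg, ← eq_neg_of_add_eq_zero_left h0]
  have h2 : d (κ z + ι (-x)) = 1 := by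
    rw [map_neg, hxy, ← map_neg, ← map_add]
    refine hκ _ fun h0 => hz x ?_
    rw [hxy, ← neg_neg y, ← eq_neg_of_add_eq_zero_left h0]
  exact ne_neg_of_ne_zero x hx
    ((huniq x hx h1).trans (huniq (-x) (neg_ne_zero.mpr hx) h2).symm)

/-- Two disjoint lines in the connection set have a third one in their span. -/
theorem exists_line_add (h : TranslationDistance ⟨[56, 42, 20], [1, 6, 28]⟩ d)
    (hall : ∀ s, d s = 1 → ∃ κ : ZMod 3 × ZMod 3 →ₗ[ZMod 3] V, (∀ x ≠ 0, d (κ x) = 1) ∧ ∃ y, κ y = s)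
    (hι : ∀ x ≠ 0, d (ι x) = 1) {c : V} (hc : d c = 1) (hcι : ∀ x, c ≠ ι x) :
    ∃ κ : ZMod 3 × ZMod 3 →ₗ[ZMod 3] V, (∀ x ≠ 0, d (κ x) = 1) ∧ (∃ y, κ y = c) ∧
      (∀ x ≠ 0, ∀ y, ι x ≠ κ y) ∧ ∀ x ≠ 0, d (ι x + κ x) = 1 := by
  classical
  obtain ⟨κ₀, hκ₀, z, rfl⟩ := hall c hc
  have hdisj := ne_of_exists_notMem h hι hκ₀ hcι
  have hdisj' : ∀ y ≠ 0, ∀ x, κ₀ y ≠ ι x := fun y hy x hxy => by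
    by_cases hx : x = 0
    · subst hx
      have := hκ₀ y hy
      rw [hxy, map_zero, h.map_zero] at this
      omega
    · exact hdisj x hx y hxy.symm
  -- The second line is reparametrised so that the partners of the basis vectors (1, 0) and (0, 1)
  -- get the same coordinates.
  obtain ⟨a, ha, hA, -⟩ := exists_partner h hκ₀ (hι (1, 0) (by decide)) (hdisj (1, 0) (by decide))
  obtain ⟨b, hb, hB, -⟩ := exists_partner h hκ₀ (hι (0, 1) (by decide)) (hdisj (0, 1) (by decide))
  let M : ZMod 3 × ZMod 3 →ₗ[ZMod 3] ZMod 3 × ZMod 3 :=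
    (LinearMap.toSpanSingleton (ZMod 3) _ a).coprod (LinearMap.toSpanSingleton (ZMod 3) _ b)
  have hM : ∀ y, M y = y.1 • a + y.2 • b := fun y => by simp [M]
  -- If a = k b then κ₀ a would have two partners on the line ι.
  have hab : ∀ k : ZMod 3, k ≠ 0 → k • b ≠ a := by
    rintro k hk rfl
    obtain ⟨y₀, -, -, huniq⟩ := exists_partner h hι (hκ₀ _ ha) (hdisj' _ ha)
    have h1 := huniq (1, 0) (by decide) (by rw [add_comm]; exact hA)
    have h2 := huniq (0, k) (by simpa using hk) (by
      have : κ₀ (k • b) + ι (0, k) = k • (ι (0, 1) + κ₀ b) := by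
        rw [map_smul, smul_add, ← map_smul ι]
        simp [add_comm]
      rw [this]
      exact h.smul_of_ternary k _ hk hB)
    have := h1.trans h2.symm
    simp at this
  have hMinj : Function.Injective M := by
    rw [injective_iff_map_eq_zero]
    rintro ⟨y₁, y₂⟩ hy
    rw [hM] at hy
    simp only at hy
    by_cases h1 : y₁ = 0
    · subst h1
      rw [zero_smul, zero_add, smul_eq_zero] at hy
      rw [hy.resolve_right hb]
      rfl
    · have hy2 : y₂ ≠ 0 := by
        rintro rfl
        rw [zero_smul, add_zero, smul_eq_zero] at hy
        exact hy.elim h1 ha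
      refine absurd ?_ (hab (-(y₁⁻¹ * y₂)) (by simp [h1, hy2]))
      rw [neg_smul, mul_smul, eq_neg_of_add_eq_zero_right hy, smul_neg, neg_neg, inv_smul_smul₀ h1]
  let κ := κ₀ ∘ₗ M
  have hκ : ∀ x ≠ 0, d (κ x) = 1 := fun x hx =>
    hκ₀ _ fun h0 => hx (hMinj (h0.trans (map_zero M).symm))
  have hdκ : ∀ x ≠ 0, ∀ y, ι x ≠ κ y := fun x hx y => hdisj x hx (M y)
  obtain ⟨z', hz'⟩ := (Finite.injective_iff_surjective.mp hMinj) z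
  refine ⟨κ, hκ, ⟨z', by simp [κ, hz']⟩, hdκ, ?_⟩
  have h10 : d (ι (1, 0) + κ (1, 0)) = 1 := by simpa [κ, hM] using hA
  have h01 : d (ι (0, 1) + κ (0, 1)) = 1 := by simpa [κ, hM] using hB
  have huniq : ∀ x y y' : ZMod 3 × ZMod 3, x ≠ 0 → y ≠ 0 → y' ≠ 0 → d (ι x + κ y) = 1 →
      d (ι x + κ y') = 1 → y = y' := by
    intro x y y' hx hy hy' h1 h2
    obtain ⟨y₀, -, -, hu⟩ := exists_partner h hκ (hι x hx) (hdκ x hx)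
    rw [hu y hy h1, hu y' hy' h2]
  have hneg : ∀ x y : ZMod 3 × ZMod 3, d (ι x + κ y) = 1 → d (ι (-x) + κ (-y)) = 1 := by
    intro x y hxy
    rw [map_neg, map_neg, ← neg_add, h.neg, hxy]
  obtain ⟨p, hp, h11, -⟩ := exists_partner h hκ (hι (1, 1) (by decide)) (hdκ (1, 1) (by decide))
  obtain ⟨q, hq, h12, -⟩ := exists_partner h hκ (hι (1, -1) (by decide)) (hdκ (1, -1) (by decide))
  -- The partner map is odd, so its values p and q at (1, 1) and (1, -1) describe the connection set
  -- in the span completely.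
  have hiff : ∀ t : (ZMod 3 × ZMod 3) × ZMod 3 × ZMod 3,
      d (ι t.1 + κ t.2) = 1 ↔ InGraph p q t := by
    rintro ⟨x, y⟩
    constructor
    · intro hxy
      simp only at hxy
      by_cases hx : x = 0
      · subst hx
        refine Or.inl ⟨rfl, ?_⟩
        rintro h0
        simp only at h0
        simp [h0, h.map_zero] at hxy
      by_cases hy : y = 0
      · exact Or.inr (Or.inl ⟨hx, hy⟩)
      have hcases : ∀ x : ZMod 3 × ZMod 3, x ≠ 0 → x = (1, 0) ∨ x = (-1, 0) ∨ x = (0, 1) ∨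
        x = (0, -1) ∨ x = (1, 1) ∨ x = (-1, -1) ∨ x = (1, -1) ∨ x = (-1, 1) := by decide
      unfold InGraph
      rcases hcases x hx with rfl | rfl | rfl | rfl | rfl | rfl | rfl | rfl
      · rw [huniq _ _ _ hx hy (by decide) hxy h10]
        simp
      · rw [huniq _ _ _ hx hy (by decide) hxy (hneg _ _ h10)]
        simp
      · rw [huniq _ _ _ hx hy (by decide) hxy h01]
        simp
      · rw [huniq _ _ _ hx hy (by decide) hxy (hneg _ _ h01)]
        simp
      · rw [huniq _ _ _ hx hy hp hxy h11]
        simp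
      · rw [huniq _ _ _ hx hy (neg_ne_zero.mpr hp) hxy (hneg _ _ h11)]
        simp
      · rw [huniq _ _ _ hx hy hq hxy h12]
        simp
      · rw [huniq _ _ _ hx hy (neg_ne_zero.mpr hq) hxy (hneg _ _ h12)]
        simp
    · intro ht
      unfold InGraph at ht
      simp only [Prod.mk.injEq] at ht
      rcases ht with ⟨rfl, h2⟩ | ⟨h1, rfl⟩ | ⟨rfl, rfl⟩ | ⟨rfl, rfl⟩ | ⟨rfl, rfl⟩ | ⟨rfl, rfl⟩ |
        ⟨rfl, rfl⟩ | ⟨rfl, rfl⟩ | ⟨rfl, rfl⟩ | ⟨rfl, rfl⟩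
      · simpa using hκ _ h2
      · simpa using hι _ h1
      · exact h10
      · exact hneg _ _ h10
      · exact h01
      · exact hneg _ _ h01
      · exact h11
      · exact hneg _ _ h11
      · exact h12
      · exact hneg _ _ h12
  have hpq : (p, q) = ((1, 1), (1, -1)) := by
    by_contra hne
    obtain ⟨v, hv1, hv2, hv, hlt⟩ := exists_many_inGraph p q hp hq hne
    have hinj : Function.Injective fun t : (ZMod 3 × ZMod 3) × ZMod 3 × ZMod 3 =>
        ι t.1 + κ t.2 := by
      rintro ⟨x, y⟩ ⟨x', y'⟩ hxy
      simp only at hxy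
      have h1 : ι (x - x') = κ (y' - y) := by
        rw [map_sub, map_sub, sub_eq_sub_iff_add_eq_add, hxy, add_comm]
      have h2 : x - x' = 0 := by
        by_contra h2
        exact hdκ _ h2 _ h1
      have h3 := injective_of_forall h hκ (h1.symm.trans ((congrArg ι h2).trans (by simp)) :
        κ (y' - y) = κ 0)
      rw [sub_eq_zero] at h2 h3
      rw [h2, h3]
    rw [← hiff] at hv
    -- A sum of two vectors of the connection set that is neither zero nor in the connection set.
    have hd2 : d (-(ι v.1 + κ v.2)) = 2 := by
      rw [h.neg]
      have h1 := h.add_le (ι v.1) _ (hκ _ hv2)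
      rw [hι _ hv1] at h1
      have h3 : d (ι v.1 + κ v.2) ≠ 0 := fun h0 => hdκ _ hv1 (-v.2) (by
        rw [h.eq_zero_iff] at h0
        rw [map_neg, ← eq_neg_of_add_eq_zero_left h0])
      omega
    have h6 := h.card_step (-(ι v.1 + κ v.2)) 1
    rw [hd2] at h6
    have h6' : #{s | d s = 1 ∧ d (-(ι v.1 + κ v.2) + s) = 1} = 6 := h6
    have hle : #{t | InGraph p q t ∧ InGraph p q (v - t)} ≤
        #{s | d s = 1 ∧ d (-(ι v.1 + κ v.2) + s) = 1} := by
      refine card_le_card_of_injOn (fun t => ι t.1 + κ t.2) (fun t ht => ?_) hinj.injOn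
      simp only [coe_filter, Set.mem_ofPred_eq, mem_univ, true_and, ← hiff] at ht ⊢
      refine ⟨ht.1, ?_⟩
      rw [← ht.2, ← h.neg]
      congr 1
      simp only [Prod.fst_sub, Prod.snd_sub, map_sub]
      abel
    omega
  simp only [Prod.mk.injEq] at hpq
  intro x hx
  have := (hiff (x, x)).mpr (by
    rw [hpq.1, hpq.2]
    revert x
    decide)
  exact this

end Spread

end Array56

namespace Array56

/-- Triples of the seven support patterns. -/
def patternVec {E : Type*} [Zero E] (m a : E → E) (x : E) : Fin 7 → E × E × E :=
  ![(x, 0, 0), (0, x, 0), (0, 0, x), (x, x, 0), (x, 0, x), (0, x, m x), (x, x, a x)]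

/-- The seven patterns have the seven different nonempty supports, and x can be read off from each
of them. -/
theorem patternVec_injective {E : Type*} [Zero E] {m a : E → E} (hm : ∀ x ≠ 0, m x ≠ 0)
    (ha : ∀ x ≠ 0, a x ≠ 0) :
    Function.Injective fun q : {x : E // x ≠ 0} × Fin 7 => patternVec m a q.1.1 q.2 := by
  rintro ⟨⟨x, hx⟩, i⟩ ⟨⟨x', hx'⟩, j⟩ hG
  have hmx := hm x hx
  have hmx' := hm x' hx'
  have hax := ha x hx
  have hax' := ha x' hx'
  have hx0' := hx'.symm
  fin_cases i <;> fin_cases j <;> simp [patternVec, hx, hx0', hmx, hax,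
    hmx'.symm, hax'.symm] at hG ⊢ <;> first | exact hG | exact hG.1

/-- Only the last pattern has full support. -/
theorem eq_of_patternVec_eq {E : Type*} [Zero E] {m a : E → E} {x x' y z : E} {i : Fin 7}
    (hx : x ≠ 0) (hy : y ≠ 0) (hz : z ≠ 0) (h : patternVec m a x' i = (x, y, z)) :
    y = x ∧ z = a x := by
  fin_cases i <;> simp [patternVec, hx.symm, hy.symm, hz.symm] at h
  obtain ⟨rfl, rfl, rfl⟩ := h
  exact ⟨rfl, rfl⟩

variable {V : Type*} [AddCommGroup V] [Module (ZMod 3) V] [Fintype V] {d : V → ℕ}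

/-- The connection set is not a union of lines. -/
theorem not_forall_exists_line (h : TranslationDistance ⟨[56, 42, 20], [1, 6, 28]⟩ d)
    (hall : ∀ s, d s = 1 →
      ∃ κ : ZMod 3 × ZMod 3 →ₗ[ZMod 3] V, (∀ x ≠ 0, d (κ x) = 1) ∧ ∃ y, κ y = s) : False := by
  classical
  obtain ⟨hcV, hSc, -⟩ := card_eq h
  set S : Finset V := {v | d v = 1} with hS
  have hne : S.Nonempty := card_pos.mp (by omega)
  obtain ⟨s, hs⟩ := hne
  obtain ⟨ι, hι, -⟩ := hall s (by simpa [hS] using hs)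
  obtain ⟨c, hc, hcι⟩ : ∃ c ∈ S, ∀ x, c ≠ ι x := by
    by_contra! hno
    have hsub : S ⊆ univ.image ι := fun c hc => by
      obtain ⟨x, hx⟩ := hno c hc
      exact mem_image.mpr ⟨x, mem_univ _, hx.symm⟩
    have := (card_le_card hsub).trans card_image_le
    rw [card_univ, Fintype.card_prod, ZMod.card] at this
    omega
  obtain ⟨κ, hκ, -, hικ, hικ'⟩ := exists_line_add h hall hι (by simpa [hS] using hc) hcι
  have hι0 := injective_of_forall h hι
  have hκ0 := injective_of_forall h hκ
  have hli : LinearIndependent (ZMod 3) ![ι (1, 0), ι (0, 1), κ (1, 0), κ (0, 1)] := by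
    rw [Fintype.linearIndependent_iff]
    intro g hg
    have h1 : ι (g 0, g 1) = κ (-(g 2), -(g 3)) := by
      have e1 : ι (g 0, g 1) = g 0 • ι (1, 0) + g 1 • ι (0, 1) := by
        rw [← map_smul, ← map_smul, ← map_add]
        simp
      have e2 : κ (-(g 2), -(g 3)) = -(g 2 • κ (1, 0) + g 3 • κ (0, 1)) := by
        rw [← map_smul, ← map_smul, ← map_add, ← map_neg]
        simp
      rw [e1, e2, ← sub_eq_zero, sub_neg_eq_add]
      simpa [Fin.sum_univ_four, add_assoc] using hg
    have h2 : (g 0, g 1) = 0 := by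
      by_contra h2
      exact hικ _ h2 _ h1
    rw [h2, map_zero] at h1
    have h3 := hκ0 (h1.symm.trans (map_zero κ).symm)
    simp only [Prod.mk_eq_zero, neg_eq_zero] at h2 h3
    intro i
    fin_cases i
    exacts [h2.1, h2.2, h3.1, h3.2]
  -- The first two lines span only four of six dimensions, so f serves to find a third line outside
  -- their span.
  obtain ⟨f, hf, hf0⟩ := exists_ne_zero_mem_dualSlice hli (by rw [hcV]; norm_num)
  rw [mem_dualSlice] at hf
  have hfι : ∀ x, f (ι x) = 0 := fun x => by
    have : ι x = x.1 • ι (1, 0) + x.2 • ι (0, 1) := by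
      rw [← map_smul, ← map_smul, ← map_add]
      simp
    have h0 : f (ι (1, 0)) = 0 := hf 0
    have h1 : f (ι (0, 1)) = 0 := hf 1
    rw [this, map_add, map_smul, map_smul, h0, h1]
    simp
  have hfκ : ∀ x, f (κ x) = 0 := fun x => by
    have : κ x = x.1 • κ (1, 0) + x.2 • κ (0, 1) := by
      rw [← map_smul, ← map_smul, ← map_add]
      simp
    have h0 : f (κ (1, 0)) = 0 := hf 2
    have h1 : f (κ (0, 1)) = 0 := hf 3
    rw [this, map_add, map_smul, map_smul, h0, h1]
    simp
  obtain ⟨c', hc', hfc'⟩ : ∃ c', d c' = 1 ∧ f c' ≠ 0 := by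
    by_contra! hno
    exact hf0 (h.dual_eq_zero (by decide) hno)
  obtain ⟨μ, hμ, ⟨z, rfl⟩, hιμ, hιμ'⟩ := exists_line_add h hall hι hc' fun x hx => hfc' (by
    rw [hx, hfι])
  have hμ0 := injective_of_forall h hμ
  have hκμ : ∀ x ≠ 0, ∀ y, κ x ≠ μ y := ne_of_exists_notMem h hκ hμ (z := z) fun x hx => hfc' (by
    rw [hx, hfκ])
  have hικμ : ∀ x ≠ 0, ∀ y, (ι + κ) x ≠ μ y :=
    ne_of_exists_notMem (ι := ι + κ) h hικ' hμ (z := z) fun x hx => hfc' (by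
      rw [hx, LinearMap.add_apply, map_add, hfι, hfκ, add_zero])
  have huniq : ∀ x y : ZMod 3 × ZMod 3, x ≠ 0 → y ≠ 0 → d (ι x + κ y) = 1 → y = x := by
    intro x y hx hy h1
    obtain ⟨y₀, -, -, hu⟩ := exists_partner h hκ (hι x hx) (hικ x hx)
    rw [hu y hy h1, hu x hx (hικ' x hx)]
  -- A vector ι x + κ y in the connection set with x, y ≠ 0 has y = x by uniqueness of partners, and
  -- the line ι + κ is disjoint from μ.
  have hsolid : ∀ x y, x ≠ 0 ∨ y ≠ 0 → ∀ z, ι x + κ y ≠ μ z := by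
    intro x y hxy z hz
    by_cases hx : x = 0
    · subst hx
      rw [map_zero, zero_add] at hz
      exact hκμ y (hxy.resolve_left fun h => h rfl) z hz
    by_cases hy : y = 0
    · subst hy
      rw [map_zero, add_zero] at hz
      exact hιμ x hx z hz
    have hz0 : z ≠ 0 := by
      rintro rfl
      rw [map_zero] at hz
      exact hικ x hx (-y) (by rw [map_neg, eq_neg_of_add_eq_zero_left hz])
    obtain rfl := huniq x y hx hy (by rw [hz, hμ z hz0])
    exact hικμ y hx z hz
  let vec : (ZMod 3 × ZMod 3) × (ZMod 3 × ZMod 3) × ZMod 3 × ZMod 3 → V :=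
    fun q => ι q.1 + κ q.2.1 + μ q.2.2
  have hvec : Function.Injective vec := by
    rintro ⟨x, y, z⟩ ⟨x', y', z'⟩ hq
    simp only [vec] at hq
    have h1 : ι (x - x') + κ (y - y') = μ (z' - z) := by
      rw [map_sub, map_sub, map_sub, ← sub_eq_zero, ← sub_eq_zero.mpr hq]
      abel
    have h2 : x - x' = 0 ∧ y - y' = 0 := by
      by_contra h2
      rw [not_and_or] at h2
      exact hsolid _ _ h2 _ h1
    rw [h2.1, h2.2, map_zero, map_zero, zero_add] at h1
    have h3 := hμ0 ((map_zero μ).trans h1)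
    rw [eq_comm, sub_eq_zero] at h3
    rw [sub_eq_zero.mp h2.1, sub_eq_zero.mp h2.2, h3]
  have hm : ∀ y, ∃ z, y ≠ 0 → z ≠ 0 ∧ d (κ y + μ z) = 1 := fun y => by
    by_cases hy : y = 0
    · exact ⟨0, fun h => absurd hy h⟩
    · obtain ⟨z, hz, h1, -⟩ := exists_partner h hμ (hκ y hy) (hκμ y hy)
      exact ⟨z, fun _ => ⟨hz, h1⟩⟩
  have ha : ∀ x, ∃ z, x ≠ 0 → z ≠ 0 ∧ d (ι x + κ x + μ z) = 1 := fun x => by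
    by_cases hx : x = 0
    · exact ⟨0, fun h => absurd hx h⟩
    · obtain ⟨z, hz, h1, -⟩ := exists_partner h hμ (hικ' x hx) (hικμ x hx)
      exact ⟨z, fun _ => ⟨hz, h1⟩⟩
  choose m hm using hm
  choose a ha using ha
  let G : {x : ZMod 3 × ZMod 3 // x ≠ 0} × Fin 7 →
    (ZMod 3 × ZMod 3) × (ZMod 3 × ZMod 3) × ZMod 3 × ZMod 3 := fun q => patternVec m a q.1.1 q.2
  have hGinj : Function.Injective G :=
    patternVec_injective (fun x hx => (hm x hx).1) fun x hx => (ha x hx).1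
  have hGmem : ∀ q, G q ∈ ({q | d (vec q) = 1} : Finset _) := by
    rintro ⟨⟨x, hx⟩, i⟩
    simp only [mem_filter, mem_univ, true_and]
    fin_cases i
    · simpa [G, patternVec, vec] using hι x hx
    · simpa [G, patternVec, vec] using hκ x hx
    · simpa [G, patternVec, vec] using hμ x hx
    · simpa [G, patternVec, vec] using hικ' x hx
    · simpa [G, patternVec, vec] using hιμ' x hx
    · simpa [G, patternVec, vec] using (hm x hx).2
    · simpa [G, patternVec, vec] using (ha x hx).2
  -- Seven patterns with eight vectors each give 56 vectors, which is all of the connection set.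
  have hGsurj : ∀ q, d (vec q) = 1 → ∃ i, G i = q := by
    have hsub : univ.image G ⊆ ({q | d (vec q) = 1} : Finset _) := fun q hq => by
      obtain ⟨i, -, rfl⟩ := mem_image.mp hq
      exact hGmem i
    have hle : #({q | d (vec q) = 1} : Finset _) ≤ 56 := by
      rw [← hSc]
      refine card_le_card_of_injOn vec (fun q hq => ?_) hvec.injOn
      simpa [hS] using hq
    have heq := eq_of_subset_of_card_le hsub (by
      rw [card_image_of_injective _ hGinj, card_univ, Fintype.card_prod, Fintype.card_fin]
      refine hle.trans ?_
      decide +kernel)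
    intro q hq
    have : q ∈ univ.image G := by
      rw [heq]
      simpa using hq
    obtain ⟨i, -, hi⟩ := mem_image.mp this
    exact ⟨i, hi⟩
  have h111 : ∀ x y z, x ≠ 0 → y ≠ 0 → z ≠ 0 → d (ι x + κ y + μ z) = 1 → y = x ∧ z = a x := by
    intro x y z hx hy hz h1
    obtain ⟨⟨⟨x', hx'⟩, i⟩, hG⟩ := hGsurj (x, y, z) h1
    exact eq_of_patternVec_eq hx hy hz hG
  -- The partner of ι x + μ x on κ yields a vector of full support, which must be (x, x, x).
  have hax : ∀ x ≠ 0, a x = x := by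
    intro x hx
    obtain ⟨y, hy, h1, -⟩ := exists_partner h hκ (hιμ' x hx) fun y hy =>
      hsolid x (-y) (Or.inl hx) (-x) (by
        rw [map_neg, map_neg, ← hy]
        abel)
    rw [add_right_comm] at h1
    exact (h111 x y x hx hy hx h1).2.symm
  have he : ((1, 0) : ZMod 3 × ZMod 3) ≠ 0 := by decide
  generalize ((1, 0) : ZMod 3 × ZMod 3) = e at he
  obtain ⟨y, hy, h1, -⟩ := exists_partner (ι := ι + κ) h hικ' (hιμ' e he) fun y hy => by
    refine hsolid (e - y) (-y) ?_ (-e) ?_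
    · by_contra! h0
      exact he (by simpa [neg_eq_zero.mp h0.2] using h0.1)
    · rw [map_sub, map_neg, map_neg, ← sub_eq_zero, ← sub_eq_zero.mpr hy, LinearMap.add_apply]
      abel
  have h2 : d (vec (e + y, y, e)) = 1 := by
    rw [← h1]
    simp only [vec, LinearMap.add_apply, map_add]
    congr 1
    abel
  -- Otherwise (e + y, y, e) has full support and e + y = y.
  have hye : e + y = 0 := by
    by_contra h0
    have := (h111 _ _ _ h0 hy he h2).1
    exact he (by simpa using this)
  obtain rfl : y = -e := (neg_eq_of_add_eq_zero_right hye).symm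
  -- Its partner on ι gives (x, -e, e) of full support, hence x = -e and e = a x = x = -e.
  have h3 : d (κ (-e) + μ e) = 1 := by simpa [vec] using h2
  obtain ⟨x, hx, h4, -⟩ := exists_partner h hι h3 fun x hx => by
    refine hsolid x (- -e) (Or.inr (by simpa using he)) e ?_
    rw [map_neg κ (-e), ← hx]
    abel
  obtain ⟨h5, h6⟩ := h111 x (-e) e hx (by simpa using he) he (by
    rw [← h4]
    congr 1
    abel)
  rw [hax x hx, ← h5] at h6
  exact ne_neg_of_ne_zero e he h6

end Array56

/-! ### Six collinear triples through a vector, and the relation between them -/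

section SixLines

variable {V : Type*} [AddCommGroup V]

/-- The values of `x` lie in `T`, and no two of them are equal or exchanged by `u ↦ -s - u`. -/
structure IsTransversal (s : V) (T : Finset V) {n : ℕ} (x : Fin n → V) : Prop where
  mem : ∀ i, x i ∈ T
  injective : Function.Injective x
  ne : ∀ i j, x i ≠ -s - x j

theorem IsTransversal.comp {s : V} {T : Finset V} {n m : ℕ} {x : Fin n → V}
    (hx : IsTransversal s T x) {e : Fin m → Fin n} (he : Function.Injective e) :
    IsTransversal s T (x ∘ e) :=
  ⟨fun _ => hx.mem _, hx.injective.comp he, fun _ _ => hx.ne _ _⟩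

/-- The map u ↦ -s - u is an involution without fixed points on T; one vector is chosen from each of
its pairs. -/
theorem exists_isTransversal {s : V} {n : ℕ} {T : Finset V} (hT : #T = 2 * n)
    (hinv : ∀ u ∈ T, -s - u ∈ T) (hne : ∀ u ∈ T, u ≠ -s - u) :
    ∃ x : Fin n → V, IsTransversal s T x := by
  classical
  induction n generalizing T with
  | zero => exact ⟨Fin.elim0, ⟨fun i => i.elim0, fun i => i.elim0, fun i => i.elim0⟩⟩
  | succ n ih =>
    obtain ⟨u, hu⟩ : T.Nonempty := card_pos.mp (by omega)
    have hu' := hinv u hu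
    have hmem : -s - u ∈ T.erase u := mem_erase.mpr ⟨(hne u hu).symm, hu'⟩
    obtain ⟨x, hx⟩ := ih (T := (T.erase u).erase (-s - u))
      (by rw [card_erase_of_mem hmem, card_erase_of_mem hu]; omega)
      (fun v hv => by
        simp only [mem_erase] at hv ⊢
        refine ⟨fun h => hv.2.1 (sub_right_injective h), fun h => hv.1 ?_, hinv v hv.2.2⟩
        rw [← h]
        abel)
      (fun v hv => hne v (mem_of_mem_erase (mem_of_mem_erase hv)))
    have hxu : ∀ i, x i ≠ u ∧ x i ≠ -s - u ∧ x i ∈ T := fun i => by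
      have := hx.mem i
      simp only [mem_erase] at this
      exact ⟨this.2.1, this.1, this.2.2⟩
    refine ⟨Fin.cons u x, ⟨?_, ?_, ?_⟩⟩
    · intro i
      refine Fin.cases ?_ (fun j => ?_) i
      · exact hu
      · exact (hxu j).2.2
    · rw [Fin.cons_injective_iff]
      exact ⟨fun ⟨i, hi⟩ => (hxu i).1 hi, hx.injective⟩
    · intro i j
      refine Fin.cases ?_ (fun i => ?_) i <;> refine Fin.cases ?_ (fun j => ?_) j
      · exact hne u hu
      · simp only [Fin.cons_zero, Fin.cons_succ]
        intro h
        refine (hxu j).2.1 ?_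
        rw [h]
        abel
      · simpa using (hxu i).2.1
      · simpa using hx.ne i j

variable [Module (ZMod 3) V]

/-- Pigeonhole on the combinations of s and the x i. -/
theorem exists_relation [Fintype V] {s : V} (hs : s ≠ 0) {n : ℕ} {x : Fin n → V}
    (hc : Fintype.card V < 3 ^ (n + 1)) :
    ∃ c : Fin n → ZMod 3, c ≠ 0 ∧ ∃ k : ZMod 3, ∑ i, c i • x i = k • s := by
  have hcard : Fintype.card V < Fintype.card (ZMod 3 × (Fin n → ZMod 3)) := by
    rw [Fintype.card_prod, Fintype.card_fun, ZMod.card, Fintype.card_fin]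
    rw [pow_succ] at hc
    omega
  obtain ⟨q, q', hne, heq⟩ := Fintype.exists_ne_map_eq_of_card_lt
    (fun q : ZMod 3 × (Fin n → ZMod 3) => ∑ i, q.2 i • x i - q.1 • s) hcard
  have h1 : ∑ i, (q.2 - q'.2) i • x i = (q.1 - q'.1) • s := by
    simp only [Pi.sub_apply, sub_smul, sum_sub_distrib]
    exact sub_eq_sub_iff_sub_eq_sub.mp heq
  refine ⟨q.2 - q'.2, fun h0 => hne ?_, _, h1⟩
  rw [h0] at h1
  simp only [Pi.zero_apply, zero_smul, sum_const_zero] at h1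
  exact Prod.ext (sub_eq_zero.mp ((smul_eq_zero.mp h1.symm).resolve_right hs)) (sub_eq_zero.mp h0)

/-- Six pairs without relations that involve only some of them can be oriented so that they sum
up to a multiple of `s`. -/
theorem exists_sum_eq_smul [Fintype V] {s : V} (hs : s ≠ 0) {T : Finset V} (hT : #T = 12)
    (hinv : ∀ u ∈ T, -s - u ∈ T) (hne : ∀ u ∈ T, u ≠ -s - u) (hc : Fintype.card V = 3 ^ 6)
    (hfull : ∀ x : Fin 6 → V, IsTransversal s T x → ∀ (c : Fin 6 → ZMod 3) (k : ZMod 3),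
      ∑ i, c i • x i = k • s → c ≠ 0 → ∀ i, c i ≠ 0) :
    ∃ x : Fin 6 → V, IsTransversal s T x ∧ (∃ a : ZMod 3, ∑ i, x i = a • s) ∧
      ∀ (c : Fin 6 → ZMod 3) (k : ZMod 3), ∑ i, c i • x i = k • s → ∀ i, c i = c 0 := by
  obtain ⟨y, hy⟩ := exists_isTransversal (n := 6) (s := s) hT hinv hne
  obtain ⟨c, hc0, k, hck⟩ := exists_relation hs (x := y) (by rw [hc]; norm_num)
  have hci := hfull y hy c k hck hc0
  have hci : ∀ i, c i = 1 ∨ c i = -1 := fun i => by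
    have h3 : ∀ a : ZMod 3, a ≠ 0 → a = 1 ∨ a = -1 := by decide
    exact h3 _ (hci i)
  -- Replacing y i by its partner -s - y i changes the sign of its coefficient modulo s, so that all
  -- coefficients of the relation become 1.
  let x : Fin 6 → V := fun i => if c i = 1 then y i else -s - y i
  have hx1 : ∀ i, x i = c i • y i + (if c i = 1 then (0 : ZMod 3) else -1) • s := fun i => by
    simp only [x]
    rcases hci i with h | h
    · simp [h]
    · have h1 : (-1 : ZMod 3) ≠ 1 := by decide
      rw [h, if_neg h1, if_neg h1]
      module
  have hx : IsTransversal s T x := by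
    have hinj : Function.Injective x := by
      intro i j hij
      simp only [x] at hij
      split_ifs at hij
      · exact hy.injective hij
      · exact absurd hij (hy.ne i j)
      · exact absurd hij.symm (hy.ne j i)
      · exact hy.injective (sub_right_injective hij)
    refine ⟨fun i => ?_, hinj, fun i j hij => ?_⟩
    · simp only [x]
      split_ifs
      · exact hy.mem i
      · exact hinv _ (hy.mem i)
    · by_cases hij' : i = j
      · subst hij'
        simp only [x] at hij
        split_ifs at hij
        · exact hne _ (hy.mem i) hij
        · refine hne _ (hy.mem i) ?_
          rw [hij]
          abel
      · simp only [x] at hij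
        split_ifs at hij
        · exact hy.ne i j hij
        · exact hij' (hy.injective (hij.trans (by abel)))
        · exact hij' (hy.injective (sub_right_injective hij))
        · refine hy.ne i j ?_
          have : y i = -s - (-s - y i) := by abel
          rw [this, hij]
          abel
  refine ⟨x, hx, ⟨k + ∑ i, (if c i = 1 then (0 : ZMod 3) else -1), ?_⟩, fun c' k' hck' i => ?_⟩
  · rw [sum_congr rfl fun i _ => hx1 i, sum_add_distrib, hck, ← sum_smul, ← add_smul]
  · by_contra hne'
    have hsum : ∃ a : ZMod 3, ∑ i, x i = a • s :=
      ⟨k + ∑ i, (if c i = 1 then (0 : ZMod 3) else -1), by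
        rw [sum_congr rfl fun i _ => hx1 i, sum_add_distrib, hck, ← sum_smul, ← add_smul]⟩
    obtain ⟨a, ha⟩ := hsum
    -- Subtracting c' 0 times the relation with all coefficients 1 gives a relation that misses
    -- index 0, which must be trivial.
    refine hfull x hx (fun i => c' i - c' 0) (k' - c' 0 * a) ?_ (fun h0 => hne' ?_) 0 (sub_self _)
    · simp only [sub_smul, sum_sub_distrib, hck', ← smul_sum, ha, mul_smul]
    · have := congrFun h0 i
      exact sub_eq_zero.mp this

/-- A relation among s and the first five vectors has coefficient 0 at the sixth, and all
coefficients are equal. -/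
theorem linearIndependent_of_relation {s : V} (hs : s ≠ 0) {x : Fin 6 → V}
    (hrel : ∀ (c : Fin 6 → ZMod 3) (k : ZMod 3), ∑ i, c i • x i = k • s → ∀ i, c i = c 0) :
    LinearIndependent (ZMod 3) (Fin.cons s fun i : Fin 5 => x i.castSucc : Fin 6 → V) := by
  rw [Fintype.linearIndependent_iff]
  intro g hg
  rw [Fin.sum_univ_succ] at hg
  simp only [Fin.cons_zero, Fin.cons_succ] at hg
  have h1 := hrel (Fin.snoc (fun i : Fin 5 => g i.succ) 0) (-g 0) (by
    rw [Fin.sum_univ_castSucc]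
    simp only [Fin.snoc_castSucc, Fin.snoc_last, zero_smul, add_zero, neg_smul]
    exact eq_neg_of_add_eq_zero_right hg)
  have h0 : ∀ i : Fin 5, g i.succ = 0 := fun i => by
    have h2 := h1 i.castSucc
    have h3 := h1 (Fin.last 5)
    rw [Fin.snoc_castSucc] at h2
    rw [Fin.snoc_last] at h3
    rw [h2, ← h3]
  simp only [h0, zero_smul, sum_const_zero, add_zero] at hg
  intro i
  refine Fin.cases ?_ h0 i
  exact (smul_eq_zero.mp hg).resolve_right hs

/-- Functionals on the quotient by `s` in terms of their values on the six pairs. -/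
theorem exists_dual_of_sum_eq_zero {s : V} (hs : s ≠ 0) {x : Fin 6 → V} {a : ZMod 3}
    (hsum : ∑ i, x i = a • s)
    (hrel : ∀ (c : Fin 6 → ZMod 3) (k : ZMod 3), ∑ i, c i • x i = k • s → ∀ i, c i = c 0)
    {y : Fin 6 → ZMod 3} {e : ZMod 3} (hy : ∑ i, y i = a * e) :
    ∃ f : Module.Dual (ZMod 3) V, f s = e ∧ ∀ i, f (x i) = y i := by
  have hli := linearIndependent_of_relation hs hrel
  obtain ⟨f, hf⟩ := exists_dual_apply_eq hli (Fin.cons e fun i : Fin 5 => y i.castSucc)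
  have hfs : f s = e := by simpa using hf 0
  have hfx : ∀ i : Fin 5, f (x i.castSucc) = y i.castSucc := fun i => by simpa using hf i.succ
  refine ⟨f, hfs, fun i => ?_⟩
  refine Fin.lastCases ?_ hfx i
  have h1 := congrArg f hsum
  rw [map_sum, map_smul, hfs, smul_eq_mul, ← hy, Fin.sum_univ_castSucc,
    Fin.sum_univ_castSucc (f := y),
    sum_congr rfl fun i _ => hfx i] at h1
  exact add_left_cancel h1

end SixLines

/-! ### Counting the connection set in cosets of a line -/

section Cosets

variable {V : Type*} [AddCommGroup V] [Module (ZMod 3) V]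

/-- The number of vectors of the coset of the line of `s` with coordinates `c` for which `P`
holds. -/
def cosetCount (P : V → Prop) [DecidablePred P] (s : V) {n : ℕ} (x : Fin n → V)
    (c : Fin n → ZMod 3) : ℕ :=
  #{k : ZMod 3 | P (k • s + ∑ i, c i • x i)}

theorem cosetCount_neg {P : V → Prop} [DecidablePred P] (hP : ∀ v, P (-v) ↔ P v) {s : V} {n : ℕ}
    {x : Fin n → V} (c : Fin n → ZMod 3) : cosetCount P s x (-c) = cosetCount P s x c := by
  have e : ∀ (k : ZMod 3) (c : Fin n → ZMod 3), -k • s + ∑ i, (-c) i • x i =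
      -(k • s + ∑ i, c i • x i) := fun k c => by
    simp only [Pi.neg_apply, neg_smul, sum_neg_distrib]
    abel
  unfold cosetCount
  refine card_bij (fun k _ => -k) (fun k hk => ?_) (fun k _ k' _ h => neg_injective h)
    fun k hk => ⟨-k, ?_, neg_neg k⟩
  · simp only [mem_filter, mem_univ, true_and] at hk ⊢
    rw [← hP, ← e, neg_neg]
    exact hk
  · simp only [mem_filter, mem_univ, true_and] at hk ⊢
    rw [e, hP]
    exact hk

/-- Coordinates of the origin, the vectors of weight one and the vectors of weight two with support
in a given list of pairs. -/
def coef {n m : ℕ} (pr : Fin m → Fin n × Fin n) :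
    Unit ⊕ (Fin n × Bool) ⊕ (Fin m × Bool × Bool) → Fin n → ZMod 3
  | .inl _ => 0
  | .inr (.inl (i, b)) => Pi.single i (if b then 1 else -1)
  | .inr (.inr (j, b, b')) =>
    Pi.single (pr j).1 (if b then 1 else -1) + Pi.single (pr j).2 (if b' then 1 else -1)

/-- Opposite coordinate vectors have equal values; each pair of indices contributes the classes of a
sum and of a difference. -/
theorem sum_coef {n m : ℕ} (pr : Fin m → Fin n × Fin n) (F : (Fin n → ZMod 3) → ℕ)
    (hF : ∀ c, F (-c) = F c) :
    ∑ i, F (coef pr i) = F 0 + 2 * ∑ i, F (Pi.single i 1) +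
      2 * ∑ j, (F (Pi.single (pr j).1 1 + Pi.single (pr j).2 1) +
        F (Pi.single (pr j).1 1 - Pi.single (pr j).2 1)) := by
  rw [Fintype.sum_sum_type, Fintype.sum_sum_type, Fintype.sum_prod_type, Fintype.sum_prod_type,
    ← add_assoc]
  simp only [Fintype.sum_bool, Fintype.sum_prod_type, univ_unique, sum_singleton, mul_sum]
  congr 1
  · congr 1
    refine sum_congr rfl fun i _ => ?_
    simp only [coef, if_true, Bool.false_eq_true, if_false]
    rw [Pi.single_neg, hF]
    omega
  · refine sum_congr rfl fun j _ => ?_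
    simp only [coef, if_true, Bool.false_eq_true, if_false]
    rw [Pi.single_neg, Pi.single_neg, ← sub_eq_add_neg, ← neg_add, hF, neg_add_eq_sub,
      ← neg_sub, hF]
    omega

theorem sum_cosetCount {P : V → Prop} [DecidablePred P] {s : V} {n : ℕ} {x : Fin n → V} {I : Type*}
    [Fintype I] (m : I → Fin n → ZMod 3) :
    ∑ i, cosetCount P s x (m i) = #{q : I × ZMod 3 | P (q.2 • s + ∑ l, m q.1 l • x l)} := by
  rw [card_filter, Fintype.sum_prod_type]
  simp only [cosetCount, card_filter]

/-- A coincidence would be a relation modulo s between two of the coordinate vectors. -/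
theorem coset_injective {s : V} (hs : s ≠ 0) {n : ℕ} {x : Fin n → V} {I : Type*}
    {m : I → Fin n → ZMod 3}
    (hm : ∀ i j, (∃ k : ZMod 3, ∑ l, (m i - m j) l • x l = k • s) → i = j) :
    Function.Injective fun q : I × ZMod 3 => q.2 • s + ∑ l, m q.1 l • x l := by
  rintro ⟨i, k⟩ ⟨j, k'⟩ h
  simp only at h
  have h1 : ∑ l, (m i - m j) l • x l = (k' - k) • s := by
    simp only [Pi.sub_apply, sub_smul, sum_sub_distrib]
    rw [sub_eq_sub_iff_add_eq_add, add_comm, h]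
  obtain rfl := hm i j ⟨_, h1⟩
  rw [add_left_inj, ← sub_eq_zero, ← sub_smul, smul_eq_zero, sub_eq_zero] at h
  rw [h.resolve_right hs]

end Cosets

namespace Array56

/-- The connection set in the plane of two collinear triples with a common vector. -/
theorem plane_type {P : (Fin 3 → ZMod 3) → ℕ} (hneg : ∀ t, P (-t) = P t) (h0 : P 0 ≠ 1)
    (h3 : 3 ∣ #{t | P t = 1}) (h12 : #{t | P t = 1} ≤ 12)
    (hs : P ![1, 0, 0] = 1) (hu : P ![0, 1, 0] = 1) (hsu : P ![1, 1, 0] = 1)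
    (hw : P ![0, 0, 1] = 1) (hsw : P ![1, 0, 1] = 1) (hu' : P ![1, -1, 0] ≠ 1)
    (hw' : P ![1, 0, -1] ≠ 1) :
    (∃ t : Fin 3 → ZMod 3, t 1 ≠ 0 ∧ t 2 ≠ 0 ∧ P t = 1) ∧
      ∀ t : Fin 3 → ZMod 3, t 1 ≠ 0 → t 2 ≠ 0 → P t = 1 → P (t + ![1, 0, 0]) ≠ 1 := by
  let L₀ : List (Fin 3 → ZMod 3) := [![1, 0, 0], ![0, 1, 0], ![1, 1, 0], ![0, 0, 1], ![1, 0, 1]]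
  have hL₀ : ∀ t ∈ L₀, P t = 1 := by simp [L₀, hs, hu, hsu, hw, hsw]
  have hsub : ∀ L : List (Fin 3 → ZMod 3), (∀ t ∈ L, P t = 1) → signed L ⊆ ({t | P t = 1} : Finset _) :=
    fun L hL t ht => mem_filter.mpr ⟨mem_univ _, eq_of_mem_signed hneg hL ht⟩
  have hc₀ : #(signed L₀) = 10 := by decide +kernel
  -- The five known lines give ten vectors, and the number is a multiple of 3 and at most 12. So
  -- there is exactly one further pair ±t.
  have hcard : #{t | P t = 1} = 12 := by
    have h1 := card_le_card (hsub L₀ hL₀)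
    omega
  refine ⟨?_, fun t h1 h2 hP hP' => ?_⟩
  · by_contra! hno
    have hsub' : ({t | P t = 1} : Finset (Fin 3 → ZMod 3)) ⊆ signed L₀ := by
      intro t ht
      have ht : P t = 1 := by simpa using ht
      have hcov : ∀ t : Fin 3 → ZMod 3, t = 0 ∨ t ∈ signed L₀ ∨ t = ![1, -1, 0] ∨
        -t = ![1, -1, 0] ∨ t = ![1, 0, -1] ∨ -t = ![1, 0, -1] ∨ t 1 ≠ 0 ∧ t 2 ≠ 0 := by
        decide +kernel
      rcases hcov t with rfl | h | rfl | h | rfl | h | h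
      · exact absurd ht h0
      · exact h
      · exact absurd ht hu'
      · rw [← h, hneg] at hu'
        exact absurd ht hu'
      · exact absurd ht hw'
      · rw [← h, hneg] at hw'
        exact absurd ht hw'
      · exact absurd ht (hno t h.1 h.2)
    have h1 := card_le_card hsub'
    omega
  · have h4 := card_le_card (hsub (t :: (t + ![1, 0, 0]) :: L₀) (by
      simp only [List.forall_mem_cons]
      exact ⟨hP, hP', hL₀⟩))
    have h5 : ∀ t : Fin 3 → ZMod 3, t 1 ≠ 0 → t 2 ≠ 0 →
        #(signed (t :: (t + ![1, 0, 0]) :: L₀)) = 14 := by decide +kernel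
    have := h5 t h1 h2
    omega

end Array56

/-! ### Collinear triples through a vector of a ternary connection set -/

section Triples

variable {V : Type*} [AddCommGroup V] [Fintype V] {A : IntersectionArray} {d : V → ℕ} {s : V}

/-- The other vectors on collinear triples through `s`. -/
def triples (d : V → ℕ) (s : V) : Finset V := {u | d u = 1 ∧ d (s + u) = 1 ∧ d (u - s) ≠ 0}

theorem mem_triples {u : V} : u ∈ triples d s ↔ d u = 1 ∧ d (s + u) = 1 ∧ d (u - s) ≠ 0 := by
  simp [triples]

variable [Module (ZMod 3) V]

/-- Among the u with u and s + u in the connection set, only u = s is left out; it is a solution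
since s + s = -s. -/
theorem card_triples (h : TranslationDistance A d) (hs : d s = 1) :
    #(triples d s) + 1 = A.stepNum 1 1 := by
  classical
  have h1 := h.card_step s 1
  rw [hs] at h1
  have hmem : s ∈ ({u | d u = 1 ∧ d (s + u) = 1} : Finset V) := by
    have : s + s = -s := by
      rw [← neg_inj, neg_neg, neg_add, ← sub_eq_add_neg, neg_sub_self_eq]
    simp [hs, this, h.neg]
  have h2 : triples d s = ({u | d u = 1 ∧ d (s + u) = 1} : Finset V).erase s := by
    ext u
    simp only [mem_triples, mem_erase, mem_filter, mem_univ, true_and, Ne, h.eq_zero_iff,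
      sub_eq_zero]
    tauto
  rw [h2, card_erase_add_one hmem, h1]

theorem neg_sub_mem_triples (h : TranslationDistance A d) {u : V} (hu : u ∈ triples d s) :
    -s - u ∈ triples d s := by
  rw [mem_triples] at hu ⊢
  refine ⟨?_, ?_, ?_⟩
  · rw [← hu.2.1, ← h.neg]
    congr 1
    abel
  · rw [← hu.1, ← h.neg]
    congr 1
    abel
  · have : -s - u - s = -(u - s) := by
      rw [sub_right_comm, neg_sub_self_eq, neg_sub]
    rw [this, h.neg]
    exact hu.2.2

theorem ne_neg_sub_of_mem_triples (h : TranslationDistance A d) {u : V} (hu : u ∈ triples d s) :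
    u ≠ -s - u := by
  intro hne
  refine (mem_triples.mp hu).2.2 ?_
  rw [h.eq_zero_iff]
  have h1 : s = -u - u := by
    rw [eq_sub_iff_add_eq] at hne
    rw [← neg_inj, ← hne]
    abel
  rw [neg_sub_self_eq] at h1
  rw [h1, sub_self]

theorem ne_smul_of_mem_triples (h : TranslationDistance A d) {u : V} (hu : u ∈ triples d s)
    (k : ZMod 3) : u ≠ k • s := by
  rw [mem_triples, Ne, h.eq_zero_iff] at hu
  have h3 : ∀ k : ZMod 3, k = 0 ∨ k = 1 ∨ k = -1 := by decide
  rcases h3 k with rfl | rfl | rfl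
  · rintro rfl
    simp [h.map_zero] at hu
  · rintro rfl
    simp at hu
  · rintro rfl
    simp [h.map_zero] at hu

/-- If v lay in the plane of s and u, then apart from the excluded cases v = u and v = -s - u, and
multiples of s, one of v and s + v would be s - u up to sign. This would put a full line into the
connection set. -/
theorem ne_smul_add_smul_of_mem_triples (h : TranslationDistance A d)
    (hno : ∀ u ∈ triples d s, d (s - u) ≠ 1) {u v : V} (hu : u ∈ triples d s) (hv : v ∈ triples d s)
    (huv : u ≠ v) (huv' : u ≠ -s - v) (a b : ZMod 3) : v ≠ a • s + b • u := by
  have h3 : ∀ k : ZMod 3, k = 0 ∨ k = 1 ∨ k = -1 := by decide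
  have hnu := hno u hu
  have hnv := hno v hv
  have hv' := mem_triples.mp hv
  intro heq
  rcases h3 b with rfl | rfl | rfl
  · rw [zero_smul, add_zero] at heq
    exact ne_smul_of_mem_triples h hv a heq
  · rcases h3 a with rfl | rfl | rfl
    · exact huv (by rw [heq]; module)
    · refine hnu ?_
      rw [← hv'.2.1, heq, ← h.neg]
      congr 1
      have := neg_sub_self_eq s
      rw [← sub_eq_zero] at this ⊢
      rw [← this]
      module
    · refine hnu ?_
      rw [← hv'.1, heq, ← h.neg]
      congr 1
      module
  · rcases h3 a with rfl | rfl | rfl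
    · refine hnu ?_
      rw [← hv'.2.1, heq]
      congr 1
      module
    · refine hnu ?_
      rw [← hv'.1, heq]
      congr 1
      module
    · refine huv' ?_
      rw [heq]
      module

theorem linearIndependent_of_mem_triples (h : TranslationDistance A d) (hs : d s = 1)
    (hno : ∀ u ∈ triples d s, d (s - u) ≠ 1) {u v : V} (hu : u ∈ triples d s) (hv : v ∈ triples d s)
    (huv : u ≠ v) (huv' : u ≠ -s - v) : LinearIndependent (ZMod 3) ![s, u, v] := by
  have hs0 : s ≠ 0 := by
    rintro rfl
    rw [h.map_zero] at hs
    omega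
  rw [Fintype.linearIndependent_iff]
  intro g hg
  simp only [Fin.sum_univ_three, Matrix.cons_val_zero, Matrix.cons_val_one, Matrix.cons_val] at hg
  have h2 : g 2 = 0 := by
    by_contra h2
    refine ne_smul_add_smul_of_mem_triples h hno hu hv huv huv' (-((g 2)⁻¹ * g 0))
      (-((g 2)⁻¹ * g 1)) ?_
    have : v = (g 2)⁻¹ • g 2 • v := (inv_smul_smul₀ h2 v).symm
    rw [this, eq_neg_of_add_eq_zero_right hg]
    module
  rw [h2, zero_smul, add_zero] at hg
  have h1 : g 1 = 0 := by
    by_contra h1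
    refine ne_smul_of_mem_triples h hu (-((g 1)⁻¹ * g 0)) ?_
    have : u = (g 1)⁻¹ • g 1 • u := (inv_smul_smul₀ h1 u).symm
    rw [this, eq_neg_of_add_eq_zero_right hg]
    module
  rw [h1, zero_smul, add_zero, smul_eq_zero] at hg
  intro i
  fin_cases i
  exacts [hg.resolve_right hs0, h1, h2]

end Triples

namespace Array56

variable {V : Type*} [AddCommGroup V] [Module (ZMod 3) V] [Fintype V] {d : V → ℕ} {s : V}

theorem plane_of_mem_triples (h : TranslationDistance ⟨[56, 42, 20], [1, 6, 28]⟩ d) (hs : d s = 1)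
    (hno : ∀ u ∈ triples d s, d (s - u) ≠ 1) {u v : V} (hu : u ∈ triples d s) (hv : v ∈ triples d s)
    (huv : u ≠ v) (huv' : u ≠ -s - v) :
    (∃ a b c : ZMod 3, b ≠ 0 ∧ c ≠ 0 ∧ d (a • s + b • u + c • v) = 1) ∧
      ∀ a b c : ZMod 3, b ≠ 0 → c ≠ 0 → d (a • s + b • u + c • v) = 1 →
        d ((a + 1) • s + b • u + c • v) ≠ 1 := by
  have hx := linearIndependent_of_mem_triples h hs hno hu hv huv huv'
  have hnu := hno u hu
  have hnv := hno v hv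
  have hsum : ∀ t : Fin 3 → ZMod 3,
      ∑ i, t i • (![s, u, v] : Fin 3 → V) i = t 0 • s + t 1 • u + t 2 • v := fun t => by
    simp [Fin.sum_univ_three]
  obtain ⟨hu1, hu2, -⟩ := mem_triples.mp hu
  obtain ⟨hv1, hv2, -⟩ := mem_triples.mp hv
  have hle : ∀ t : Fin 3 → ZMod 3, d (∑ i, t i • (![s, u, v] : Fin 3 → V) i) ≤ 2 := by
    have hadd : ∀ x y, d x ≤ 1 → d y ≤ 1 → d (x + y) ≤ 2 := fun x y hx hy => by
      by_cases h0 : d y = 0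
      · rw [(h.eq_zero_iff y).mp h0, add_zero]
        omega
      · have := h.add_le x y (by omega)
        omega
    have hsm : ∀ (k : ZMod 3) x, d x = 1 → d (k • x) ≤ 1 := fun k x hx => by
      by_cases hk : k = 0
      · rw [hk, zero_smul, h.map_zero]
        omega
      · rw [h.smul_of_ternary k x hk hx]
    intro t
    -- In each case a s + b u + c v is a sum of two multiples of s, u, v, s + u, s + v, so the span
    -- has no vectors at distance three.
    have hcases : ∀ a b c : ZMod 3, a = 0 ∨ b = 0 ∨ c = 0 ∨ b = a ∨ c = a ∨ b = -a ∧ c = -a := by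
      decide
    rw [hsum]
    rcases hcases (t 0) (t 1) (t 2) with h0 | h0 | h0 | h0 | h0 | ⟨h0, h0'⟩
    · rw [h0, zero_smul, zero_add]
      exact hadd _ _ (hsm _ _ hu1) (hsm _ _ hv1)
    · rw [h0, zero_smul, add_zero]
      exact hadd _ _ (hsm _ _ hs) (hsm _ _ hv1)
    · rw [h0, zero_smul, add_zero]
      exact hadd _ _ (hsm _ _ hs) (hsm _ _ hu1)
    · rw [h0, ← smul_add]
      exact hadd _ _ (hsm _ _ hu2) (hsm _ _ hv1)
    · rw [h0, add_right_comm, ← smul_add]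
      exact hadd _ _ (hsm _ _ hv2) (hsm _ _ hu1)
    · have : t 0 • s + t 1 • u + t 2 • v = (-t 0) • (s + u) + (-t 0) • (s + v) := by
        have h1 : t 0 • (-s - s) = t 0 • s := by rw [neg_sub_self_eq]
        rw [h0, h0', ← h1]
        module
      rw [this]
      exact hadd _ _ (hsm _ _ hu2) (hsm _ _ hv2)
  obtain ⟨h3, h12⟩ := card_plane h hx hle
  obtain ⟨⟨t, ht1, ht2, ht⟩, hd⟩ := plane_type
    (P := fun t => d (∑ i, t i • (![s, u, v] : Fin 3 → V) i))
    (fun t => by simp only [Pi.neg_apply, neg_smul, sum_neg_distrib, h.neg])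
    (by simp [h.map_zero]) h3 h12 (by simpa [hsum] using hs) (by simpa [hsum] using hu1)
    (by simpa [hsum] using hu2) (by simpa [hsum] using hv1) (by simpa [hsum] using hv2)
    (by simpa [hsum, ← sub_eq_add_neg] using hnu) (by simpa [hsum, ← sub_eq_add_neg] using hnv)
  refine ⟨⟨t 0, t 1, t 2, ht1, ht2, by rw [← hsum, ht]⟩, fun a b c hb hc hP => ?_⟩
  have := hd ![a, b, c] hb hc (by simpa [hsum] using hP)
  simpa [hsum] using this

end Array56

/-- The Hamming weight. -/
def wt {n : ℕ} (c : Fin n → ZMod 3) : ℕ := #{i | c i ≠ 0}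

theorem sum_smul_eq_sum_support {V : Type*} [AddCommGroup V] [Module (ZMod 3) V] {n : ℕ}
    (c : Fin n → ZMod 3) (x : Fin n → V) :
    ∑ i, c i • x i = ∑ i with c i ≠ 0, c i • x i := by
  rw [sum_filter]
  refine sum_congr rfl fun i _ => ?_
  split_ifs with h
  · rfl
  · rw [not_not.mp h, zero_smul]

namespace Array56

variable {V : Type*} [AddCommGroup V] [Module (ZMod 3) V] [Fintype V] {d : V → ℕ} {s : V}

/-- Weights one and two are excluded by independence of s and two triples. In a relation of weight
three, x l and s + x l would both be vectors of the connection set in the plane of the other two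
triples, off their lines, and there is only one such pair ±t. -/
theorem four_le_wt (h : TranslationDistance ⟨[56, 42, 20], [1, 6, 28]⟩ d) (hs : d s = 1)
    (hno : ∀ u ∈ triples d s, d (s - u) ≠ 1) {n : ℕ} {x : Fin n → V}
    (hx : IsTransversal s (triples d s) x) {c : Fin n → ZMod 3} {k : ZMod 3}
    (hc : ∑ i, c i • x i = k • s) (hc0 : c ≠ 0) : 4 ≤ wt c := by
  by_contra! hlt
  rw [sum_smul_eq_sum_support] at hc
  have hpos : 0 < wt c := by
    obtain ⟨i, hi⟩ := Function.ne_iff.mp hc0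
    exact card_pos.mpr ⟨i, by simpa using hi⟩
  have hmem : ∀ i, i ∈ ({i | c i ≠ 0} : Finset (Fin n)) ↔ c i ≠ 0 := fun i => by simp
  unfold wt at hlt hpos
  obtain h1 | h2 | h3 : #{i | c i ≠ 0} = 1 ∨ #{i | c i ≠ 0} = 2 ∨ #{i | c i ≠ 0} = 3 := by omega
  · obtain ⟨i, hi⟩ := card_eq_one.mp h1
    rw [hi] at hc hmem
    rw [sum_singleton] at hc
    have hci := (hmem i).mp (by simp)
    refine ne_smul_of_mem_triples h (hx.mem i) ((c i)⁻¹ * k) ?_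
    rw [mul_smul, ← hc, inv_smul_smul₀ hci]
  · obtain ⟨i, j, hij, hi⟩ := card_eq_two.mp h2
    rw [hi] at hc hmem
    rw [sum_pair hij] at hc
    have hci := (hmem j).mp (by simp)
    refine ne_smul_add_smul_of_mem_triples h hno (hx.mem i) (hx.mem j)
      (fun h => hij (hx.injective h)) (hx.ne i j) ((c j)⁻¹ * k) (-((c j)⁻¹ * c i)) ?_
    rw [mul_smul, ← hc, neg_smul, mul_smul, smul_add, inv_smul_smul₀ hci]
    abel
  · obtain ⟨i, j, l, hij, hil, hjl, hi⟩ := card_eq_three.mp h3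
    rw [hi] at hc hmem
    rw [sum_insert (by simp [hij, hil]), sum_pair hjl] at hc
    have hci := (hmem i).mp (by simp)
    have hcj := (hmem j).mp (by simp)
    have hcl := (hmem l).mp (by simp)
    have hxl : x l = ((c l)⁻¹ * k) • s + (-((c l)⁻¹ * c i)) • x i + (-((c l)⁻¹ * c j)) • x j := by
      rw [mul_smul, ← hc, neg_smul, neg_smul, mul_smul, mul_smul, smul_add, smul_add,
        inv_smul_smul₀ hcl]
      abel
    have hl := mem_triples.mp (hx.mem l)
    refine (plane_of_mem_triples h hs hno (hx.mem i) (hx.mem j)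
      (fun h => hij (hx.injective h)) (hx.ne i j)).2 ((c l)⁻¹ * k) (-((c l)⁻¹ * c i))
      (-((c l)⁻¹ * c j)) (by simp [hci, hcl]) (by simp [hcj, hcl]) (by rw [← hxl, hl.1]) ?_
    have : ((c l)⁻¹ * k + 1) • s + (-((c l)⁻¹ * c i)) • x i + (-((c l)⁻¹ * c j)) • x j =
        s + x l := by
      rw [hxl]
      module
    rw [this, hl.2.1]

section

variable {n : ℕ} {x : Fin n → V}

theorem two_le_cosetCount_zero (h : TranslationDistance ⟨[56, 42, 20], [1, 6, 28]⟩ d)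
    (hs : d s = 1) : 2 ≤ cosetCount (fun v => d v = 1) s x 0 := by
  have : ({1, -1} : Finset (ZMod 3)) ⊆ ({k | d (k • s + ∑ i, (0 : Fin n → ZMod 3) i • x i) = 1} :
      Finset (ZMod 3)) := by
    intro k hk
    simp only [mem_insert, mem_singleton] at hk
    rcases hk with rfl | rfl <;> simp [hs, h.neg]
  exact card_le_card this

theorem two_le_cosetCount_single (hx : IsTransversal s (triples d s) x) (i : Fin n) :
    2 ≤ cosetCount (fun v => d v = 1) s x (Pi.single i 1) := by
  have hi := mem_triples.mp (hx.mem i)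
  have : ({0, 1} : Finset (ZMod 3)) ⊆
      ({k | d (k • s + ∑ j, (Pi.single i 1 : Fin n → ZMod 3) j • x j) = 1} : Finset (ZMod 3)) := by
    intro k hk
    simp only [mem_insert, mem_singleton] at hk
    rcases hk with rfl | rfl <;> simp [Pi.single_apply, hi]
  exact card_le_card this

theorem one_le_cosetCount_pair (h : TranslationDistance ⟨[56, 42, 20], [1, 6, 28]⟩ d) (hs : d s = 1)
    (hno : ∀ u ∈ triples d s, d (s - u) ≠ 1) (hx : IsTransversal s (triples d s) x) {i j : Fin n}
    (hij : i ≠ j) : 1 ≤ cosetCount (fun v => d v = 1) s x (Pi.single i 1 + Pi.single j 1) +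
      cosetCount (fun v => d v = 1) s x (Pi.single i 1 - Pi.single j 1) := by
  obtain ⟨⟨a, b, c, hb, hc, hd⟩, -⟩ := plane_of_mem_triples h hs hno (hx.mem i) (hx.mem j)
    (fun h => hij (hx.injective h)) (hx.ne i j)
  have hd' : d ((b * a) • s + x i + (b * c) • x j) = 1 := by
    rw [← h.smul_of_ternary b _ hb hd]
    congr 1
    rw [smul_add, smul_add, smul_smul, smul_smul, smul_smul]
    have h1 : ∀ b : ZMod 3, b ≠ 0 → b * b = 1 := by decide
    rw [h1 b hb, one_smul]
  have h4 : ∀ b c : ZMod 3, b ≠ 0 → c ≠ 0 → b * c = 1 ∨ b * c = -1 := by decide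
  rcases h4 b c hb hc with hbc | hbc
  · refine le_add_right (card_pos.mpr ⟨b * a, ?_⟩)
    simp only [mem_filter, mem_univ, true_and]
    rw [← hd', hbc]
    congr 1
    simp [add_smul, sum_add_distrib, Pi.single_apply, add_assoc]
  · refine le_add_left (card_pos.mpr ⟨b * a, ?_⟩)
    simp only [mem_filter, mem_univ, true_and]
    rw [← hd', hbc]
    congr 1
    simp only [Pi.sub_apply, sub_smul, sum_sub_distrib]
    simp [Pi.single_apply, sub_eq_add_neg, add_assoc]

/-- The line of s contains two vectors, each of the 2n cosets ±x i two, and for each pair of indices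
the cosets of ±x i ± x j contain two in total, all as lower bounds. -/
theorem le_sum_cosetCount (h : TranslationDistance ⟨[56, 42, 20], [1, 6, 28]⟩ d) (hs : d s = 1)
    (hno : ∀ u ∈ triples d s, d (s - u) ≠ 1) (hx : IsTransversal s (triples d s) x) {m : ℕ}
    {pr : Fin m → Fin n × Fin n} (hpr : ∀ j, (pr j).1 ≠ (pr j).2) :
    2 + 4 * n + 2 * m ≤ ∑ i, cosetCount (fun v => d v = 1) s x (coef pr i) := by
  rw [sum_coef _ _ fun c => cosetCount_neg (fun v => by rw [h.neg]) c]
  have h1 := two_le_cosetCount_zero (x := x) h hs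
  have h2 : n * 2 ≤ ∑ i, cosetCount (fun v => d v = 1) s x (Pi.single i 1) := by
    have := card_nsmul_le_sum univ (fun i => cosetCount (fun v => d v = 1) s x (Pi.single i 1)) 2
      fun i _ => two_le_cosetCount_single hx i
    simpa using this
  have h3 : m * 1 ≤ ∑ j, (cosetCount (fun v => d v = 1) s x
      (Pi.single (pr j).1 1 + Pi.single (pr j).2 1) + cosetCount (fun v => d v = 1) s x
      (Pi.single (pr j).1 1 - Pi.single (pr j).2 1)) := by
    have := card_nsmul_le_sum univ (fun j => cosetCount (fun v => d v = 1) s x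
      (Pi.single (pr j).1 1 + Pi.single (pr j).2 1) + cosetCount (fun v => d v = 1) s x
      (Pi.single (pr j).1 1 - Pi.single (pr j).2 1)) 1
      fun j _ => one_le_cosetCount_pair h hs hno hx (hpr j)
    simpa using this
  omega

end

/-- The equation 3z - 56 = 2θ for the eigenvalues 20, 2, -7. -/
theorem card_filter_ker (h : TranslationDistance ⟨[56, 42, 20], [1, 6, 28]⟩ d)
    {f : Module.Dual (ZMod 3) V} (hf : f ≠ 0) :
    #{v | d v = 1 ∧ f v = 0} = 32 ∨ #{v | d v = 1 ∧ f v = 0} = 20 ∨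
      #{v | d v = 1 ∧ f v = 0} = 14 := by
  have h1 := kerSum_cases h f hf
  have h2 := kerSum_eq ({v | d v = 1} : Finset V) f
  rw [(card_eq h).2.1, filter_filter] at h2
  push_cast at h2
  omega

/-- Pairs of indices whose sums are distinct modulo relations not involving the last index. -/
def starPairs : Fin 6 → Fin 5 × Fin 5 := ![(0, 1), (0, 2), (0, 4), (1, 4), (2, 4), (3, 4)]

theorem wt_coef_starPairs_sub : ∀ i j, i ≠ j →
    wt (coef starPairs i - coef starPairs j) ≠ 0 ∧ (wt (coef starPairs i - coef starPairs j) < 4 ∨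
      wt (coef starPairs i - coef starPairs j) = 4 ∧
        (coef starPairs i - coef starPairs j) 4 ≠ 0) := by
  decide +kernel

end Array56

section

variable {V : Type*} [AddCommGroup V] [Module (ZMod 3) V] [Fintype V]

/-- Dependent vectors, as many as the dimension, lie in a hyperplane. -/
theorem exists_dual_of_relation {n : ℕ} {x : Fin n → V} (hc : Fintype.card V = 3 ^ n)
    {g : Fin n → ZMod 3} (hg : g ≠ 0) (hrel : ∑ i, g i • x i = 0) :
    ∃ f : Module.Dual (ZMod 3) V, f ≠ 0 ∧ ∀ i, f (x i) = 0 := by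
  have hlt : Submodule.span (ZMod 3) (Set.range x) < ⊤ := by
    rw [lt_top_iff_ne_top]
    intro htop
    have hsurj : Function.Surjective fun t : Fin n → ZMod 3 => ∑ i, t i • x i := fun v =>
      (Submodule.mem_span_range_iff_exists_fun _).mp (htop ▸ Submodule.mem_top)
    have hinj := ((Fintype.bijective_iff_surjective_and_card _).mpr ⟨hsurj, by
      rw [hc, Fintype.card_fun, ZMod.card, Fintype.card_fin]⟩).1
    exact hg (hinj (by simpa using hrel))
  obtain ⟨f, hf, hle⟩ := Submodule.exists_le_ker_of_lt_top _ hlt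
  exact ⟨f, hf, fun i => hle (Submodule.subset_span ⟨i, rfl⟩)⟩

end

/-- The supports share three positions. At two of them at least the sum cancels, or at two of them
the difference, which leaves weight at most three. -/
theorem wt_add_or_wt_sub : ∀ j : Fin 5, ∀ c : Fin 5 → ZMod 3, c j = 0 → wt c = 4 →
    ∀ c' : Fin 5 → ZMod 3, c' j ≠ 0 → wt c' = 4 → wt (c + c') < 4 ∨ wt (c - c') < 4 := by
  decide +kernel

namespace Array56

variable {V : Type*} [AddCommGroup V] [Module (ZMod 3) V] [Fintype V] {d : V → ℕ} {s : V}

/-- The cosets for `starPairs` are distinct: two of its pairs that both avoid the last index meet,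
so a difference of weight four involves that index. The hyperplane would then contain 2 + 4·5 + 2·6
= 34 vectors, but at most 32 are allowed. -/
theorem not_five_in_ker_of_wt (h : TranslationDistance ⟨[56, 42, 20], [1, 6, 28]⟩ d) (hs : d s = 1)
    (hno : ∀ u ∈ triples d s, d (s - u) ≠ 1) {x : Fin 5 → V}
    (hx : IsTransversal s (triples d s) x) {f : Module.Dual (ZMod 3) V} (hf : f ≠ 0) (hfs : f s = 0)
    (hfx : ∀ i, f (x i) = 0)
    (hwt : ∀ (c : Fin 5 → ZMod 3) (k : ZMod 3), ∑ i, c i • x i = k • s → wt c = 4 → c 4 = 0) :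
    False := by
  have hs0 : s ≠ 0 := by
    rintro rfl
    rw [h.map_zero] at hs
    omega
  have hinj := coset_injective hs0 (x := x) (m := coef starPairs) (by
    rintro i j ⟨k, hk⟩
    by_contra hij
    obtain ⟨h0, h1⟩ := wt_coef_starPairs_sub i j hij
    have h4 := four_le_wt h hs hno hx hk (by
      intro hz
      rw [hz] at h0
      exact h0 (by decide))
    rcases h1 with h1 | ⟨h1, h2⟩
    · omega
    · exact h2 (hwt _ k hk h1))
  have h1 := le_sum_cosetCount h hs hno hx (pr := starPairs) (by decide)
  rw [sum_cosetCount] at h1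
  have h2 : #{q : _ × ZMod 3 | d (q.2 • s + ∑ l, coef starPairs q.1 l • x l) = 1} ≤
      #{v | d v = 1 ∧ f v = 0} := by
    refine card_le_card_of_injOn _ (fun q hq => ?_) hinj.injOn
    simp only [coe_filter, Set.mem_ofPred_eq, mem_univ, true_and] at hq ⊢
    exact ⟨hq, by simp [hfs, hfx]⟩
  have := card_filter_ker h hf
  omega

/-- Relations of weight four all miss the same index j, since otherwise a sum or difference of two
has weight below four. Exchanging j with the last index gives the special case. -/
theorem not_five_in_ker (h : TranslationDistance ⟨[56, 42, 20], [1, 6, 28]⟩ d) (hs : d s = 1)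
    (hno : ∀ u ∈ triples d s, d (s - u) ≠ 1) {x : Fin 5 → V}
    (hx : IsTransversal s (triples d s) x) {f : Module.Dual (ZMod 3) V} (hf : f ≠ 0) (hfs : f s = 0)
    (hfx : ∀ i, f (x i) = 0) : False := by
  by_cases hwt : ∀ (c : Fin 5 → ZMod 3) (k : ZMod 3), ∑ i, c i • x i = k • s → wt c = 4 → c 4 = 0
  · exact not_five_in_ker_of_wt h hs hno hx hf hfs hfx hwt
  push Not at hwt
  obtain ⟨c, k, hck, hc4, -⟩ := hwt
  obtain ⟨j, hj⟩ : ∃ j, c j = 0 := by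
    by_contra! hall
    rw [wt, filter_true_of_mem fun i _ => hall i, card_univ, Fintype.card_fin] at hc4
    omega
  let σ := Equiv.swap j 4
  refine not_five_in_ker_of_wt h hs hno (hx.comp σ.injective) hf hfs (fun i => hfx _)
    fun c' k' hck' hc4' => ?_
  by_contra hne
  have hrel : ∑ i, (c' ∘ σ) i • x i = k' • s := by
    rw [← hck', ← Equiv.sum_comp σ]
    refine sum_congr rfl fun i _ => ?_
    simp [σ]
  have hwt' : wt (c' ∘ σ) = 4 := by
    rw [← hc4', wt, wt]
    refine card_bij (fun i _ => σ i) (fun i hi => by simpa using hi)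
      (fun i _ i' _ h => σ.injective h) fun i hi => ⟨σ i, ?_, by simp [σ]⟩
    simpa [σ] using hi
  have hj' : (c' ∘ σ) j ≠ 0 := by simpa [σ] using hne
  have hlt := wt_add_or_wt_sub j c hj hc4 _ hj' hwt'
  have h1 := four_le_wt h hs hno hx (c := c + c' ∘ σ) (k := k + k') (by
    simp only [Pi.add_apply, add_smul, sum_add_distrib, hck, hrel]) fun h0 => hj' (by
      have := congrFun h0 j
      simpa [hj] using this)
  have h2 := four_le_wt h hs hno hx (c := c - c' ∘ σ) (k := k - k') (by
    simp only [Pi.sub_apply, sub_smul, sum_sub_distrib, hck, hrel]) fun h0 => hj' (by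
      have := congrFun h0 j
      simpa [hj] using this)
  omega

end Array56

/-- The pairs of six indices. -/
def allPairs : Fin 15 → Fin 6 × Fin 6 := ![(0, 1), (0, 2), (0, 3), (0, 4), (0, 5), (1, 2), (1, 3),
  (1, 4), (1, 5), (2, 3), (2, 4), (2, 5), (3, 4), (3, 5), (4, 5)]

/-- The only relations have constant coefficients, so this makes the cosets distinct. -/
theorem coef_allPairs_sub : ∀ i j, i ≠ j →
    ∃ l, (coef allPairs i - coef allPairs j) l ≠ (coef allPairs i - coef allPairs j) 0 := by
  decide +kernel

theorem allPairs_difference : ∀ p j : Fin 15,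
    ((Pi.single (allPairs p).1 1 - Pi.single (allPairs p).2 1 : Fin 6 → ZMod 3) (allPairs j).1 -
      (Pi.single (allPairs p).1 1 - Pi.single (allPairs p).2 1 : Fin 6 → ZMod 3) (allPairs j).2 = 0 ↔
      j ∈ ({j | ∀ i, i = (allPairs j).1 ∨ i = (allPairs j).2 →
        i ≠ (allPairs p).1 ∧ i ≠ (allPairs p).2} : Finset (Fin 15))) ∧
    ((Pi.single (allPairs p).1 1 - Pi.single (allPairs p).2 1 : Fin 6 → ZMod 3) (allPairs j).1 +
      (Pi.single (allPairs p).1 1 - Pi.single (allPairs p).2 1 : Fin 6 → ZMod 3) (allPairs j).2 = 0 ↔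
      j = p ∨ j ∈ ({j | ∀ i, i = (allPairs j).1 ∨ i = (allPairs j).2 →
        i ≠ (allPairs p).1 ∧ i ≠ (allPairs p).2} : Finset (Fin 15))) ∧
    #{j | ∀ i, i = (allPairs j).1 ∨ i = (allPairs j).2 →
        i ≠ (allPairs p).1 ∧ i ≠ (allPairs p).2} = 6 := by
  decide +kernel

theorem exists_eq_of_card_le {α β : Type*} [Fintype α] [Fintype β] {P : β → Prop} [DecidablePred P]
    {g : α → β} (hg : Function.Injective g) (hc : #{b | P b} ≤ #{a | P (g a)}) (b : β) (hb : P b) :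
    ∃ a, g a = b := by
  classical
  have hsub : ({a | P (g a)} : Finset α).image g ⊆ ({b | P b} : Finset β) := fun v hv => by
    obtain ⟨q, hq, rfl⟩ := mem_image.mp hv
    simpa using hq
  have heq := eq_of_subset_of_card_le hsub (by rwa [card_image_of_injective _ hg])
  have : b ∈ ({b | P b} : Finset β) := by simpa using hb
  rw [← heq] at this
  obtain ⟨a, -, ha⟩ := mem_image.mp this
  exact ⟨a, ha⟩

namespace Array56

variable {V : Type*} [AddCommGroup V] [Module (ZMod 3) V] [Fintype V] {d : V → ℕ} {s : V}

set_option maxRecDepth 8000 in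
/-- Every vector of the connection set lies on a line in the connection set. -/
theorem exists_mem_triples (h : TranslationDistance ⟨[56, 42, 20], [1, 6, 28]⟩ d) (hs : d s = 1) :
    ∃ u ∈ triples d s, d (s - u) = 1 := by
  by_contra! hno
  have hs0 : s ≠ 0 := by
    rintro rfl
    rw [h.map_zero] at hs
    omega
  obtain ⟨x, hx, ⟨a, ha⟩, hrel⟩ := exists_sum_eq_smul hs0 (T := triples d s)
    (by
      have := card_triples h hs
      simp [IntersectionArray.stepNum, IntersectionArray.aNum, IntersectionArray.bNum,
        IntersectionArray.cNum] at this
      omega)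
    (fun u hu => neg_sub_mem_triples h hu) (fun u hu => ne_neg_sub_of_mem_triples h hu)
    (card_eq h).1 (by
      -- A relation that misses index i makes s and the other five vectors dependent, so they lie in
      -- a hyperplane.
      intro x hx c k hck hc0 i hi
      obtain ⟨f, hf, hfx⟩ := exists_dual_of_relation (x := Fin.cons s (x ∘ i.succAbove))
        (g := Fin.cons (-k) (c ∘ i.succAbove)) (card_eq h).1 (by
          intro h0
          refine hc0 (funext fun j => ?_)
          by_cases hj : j = i
          · rw [hj, hi]
            rfl
          · obtain ⟨l, rfl⟩ := Fin.exists_succAbove_eq hj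
            have := congrFun h0 l.succ
            simpa using this) (by
          rw [Fin.sum_univ_succ]
          rw [Fin.sum_univ_succAbove _ i, hi, zero_smul, zero_add] at hck
          simp [hck])
      exact not_five_in_ker h hs hno (hx.comp Fin.succAbove_right_injective) hf
        (by simpa using hfx 0) fun j => by simpa using hfx j.succ)
  set H := cosetCount (fun v => d v = 1) s x with hH
  have hinj := coset_injective hs0 (x := x) (m := coef allPairs) (by
    rintro i j ⟨k, hk⟩
    by_contra hij
    obtain ⟨l, hl⟩ := coef_allPairs_sub i j hij
    exact hl (hrel _ k hk l))
  have hneg : ∀ c, H (-c) = H c := fun c => cosetCount_neg (fun v => by rw [h.neg]) c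
  have hne : ∀ j, (allPairs j).1 ≠ (allPairs j).2 := by decide
  have hcard : #{q : _ × ZMod 3 | d (q.2 • s + ∑ l, coef allPairs q.1 l • x l) = 1} ≤
      #{v | d v = 1} := by
    refine card_le_card_of_injOn _ (fun q hq => ?_) hinj.injOn
    simp only [coe_filter, Set.mem_ofPred_eq, mem_univ, true_and] at hq ⊢
    exact hq
  rw [(card_eq h).2.1] at hcard
  have h0 : 2 ≤ H 0 := two_le_cosetCount_zero h hs
  have h1 : ∀ i, 2 ≤ H (Pi.single i 1) := fun i => two_le_cosetCount_single hx i
  have h2 : ∀ j, 1 ≤ H (Pi.single (allPairs j).1 1 + Pi.single (allPairs j).2 1) +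
      H (Pi.single (allPairs j).1 1 - Pi.single (allPairs j).2 1) := fun j =>
    one_le_cosetCount_pair h hs hno hx (hne j)
  -- The lower bounds add up to 2 + 4·6 + 2·15 = 56, the size of the connection set. So they are
  -- attained, and the cosets contain the whole connection set.
  have htot : H 0 + 2 * ∑ i, H (Pi.single i 1) +
      2 * ∑ j, (H (Pi.single (allPairs j).1 1 + Pi.single (allPairs j).2 1) +
        H (Pi.single (allPairs j).1 1 - Pi.single (allPairs j).2 1)) =
      #{q : _ × ZMod 3 | d (q.2 • s + ∑ l, coef allPairs q.1 l • x l) = 1} := by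
    rw [← sum_coef allPairs H hneg, hH, sum_cosetCount]
  have hs1 : ∑ _i : Fin 6, 2 ≤ ∑ i : Fin 6, H (Pi.single i 1) := sum_le_sum fun i _ => h1 i
  have hs2 : ∑ _j : Fin 15, 1 ≤ ∑ j, (H (Pi.single (allPairs j).1 1 + Pi.single (allPairs j).2 1) +
    H (Pi.single (allPairs j).1 1 - Pi.single (allPairs j).2 1)) := sum_le_sum fun j _ => h2 j
  have e1 : ∀ i, H (Pi.single i 1) = 2 := fun i => by
    refine (((sum_eq_sum_iff_of_le fun i _ => h1 i).mp (le_antisymm hs1 ?_)) i (mem_univ _)).symm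
    simp only [sum_const, card_univ, Fintype.card_fin, smul_eq_mul] at hs2 ⊢
    omega
  have e2 : ∀ j, H (Pi.single (allPairs j).1 1 + Pi.single (allPairs j).2 1) +
      H (Pi.single (allPairs j).1 1 - Pi.single (allPairs j).2 1) = 1 := fun j => by
    refine (((sum_eq_sum_iff_of_le fun j _ => h2 j).mp (le_antisymm hs2 ?_)) j (mem_univ _)).symm
    simp only [sum_const, card_univ, Fintype.card_fin, smul_eq_mul] at hs1 ⊢
    omega
  have e0 : H 0 = 2 ∧
      #{q : _ × ZMod 3 | d (q.2 • s + ∑ l, coef allPairs q.1 l • x l) = 1} = 56 := by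
    simp only [sum_const, card_univ, Fintype.card_fin, smul_eq_mul] at hs1 hs2
    omega
  have hsurj : ∀ v, d v = 1 → ∃ q : _ × ZMod 3, q.2 • s + ∑ l, coef allPairs q.1 l • x l = v := by
    refine exists_eq_of_card_le (P := fun v => d v = 1) hinj ?_
    rw [e0.2, (card_eq h).2.1]
  -- The functional vanishes at s and takes the values y at the six vectors, so it is constant on
  -- cosets and its zeros are counted coset by coset.
  have hker : ∀ y : Fin 6 → ZMod 3, y ≠ 0 → ∑ i, y i = 0 → ∃ z, (z = 32 ∨ z = 20 ∨ z = 14) ∧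
      z = 2 + 2 * ∑ i, (if y i = 0 then 2 else 0) +
        2 * ∑ j, ((if y (allPairs j).1 + y (allPairs j).2 = 0 then
          H (Pi.single (allPairs j).1 1 + Pi.single (allPairs j).2 1) else 0) +
          if y (allPairs j).1 - y (allPairs j).2 = 0 then
          H (Pi.single (allPairs j).1 1 - Pi.single (allPairs j).2 1) else 0) := by
    intro y hy0 hy
    obtain ⟨f, hfs, hfx⟩ := exists_dual_of_sum_eq_zero hs0 ha hrel (y := y) (e := 0) (by simpa using hy)
    have hf : f ≠ 0 := by
      rintro rfl
      exact hy0 (funext fun i => (hfx i).symm)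
    refine ⟨_, card_filter_ker h hf, ?_⟩
    have hsum := sum_coef allPairs (fun c => if ∑ l, c l * y l = 0 then H c else 0) fun c => by
      simp only [Pi.neg_apply, neg_mul, sum_neg_distrib, neg_eq_zero, hneg]
    have hz : #{v | d v = 1 ∧ f v = 0} =
        ∑ i, (if ∑ l, coef allPairs i l * y l = 0 then H (coef allPairs i) else 0) := by
      have hv : ∀ q : (Unit ⊕ (Fin 6 × Bool) ⊕ (Fin 15 × Bool × Bool)) × ZMod 3,
          f (q.2 • s + ∑ l, coef allPairs q.1 l • x l) = ∑ l, coef allPairs q.1 l * y l := fun q => by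
        simp [hfs, hfx]
      have : #{v | d v = 1 ∧ f v = 0} = #{q : _ × ZMod 3 |
          d (q.2 • s + ∑ l, coef allPairs q.1 l • x l) = 1 ∧ ∑ l, coef allPairs q.1 l * y l = 0} := by
        symm
        refine card_bij (fun q _ => q.2 • s + ∑ l, coef allPairs q.1 l • x l) (fun q hq => ?_)
          (fun q _ q' _ hqq => hinj hqq) fun v hv' => ?_
        · simp only [mem_filter, mem_univ, true_and] at hq ⊢
          exact ⟨hq.1, by rw [hv, hq.2]⟩
        · simp only [mem_filter, mem_univ, true_and] at hv'
          obtain ⟨q, rfl⟩ := hsurj v hv'.1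
          refine ⟨q, ?_, rfl⟩
          simp only [mem_filter, mem_univ, true_and]
          exact ⟨hv'.1, by rw [← hv, hv'.2]⟩
      rw [this, card_filter, Fintype.sum_prod_type]
      refine sum_congr rfl fun i _ => ?_
      split_ifs with hi
      · simp only [hi, and_true, hH, cosetCount, card_filter]
      · simp only [hi, and_false, if_false, sum_const_zero]
    rw [hz, hsum]
    simp [Pi.single_apply, add_mul, sub_mul, sum_add_distrib, sum_sub_distrib, e0.1, e1]
  -- For y = e_i - e_j the count of zeros is 2 + 16 + 2(6 + H) with H = 0 or 1, and only 32 is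
  -- allowed.
  have hplus : ∀ p, H (Pi.single (allPairs p).1 1 + Pi.single (allPairs p).2 1) = 1 := by
    intro p
    obtain ⟨z, hz, hzeq⟩ := hker (Pi.single (allPairs p).1 1 - Pi.single (allPairs p).2 1)
      (by
        revert p
        decide) (by simp)
    have hcoord : ∀ p : Fin 15, ∑ i, (if (Pi.single (allPairs p).1 1 - Pi.single (allPairs p).2 1 :
        Fin 6 → ZMod 3) i = 0 then 2 else 0) = 8 := by decide +kernel
    rw [hcoord, sum_congr rfl (g := fun j => (if j ∈ ({j | ∀ i, i = (allPairs j).1 ∨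
        i = (allPairs j).2 → i ≠ (allPairs p).1 ∧ i ≠ (allPairs p).2} : Finset (Fin 15)) then 1 else 0) +
        if j = p then H (Pi.single (allPairs p).1 1 + Pi.single (allPairs p).2 1) else 0)
      fun j _ => ?_, sum_add_distrib, sum_boole, sum_ite_eq' univ, if_pos (mem_univ _)] at hzeq
    · have h6 := (allPairs_difference p p).2.2
      have := e2 p
      simp only [filter_mem_eq_inter, univ_inter, Nat.cast_id] at hzeq
      omega
    · obtain ⟨hm, hp, -⟩ := allPairs_difference p j
      simp only [hm, hp]
      by_cases hjp : j = p
      · subst hjp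
        simp
      · simp only [hjp, false_or, if_false, add_zero]
        split_ifs
        · exact e2 j
        · rfl
  -- For y = (1, ..., 1) only the coset of the origin contributes, and two zeros are too few.
  obtain ⟨z, hz, hzeq⟩ := hker 1 (by decide) (by decide)
  have hminus : ∀ p, H (Pi.single (allPairs p).1 1 - Pi.single (allPairs p).2 1) = 0 := fun p => by
    have := e2 p
    have := hplus p
    omega
  have hone : (1 : ZMod 3) + 1 ≠ 0 := by decide
  simp [hminus, hone] at hzeq
  omega

end Array56

theorem noTranslationDistance_56_42_20 : NoTranslationDistance ⟨[56, 42, 20], [1, 6, 28]⟩ := by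
  intro p hp V _ _ hV d h
  obtain rfl : p = 3 := TranslationDistance.eq_of_card_eq_prime_pow hp Nat.prime_three
    (by norm_num) hV (Array56.card_eq h).1
  let _ : Module (ZMod 3) V := AddCommGroup.zmodModule hV
  refine Array56.not_forall_exists_line h fun s hs => ?_
  obtain ⟨u, hu, hsu⟩ := Array56.exists_mem_triples h hs
  have hu' := mem_triples.mp hu
  refine ⟨(LinearMap.toSpanSingleton (ZMod 3) V s).coprod (LinearMap.toSpanSingleton (ZMod 3) V u),
    fun q hq => ?_, (1, 0), by simp⟩
  have hcases : ∀ q : ZMod 3 × ZMod 3, q ≠ 0 → q = (1, 0) ∨ q = (-1, 0) ∨ q = (0, 1) ∨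
    q = (0, -1) ∨ q = (1, 1) ∨ q = (-1, -1) ∨ q = (1, -1) ∨ q = (-1, 1) := by decide
  have hd : d (-s - u) = 1 := by rw [← neg_add', h.neg, hu'.2.1]
  have hd' : d (-s + u) = 1 := by rw [← h.neg, ← hsu]; congr 1; abel
  rcases hcases q hq with rfl | rfl | rfl | rfl | rfl | rfl | rfl | rfl <;>
    simp [hs, h.neg, hu'.1, hu'.2.1, hd, hd', ← sub_eq_add_neg, hsu]

/-! ### The array {140,126,20,1;1,10,126,140}: a certified search for labellings -/

namespace Array140

/-- The vector of ternary digits of `n`. -/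
def vec (n : ℕ) : Fin 6 → ZMod 3 := fun i => ((n / 3 ^ (i : ℕ) : ℕ) : ZMod 3)

/-- The ternary digits of `n`, moved to base `32`. -/
def pack (n : ℕ) : ℕ :=
  n % 3 + 32 * (n / 3 % 3) + 1024 * (n / 9 % 3) + 32768 * (n / 27 % 3) + 1048576 * (n / 81 % 3) +
    33554432 * (n / 243 % 3)

/-- The ternary digits of `n` in the opposite order, moved to base `32`. -/
def packRev (n : ℕ) : ℕ :=
  33554432 * (n % 3) + 1048576 * (n / 3 % 3) + 32768 * (n / 9 % 3) + 1024 * (n / 27 % 3) +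
    32 * (n / 81 % 3) + n / 243 % 3

/-- The middle digit of the product is a scalar product. -/
def dotN (a b : ℕ) : ℕ := a * b / 33554432 % 32 % 3

/-- Scalar products of ternary vectors through one integer multiplication: digits of the product in
base 32 are at most 6·4 = 24, so there are no carries. -/
theorem middle_digit {a₀ a₁ a₂ a₃ a₄ a₅ b₀ b₁ b₂ b₃ b₄ b₅ : ℕ} (h : ∀ a ∈ [a₀, a₁, a₂, a₃, a₄, a₅],
    a < 3) (h' : ∀ b ∈ [b₀, b₁, b₂, b₃, b₄, b₅], b < 3) :
    (a₀ + 32 * a₁ + 1024 * a₂ + 32768 * a₃ + 1048576 * a₄ + 33554432 * a₅) *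
      (33554432 * b₀ + 1048576 * b₁ + 32768 * b₂ + 1024 * b₃ + 32 * b₄ + b₅) / 33554432 % 32 =
      a₀ * b₀ + a₁ * b₁ + a₂ * b₂ + a₃ * b₃ + a₄ * b₄ + a₅ * b₅ := by
  have hm : ∀ {a b : ℕ}, a < 3 → b < 3 → a * b ≤ 4 := fun ha hb =>
    Nat.mul_le_mul (Nat.le_of_lt_succ ha) (Nat.le_of_lt_succ hb)
  simp only [List.mem_cons, List.not_mem_nil, or_false, forall_eq_or_imp, forall_eq] at h h'
  obtain ⟨h0, h1, h2, h3, h4, h5⟩ := h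
  obtain ⟨k0, k1, k2, k3, k4, k5⟩ := h'
  have e : (a₀ + 32 * a₁ + 1024 * a₂ + 32768 * a₃ + 1048576 * a₄ + 33554432 * a₅) *
      (33554432 * b₀ + 1048576 * b₁ + 32768 * b₂ + 1024 * b₃ + 32 * b₄ + b₅) =
      (a₀ * b₅ + 32 * (a₀ * b₄ + a₁ * b₅) + 1024 * (a₀ * b₃ + a₁ * b₄ + a₂ * b₅) +
        32768 * (a₀ * b₂ + a₁ * b₃ + a₂ * b₄ + a₃ * b₅) +
        1048576 * (a₀ * b₁ + a₁ * b₂ + a₂ * b₃ + a₃ * b₄ + a₄ * b₅)) +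
      33554432 * ((a₀ * b₀ + a₁ * b₁ + a₂ * b₂ + a₃ * b₃ + a₄ * b₄ + a₅ * b₅) +
        32 * (a₁ * b₀ + a₂ * b₁ + a₃ * b₂ + a₄ * b₃ + a₅ * b₄ +
          32 * (a₂ * b₀ + a₃ * b₁ + a₄ * b₂ + a₅ * b₃) + 1024 * (a₃ * b₀ + a₄ * b₁ + a₅ * b₂) +
          32768 * (a₄ * b₀ + a₅ * b₁) + 1048576 * (a₅ * b₀))) := by ring
  have l00 := hm h0 k0; have l11 := hm h1 k1; have l22 := hm h2 k2
  have l33 := hm h3 k3; have l44 := hm h4 k4; have l55 := hm h5 k5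
  have l05 := hm h0 k5; have l04 := hm h0 k4; have l15 := hm h1 k5
  have l03 := hm h0 k3; have l14 := hm h1 k4; have l25 := hm h2 k5
  have l02 := hm h0 k2; have l13 := hm h1 k3; have l24 := hm h2 k4; have l35 := hm h3 k5
  have l01 := hm h0 k1; have l12 := hm h1 k2; have l23 := hm h2 k3; have l34 := hm h3 k4
  have l45 := hm h4 k5
  rw [e, Nat.add_mul_div_left _ _ (by norm_num), Nat.div_eq_of_lt (by omega), zero_add,
    Nat.add_mul_mod_self_left, Nat.mod_eq_of_lt (by omega)]

theorem dotN_pack (c y : ℕ) : ((dotN (pack c) (packRev y) : ℕ) : ZMod 3) = vec c ⬝ᵥ vec y := by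
  rw [dotN, pack, packRev, middle_digit (by simp; omega) (by simp; omega), ZMod.natCast_mod]
  simp [vec, dotProduct, Fin.sum_univ_six]

theorem dotN_lt (a b : ℕ) : dotN a b < 3 := Nat.mod_lt _ (by norm_num)

theorem dotN_pack_eq_zero (c y : ℕ) : dotN (pack c) (packRev y) = 0 ↔ vec c ⬝ᵥ vec y = 0 := by
  rw [← dotN_pack, ZMod.natCast_eq_zero_iff]
  have := dotN_lt (pack c) (packRev y)
  omega

/-- The contribution of a form to the number of zeros: the forms flagged `true` stand for two
points, and their label is the missing value. -/
def term (neg : Bool) (a : ZMod 3) : ℕ := if a = 0 then (bif neg then 0 else 1) else bif neg then 1 else 0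

section Sums

variable (κ : (Fin 6 → ZMod 3) → ZMod 3) (F : List (ℕ × Bool))

/-- The number of zeros. -/
def zeros (η : Fin 6 → ZMod 3) : ℕ :=
  (F.map fun v => term v.2 (κ (vec v.1) + vec v.1 ⬝ᵥ η)).sum

/-- The labels of the first forms. -/
def Agree : List (ℕ × Bool) → List ℕ → Prop
  | v :: F, k :: ks => (k : ZMod 3) = κ (vec v.1) ∧ Agree F ks
  | _, _ => True

/-- The forms in packed shape. -/
def packed : List (ℕ × Bool) := F.map fun v => (pack v.1, v.2)

end Sums

/-- `y` and `z` vanish on a form. -/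
def perp (y z a : ℕ) : Bool := Nat.beq (dotN a y + dotN a z) 0

/-- The contribution of a form that is not constant on an affine subspace of size `3 * q`. -/
def mean (q : ℕ) (neg : Bool) : ℕ := bif neg then 2 * q else q

/-- The known part of the sum of the numbers of zeros over an affine subspace of size `3 * q`. -/
def cutLow (q y z e : ℕ) : List (ℕ × Bool) → List ℕ → ℕ
  | [], _ => 0
  | v :: F, [] => (bif perp y z v.1 then 0 else mean q v.2) + cutLow q y z e F []
  | v :: F, k :: ks => (bif perp y z v.1 then
      (bif Nat.beq ((k + dotN v.1 e) % 3) 0 then (bif v.2 then 0 else 3 * q)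
        else bif v.2 then 3 * q else 0) else mean q v.2) + cutLow q y z e F ks

/-- The number of forms without label that are constant on the affine subspace. -/
def cutFree (y z : ℕ) : List (ℕ × Bool) → List ℕ → ℕ
  | [], _ => 0
  | v :: F, [] => (bif perp y z v.1 then 1 else 0) + cutFree y z F []
  | _ :: F, _ :: ks => cutFree y z F ks

/-- No admissible sum is possible. -/
def cutTest (q low free : ℕ) : Bool :=
  (List.range (free + 1)).all fun j => !(Nat.ble (48 * q) (low + 3 * q * j) &&
    Nat.ble (low + 3 * q * j) (75 * q) && Nat.beq ((low + 3 * q * j - 48 * q) % 9) 0)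

theorem perp_iff (y z c : ℕ) : perp (packRev y) (packRev z) (pack c) = true ↔
    vec c ⬝ᵥ vec y = 0 ∧ vec c ⬝ᵥ vec z = 0 := by
  rw [perp, Nat.beq_eq, Nat.add_eq_zero_iff, dotN_pack_eq_zero, dotN_pack_eq_zero]

theorem label_eq_zero_iff {κ : (Fin 6 → ZMod 3) → ZMod 3} {k c e : ℕ} (hk : (k : ZMod 3) = κ (vec c)) :
    Nat.beq ((k + dotN (pack c) (packRev e)) % 3) 0 = true ↔ κ (vec c) + vec c ⬝ᵥ vec e = 0 := by
  rw [Nat.beq_eq, ← hk, ← dotN_pack, ← Nat.cast_add, ZMod.natCast_eq_zero_iff]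
  omega

/-- Here j counts the zeros from those forms that are constant on the affine subspace but have no
label yet. All other contributions are known, since a nonconstant form takes each value equally
often. -/
theorem exists_sum_eq_cutLow {κ : (Fin 6 → ZMod 3) → ZMod 3} (q y z e : ℕ) :
    ∀ (F : List (ℕ × Bool)) (ks : List ℕ), Agree κ F ks →
    ∃ j ≤ cutFree (packRev y) (packRev z) (packed F) ks,
      (F.map fun v => if vec v.1 ⬝ᵥ vec y = 0 ∧ vec v.1 ⬝ᵥ vec z = 0 then
        3 * q * term v.2 (κ (vec v.1) + vec v.1 ⬝ᵥ vec e) else mean q v.2).sum =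
      cutLow q (packRev y) (packRev z) (packRev e) (packed F) ks + 3 * q * j
  | [], _, _ => ⟨0, Nat.zero_le _, rfl⟩
  | v :: F, [], _ => by
    obtain ⟨j, hj, h⟩ := exists_sum_eq_cutLow q y z e F [] (by cases F <;> trivial)
    have hp := perp_iff y z v.1
    simp only [packed, List.map_cons, List.sum_cons, cutLow, cutFree] at h hj ⊢
    rw [h]
    by_cases hv : vec v.1 ⬝ᵥ vec y = 0 ∧ vec v.1 ⬝ᵥ vec z = 0
    · rw [if_pos hv, hp.mpr hv]
      refine ⟨j + term v.2 (κ (vec v.1) + vec v.1 ⬝ᵥ vec e), ?_, ?_⟩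
      · have : term v.2 (κ (vec v.1) + vec v.1 ⬝ᵥ vec e) ≤ 1 := by
          unfold term
          split_ifs <;> cases v.2 <;> simp
        simp only [cond_true]
        omega
      · simp only [cond_true]
        ring
    · rw [if_neg hv, Bool.eq_false_iff.mpr (fun h => hv (hp.mp h))]
      refine ⟨j, ?_, ?_⟩
      · simp only [cond_false]
        omega
      · simp only [cond_false]
        ring
  | v :: F, k :: ks, hk => by
    obtain ⟨j, hj, h⟩ := exists_sum_eq_cutLow q y z e F ks hk.2
    have hp := perp_iff y z v.1
    have hl := label_eq_zero_iff (e := e) hk.1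
    refine ⟨j, hj, ?_⟩
    simp only [packed, List.map_cons, List.sum_cons, cutLow] at h ⊢
    rw [h]
    by_cases hv : vec v.1 ⬝ᵥ vec y = 0 ∧ vec v.1 ⬝ᵥ vec z = 0
    · rw [if_pos hv, hp.mpr hv]
      by_cases h0 : κ (vec v.1) + vec v.1 ⬝ᵥ vec e = 0
      · rw [hl.mpr h0, term, if_pos h0]
        cases v.2 <;> simp [add_assoc]
      · rw [Bool.eq_false_iff.mpr (fun h => h0 (hl.mp h)), term, if_neg h0]
        cases v.2 <;> simp [add_assoc]
    · rw [if_neg hv, Bool.eq_false_iff.mpr (fun h => hv (hp.mp h))]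
      simp only [cond_false]
      ring

theorem sum_term_line : ∀ (neg : Bool) (a b : ZMod 3), term neg a + term neg (a + b) +
    term neg (a + 2 * b) = if b = 0 then 3 * term neg a else mean 1 neg := by
  decide

theorem sum_term_plane : ∀ (neg : Bool) (a b b' : ZMod 3),
    (term neg a + term neg (a + b) + term neg (a + 2 * b)) +
    (term neg (a + b') + term neg (a + b' + b) + term neg (a + b' + 2 * b)) +
    (term neg (a + 2 * b') + term neg (a + 2 * b' + b) + term neg (a + 2 * b' + 2 * b)) =
    if b = 0 ∧ b' = 0 then 9 * term neg a else mean 3 neg := by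
  decide

/-- The sign of a form. -/
def sgn (neg : Bool) : ZMod 3 := bif neg then -1 else 1

/-- Modulo 3 the contribution of a form with value x is 1 - x² or x², so the difference of the
contributions at k + a and k - a is bilinear in k and a. -/
theorem term_add_sgn_mul : ∀ (neg : Bool) (k a : ZMod 3),
    (term neg (k + a) : ZMod 3) + sgn neg * a * k = term neg (k + -a) := by
  decide

theorem sum_map_ite {α : Type*} (p : α → Prop) [DecidablePred p] (f g : α → ℕ) (l : List α) :
    (l.map fun v => if p v then 3 * f v else g v).sum =
      3 * (l.map fun v => if p v then f v else 0).sum + (l.map fun v => if p v then 0 else g v).sum := by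
  induction l with
  | nil => rfl
  | cons v l ih =>
    simp only [List.map_cons, List.sum_cons, ih]
    split_ifs <;> ring

section Cuts

variable {κ : (Fin 6 → ZMod 3) → ZMod 3} {F : List (ℕ × Bool)}

theorem sum_zeros_line (η y : Fin 6 → ZMod 3) :
    zeros κ F η + zeros κ F (η + y) + zeros κ F (η + 2 • y) = (F.map fun v =>
      if vec v.1 ⬝ᵥ y = 0 then 3 * term v.2 (κ (vec v.1) + vec v.1 ⬝ᵥ η) else mean 1 v.2).sum := by
  simp only [zeros, ← List.sum_map_add]
  refine congrArg List.sum (List.map_congr_left fun v _ => ?_)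
  rw [← sum_term_line, dotProduct_add, dotProduct_add, dotProduct_smul, ← add_assoc, ← add_assoc,
    nsmul_eq_mul, Nat.cast_ofNat]

theorem sum_zeros_plane (η y z : Fin 6 → ZMod 3) :
    (zeros κ F η + zeros κ F (η + y) + zeros κ F (η + 2 • y)) +
    (zeros κ F (η + z) + zeros κ F (η + z + y) + zeros κ F (η + z + 2 • y)) +
    (zeros κ F (η + 2 • z) + zeros κ F (η + 2 • z + y) + zeros κ F (η + 2 • z + 2 • y)) =
    (F.map fun v => if vec v.1 ⬝ᵥ y = 0 ∧ vec v.1 ⬝ᵥ z = 0 then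
      9 * term v.2 (κ (vec v.1) + vec v.1 ⬝ᵥ η) else mean 3 v.2).sum := by
  simp only [zeros, ← List.sum_map_add]
  refine congrArg List.sum (List.map_congr_left fun v _ => ?_)
  rw [← sum_term_plane]
  simp only [dotProduct_add, dotProduct_smul, ← add_assoc]
  simp only [nsmul_eq_mul, Nat.cast_ofNat]

/-- Nine numbers equal to 16 or 25 have a sum between 144 and 225, congruent to 144 modulo 9. The
actual j passes these conditions. -/
theorem not_cutTest_plane
    (hz : ∀ η : Fin 6 → ZMod 3, ∑ i, η i = 0 → zeros κ F η = 16 ∨ zeros κ F η = 25)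
    {y z e : ℕ} {ks : List ℕ} (hy : ∑ i, vec y i = 0) (hz' : ∑ i, vec z i = 0)
    (he : ∑ i, vec e i = 0) (hk : Agree κ F ks) :
    cutTest 3 (cutLow 3 (packRev y) (packRev z) (packRev e) (packed F) ks)
      (cutFree (packRev y) (packRev z) (packed F) ks) = false := by
  obtain ⟨j, hj, h⟩ := exists_sum_eq_cutLow (κ := κ) 3 y z e F ks hk
  have hs := sum_zeros_plane (κ := κ) (F := F) (vec e) (vec y) (vec z)
  have hsum : ∀ i j : ℕ, ∑ k, (vec e + i • vec z + j • vec y) k = 0 := fun i j => by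
    simp [sum_add_distrib, ← mul_sum, hy, hz', he]
  have g := fun i j => hz _ (hsum i j)
  have g00 := g 0 0; have g01 := g 0 1; have g02 := g 0 2
  have g10 := g 1 0; have g11 := g 1 1; have g12 := g 1 2
  have g20 := g 2 0; have g21 := g 2 1; have g22 := g 2 2
  simp only [zero_smul, add_zero, one_smul] at g00 g01 g02 g10 g11 g12 g20 g21 g22
  rw [show 3 * 3 = 9 from rfl] at h
  rw [h] at hs
  rw [cutTest, List.all_eq_false]
  refine ⟨j, List.mem_range.mpr (by omega), ?_⟩
  simp only [Bool.not_eq_true', Bool.not_eq_false, Bool.and_eq_true, Nat.ble_eq, Nat.beq_eq]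
  omega

theorem not_cutTest_line
    (hz : ∀ η : Fin 6 → ZMod 3, ∑ i, η i = 0 → zeros κ F η = 16 ∨ zeros κ F η = 25)
    {y e : ℕ} {ks : List ℕ} (hy : ∑ i, vec y i = 0)
    (he : ∑ i, vec e i = 0) (hk : Agree κ F ks) :
    cutTest 1 (cutLow 1 (packRev y) (packRev 0) (packRev e) (packed F) ks)
      (cutFree (packRev y) (packRev 0) (packed F) ks) = false := by
  obtain ⟨j, hj, h⟩ := exists_sum_eq_cutLow (κ := κ) 1 y 0 e F ks hk
  have hs := sum_zeros_line (κ := κ) (F := F) (vec e) (vec y)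
  have h0 : vec 0 = 0 := by
    ext i
    simp [vec]
  simp only [h0, dotProduct_zero, and_true] at h
  have hsum : ∀ j : ℕ, ∑ k, (vec e + j • vec y) k = 0 := fun j => by
    simp [sum_add_distrib, ← mul_sum, hy, he]
  have g := fun j => hz _ (hsum j)
  have g0 := g 0; have g1 := g 1; have g2 := g 2
  simp only [zero_smul, add_zero, one_smul] at g0 g1 g2
  simp only [mul_one] at h
  rw [h] at hs
  rw [cutTest, List.all_eq_false]
  refine ⟨j, List.mem_range.mpr (by omega), ?_⟩
  simp only [Bool.not_eq_true', Bool.not_eq_false, Bool.and_eq_true, Nat.ble_eq, Nat.beq_eq]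
  omega

/-- On a line of direction y the zeros add up to 3 modulo 9, so the contribution of the forms
vanishing at y is determined modulo 3. Comparing the lines through ζ and -ζ cancels the quadratic
part and leaves a linear relation between labels. -/
theorem sum_sgn_mul
    (hz : ∀ η : Fin 6 → ZMod 3, ∑ i, η i = 0 → zeros κ F η = 16 ∨ zeros κ F η = 25)
    {y ζ : Fin 6 → ZMod 3} (hy : ∑ i, y i = 0) (hζ : ∑ i, ζ i = 0) :
    (F.map fun v => if vec v.1 ⬝ᵥ y = 0 then sgn v.2 * (vec v.1 ⬝ᵥ ζ) * κ (vec v.1) else 0).sum = 0 := by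
  have key : ∀ η : Fin 6 → ZMod 3, ∑ i, η i = 0 → (3 * (F.map fun v => if vec v.1 ⬝ᵥ y = 0 then
      term v.2 (κ (vec v.1) + vec v.1 ⬝ᵥ η) else 0).sum +
      (F.map fun v => if vec v.1 ⬝ᵥ y = 0 then 0 else mean 1 v.2).sum) % 9 = 3 := fun η hη => by
    have hs := sum_zeros_line (κ := κ) (F := F) η y
    rw [sum_map_ite] at hs
    have hsum : ∀ j : ℕ, ∑ k, (η + j • y) k = 0 := fun j => by
      simp [sum_add_distrib, ← mul_sum, hy, hη]
    have g0 := hz _ (hsum 0); have g1 := hz _ (hsum 1); have g2 := hz _ (hsum 2)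
    simp only [zero_smul, add_zero, one_smul] at g0 g1 g2
    omega
  have h1 := key ζ hζ
  have h2 := key (-ζ) (by simp [hζ])
  have h3 := (ZMod.natCast_eq_natCast_iff' _ _ 3).mpr (show
    (F.map fun v => if vec v.1 ⬝ᵥ y = 0 then term v.2 (κ (vec v.1) + vec v.1 ⬝ᵥ ζ) else 0).sum % 3 =
    (F.map fun v => if vec v.1 ⬝ᵥ y = 0 then term v.2 (κ (vec v.1) + vec v.1 ⬝ᵥ -ζ) else 0).sum % 3
    by omega)
  rw [Nat.cast_list_sum, Nat.cast_list_sum, List.map_map, List.map_map] at h3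
  rw [← add_eq_left, ← List.sum_map_add, h3]
  refine congrArg List.sum (List.map_congr_left fun v _ => ?_)
  simp only [Function.comp_apply]
  split_ifs
  · rw [dotProduct_neg, term_add_sgn_mul]
  · simp

end Cuts

/-- The coefficient of a form in a linear relation between the labels. -/
def coefN (y ζ : ℕ) (v : ℕ × Bool) : ℕ :=
  bif Nat.beq (dotN v.1 y) 0 then (bif v.2 then 2 * dotN v.1 ζ else dotN v.1 ζ) else 0

/-- The part of a linear relation that involves the given labels. -/
def forceSum (y ζ : ℕ) : List (ℕ × Bool) → List ℕ → ℕ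
  | v :: F, k :: ks => coefN y ζ v * k + forceSum y ζ F ks
  | _, _ => 0

/-- The first form without label occurs with coefficient `-1`, and the others do not occur. -/
def forceTest (y ζ : ℕ) : List (ℕ × Bool) → List ℕ → Bool
  | [], _ => false
  | v :: F, [] => Nat.beq (coefN y ζ v % 3) 2 && F.all fun w => Nat.beq (coefN y ζ w % 3) 0
  | _ :: F, _ :: ks => forceTest y ζ F ks

/-- The coordinates of the vector add up to zero. -/
def sumTest (y : ℕ) : Bool := Nat.beq (dotN 34636833 (packRev y)) 0

theorem sum_vec_of_sumTest {y : ℕ} (hy : sumTest y = true) : ∑ i, vec y i = 0 := by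
  rw [sumTest, Nat.beq_eq, show 34636833 = pack 364 from rfl, dotN_pack_eq_zero] at hy
  rw [← hy, show vec 364 = 1 by decide, one_dotProduct]

theorem coefN_pack (y ζ : ℕ) (v : ℕ × Bool) :
    (coefN (packRev y) (packRev ζ) (pack v.1, v.2) : ZMod 3) =
      if vec v.1 ⬝ᵥ vec y = 0 then sgn v.2 * (vec v.1 ⬝ᵥ vec ζ) else 0 := by
  unfold coefN
  by_cases h : vec v.1 ⬝ᵥ vec y = 0
  · have h' := (Nat.beq_eq (x := _) (y := _)).mpr ((dotN_pack_eq_zero v.1 y).mpr h)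
    simp only [h', if_pos h, cond_true]
    cases v.2
    · simp [sgn, dotN_pack]
    · simp only [cond_true, Nat.cast_mul, dotN_pack, sgn]
      congr 1
  · have h' : Nat.beq (dotN (pack v.1) (packRev y)) 0 = false :=
      Bool.eq_false_iff.mpr fun h' => h ((dotN_pack_eq_zero v.1 y).mp (Nat.beq_eq.mp h'))
    simp only [h', if_neg h, cond_false, Nat.cast_zero]

/-- As the first unlabelled form has coefficient -1, its label equals the known part of the
relation; `m` carries the part already passed by the recursion. -/
theorem agree_append_forceSum {κ : (Fin 6 → ZMod 3) → ZMod 3} {y ζ : ℕ} : ∀ {F : List (ℕ × Bool)}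
    {ks : List ℕ} {m : ℕ}, Agree κ F ks →
    forceTest (packRev y) (packRev ζ) (packed F) ks = true →
    (m : ZMod 3) + (F.map fun v => (if vec v.1 ⬝ᵥ vec y = 0 then sgn v.2 * (vec v.1 ⬝ᵥ vec ζ) else 0) *
      κ (vec v.1)).sum = 0 →
    Agree κ F (ks ++ [(m + forceSum (packRev y) (packRev ζ) (packed F) ks) % 3])
  | [], _, _, _, h, _ => by cases h
  | v :: F, [], m, _, h, hs => by
    simp only [packed, List.map_cons, forceTest, Bool.and_eq_true, Nat.beq_eq, List.all_eq_true,
      List.mem_map, forall_exists_index, and_imp, forall_apply_eq_imp_iff₂] at h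
    have hF : (F.map fun v => (if vec v.1 ⬝ᵥ vec y = 0 then sgn v.2 * (vec v.1 ⬝ᵥ vec ζ) else 0) *
        κ (vec v.1)).sum = 0 := by
      refine List.sum_eq_zero fun a ha => ?_
      obtain ⟨w, hw, rfl⟩ := List.mem_map.mp ha
      have := h.2 w hw
      rw [← coefN_pack, (ZMod.natCast_eq_zero_iff _ _).mpr (Nat.dvd_of_mod_eq_zero this), zero_mul]
    have hv : (if vec v.1 ⬝ᵥ vec y = 0 then sgn v.2 * (vec v.1 ⬝ᵥ vec ζ) else 0) = (2 : ZMod 3) := by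
      rw [← coefN_pack, ← ZMod.natCast_mod, h.1]
      rfl
    rw [List.map_cons, List.sum_cons, hF, hv, add_zero] at hs
    refine ⟨?_, by cases F <;> trivial⟩
    rw [ZMod.natCast_mod, Nat.cast_add]
    change (m : ZMod 3) + ((0 : ℕ) : ZMod 3) = _
    rw [Nat.cast_zero, add_zero, eq_neg_of_add_eq_zero_left hs]
    generalize κ (vec v.1) = k
    revert k
    decide
  | v :: F, k :: ks, m, hk, h, hs => by
    refine ⟨hk.1, ?_⟩
    change Agree κ F (ks ++ _)
    have := agree_append_forceSum (m := m + coefN (packRev y) (packRev ζ) (pack v.1, v.2) * k)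
      hk.2 h ?_
    · simpa only [packed, List.map_cons, forceSum, ← add_assoc] using this
    · rw [List.map_cons, List.sum_cons, ← coefN_pack, ← add_assoc] at hs
      rw [Nat.cast_add, Nat.cast_mul, hk.1, hs]

/-- Certificates for a search through the labels. -/
inductive SearchTree
  | leaf
  | cut (y z e : ℕ)
  | force (t : SearchTree)
  | branch (t₀ t₁ t₂ : SearchTree)

/-- The labels found so far are listed in reverse order; `rules` holds the linear relations that
determine the labels which are not branched on. -/
def check (goal : List ℕ → Bool) (P : List (ℕ × Bool)) :
    SearchTree → List (ℕ × ℕ) → List ℕ → Bool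
  | .leaf, _, ks => goal ks.reverse
  -- A second direction 0 marks a cut by an affine line; otherwise the cut uses an affine plane.
  | .cut y 0 e, _, ks => sumTest y && sumTest e &&
      cutTest 1 (cutLow 1 (packRev y) (packRev 0) (packRev e) P ks.reverse)
        (cutFree (packRev y) (packRev 0) P ks.reverse)
  | .cut y (z + 1) e, _, ks => sumTest y && sumTest (z + 1) && sumTest e &&
      cutTest 3 (cutLow 3 (packRev y) (packRev (z + 1)) (packRev e) P ks.reverse)
        (cutFree (packRev y) (packRev (z + 1)) P ks.reverse)
  | .force _, [], _ => false
  | .force t, r :: rs, ks => sumTest r.1 && sumTest r.2 &&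
      forceTest (packRev r.1) (packRev r.2) P ks.reverse &&
      match forceSum (packRev r.1) (packRev r.2) P ks.reverse % 3 with
        | 0 => check goal P t rs (0 :: ks)
        | 1 => check goal P t rs (1 :: ks)
        | _ => check goal P t rs (2 :: ks)
  | .branch t₀ t₁ t₂, rs, ks => check goal P t₀ rs.tail (0 :: ks) &&
      check goal P t₁ rs.tail (1 :: ks) && check goal P t₂ rs.tail (2 :: ks)

theorem exists_agree_append {κ : (Fin 6 → ZMod 3) → ZMod 3} : ∀ {F : List (ℕ × Bool)}
    {ks : List ℕ}, Agree κ F ks → ∃ k < 3, Agree κ F (ks ++ [k])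
  | [], _, _ => ⟨0, by norm_num, trivial⟩
  | v :: F, [], _ => ⟨(κ (vec v.1)).val, ZMod.val_lt _, ZMod.natCast_zmod_val _, by cases F <;> trivial⟩
  | v :: F, k :: ks, h => by
    obtain ⟨m, hm, h'⟩ := exists_agree_append h.2
    exact ⟨m, hm, h.1, h'⟩

/-- Soundness of the certificates: cuts cannot hold, forced labels are correct, one branch is the
true one, and so some leaf is reached whose labels are those of κ. -/
theorem exists_of_check {κ : (Fin 6 → ZMod 3) → ZMod 3} {F : List (ℕ × Bool)}
    (hz : ∀ η : Fin 6 → ZMod 3, ∑ i, η i = 0 → zeros κ F η = 16 ∨ zeros κ F η = 25)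
    {goal : List ℕ → Bool} : ∀ {t : SearchTree} {rs : List (ℕ × ℕ)} {ks : List ℕ},
    check goal (packed F) t rs ks = true → Agree κ F ks.reverse →
    ∃ l, Agree κ F l ∧ goal l = true
  | .leaf, _, ks, h, hk => ⟨_, hk, h⟩
  | .cut y 0 e, _, ks, h, hk => by
    simp only [check, Bool.and_eq_true] at h
    rw [not_cutTest_line hz (sum_vec_of_sumTest h.1.1) (sum_vec_of_sumTest h.1.2) hk] at h
    exact absurd h.2 (by simp)
  | .cut y (z + 1) e, _, ks, h, hk => by
    simp only [check, Bool.and_eq_true] at h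
    rw [not_cutTest_plane hz (sum_vec_of_sumTest h.1.1.1) (sum_vec_of_sumTest h.1.1.2)
      (sum_vec_of_sumTest h.1.2) hk] at h
    exact absurd h.2 (by simp)
  | .force _, [], _, h, _ => by cases h
  | .force t, r :: rs, ks, h, hk => by
    simp only [check, Bool.and_eq_true] at h
    have hs := sum_sgn_mul hz (sum_vec_of_sumTest h.1.1.1) (sum_vec_of_sumTest h.1.1.2)
    have ha := agree_append_forceSum (m := 0) hk h.1.2 (by
      rw [Nat.cast_zero, zero_add]
      refine Eq.trans ?_ hs
      refine congrArg List.sum (List.map_congr_left fun v _ => ?_)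
      rw [ite_mul, zero_mul])
    rw [zero_add] at ha
    have h2 := h.2
    have hlt := Nat.mod_lt (forceSum (packRev r.1) (packRev r.2) (packed F) ks.reverse)
      (show 3 > 0 by norm_num)
    generalize forceSum (packRev r.1) (packRev r.2) (packed F) ks.reverse % 3 = m at *
    rcases m with _ | _ | _ | m
    · exact exists_of_check hz h2 (by rwa [List.reverse_cons])
    · exact exists_of_check hz h2 (by rwa [List.reverse_cons])
    · exact exists_of_check hz h2 (by rwa [List.reverse_cons])
    · omega
  | .branch t₀ t₁ t₂, rs, ks, h, hk => by
    simp only [check, Bool.and_eq_true] at h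
    obtain ⟨k, hk3, ha⟩ := exists_agree_append hk
    rw [← List.reverse_cons] at ha
    rcases k with _ | _ | _ | k
    · exact exists_of_check hz h.1.1 ha
    · exact exists_of_check hz h.1.2 ha
    · exact exists_of_check hz h.2 ha
    · omega

end Array140

/-! ### Forms, relations and search trees -/

namespace Array140

/-- The forms with their flags, in the order of the search. -/
def forms : List (ℕ × Bool) :=
  [(117, false), (93, false), (318, false), (273, false), (426, false), (327, false),
  (255, false), (333, false), (210, false), (39, false), (156, false), (534, false), (279, false),
  (111, false), (588, false), (417, false), (525, false), (147, false), (3, true), (705, false),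
  (9, true), (714, false), (363, true), (711, false), (300, false), (570, false), (192, false),
  (306, false), (576, false), (198, false), (27, true), (66, false), (603, false), (657, false),
  (441, false), (675, false), (651, false), (687, false), (381, false), (387, false),
  (549, false), (225, false), (594, false), (219, false), (432, false), (543, false),
  (435, false), (597, false), (498, false), (81, true), (174, false), (243, true), (471, false),
  (633, false), (264, false), (237, false), (615, false), (561, false), (669, false),
  (102, false), (453, false), (48, false), (399, false)]

/-- The same forms in packed shape. -/
def packedForms : List (ℕ × Bool) :=
  [(1082368, false), (1049632, false), (33622048, false), (33587232, false), (35653664, false),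
  (34603040, false), (33555488, false), (34604032, false), (2132000, false), (33824, false),
  (1116192, false), (67143712, false), (33588224, false), (1081376, false), (68159520, false),
  (35652640, false), (67142688, false), (1115168, false), (32, true), (69271584, false),
  (1024, true), (69272608, false), (34636832, true), (69272576, false), (33620000, false),
  (68157472, false), (2129952, false), (33620992, false), (68158464, false), (2130944, false),
  (32768, true), (66592, false), (68191232, false), (69207040, false), (35685376, false),
  (69238784, false), (69206048, false), (69239840, false), (34668576, false), (34669568, false),
  (67175424, false), (2163712, false), (68190208, false), (2162720, false), (35684352, false),
  (67174432, false), (35684384, false), (68190240, false), (67109920, false), (1048576, true),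
  (2098208, false), (33554432, true), (35718176, false), (68224032, false), (33556512, false),
  (2164768, false), (68192288, false), (67176480, false), (69208096, false), (1050656, false),
  (35686432, false), (34848, false), (34670624, false)]

/-- The linear relations that determine labels, at the positions where they are used. -/
def rules : List (ℕ × ℕ) :=
  [(0, 0), (0, 0), (0, 0), (0, 0), (0, 0), (0, 0), (0, 0), (0, 0), (0, 0), (0, 0), (364, 495),
  (364, 87), (0, 0), (364, 351), (364, 189), (0, 0), (0, 0), (0, 0), (0, 0), (0, 0), (0, 0),
  (0, 0), (723, 11), (351, 431), (0, 0), (0, 0), (351, 426), (0, 0), (351, 666), (351, 171),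
  (0, 0), (0, 0), (0, 0), (0, 0), (370, 666), (0, 0), (697, 33), (697, 348), (567, 534),
  (567, 524), (588, 146), (426, 308), (0, 0), (462, 721), (660, 721), (39, 29), (606, 721),
  (444, 721), (552, 271), (552, 91), (228, 109), (228, 253), (21, 297), (21, 351), (0, 0),
  (189, 495), (189, 333), (495, 405), (495, 297), (333, 405), (171, 405), (279, 297), (63, 297)]

open SearchTree in
/-- The search through the labels of the forms in the first hyperplane. -/
def firstTree : SearchTree :=
  branch (branch (cut 124 249 0) (branch (cut 124 249 0) (branch (cut 99 292 0) (branch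
  (cut 99 292 0) (branch (force (force (branch (cut 364 0 45) (force (force leaf)) (force (force
  leaf))))) (force (cut 364 0 93)) (force (force (branch (force (force leaf)) (cut 364 0 44)
  (force (force leaf)))))) (cut 99 292 52)) (branch (cut 99 292 0) (cut 99 292 68) (branch (force
  (cut 140 308 0)) (force (cut 140 308 52)) (force (cut 104 290 68))))) (cut 124 249 52)) (branch
  (cut 124 249 0) (cut 124 249 68) (branch (cut 99 292 0) (branch (cut 99 292 0) (branch (force
  (cut 140 308 0)) (force (cut 104 290 52)) (force (cut 140 308 68))) (cut 99 292 52)) (branch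
  (cut 99 292 0) (cut 99 292 68) (branch (force (force (branch (cut 364 0 63) (force (force leaf))
  (force (force leaf))))) (force (force (branch (force (force leaf)) (force (force leaf))
  (cut 364 0 76)))) (force (cut 364 0 186))))))) (branch (branch (cut 124 249 0) (branch (branch
  (cut 99 292 0) (branch (force (cut 364 0 0)) (force (cut 45 346 176)) (force (cut 364 0 106)))
  (branch (force (force (branch (cut 364 0 0) (cut 364 0 142) (force (force leaf))))) (force
  (force (branch (cut 364 0 0) (force (force leaf)) (cut 364 0 76)))) (force (force
  (cut 364 0 176))))) (branch (cut 99 292 50) (branch (force (cut 364 0 45)) (cut 128 266 76)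
  (force (cut 45 346 106))) (cut 99 292 76)) (branch (cut 142 312 0) (branch (force
  (cut 45 346 0)) (force (cut 364 0 239)) (force (cut 364 0 142))) (branch (force (force (branch
  (cut 364 0 63) (cut 364 0 124) (force (force leaf))))) (force (force (branch (cut 364 0 0)
  (force (force leaf)) (cut 364 0 76)))) (force (force (cut 364 0 142)))))) (cut 124 249 63))
  (branch (branch (branch (cut 99 292 0) (branch (force (force (branch (cut 364 0 0) (force (force
  leaf)) (cut 364 0 156)))) (force (cut 44 332 0)) (force (force (branch (cut 364 0 0)
  (cut 364 0 44) (force (force leaf)))))) (branch (force (force (cut 364 0 0))) (force (force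
  (cut 364 0 76))) (force (cut 44 332 0)))) (branch (cut 99 292 50) (branch (force (force
  (cut 364 0 83))) (cut 128 266 76) (force (force (cut 364 0 44)))) (cut 99 292 76)) (branch
  (branch (force (cut 364 0 0)) (force (cut 364 0 70)) (force (cut 122 245 50))) (cut 156 316 44)
  (branch (force (force (branch (cut 364 0 63) (force (force leaf)) (cut 364 0 15)))) (force
  (force (branch (force (force leaf)) (cut 364 0 44) (cut 364 0 76)))) (force (cut 364 0 44)))))
  (branch (branch (cut 99 292 0) (branch (force (force (branch (cut 364 0 7) (force (force leaf))
  (cut 364 0 33)))) (cut 98 278 7) (force (force (branch (cut 364 0 7) (cut 364 0 62) (force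
  (force leaf)))))) (branch (force (force (branch (cut 364 0 148) (cut 364 0 62) (force (force
  leaf))))) (force (force (branch (cut 364 0 7) (force (force leaf)) (cut 364 0 93))))
  (cut 98 278 62))) (cut 29 338 93) (branch (branch (cut 98 278 33) (force (cut 122 245 70))
  (force (cut 364 0 142))) (branch (force (force (cut 364 0 83))) (cut 98 278 7) (force (force
  (cut 364 0 44)))) (branch (force (force (cut 364 0 148))) (force (force (cut 364 0 93)))
  (cut 98 278 62)))) (branch (branch (cut 99 292 0) (branch (force (force (cut 364 0 106))) (force
  (force (cut 140 308 76))) (force (force (cut 364 0 171)))) (branch (force (force (branch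
  (cut 364 0 148) (force (force leaf)) (cut 364 0 161)))) (force (force (branch (force (force
  leaf)) (cut 364 0 106) (cut 364 0 93)))) (force (force (cut 364 0 62))))) (branch
  (cut 99 292 50) (branch (force (force (branch (force (force leaf)) (cut 364 0 220)
  (cut 364 0 78)))) (cut 128 266 76) (force (force (branch (cut 364 0 52) (force (force leaf))
  (cut 364 0 194))))) (cut 99 292 76)) (branch (branch (force (cut 104 290 63)) (force
  (cut 364 0 194)) (force (cut 364 0 171))) (branch (force (force (branch (cut 364 0 63)
  (cut 364 0 140) (force (force leaf))))) (force (cut 132 268 44)) (force (force (branch (force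
  (force leaf)) (cut 364 0 44) (cut 364 0 11))))) (branch (force (force (branch (cut 364 0 63)
  (cut 364 0 140) (force (force leaf))))) (force (force (branch (cut 364 0 52) (force (force
  leaf)) (cut 364 0 76)))) (force (force (cut 364 0 44))))))) (branch (cut 124 249 76) (branch
  (branch (cut 99 292 0) (branch (force (force (branch (cut 364 0 7) (cut 364 0 21) (force (force
  leaf))))) (force (force (cut 364 0 93))) (force (force (branch (force (force leaf))
  (cut 364 0 62) (cut 364 0 76))))) (branch (force (force (cut 364 0 76))) (force (cut 364 0 99))
  (force (force (cut 140 308 50))))) (branch (cut 99 292 50) (branch (force (force (branch (force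
  (force leaf)) (cut 364 0 21) (cut 364 0 76)))) (cut 128 266 76) (force (force (branch
  (cut 364 0 50) (force (force leaf)) (cut 364 0 76))))) (cut 99 292 76)) (branch (branch (force
  (force (cut 364 0 142))) (force (force (branch (force (force leaf)) (cut 364 0 99)
  (cut 364 0 13)))) (force (force (branch (cut 364 0 50) (cut 364 0 99) (force (force leaf))))))
  (branch (force (force (cut 364 0 83))) (force (cut 132 268 68)) (force (force (cut 364 0 44))))
  (branch (force (force (branch (cut 364 0 63) (force (force leaf)) (cut 364 0 76)))) (force
  (force (branch (force (force leaf)) (cut 364 0 99) (cut 364 0 76)))) (force (cut 104 290 68)))))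
  (branch (branch (cut 99 292 0) (branch (force (force (branch (cut 364 0 0) (cut 364 0 57) (force
  (force leaf))))) (force (force (cut 364 0 215))) (force (force (branch (force (force leaf))
  (cut 364 0 44) (cut 364 0 31))))) (branch (force (force (branch (cut 364 0 0) (force (force
  leaf)) (cut 364 0 76)))) (force (force (branch (force (force leaf)) (cut 364 0 99)
  (cut 364 0 76)))) (force (cut 104 290 5)))) (branch (cut 99 292 50) (branch (force (force
  (cut 364 0 21))) (cut 128 266 76) (force (force (cut 364 0 76)))) (cut 99 292 76)) (branch
  (branch (force (force (cut 364 0 241))) (force (force (branch (cut 364 0 0) (force (force leaf))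
  (cut 364 0 13)))) (force (force (branch (force (force leaf)) (cut 364 0 99) (cut 364 0 194)))))
  (branch (force (force (branch (cut 364 0 63) (force (force leaf)) (cut 364 0 239)))) (force
  (cut 364 0 215)) (force (force (branch (cut 364 0 83) (cut 364 0 44) (force (force leaf))))))
  (branch (force (cut 364 0 63)) (force (force (cut 364 0 76))) (force (force
  (cut 140 308 68)))))))) (branch (branch (cut 124 249 0) (cut 124 249 45) (branch (branch
  (cut 99 292 0) (branch (force (force (branch (cut 364 0 0) (force (force leaf))
  (cut 364 0 116)))) (force (force (cut 364 0 106))) (force (force (branch (cut 364 0 0)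
  (cut 364 0 44) (force (force leaf)))))) (branch (force (cut 364 0 0)) (force (cut 364 0 176))
  (force (cut 45 346 106)))) (branch (cut 142 312 0) (branch (force (force (branch (cut 364 0 45)
  (force (force leaf)) (cut 364 0 116)))) (force (force (cut 364 0 194))) (force (force (branch
  (cut 364 0 0) (cut 364 0 44) (force (force leaf)))))) (branch (force (cut 45 346 0)) (force
  (cut 364 0 194)) (force (cut 364 0 124)))) (branch (cut 99 292 70) (cut 99 292 44) (branch
  (force (cut 364 0 63)) (force (cut 45 346 176)) (cut 128 266 44))))) (branch (cut 124 249 44)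
  (branch (branch (cut 99 292 0) (branch (force (force (branch (cut 364 0 0) (cut 364 0 44) (force
  (force leaf))))) (force (cut 104 290 7)) (force (force (branch (force (force leaf))
  (cut 364 0 44) (cut 364 0 93))))) (branch (force (force (branch (cut 364 0 0) (force (force
  leaf)) (cut 364 0 33)))) (force (force (branch (force (force leaf)) (cut 364 0 62)
  (cut 364 0 76)))) (force (force (cut 364 0 148))))) (branch (branch (force (force
  (cut 364 0 122))) (force (force (branch (force (force leaf)) (cut 364 0 142) (cut 364 0 93))))
  (force (force (branch (cut 364 0 0) (cut 364 0 26) (force (force leaf)))))) (branch (force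
  (cut 364 0 45)) (force (force (cut 140 308 52))) (force (force (cut 364 0 44)))) (branch (force
  (force (branch (cut 364 0 45) (cut 364 0 124) (force (force leaf))))) (force (force (branch
  (cut 364 0 163) (force (force leaf)) (cut 364 0 76)))) (force (cut 364 0 148)))) (branch
  (cut 99 292 70) (cut 99 292 44) (branch (force (force (cut 364 0 15))) (force (force
  (cut 364 0 44))) (cut 128 266 44)))) (branch (branch (cut 99 292 0) (branch (force (force
  (cut 364 0 44))) (force (force (cut 140 308 70))) (force (cut 364 0 171))) (branch (force (force
  (branch (cut 364 0 5) (force (force leaf)) (cut 364 0 15)))) (force (force (branch (force (force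
  leaf)) (cut 364 0 44) (cut 364 0 31)))) (force (force (cut 364 0 186))))) (branch (branch (force
  (force (cut 364 0 194))) (force (force (branch (cut 364 0 70) (force (force leaf))
  (cut 364 0 93)))) (force (force (branch (force (force leaf)) (cut 364 0 26) (cut 364 0 171)))))
  (branch (force (force (branch (cut 364 0 45) (cut 364 0 44) (force (force leaf))))) (force
  (cut 104 290 52)) (force (force (branch (force (force leaf)) (cut 364 0 44) (cut 364 0 93)))))
  (branch (force (force (cut 364 0 163))) (force (force (cut 364 0 52))) (force
  (cut 132 268 52)))) (branch (cut 99 292 70) (cut 99 292 44) (branch (force (force (branch (force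
  (force leaf)) (cut 364 0 44) (cut 364 0 15)))) (force (force (branch (cut 364 0 70)
  (cut 364 0 44) (force (force leaf))))) (cut 128 266 44))))) (branch (branch (branch
  (cut 99 292 0) (branch (force (force (cut 364 0 0))) (force (cut 44 332 0)) (force (force
  (cut 364 0 44)))) (branch (force (force (branch (cut 364 0 0) (cut 364 0 104) (force (force
  leaf))))) (force (force (branch (cut 364 0 0) (force (force leaf)) (cut 364 0 76)))) (force
  (cut 44 332 0)))) (branch (branch (force (cut 364 0 0)) (force (cut 122 245 70)) (force
  (cut 364 0 50))) (branch (force (force (branch (cut 364 0 45) (cut 364 0 21) (force (force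
  leaf))))) (force (cut 364 0 76)) (force (force (branch (force (force leaf)) (cut 364 0 44)
  (cut 364 0 76))))) (cut 156 316 76)) (branch (cut 99 292 70) (cut 99 292 44) (branch (force
  (force (cut 364 0 163))) (force (force (cut 364 0 76))) (cut 128 266 44)))) (branch (branch
  (cut 99 292 0) (branch (force (force (branch (cut 364 0 128) (cut 364 0 99) (force (force
  leaf))))) (force (force (cut 364 0 31))) (force (force (branch (force (force leaf))
  (cut 364 0 99) (cut 364 0 116))))) (branch (force (force (cut 364 0 176))) (force (force
  (cut 364 0 99))) (force (force (cut 140 308 44))))) (branch (branch (force (cut 104 290 45))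
  (force (cut 364 0 99)) (force (cut 364 0 142))) (branch (force (force (branch (cut 364 0 45)
  (force (force leaf)) (cut 364 0 93)))) (force (force (cut 364 0 76))) (force (force (branch
  (cut 364 0 45) (cut 364 0 44) (force (force leaf)))))) (branch (force (force (branch
  (cut 364 0 45) (force (force leaf)) (cut 364 0 196)))) (force (force (branch (force (force
  leaf)) (cut 364 0 19) (cut 364 0 76)))) (force (cut 132 268 76)))) (branch (cut 99 292 70)
  (cut 99 292 44) (branch (force (force (branch (force (force leaf)) (cut 364 0 39)
  (cut 364 0 116)))) (force (force (branch (cut 364 0 68) (cut 364 0 142) (force (force leaf)))))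
  (cut 128 266 44)))) (branch (branch (cut 99 292 0) (branch (force (force (branch (cut 364 0 128)
  (force (force leaf)) (cut 364 0 31)))) (cut 98 278 31) (force (force (branch (cut 364 0 5)
  (cut 364 0 99) (force (force leaf)))))) (branch (force (force (branch (cut 364 0 5)
  (cut 364 0 57) (force (force leaf))))) (force (force (branch (cut 364 0 5) (force (force leaf))
  (cut 364 0 31)))) (cut 98 278 5))) (branch (branch (cut 98 278 57) (force (cut 364 0 194))
  (force (cut 122 245 50))) (branch (force (force (cut 364 0 146))) (cut 98 278 31) (force (force
  (cut 364 0 117)))) (branch (force (force (cut 364 0 163))) (force (force (cut 364 0 76)))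
  (cut 98 278 5))) (cut 29 338 186))))

/-- Representatives of the labellings of the first hyperplane. -/
def reps : List (List ℕ) :=
  [[0, 0, 0, 0, 0, 1, 1, 1, 1, 0, 1, 1, 1, 1, 0], [0, 0, 0, 0, 0, 1, 1, 1, 1, 2, 0, 2, 0, 1, 1],
  [0, 0, 0, 0, 1, 1, 2, 0, 2, 0, 1, 1, 1, 0, 1], [0, 0, 0, 0, 1, 1, 2, 0, 2, 1, 2, 0, 0, 2, 1]]

open SearchTree in
/-- The search from a labelling of the first hyperplane. -/
def treeOne : SearchTree :=
  branch (branch (branch (branch (cut 146 316 0) (branch (cut 140 304 21) (branch (force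
  (cut 15 351 0)) (force (cut 15 351 196)) (force (cut 15 351 140))) (cut 140 304 21))
  (cut 146 316 21)) (cut 146 316 0) (cut 146 316 0)) (branch (branch (cut 146 316 78) (branch
  (branch (force (force (cut 135 297 68))) (force (force (cut 140 304 21))) (force (force
  (cut 140 304 21)))) (branch (force (force (branch (branch (cut 351 0 116) (force
  (cut 351 0 226)) (cut 116 247 68)) (branch (cut 351 0 116) (force (branch (cut 351 0 7)
  (cut 351 0 29) (force (force (branch (cut 83 268 57) (branch (cut 132 260 52) (branch
  (cut 370 0 122) (branch (cut 370 0 122) (force (branch (cut 5 424 19) (cut 5 388 55)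
  (cut 128 294 45))) (force (cut 370 0 15))) (cut 52 426 182)) (cut 83 310 45))
  (cut 83 268 57)))))) (cut 351 0 68)) (cut 351 0 116)))) (force (force (cut 135 297 57))) (force
  (force (branch (cut 351 0 222) (branch (force (branch (force (force (branch (cut 87 261 39)
  (cut 87 261 39) (branch (cut 709 0 163) (branch (branch (cut 5 460 117) (cut 370 0 142) (force
  (branch (cut 5 388 234) (force (cut 697 0 194)) (cut 5 405 163)))) (branch (force
  (cut 370 0 57)) (cut 29 344 87) (force (cut 370 0 161))) (branch (force (cut 45 325 184))
  (cut 29 344 87) (cut 122 260 15))) (branch (cut 104 316 45) (cut 52 426 26) (branch (force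
  (cut 45 325 184)) (cut 29 344 87) (cut 122 260 15))))))) (cut 351 0 150) (cut 351 0 45))) (force
  (cut 351 0 111)) (cut 351 0 222)) (branch (cut 351 0 55) (force (cut 351 0 55))
  (cut 351 0 204)))))) (branch (force (force (cut 140 304 78))) (force (force (cut 351 0 78)))
  (force (force (cut 135 297 76))))) (cut 146 316 44)) (branch (cut 146 316 0) (branch (branch
  (force (force (branch (branch (force (cut 142 302 45)) (cut 351 0 226) (cut 351 0 91))
  (cut 83 271 45) (cut 351 0 226)))) (force (force (branch (branch (force (cut 351 0 29))
  (cut 351 0 78) (force (branch (cut 351 0 78) (cut 351 0 68) (cut 351 0 57)))) (cut 83 271 45)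
  (branch (force (branch (cut 351 0 44) (cut 351 0 29) (cut 351 0 45))) (cut 106 284 44)
  (cut 142 302 13))))) (force (force (cut 135 297 45)))) (branch (force (force (cut 351 0 226)))
  (force (force (branch (cut 39 348 0) (cut 351 0 29) (branch (cut 351 0 29) (cut 351 0 44) (force
  (branch (cut 351 0 39) (cut 351 0 29) (cut 351 0 91))))))) (force (force (branch
  (cut 31 332 163) (branch (cut 29 325 0) (cut 351 0 226) (force (branch (cut 351 0 39)
  (cut 351 0 29) (cut 351 0 45)))) (cut 351 0 226))))) (branch (force (force (cut 140 304 21)))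
  (force (force (cut 351 0 29))) (force (force (cut 140 304 21))))) (branch (branch (force (force
  (cut 140 304 21))) (force (force (cut 91 290 29))) (force (force (cut 132 255 21)))) (branch
  (force (force (branch (cut 31 332 163) (branch (cut 351 0 55) (cut 45 333 163) (cut 351 0 128))
  (cut 351 0 55)))) (force (force (branch (cut 31 332 163) (cut 91 290 29) (cut 31 332 13))))
  (cut 31 332 163)) (branch (force (force (cut 351 0 128))) (force (force (cut 93 294 44)))
  (cut 31 332 163)))) (branch (cut 146 316 0) (branch (branch (force (force (cut 351 0 226)))
  (force (force (cut 351 0 78))) (force (force (cut 140 304 78)))) (branch (force (force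
  (cut 140 304 29))) (force (force (cut 351 0 29))) (force (force (cut 351 0 222)))) (branch
  (force (force (branch (branch (cut 351 0 116) (cut 45 333 163) (force (cut 351 0 91)))
  (cut 83 271 45) (cut 351 0 116)))) (force (force (branch (cut 351 0 78) (cut 351 0 29) (branch
  (cut 351 0 29) (cut 351 0 78) (force (cut 351 0 29)))))) (force (force (cut 135 297 45)))))
  (cut 146 316 44))) (branch (branch (branch (branch (force (force (cut 140 304 21)))
  (cut 116 247 78) (force (force (cut 135 297 70)))) (branch (force (force (cut 135 297 62)))
  (force (force (cut 140 304 55))) (force (force (cut 140 304 55)))) (branch (force (force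
  (cut 39 348 0))) (cut 116 247 78) (force (force (branch (cut 39 348 0) (branch (force
  (cut 351 0 55)) (cut 351 0 140) (force (branch (cut 351 0 39) (force (force (branch
  (cut 99 249 68) (cut 87 261 26) (cut 87 261 26)))) (cut 351 0 140)))) (branch (cut 351 0 55)
  (cut 98 292 78) (force (cut 351 0 39)))))))) (branch (branch (cut 31 332 176) (force (force
  (cut 140 304 39))) (force (force (cut 135 297 76)))) (branch (cut 31 332 176) (force (force
  (branch (cut 351 0 111) (cut 91 290 29) (cut 31 332 176)))) (force (force (branch
  (cut 91 290 70) (cut 39 348 26) (cut 31 332 176))))) (branch (force (force (cut 93 294 45)))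
  (force (force (cut 351 0 111))) (force (force (cut 140 304 55))))) (branch (branch (force (force
  (branch (branch (force (cut 11 351 194)) (force (cut 351 0 21)) (cut 351 0 21)) (branch
  (cut 142 302 45) (force (cut 11 351 140)) (cut 351 0 21)) (cut 351 0 21)))) (force (force
  (cut 135 297 13))) (force (force (branch (branch (cut 351 0 55) (force (cut 142 302 78)) (force
  (cut 351 0 39))) (branch (cut 351 0 55) (force (cut 351 0 26)) (force (cut 142 302 68)))
  (cut 351 0 55))))) (branch (force (force (cut 140 304 39))) (force (force (cut 140 304 39)))
  (cut 85 278 55)) (branch (force (force (cut 351 0 21))) (force (force (cut 132 255 21)))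
  (cut 85 278 55)))) (branch (cut 146 316 0) (cut 146 316 45) (cut 146 316 55)) (branch
  (cut 146 316 0) (cut 146 316 45) (cut 146 316 55)))) (branch (branch (branch (cut 146 316 31)
  (branch (branch (force (force (cut 351 0 68))) (force (force (cut 140 304 21))) (force (force
  (cut 140 304 21)))) (branch (force (force (cut 140 304 55))) (force (force (cut 351 0 111)))
  (force (force (cut 140 304 55)))) (branch (force (force (branch (cut 83 271 31) (cut 99 279 68)
  (branch (cut 45 333 176) (cut 351 0 52) (cut 37 344 21))))) (force (force (branch
  (cut 351 0 111) (cut 351 0 239) (branch (cut 351 0 239) (cut 351 0 111) (force (branch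
  (cut 351 0 44) (cut 351 0 21) (force (force (branch (branch (cut 52 426 104) (cut 83 310 13)
  (branch (cut 45 431 99) (branch (force (cut 370 0 93)) (cut 5 344 135) (cut 31 405 165)) (branch
  (force (cut 370 0 33)) (cut 5 344 135) (cut 31 405 165)))) (branch (cut 52 426 104)
  (cut 83 310 13) (branch (cut 45 431 99) (branch (force (cut 370 0 93)) (cut 122 260 21)
  (cut 31 405 165)) (branch (force (cut 370 0 33)) (force (cut 5 434 45)) (cut 31 405 165))))
  (branch (cut 52 426 104) (cut 83 310 13) (branch (cut 45 431 99) (branch (force (cut 370 0 93))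
  (cut 5 344 135) (cut 31 405 165)) (branch (force (cut 370 0 33)) (cut 5 344 135)
  (cut 31 405 165))))))))))))) (force (force (cut 135 297 76))))) (branch (branch (force (force
  (branch (cut 39 348 182) (cut 99 279 68) (cut 351 0 52)))) (force (force (cut 135 297 44)))
  (force (force (branch (cut 91 290 39) (branch (cut 116 247 55) (cut 37 344 93) (cut 132 255 21))
  (cut 39 348 13))))) (branch (force (force (cut 37 344 21))) (force (force (cut 132 255 21)))
  (cut 85 278 55)) (branch (force (force (cut 351 0 52))) (force (force (cut 351 0 239)))
  (cut 85 278 55)))) (branch (cut 146 316 0) (branch (branch (force (force (cut 140 304 52)))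
  (force (force (cut 351 0 239))) (force (force (cut 135 297 45)))) (branch (force (force
  (cut 135 297 37))) (force (force (branch (cut 351 0 111) (cut 91 290 29) (branch (cut 29 325 0)
  (cut 351 0 111) (force (branch (cut 351 0 117) (cut 351 0 68) (cut 351 0 55))))))) (force (force
  (branch (cut 83 271 31) (branch (cut 351 0 55) (cut 37 344 93) (force (branch (cut 351 0 76)
  (cut 351 0 68) (cut 351 0 55)))) (cut 351 0 55))))) (branch (force (force (cut 37 344 21)))
  (force (force (cut 91 290 29))) (force (force (cut 140 304 21))))) (cut 146 316 55)) (branch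
  (cut 146 316 0) (branch (branch (force (force (cut 135 297 37))) (force (force (branch (branch
  (force (cut 351 0 0)) (cut 351 0 78) (force (cut 351 0 99))) (cut 31 332 186) (branch (force
  (branch (cut 351 0 44) (force (force (branch (branch (branch (cut 52 426 104) (cut 370 0 116)
  (branch (force (cut 370 0 116)) (cut 370 0 116) (cut 124 308 68))) (cut 709 0 182) (branch
  (cut 99 260 52) (cut 370 0 116) (branch (force (cut 370 0 116)) (cut 370 0 116)
  (cut 124 308 68)))) (cut 87 261 26) (cut 87 261 26)))) (cut 351 0 55))) (cut 351 0 44) (force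
  (cut 351 0 204)))))) (force (force (branch (cut 31 332 99) (branch (force (cut 351 0 45))
  (cut 351 0 208) (force (cut 351 0 76))) (branch (cut 351 0 55) (cut 351 0 226) (force
  (cut 351 0 204))))))) (branch (force (force (branch (branch (cut 29 325 0) (force (branch (force
  (force (branch (branch (branch (cut 370 0 122) (branch (cut 370 0 122) (force (cut 370 0 122))
  (force (cut 52 420 0))) (branch (cut 370 0 122) (force (branch (cut 116 278 15) (cut 5 388 83)
  (cut 132 273 52))) (force (cut 370 0 15)))) (branch (cut 370 0 122) (branch (cut 370 0 122)
  (force (cut 370 0 122)) (force (branch (cut 5 405 218) (force (cut 29 405 163))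
  (cut 5 388 154)))) (cut 52 426 182)) (cut 52 245 171)) (branch (branch (cut 370 0 122) (branch
  (cut 370 0 122) (cut 93 260 21) (force (cut 52 420 0))) (branch (cut 370 0 122) (cut 93 260 21)
  (force (cut 370 0 15)))) (branch (cut 370 0 122) (branch (cut 370 0 122) (cut 93 260 21) (force
  (branch (cut 5 424 19) (force (cut 29 405 163)) (cut 5 388 154)))) (cut 52 426 182))
  (cut 52 245 171)) (branch (branch (cut 370 0 122) (branch (cut 370 0 122) (cut 93 260 21) (force
  (cut 52 420 0))) (branch (cut 370 0 122) (cut 93 260 21) (force (cut 370 0 15)))) (branch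
  (cut 370 0 122) (branch (cut 370 0 122) (cut 93 260 21) (force (branch (cut 5 405 218) (force
  (cut 29 405 163)) (cut 5 388 154)))) (cut 52 426 182)) (cut 52 245 171))))) (cut 351 0 29)
  (cut 351 0 208))) (cut 351 0 31)) (cut 351 0 68) (cut 31 332 176)))) (force (force
  (cut 91 290 29))) (force (force (branch (cut 351 0 222) (cut 91 290 29) (cut 351 0 55)))))
  (branch (force (force (cut 140 304 52))) (force (force (cut 140 304 52))) (force (force
  (cut 351 0 55))))) (cut 146 316 55))) (branch (branch (branch (branch (force (force (branch
  (cut 99 279 78) (branch (cut 351 0 239) (cut 351 0 156) (cut 351 0 68)) (cut 91 290 21))))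
  (force (force (branch (cut 351 0 78) (cut 351 0 208) (branch (force (branch (cut 351 0 44)
  (force (force (branch (cut 99 249 52) (cut 99 249 52) (branch (branch (cut 52 426 104)
  (cut 370 0 116) (branch (force (cut 370 0 93)) (cut 370 0 116) (force (branch (cut 132 290 21)
  (cut 116 278 78) (cut 5 388 29))))) (branch (branch (cut 98 310 7) (cut 370 0 116) (force
  (branch (cut 5 388 19) (cut 426 0 63) (force (force (cut 426 0 63)))))) (cut 370 0 116)
  (cut 52 426 182)) (cut 132 260 33))))) (cut 351 0 13))) (cut 351 0 78) (cut 351 0 13))))) (force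
  (force (cut 135 297 70)))) (branch (force (force (cut 135 297 62))) (force (force
  (cut 128 253 13))) (force (force (cut 140 304 55)))) (branch (force (force (cut 140 304 7)))
  (force (force (cut 351 0 78))) (force (force (cut 351 0 194))))) (branch (branch (force (force
  (branch (cut 99 279 78) (branch (cut 45 333 176) (cut 37 344 7) (cut 351 0 68))
  (cut 31 332 176)))) (force (force (cut 37 344 7))) (force (force (cut 135 297 76)))) (branch
  (force (force (cut 135 297 68))) (force (force (cut 140 304 29))) (force (force
  (cut 140 304 29)))) (branch (force (force (cut 140 304 55))) (force (force (cut 351 0 111)))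
  (force (force (cut 140 304 55))))) (cut 146 316 13)) (branch (branch (branch (force (force
  (branch (branch (cut 351 0 239) (force (cut 351 0 78)) (force (cut 11 351 31))) (cut 351 0 239)
  (branch (cut 351 0 239) (force (cut 11 351 85)) (cut 142 302 13))))) (force (force
  (cut 128 253 13))) (force (force (cut 135 297 11)))) (branch (force (force (cut 135 297 0)))
  (force (force (cut 140 304 7))) (force (force (cut 351 0 194)))) (branch (force (force
  (cut 140 304 29))) (force (force (cut 351 0 208))) (force (force (cut 140 304 29))))) (branch
  (branch (force (force (cut 135 297 68))) (force (force (cut 91 290 29))) (force (force (branch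
  (branch (cut 351 0 194) (force (cut 351 0 208)) (force (cut 351 0 68))) (cut 39 348 26) (branch
  (cut 351 0 55) (force (branch (force (force (branch (cut 87 266 44) (cut 87 266 44) (branch
  (branch (cut 370 0 122) (cut 106 253 26) (cut 45 431 182)) (cut 98 310 7) (cut 132 294 26)))))
  (cut 351 0 29) (cut 351 0 13))) (force (cut 351 0 55))))))) (branch (force (force
  (cut 140 304 55))) (force (force (cut 351 0 111))) (force (force (cut 351 0 55)))) (branch
  (force (force (cut 140 304 7))) (force (force (cut 140 304 7))) (force (force
  (cut 351 0 194))))) (cut 146 316 13)) (branch (branch (branch (force (force (branch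
  (cut 351 0 78) (branch (force (cut 351 0 0)) (cut 351 0 78) (cut 351 0 128)) (branch (force
  (cut 351 0 78)) (cut 351 0 44) (cut 351 0 135))))) (force (force (cut 351 0 78))) (force (force
  (branch (cut 130 260 78) (branch (force (cut 351 0 194)) (cut 351 0 208) (force
  (cut 351 0 208))) (branch (cut 351 0 55) (cut 351 0 44) (force (cut 351 0 44))))))) (branch
  (force (force (cut 140 304 29))) (force (force (cut 91 290 29))) (force (force
  (cut 135 297 70)))) (branch (force (force (cut 135 297 62))) (force (force (cut 140 304 55)))
  (force (force (cut 351 0 55))))) (branch (branch (force (force (cut 135 297 15))) (force (force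
  (branch (cut 39 348 99) (cut 91 290 29) (cut 39 348 13)))) (force (force (branch (branch
  (cut 351 0 55) (force (cut 142 302 78)) (force (cut 351 0 55))) (branch (cut 351 0 55) (force
  (cut 351 0 7)) (force (cut 142 302 68))) (cut 351 0 55))))) (branch (force (force
  (cut 140 304 7))) (force (force (cut 351 0 7))) (force (force (cut 140 304 7)))) (branch (force
  (force (cut 140 304 29))) (force (force (cut 91 290 29))) (force (force (cut 135 297 26)))))
  (cut 146 316 44))) (branch (branch (branch (branch (force (force (branch (cut 39 348 0) (branch
  (force (branch (cut 351 0 39) (force (force (branch (cut 99 260 76) (branch (branch (branch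
  (force (cut 5 388 189)) (cut 370 0 116) (force (cut 370 0 116))) (cut 370 0 116)
  (cut 52 426 182)) (cut 709 0 182) (branch (branch (force (cut 5 388 189)) (cut 370 0 116) (force
  (cut 370 0 116))) (cut 370 0 116) (cut 52 426 182))) (cut 99 260 76)))) (cut 351 0 55))) (force
  (cut 351 0 226)) (cut 87 273 39)) (cut 31 332 176)))) (force (force (branch (branch
  (cut 351 0 239) (cut 351 0 78) (force (branch (cut 351 0 39) (cut 351 0 194) (force (force
  (branch (cut 87 261 55) (branch (branch (cut 52 426 104) (branch (cut 91 260 0) (force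
  (cut 370 0 39)) (cut 370 0 39)) (branch (cut 91 260 0) (force (cut 370 0 202)) (force
  (cut 370 0 39)))) (cut 98 294 7) (branch (cut 99 260 0) (branch (cut 91 260 0) (force
  (cut 370 0 39)) (cut 370 0 39)) (branch (cut 91 260 0) (force (cut 370 0 202)) (force
  (cut 370 0 39))))) (cut 87 261 55))))))) (cut 351 0 239) (branch (cut 351 0 239) (cut 351 0 44)
  (force (branch (cut 351 0 39) (force (force (branch (cut 99 249 52) (cut 87 261 26)
  (cut 87 261 26)))) (cut 351 0 13))))))) (force (force (cut 135 297 39)))) (cut 140 304 55)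
  (cut 140 304 55)) (cut 146 316 76) (cut 146 316 55)) (cut 146 316 55) (cut 146 316 55))) (branch
  (branch (branch (branch (branch (force (force (cut 351 0 68))) (cut 31 332 186) (force (force
  (cut 351 0 124)))) (branch (force (force (cut 135 297 62))) (force (force (branch
  (cut 111 249 0) (cut 31 332 186) (cut 83 271 44)))) (force (force (branch (cut 122 268 11)
  (cut 99 279 68) (cut 351 0 124))))) (branch (force (force (branch (cut 351 0 0) (cut 31 332 186)
  (branch (cut 351 0 0) (force (cut 351 0 21)) (cut 351 0 21))))) (cut 31 332 186) (force (force
  (branch (cut 351 0 130) (cut 31 332 186) (branch (cut 351 0 124) (cut 351 0 130) (force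
  (cut 351 0 124)))))))) (cut 146 316 68) (cut 146 316 44)) (branch (cut 146 316 0)
  (cut 146 316 68) (branch (branch (force (force (cut 135 297 74))) (force (force (branch (branch
  (force (cut 351 0 208)) (cut 351 0 130) (cut 132 255 21)) (cut 351 0 208) (cut 50 340 21))))
  (force (force (branch (cut 351 0 130) (cut 99 279 68) (cut 50 340 21))))) (branch (force (force
  (cut 351 0 68))) (force (force (cut 91 290 29))) (cut 85 278 55)) (branch (force (force (branch
  (cut 111 249 0) (cut 99 279 68) (cut 351 0 21)))) (force (force (branch (cut 111 249 0)
  (cut 351 0 208) (cut 351 0 55)))) (cut 85 278 55)))) (branch (cut 146 316 0) (branch (branch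
  (cut 116 247 68) (force (force (branch (branch (force (cut 11 351 142)) (cut 351 0 208)
  (cut 351 0 204)) (cut 351 0 208) (cut 351 0 204)))) (force (force (branch (cut 31 332 99)
  (cut 39 348 26) (cut 83 271 44))))) (branch (cut 116 247 68) (force (force (cut 135 297 7)))
  (force (force (branch (cut 39 348 91) (cut 39 348 26) (cut 83 271 44))))) (branch (force (force
  (cut 39 348 26))) (force (force (cut 351 0 208))) (force (force (cut 39 348 26)))))
  (cut 146 316 44))) (branch (cut 146 316 44) (branch (branch (branch (force (cut 15 351 85))
  (force (cut 15 351 29)) (force (cut 15 351 222))) (cut 140 304 29) (cut 140 304 29))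
  (cut 146 316 29) (cut 146 316 44)) (cut 146 316 44)) (branch (branch (branch (branch (force
  (force (cut 140 304 11))) (force (force (cut 135 297 50))) (force (force (cut 140 304 11))))
  (branch (force (force (branch (branch (cut 142 302 0) (force (branch (cut 351 0 39)
  (cut 351 0 31) (cut 351 0 91))) (cut 116 247 68)) (branch (force (branch (cut 351 0 124)
  (cut 351 0 68) (cut 351 0 55))) (force (cut 351 0 44)) (cut 351 0 68)) (cut 31 332 176))))
  (force (force (branch (cut 39 348 0) (branch (cut 150 318 29) (cut 351 0 44) (cut 45 333 186))
  (cut 351 0 44)))) (force (force (cut 135 297 39)))) (branch (force (force (cut 135 297 31)))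
  (force (force (cut 140 304 29))) (force (force (cut 351 0 222))))) (cut 146 316 26)
  (cut 146 316 44)) (branch (branch (branch (force (force (branch (cut 91 290 0) (branch (force
  (cut 351 0 239)) (cut 351 0 208) (cut 351 0 68)) (cut 351 0 226)))) (force (force (branch
  (cut 39 348 0) (cut 31 332 186) (branch (force (branch (cut 351 0 39) (force (force (branch
  (branch (branch (cut 52 426 104) (cut 370 0 116) (cut 99 260 76)) (cut 709 0 182) (branch
  (branch (force (cut 370 0 0)) (cut 370 0 116) (force (branch (cut 11 412 116) (cut 5 388 189)
  (force (cut 723 0 117))))) (cut 370 0 116) (cut 99 260 76))) (cut 87 261 26) (cut 87 261 26))))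
  (cut 351 0 11))) (cut 351 0 44) (cut 87 273 39))))) (force (force (cut 135 297 39)))) (branch
  (force (force (cut 135 297 31))) (force (force (cut 91 290 29))) (force (force
  (cut 140 304 29)))) (branch (force (force (cut 140 304 55))) (force (force (cut 135 297 50)))
  (force (force (cut 351 0 55))))) (branch (branch (cut 31 332 176) (force (force
  (cut 93 294 45))) (force (force (cut 37 344 11)))) (branch (cut 31 332 176) (force (force
  (branch (cut 351 0 111) (cut 351 0 29) (cut 31 332 176)))) (force (force (branch (cut 39 348 91)
  (branch (cut 351 0 55) (cut 351 0 226) (cut 87 273 39)) (cut 351 0 55))))) (branch (force (force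
  (cut 39 348 26))) (force (force (cut 351 0 29))) (force (force (cut 140 304 29)))))
  (cut 146 316 55)) (branch (branch (branch (force (force (branch (branch (cut 351 0 11)
  (cut 351 0 208) (cut 98 292 68)) (cut 351 0 208) (cut 31 332 176)))) (force (force
  (cut 91 290 29))) (force (force (cut 128 253 26)))) (branch (force (force (cut 135 297 62)))
  (force (force (cut 140 304 11))) (force (force (cut 351 0 55)))) (branch (force (force (branch
  (cut 91 290 0) (branch (cut 29 325 0) (cut 351 0 208) (cut 351 0 170)) (cut 99 279 55)))) (force
  (force (cut 135 297 78))) (force (force (branch (cut 351 0 222) (branch (cut 351 0 55)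
  (cut 351 0 208) (cut 351 0 222)) (cut 351 0 55)))))) (cut 146 316 26) (cut 146 316 44))))

open SearchTree in
/-- The search from a labelling of the first hyperplane. -/
def treeTwo : SearchTree :=
  branch (branch (branch (cut 146 316 21) (cut 146 316 21) (branch (cut 146 316 0) (branch (branch
  (force (cut 15 351 0)) (force (cut 15 351 196)) (force (cut 15 351 140))) (cut 140 304 0)
  (cut 140 304 0)) (cut 146 316 21))) (branch (branch (branch (branch (force (force
  (cut 140 304 63))) (force (force (cut 140 304 63))) (force (force (cut 37 344 178)))) (branch
  (force (force (branch (cut 351 0 150) (branch (cut 351 0 150) (cut 351 0 85) (cut 351 0 178))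
  (cut 351 0 85)))) (force (force (branch (cut 351 0 202) (branch (cut 351 0 202) (cut 351 0 140)
  (cut 351 0 178)) (cut 31 332 13)))) (force (force (branch (cut 351 0 222) (cut 351 0 140)
  (branch (cut 87 273 63) (cut 351 0 140) (cut 351 0 146)))))) (branch (force (force
  (cut 140 304 0))) (force (force (cut 140 304 0))) (force (force (cut 351 0 140))))) (branch
  (branch (force (force (branch (cut 351 0 150) (cut 351 0 76) (cut 351 0 226)))) (force (force
  (branch (branch (cut 351 0 202) (cut 351 0 44) (cut 351 0 76)) (cut 351 0 76) (cut 351 0 44))))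
  (force (force (cut 91 290 76)))) (branch (force (force (cut 140 304 29))) (force (force
  (cut 140 304 29))) (force (force (cut 351 0 222)))) (branch (force (force (branch
  (cut 351 0 150) (branch (cut 351 0 106) (cut 29 325 85) (cut 351 0 76)) (branch (cut 351 0 150)
  (cut 351 0 85) (force (cut 351 0 222)))))) (force (force (branch (cut 91 290 50) (branch
  (cut 351 0 239) (cut 351 0 140) (cut 351 0 76)) (branch (cut 37 344 165) (cut 29 325 85)
  (cut 351 0 196))))) (force (force (branch (cut 351 0 222) (cut 351 0 140) (branch
  (cut 132 255 45) (cut 351 0 140) (cut 351 0 215))))))) (cut 146 316 21)) (branch (branch (branch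
  (force (force (branch (branch (cut 351 0 0) (force (cut 351 0 0)) (force (branch (cut 351 0 0)
  (cut 351 0 21) (cut 351 0 13)))) (branch (cut 45 333 0) (force (cut 142 302 45)) (force (branch
  (cut 351 0 76) (cut 351 0 63) (cut 351 0 128)))) (cut 83 271 63)))) (force (force
  (cut 135 297 50))) (force (force (cut 135 297 11)))) (branch (force (force (cut 351 0 0)))
  (force (force (cut 140 304 0))) (force (force (cut 351 0 140)))) (branch (force (force
  (cut 351 0 85))) (force (force (cut 135 297 19))) (force (force (cut 140 304 29))))) (branch
  (branch (force (force (cut 140 304 63))) (force (force (cut 140 304 63))) (force (force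
  (cut 140 304 63)))) (branch (force (force (branch (cut 351 0 150) (branch (cut 351 0 150)
  (cut 351 0 226) (force (cut 351 0 76))) (cut 351 0 226)))) (force (force (branch (cut 351 0 202)
  (branch (cut 351 0 29) (cut 351 0 140) (force (cut 351 0 76))) (cut 31 332 13)))) (force (force
  (branch (cut 39 348 99) (cut 351 0 140) (cut 83 271 63))))) (branch (force (force
  (cut 128 253 0))) (force (force (cut 140 304 0))) (force (force (cut 351 0 140)))))
  (cut 146 316 21)) (branch (branch (branch (force (force (cut 128 253 0))) (force (force (branch
  (branch (cut 116 247 63) (cut 351 0 44) (force (cut 351 0 44))) (cut 39 348 98)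
  (cut 351 0 44)))) (force (force (branch (cut 39 348 0) (cut 31 332 178) (cut 83 271 63)))))
  (branch (force (force (cut 140 304 29))) (force (force (cut 140 304 29))) (force (force
  (cut 351 0 222)))) (branch (force (force (branch (cut 351 0 0) (branch (cut 351 0 0)
  (cut 116 247 62) (force (cut 351 0 106))) (branch (cut 351 0 0) (cut 351 0 85) (force
  (cut 351 0 222)))))) (force (force (branch (branch (force (cut 351 0 62)) (cut 351 0 62) (force
  (branch (cut 351 0 0) (force (force (branch (branch (cut 98 294 15) (branch (cut 52 426 7)
  (cut 99 260 44) (branch (cut 370 0 186) (cut 31 405 19) (cut 29 344 99))) (branch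
  (cut 106 253 63) (cut 99 260 44) (branch (cut 370 0 186) (force (cut 5 388 146))
  (cut 29 344 99)))) (branch (cut 98 294 15) (branch (cut 52 426 7) (cut 99 260 44) (branch
  (cut 370 0 186) (cut 31 405 19) (cut 29 344 99))) (branch (branch (force (cut 370 0 142))
  (cut 370 0 142) (cut 29 344 99)) (cut 99 260 44) (cut 104 260 11))) (branch (cut 98 294 15)
  (branch (cut 52 426 7) (branch (force (cut 370 0 62)) (cut 31 405 19) (cut 370 0 154)) (branch
  (cut 370 0 186) (cut 31 405 19) (cut 29 344 99))) (branch (cut 106 253 63) (branch (force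
  (cut 370 0 62)) (force (cut 370 0 142)) (cut 370 0 154)) (cut 104 260 11)))))) (cut 351 0 50))))
  (branch (cut 351 0 239) (force (branch (cut 351 0 44) (force (force (branch (cut 99 249 68)
  (branch (cut 132 260 52) (cut 52 426 7) (branch (cut 52 426 7) (branch (cut 124 255 62) (force
  (cut 45 325 26)) (force (cut 370 0 170))) (branch (cut 370 0 186) (force (cut 370 0 186)) (force
  (cut 370 0 128))))) (cut 99 249 68)))) (cut 351 0 62))) (force (cut 351 0 154))) (branch (force
  (branch (cut 351 0 0) (cut 351 0 63) (force (force (branch (cut 87 261 50) (cut 87 261 50)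
  (branch (cut 709 0 163) (branch (cut 52 426 7) (cut 50 332 93) (branch (force (branch
  (cut 116 284 19) (force (cut 156 284 19)) (cut 5 388 146))) (cut 29 344 87) (force
  (cut 370 0 154)))) (branch (branch (force (cut 370 0 0)) (cut 370 0 142) (force
  (cut 370 0 142))) (cut 50 332 93) (branch (force (cut 52 420 171)) (cut 29 344 87) (force
  (cut 370 0 154)))))))))) (force (cut 351 0 62)) (cut 351 0 154))))) (force (force (branch
  (cut 351 0 222) (cut 122 268 45) (branch (cut 45 333 0) (force (cut 351 0 62))
  (cut 351 0 146))))))) (branch (branch (force (force (cut 351 0 150))) (force (force (branch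
  (branch (cut 351 0 150) (force (cut 351 0 44)) (force (cut 150 318 13))) (branch
  (cut 116 247 63) (force (cut 142 302 45)) (force (branch (cut 351 0 76) (cut 351 0 63)
  (cut 351 0 128)))) (cut 31 332 13)))) (force (force (cut 135 297 45)))) (branch (force (force
  (cut 351 0 226))) (force (force (cut 135 297 7))) (force (force (cut 140 304 0)))) (branch
  (force (force (cut 140 304 29))) (force (force (cut 135 297 29))) (force (force
  (cut 351 0 222))))) (cut 146 316 44))) (branch (branch (branch (branch (force (force
  (cut 140 304 39))) (force (force (cut 135 297 78))) (force (force (cut 351 0 76)))) (branch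
  (force (force (cut 135 297 31))) (force (force (branch (cut 111 249 0) (branch (cut 351 0 98)
  (cut 351 0 140) (force (cut 351 0 178))) (branch (cut 351 0 63) (cut 29 325 85) (force
  (cut 351 0 154)))))) (force (force (cut 135 297 70)))) (branch (force (force (cut 135 297 62)))
  (force (force (cut 135 297 50))) (force (force (branch (cut 111 249 0) (cut 351 0 76) (branch
  (force (cut 351 0 55)) (cut 29 325 85) (cut 351 0 76))))))) (cut 146 316 76) (cut 146 316 21))
  (branch (branch (branch (force (force (branch (branch (force (cut 351 0 176)) (cut 351 0 182)
  (cut 351 0 154)) (branch (force (cut 351 0 76)) (cut 351 0 226) (cut 351 0 76))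
  (cut 351 0 154)))) (force (force (branch (branch (cut 351 0 63) (force (branch (cut 351 0 0)
  (cut 351 0 63) (force (force (branch (cut 87 261 50) (cut 87 261 50) (cut 99 249 0))))))
  (cut 351 0 154)) (branch (cut 351 0 63) (force (cut 351 0 154)) (cut 351 0 154))
  (cut 351 0 63)))) (force (force (branch (branch (cut 45 333 0) (force (cut 351 0 76))
  (cut 351 0 39)) (cut 351 0 76) (cut 351 0 154))))) (branch (force (force (branch (cut 31 332 0)
  (branch (force (cut 351 0 0)) (cut 351 0 140) (force (cut 351 0 140))) (cut 351 0 226)))) (force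
  (force (branch (cut 351 0 111) (branch (cut 351 0 239) (cut 351 0 111) (force (cut 351 0 140)))
  (cut 83 271 63)))) (force (force (branch (cut 111 249 0) (cut 91 290 76) (cut 83 271 63)))))
  (branch (force (force (cut 37 344 182))) (force (force (cut 140 304 0))) (force (force
  (cut 351 0 76))))) (cut 146 316 45) (cut 146 316 21)) (branch (branch (branch (force (force
  (branch (cut 91 290 62) (branch (cut 142 302 45) (cut 351 0 226) (cut 87 273 76))
  (cut 351 0 226)))) (force (force (branch (branch (cut 45 333 0) (force (branch (cut 351 0 78)
  (cut 351 0 63) (cut 351 0 62))) (force (cut 142 302 11))) (branch (cut 351 0 45) (force (branch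
  (cut 351 0 44) (cut 351 0 104) (cut 351 0 45))) (force (cut 351 0 45))) (cut 31 332 104))))
  (force (force (branch (branch (cut 351 0 45) (force (cut 150 318 39)) (cut 87 273 76))
  (cut 351 0 45) (cut 83 271 63))))) (branch (force (force (cut 351 0 226))) (force (force
  (cut 140 304 0))) (force (force (cut 140 304 0)))) (branch (force (force (branch (cut 31 332 0)
  (branch (force (branch (cut 351 0 0) (cut 351 0 26) (cut 351 0 140))) (cut 37 344 182)
  (cut 351 0 154)) (cut 351 0 154)))) (force (force (branch (cut 111 249 0) (branch (cut 45 333 0)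
  (force (branch (cut 351 0 0) (cut 351 0 26) (cut 351 0 140))) (cut 351 0 154))
  (cut 351 0 154)))) (force (force (branch (cut 351 0 222) (cut 31 332 26) (cut 351 0 154))))))
  (cut 146 316 45) (branch (branch (force (force (cut 351 0 182))) (cut 116 247 63) (force (force
  (cut 140 304 39)))) (branch (force (force (branch (cut 50 340 182) (cut 39 348 98)
  (cut 351 0 226)))) (cut 116 247 63) (cut 85 278 55)) (branch (force (force (cut 135 297 52)))
  (force (force (branch (cut 50 340 182) (cut 39 348 98) (branch (cut 351 0 63) (cut 132 255 44)
  (force (cut 351 0 154)))))) (cut 85 278 55)))))) (branch (branch (branch (cut 146 316 31)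
  (cut 146 316 76) (cut 146 316 21)) (branch (cut 146 316 31) (cut 146 316 76) (cut 146 316 21))
  (branch (branch (branch (force (force (cut 140 304 76))) (force (force (cut 140 304 76))) (force
  (force (cut 140 304 76)))) (branch (cut 31 332 0) (force (force (branch (cut 31 332 0) (branch
  (cut 351 0 239) (cut 87 273 62) (cut 132 255 31)) (cut 39 348 85)))) (force (force (branch
  (cut 351 0 222) (branch (cut 124 266 0) (cut 351 0 140) (cut 351 0 222)) (cut 31 332 93)))))
  (branch (cut 31 332 0) (force (force (cut 351 0 239))) (force (force (cut 93 294 62))))) (branch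
  (branch (force (force (cut 351 0 150))) (force (force (cut 140 304 52))) (cut 116 247 76))
  (branch (force (force (cut 135 297 37))) (force (force (cut 135 297 7))) (force (force
  (cut 140 304 0)))) (branch (force (force (branch (cut 31 332 0) (branch (force (cut 351 0 0))
  (force (branch (cut 351 0 76) (cut 351 0 111) (cut 351 0 62))) (cut 351 0 76)) (branch (force
  (cut 142 302 21)) (cut 150 318 52) (cut 116 247 76))))) (force (force (cut 135 297 29)))
  (cut 116 247 76))) (branch (branch (force (force (branch (cut 50 340 182) (branch (force
  (cut 351 0 106)) (cut 116 247 52) (cut 132 255 21)) (branch (cut 351 0 63) (cut 351 0 52)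
  (cut 351 0 21))))) (force (force (branch (cut 50 340 182) (branch (cut 351 0 239)
  (cut 132 255 44) (force (cut 351 0 76))) (cut 31 332 13)))) (force (force (branch
  (cut 351 0 222) (branch (force (cut 351 0 87)) (cut 351 0 140) (cut 351 0 222)) (branch
  (cut 351 0 63) (cut 132 255 44) (cut 351 0 215)))))) (branch (force (force (branch
  (cut 351 0 150) (branch (cut 351 0 150) (cut 37 344 15) (force (cut 351 0 109)))
  (cut 39 348 13)))) (force (force (branch (cut 351 0 202) (branch (cut 351 0 202) (cut 351 0 140)
  (force (cut 351 0 109))) (cut 31 332 13)))) (cut 85 278 55)) (branch (force (force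
  (cut 140 304 0))) (force (force (cut 132 255 44))) (cut 85 278 55))))) (branch (branch (branch
  (branch (force (force (cut 140 304 76))) (force (force (cut 135 297 78))) (force (force
  (cut 351 0 76)))) (branch (force (force (cut 351 0 85))) (force (force (cut 140 304 29))) (force
  (force (cut 351 0 222)))) (branch (force (force (cut 135 297 62))) (force (force
  (cut 351 0 239))) (force (force (branch (cut 351 0 222) (cut 351 0 76) (branch (cut 98 292 55)
  (cut 351 0 85) (cut 351 0 76))))))) (cut 146 316 7) (cut 146 316 44)) (branch (branch (branch
  (force (force (branch (cut 122 268 31) (cut 83 271 76) (cut 351 0 85)))) (force (force (branch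
  (branch (cut 351 0 63) (force (branch (cut 351 0 44) (cut 351 0 19) (force (force (branch
  (cut 87 261 50) (cut 87 261 50) (cut 99 249 0)))))) (force (cut 351 0 154))) (cut 351 0 239)
  (cut 351 0 63)))) (force (force (branch (branch (cut 87 273 63) (force (cut 351 0 76))
  (cut 351 0 76)) (cut 351 0 76) (cut 39 348 85))))) (branch (force (force (cut 140 304 13)))
  (force (force (cut 128 253 13))) (force (force (cut 140 304 13)))) (branch (force (force
  (cut 140 304 76))) (force (force (cut 140 304 76))) (force (force (cut 351 0 76)))))
  (cut 146 316 76) (branch (branch (force (force (cut 140 304 13))) (cut 31 332 13) (force (force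
  (cut 140 304 13)))) (branch (force (force (cut 132 255 44))) (cut 31 332 13) (cut 85 278 55))
  (branch (force (force (cut 140 304 29))) (force (force (cut 93 294 63))) (cut 85 278 55))))
  (branch (branch (branch (force (force (cut 140 304 13))) (force (force (cut 140 304 13))) (force
  (force (cut 140 304 13)))) (branch (force (force (branch (cut 31 332 0) (branch (force
  (cut 142 302 7)) (cut 37 344 182) (force (branch (cut 351 0 76) (cut 351 0 182)
  (cut 351 0 62)))) (branch (force (cut 351 0 0)) (cut 351 0 44) (force (branch (cut 351 0 44)
  (cut 351 0 31) (cut 351 0 91))))))) (force (force (branch (cut 99 279 78) (branch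
  (cut 87 273 63) (cut 351 0 44) (force (cut 150 318 29))) (cut 351 0 44)))) (force (force (branch
  (cut 351 0 222) (cut 31 332 178) (branch (cut 87 273 63) (cut 142 302 44) (cut 351 0 222))))))
  (branch (force (force (cut 140 304 29))) (force (force (cut 140 304 29))) (force (force
  (cut 351 0 222))))) (cut 146 316 7) (cut 146 316 44))) (branch (cut 146 316 76) (cut 146 316 76)
  (branch (branch (cut 140 304 76) (branch (force (cut 15 351 170)) (force (cut 15 351 111))
  (force (cut 15 351 55))) (cut 140 304 76)) (cut 146 316 76) (cut 146 316 55)))) (branch (branch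
  (branch (cut 146 316 62) (branch (branch (force (force (branch (cut 351 0 62) (cut 99 279 68)
  (branch (cut 37 344 165) (cut 351 0 62) (force (branch (cut 351 0 76) (cut 351 0 68)
  (cut 351 0 62))))))) (force (force (cut 37 344 165))) (force (force (branch (cut 39 348 99)
  (cut 351 0 76) (branch (cut 351 0 124) (force (branch (cut 351 0 76) (cut 351 0 111)
  (cut 351 0 62))) (cut 351 0 76)))))) (branch (force (force (cut 140 304 0))) (force (force
  (cut 140 304 0))) (force (force (cut 91 290 76)))) (branch (force (force (cut 140 304 29)))
  (force (force (cut 140 304 29))) (force (force (cut 351 0 222))))) (cut 146 316 21)) (branch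
  (branch (branch (force (force (cut 39 348 85))) (force (force (branch (branch (cut 351 0 239)
  (force (branch (cut 351 0 0) (force (force (branch (cut 87 261 63) (cut 99 249 0)
  (cut 87 261 63)))) (cut 351 0 62))) (cut 351 0 154)) (cut 351 0 239) (cut 351 0 154)))) (force
  (force (cut 39 348 85)))) (branch (cut 31 332 0) (force (force (cut 37 344 165))) (force (force
  (cut 140 304 62)))) (branch (cut 31 332 0) (force (force (cut 140 304 0))) (force (force
  (cut 91 290 76))))) (branch (branch (force (force (cut 135 297 37))) (force (force (branch
  (branch (cut 37 344 165) (cut 132 255 44) (force (cut 351 0 99))) (cut 91 290 76)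
  (cut 122 268 44)))) (force (force (cut 351 0 76)))) (branch (force (force (cut 135 297 68)))
  (force (force (cut 135 297 29))) (force (force (cut 140 304 29)))) (branch (force (force
  (cut 140 304 62))) (force (force (cut 351 0 165))) (force (force (cut 135 297 45)))))
  (cut 146 316 21)) (branch (cut 146 316 62) (branch (branch (force (force (branch (branch (force
  (cut 351 0 124)) (cut 351 0 62) (cut 98 292 68)) (cut 39 348 26) (cut 39 348 85)))) (force
  (force (branch (branch (force (cut 351 0 63)) (cut 45 333 26) (cut 351 0 222)) (cut 39 348 26)
  (cut 91 290 63)))) (force (force (cut 128 253 26)))) (branch (force (force (cut 351 0 62)))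
  (force (force (cut 140 304 62))) (force (force (cut 140 304 62)))) (branch (force (force
  (cut 140 304 0))) (force (force (cut 140 304 0))) (force (force (cut 140 304 0)))))
  (cut 146 316 44))) (branch (cut 146 316 44) (branch (cut 146 316 50) (branch (branch (force
  (force (branch (cut 351 0 150) (branch (cut 351 0 150) (force (cut 150 318 15)) (force
  (cut 351 0 68))) (branch (cut 351 0 150) (force (cut 351 0 44)) (force (cut 142 302 13))))))
  (force (force (branch (cut 39 348 99) (branch (cut 37 344 165) (force (branch (cut 351 0 76)
  (cut 351 0 63) (force (force (branch (branch (branch (branch (cut 370 0 148) (cut 5 344 45)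
  (force (cut 370 0 68))) (cut 99 260 57) (cut 370 0 148)) (branch (cut 52 426 7) (cut 99 260 57)
  (cut 370 0 148)) (cut 709 0 171)) (branch (branch (branch (cut 370 0 148) (cut 5 344 45) (force
  (cut 370 0 68))) (branch (cut 370 0 148) (cut 5 344 45) (force (cut 370 0 165)))
  (cut 370 0 148)) (branch (cut 52 426 7) (branch (cut 370 0 148) (cut 5 344 45) (force
  (cut 370 0 165))) (cut 370 0 148)) (cut 709 0 171)) (branch (branch (branch (cut 370 0 148)
  (force (cut 50 332 99)) (force (cut 370 0 68))) (cut 99 260 57) (cut 370 0 148)) (branch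
  (cut 52 426 7) (cut 99 260 57) (cut 370 0 148)) (cut 709 0 171))))))) (cut 351 0 76))
  (cut 31 332 13)))) (force (force (branch (branch (cut 142 302 11) (force (cut 11 351 111))
  (cut 351 0 76)) (cut 351 0 76) (branch (force (cut 11 351 165)) (force (cut 351 0 44))
  (cut 351 0 76)))))) (cut 140 304 29) (cut 140 304 29)) (cut 146 316 44)) (cut 146 316 44))
  (branch (branch (branch (branch (force (force (cut 39 348 85))) (force (force (cut 351 0 154)))
  (force (force (cut 128 253 26)))) (branch (cut 116 247 62) (force (force (branch (cut 351 0 62)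
  (branch (cut 351 0 239) (cut 351 0 62) (force (cut 351 0 76))) (cut 39 348 85)))) (force (force
  (branch (cut 351 0 62) (cut 91 290 76) (branch (cut 116 247 11) (cut 351 0 62)
  (cut 351 0 222)))))) (branch (cut 116 247 62) (force (force (cut 140 304 76))) (force (force
  (cut 91 290 76))))) (cut 146 316 76) (cut 146 316 44)) (branch (cut 146 316 11) (cut 146 316 76)
  (branch (branch (force (force (cut 37 344 182))) (force (force (cut 132 255 44))) (force (force
  (cut 91 290 76)))) (branch (force (force (cut 140 304 29))) (force (force (cut 140 304 29)))
  (cut 85 278 55)) (branch (force (force (branch (cut 31 332 182) (branch (cut 351 0 106)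
  (cut 351 0 189) (cut 351 0 76)) (cut 99 279 55)))) (force (force (branch (cut 50 340 182)
  (branch (cut 351 0 239) (cut 351 0 140) (cut 351 0 76)) (cut 351 0 154)))) (cut 85 278 55))))
  (branch (cut 146 316 11) (branch (branch (force (force (cut 135 297 15))) (force (force (branch
  (branch (cut 142 302 11) (cut 45 333 26) (cut 351 0 154)) (cut 31 332 26) (cut 351 0 154))))
  (cut 31 332 26)) (branch (force (force (cut 351 0 226))) (force (force (cut 93 294 76))) (force
  (force (branch (cut 351 0 222) (cut 31 332 26) (branch (force (branch (cut 351 0 44)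
  (cut 351 0 29) (cut 351 0 45))) (cut 351 0 44) (cut 351 0 222)))))) (branch (force (force
  (cut 140 304 26))) (force (force (cut 351 0 154))) (cut 31 332 26))) (cut 146 316 44))))

open SearchTree in
/-- The search from a labelling of the first hyperplane. -/
def treeThree : SearchTree :=
  branch (branch (cut 140 304 21) (branch (branch (branch (cut 140 304 21) (branch (force (force
  (branch (cut 142 302 62) (branch (force (branch (cut 351 0 85) (cut 351 0 106) (cut 351 0 220)))
  (cut 87 273 7) (cut 150 318 21)) (cut 31 332 85)))) (force (force (branch (cut 39 348 11)
  (cut 150 318 7) (branch (cut 142 302 63) (cut 37 344 104) (force (branch (cut 351 0 44)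
  (cut 351 0 104) (cut 351 0 50))))))) (force (force (branch (cut 31 332 163) (branch
  (cut 351 0 228) (cut 142 302 62) (force (branch (cut 351 0 39) (cut 351 0 228) (cut 351 0 50))))
  (branch (cut 116 247 11) (cut 142 302 62) (cut 150 318 21)))))) (cut 140 304 21))
  (cut 146 316 76) (cut 146 316 63)) (cut 146 316 63) (cut 146 316 63)) (branch (cut 146 316 76)
  (cut 146 316 76) (branch (branch (cut 140 304 21) (branch (force (force (branch (branch
  (cut 351 0 11) (cut 351 0 62) (cut 37 344 91)) (branch (cut 87 273 11) (cut 351 0 208)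
  (cut 351 0 128)) (cut 31 332 176)))) (force (force (branch (branch (cut 351 0 11)
  (cut 351 0 111) (cut 132 255 39)) (cut 91 290 7) (branch (cut 351 0 63) (cut 106 284 44)
  (cut 351 0 135))))) (force (force (branch (cut 31 332 11) (branch (cut 116 247 11)
  (cut 351 0 208) (cut 351 0 76)) (branch (cut 351 0 124) (cut 45 333 163) (cut 351 0 135))))))
  (cut 140 304 21)) (cut 146 316 76) (cut 146 316 63)))) (branch (branch (cut 146 316 76)
  (cut 146 316 76) (branch (cut 146 316 62) (cut 146 316 76) (branch (cut 140 304 21) (branch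
  (force (force (branch (cut 142 302 62) (branch (force (branch (cut 351 0 37) (cut 351 0 106)
  (cut 351 0 52))) (cut 37 344 15) (cut 150 318 21)) (cut 122 268 52)))) (force (force (branch
  (cut 99 279 62) (cut 150 318 7) (branch (cut 142 302 63) (cut 106 284 44) (force (branch
  (cut 351 0 44) (cut 351 0 233) (cut 351 0 52))))))) (force (force (branch (cut 31 332 163)
  (branch (cut 351 0 87) (cut 142 302 62) (force (branch (cut 351 0 87) (cut 351 0 99)
  (cut 351 0 222)))) (branch (cut 37 344 87) (cut 142 302 62) (cut 150 318 21))))))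
  (cut 140 304 21)))) (branch (cut 146 316 76) (cut 146 316 76) (branch (branch (branch (force
  (force (branch (cut 39 348 11) (cut 111 249 76) (cut 122 268 52)))) (force (force (branch
  (cut 39 348 11) (cut 31 332 186) (cut 99 279 63)))) (force (force (branch (cut 91 290 11)
  (cut 111 249 76) (cut 99 279 63))))) (cut 140 304 7) (cut 140 304 7)) (cut 146 316 76)
  (cut 146 316 63))) (cut 146 316 76)) (branch (branch (cut 146 316 62) (branch (cut 146 316 62)
  (cut 146 316 76) (branch (cut 140 304 21) (branch (force (force (branch (branch (cut 351 0 194)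
  (cut 351 0 62) (cut 351 0 91)) (branch (force (cut 351 0 37)) (cut 351 0 148) (cut 351 0 128))
  (cut 91 290 21)))) (force (force (branch (branch (cut 351 0 194) (cut 351 0 111) (force
  (cut 351 0 233))) (cut 122 268 29) (branch (cut 351 0 63) (cut 351 0 44) (cut 351 0 21)))))
  (force (force (branch (cut 31 332 163) (cut 91 290 76) (branch (cut 351 0 124) (force
  (cut 351 0 93)) (cut 351 0 21)))))) (cut 140 304 21))) (cut 146 316 62)) (branch (branch
  (cut 146 316 50) (cut 146 316 76) (cut 146 316 44)) (branch (cut 146 316 50) (cut 146 316 29)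
  (cut 146 316 63)) (branch (cut 146 316 62) (cut 146 316 29) (cut 146 316 44))) (branch
  (cut 146 316 76) (cut 146 316 76) (branch (cut 146 316 62) (cut 146 316 76) (branch
  (cut 140 304 11) (cut 140 304 11) (branch (force (force (branch (branch (force (branch
  (cut 351 0 241) (cut 351 0 106) (cut 351 0 91))) (cut 142 302 62) (cut 37 344 91))
  (cut 111 249 76) (cut 150 318 21)))) (force (force (branch (branch (cut 150 318 11)
  (cut 106 284 44) (cut 142 302 76)) (cut 91 290 7) (branch (force (branch (cut 351 0 44)
  (cut 351 0 29) (cut 351 0 98))) (cut 351 0 44) (cut 142 302 76))))) (force (force (branch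
  (cut 31 332 163) (cut 142 302 76) (branch (cut 150 318 11) (force (branch (cut 351 0 44)
  (cut 351 0 33) (cut 351 0 222))) (cut 45 333 186))))))))))

open SearchTree in
/-- The search from a labelling of the first hyperplane. -/
def treeFour : SearchTree :=
  branch (branch (branch (branch (cut 146 316 62) (cut 146 316 15) (cut 146 316 21)) (branch
  (cut 146 316 0) (cut 146 316 76) (cut 146 316 21)) (branch (cut 146 316 0) (cut 146 316 15)
  (cut 146 316 63))) (branch (branch (branch (cut 140 304 50) (branch (force (force (branch
  (branch (cut 351 0 0) (cut 351 0 62) (cut 351 0 50)) (cut 122 268 15) (branch (cut 351 0 176)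
  (cut 351 0 93) (force (cut 351 0 135)))))) (force (force (branch (cut 91 290 50) (branch
  (cut 351 0 220) (force (cut 351 0 7)) (cut 351 0 186)) (branch (cut 351 0 63) (cut 351 0 93)
  (cut 351 0 196))))) (force (force (branch (branch (force (cut 351 0 194)) (cut 351 0 163)
  (cut 351 0 50)) (cut 91 290 76) (cut 31 332 93))))) (cut 140 304 50)) (cut 146 316 76)
  (cut 146 316 63)) (cut 146 316 63) (cut 146 316 63)) (branch (cut 146 316 76) (cut 146 316 76)
  (branch (branch (branch (force (force (branch (branch (cut 351 0 0) (force (branch (cut 351 0 0)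
  (cut 351 0 189) (cut 351 0 15))) (cut 142 302 76)) (cut 91 290 37) (branch (cut 106 284 0)
  (cut 150 318 33) (cut 142 302 76))))) (force (force (branch (cut 150 318 50) (cut 111 249 76)
  (branch (cut 142 302 63) (force (branch (cut 351 0 154) (cut 351 0 146) (cut 351 0 208)))
  (cut 37 344 186))))) (force (force (branch (branch (force (branch (cut 351 0 0) (cut 351 0 146)
  (cut 351 0 11))) (cut 150 318 33) (cut 45 333 83)) (cut 142 302 76) (cut 31 332 93)))))
  (cut 140 304 33) (cut 140 304 33)) (cut 146 316 76) (cut 146 316 63)))) (branch (branch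
  (cut 146 316 76) (cut 146 316 76) (branch (cut 146 316 62) (cut 146 316 76) (branch
  (cut 140 304 37) (cut 140 304 37) (branch (force (force (branch (cut 99 279 62) (cut 31 332 106)
  (cut 39 348 21)))) (force (force (branch (cut 122 268 19) (cut 111 249 76) (cut 39 348 21))))
  (force (force (branch (cut 99 279 62) (cut 111 249 76) (cut 91 290 33)))))))) (branch
  (cut 146 316 76) (cut 146 316 76) (branch (branch (cut 140 304 50) (branch (force (force (branch
  (branch (cut 106 284 0) (cut 142 302 62) (force (branch (cut 351 0 0) (cut 351 0 19)
  (cut 351 0 135)))) (cut 150 318 37) (cut 99 279 63)))) (force (force (branch (cut 122 268 19)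
  (branch (cut 37 344 19) (force (branch (cut 351 0 7) (cut 351 0 19) (cut 351 0 208)))
  (cut 150 318 50)) (cut 142 302 63)))) (force (force (branch (branch (cut 142 302 63)
  (cut 37 344 163) (cut 150 318 50)) (branch (cut 142 302 63) (cut 351 0 200) (force (branch
  (cut 351 0 200) (cut 351 0 146) (cut 351 0 135)))) (cut 31 332 93))))) (cut 140 304 50))
  (cut 146 316 76) (cut 146 316 63))) (cut 146 316 76)) (branch (branch (cut 146 316 62) (branch
  (cut 146 316 62) (cut 146 316 76) (branch (cut 140 304 50) (branch (force (force (branch (branch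
  (cut 37 344 176) (cut 142 302 62) (force (branch (cut 351 0 0) (cut 351 0 21) (cut 351 0 210))))
  (cut 150 318 37) (cut 39 348 21)))) (force (force (branch (cut 31 332 171) (branch
  (cut 87 273 37) (force (branch (cut 351 0 202) (cut 351 0 148) (cut 351 0 140)))
  (cut 150 318 50)) (cut 142 302 63)))) (force (force (branch (branch (cut 142 302 63)
  (cut 116 247 33) (cut 150 318 50)) (branch (cut 142 302 63) (cut 351 0 140) (force (branch
  (cut 351 0 5) (cut 351 0 21) (cut 351 0 140)))) (cut 31 332 93))))) (cut 140 304 50)))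
  (cut 146 316 62)) (cut 140 304 50) (branch (cut 146 316 76) (cut 146 316 76) (branch
  (cut 146 316 62) (cut 146 316 76) (branch (cut 140 304 50) (branch (force (force (branch (branch
  (cut 106 284 0) (cut 351 0 62) (cut 351 0 233)) (cut 91 290 37) (branch (cut 351 0 176)
  (cut 351 0 33) (cut 132 255 5))))) (force (force (branch (cut 31 332 83) (branch (cut 351 0 106)
  (cut 87 273 33) (cut 351 0 186)) (branch (cut 351 0 63) (cut 351 0 33) (cut 37 344 186)))))
  (force (force (branch (branch (cut 45 333 106) (cut 351 0 163) (cut 351 0 233)) (branch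
  (cut 351 0 106) (cut 116 247 33) (cut 351 0 76)) (cut 31 332 5))))) (cut 140 304 50)))))

/-- Representatives of the pairs of opposite dual vectors. -/
def duals : List ℕ :=
  [366, 370, 356, 418, 526, 148, 364, 697, 643, 481, 691, 637, 475, 619, 457, 403]

/-- The effect of the rotation on the forms of the first hyperplane. -/
def rotTable : List (ℕ × ℕ × ℕ) :=
  [(13, 1, 0), (12, 2, 1), (8, 1, 1), (1, 2, 1), (10, 1, 1), (9, 2, 1), (0, 2, 1), (5, 1, 0),
  (14, 1, 1), (7, 2, 1), (11, 1, 1), (4, 1, 1), (3, 1, 0), (6, 2, 1), (2, 1, 1)]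

/-- The effect of the exchange on the forms of the first hyperplane. -/
def swapTable : List (ℕ × ℕ × ℕ) :=
  [(0, 2, 1), (5, 1, 0), (8, 1, 2), (3, 2, 1), (4, 2, 0), (1, 1, 0), (7, 1, 0), (6, 1, 0),
  (2, 1, 1), (9, 2, 1), (10, 2, 2), (11, 2, 1), (13, 2, 1), (12, 2, 1), (14, 1, 0)]

end Array140

/-! ### Labellings, their symmetries, and the outcome of the search -/

namespace Array140

/-- The number of points on the line that a form stands for. -/
def mult (c : Fin 6 → ZMod 3) : ℕ := (7 - (duals.filter fun y => c ⬝ᵥ vec y = 0).length) / 3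

/-- The contribution of a form with `m` points to the number of zeros. -/
def weight (m : ℕ) (a : ZMod 3) : ℕ :=
  if m = 1 then (if a = 0 then 1 else 0) else if m = 2 then (if a = 0 then 0 else 1) else 0

/-- Labels of the forms, such that every functional has `16` or `25` zeros; each is counted six
times, for the six representatives of a form. -/
structure IsLabelling (κ : (Fin 6 → ZMod 3) → ZMod 3) : Prop where
  neg : ∀ c, κ (-c) = -κ c
  add_one : ∀ c, κ (c + 1) = κ c
  sum_weight : ∀ η : Fin 6 → ZMod 3, ∑ i, η i = 0 →
    ∑ c, weight (mult c) (κ c + c ⬝ᵥ η) = 96 ∨ ∑ c, weight (mult c) (κ c + c ⬝ᵥ η) = 150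

theorem vec_injOn : Set.InjOn vec (range 729 : Finset ℕ) := by
  intro m hm n hn h
  simp only [coe_range, Set.mem_Iio] at hm hn
  have h' : ∀ i : Fin 6, m / 3 ^ (i : ℕ) % 3 = n / 3 ^ (i : ℕ) % 3 := fun i =>
    (ZMod.natCast_eq_natCast_iff' _ _ _).mp (congrFun h i)
  have h0 := h' 0; have h1 := h' 1; have h2 := h' 2; have h3 := h' 3; have h4 := h' 4
  have h5 := h' 5
  simp only [Fin.coe_ofNat_eq_mod] at h0 h1 h2 h3 h4 h5
  norm_num at h0 h1 h2 h3 h4 h5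
  omega

theorem image_vec : (range 729).image vec = univ := by
  rw [← card_eq_iff_eq_univ, card_image_of_injOn vec_injOn]
  simp

theorem exists_vec_eq (c : Fin 6 → ZMod 3) : ∃ n < 729, vec n = c := by
  have := mem_univ c
  rw [← image_vec, mem_image] at this
  simpa using this

theorem sum_vec (g : (Fin 6 → ZMod 3) → ℕ) : ∑ c, g c = ∑ n ∈ range 729, g (vec n) := by
  rw [← image_vec, sum_image vec_injOn]

/-- The code of the vector with the given coordinates. -/
def code (a₀ a₁ a₂ a₃ a₄ a₅ : ℕ) : ℕ :=
  a₀ % 3 + 3 * (a₁ % 3) + 9 * (a₂ % 3) + 27 * (a₃ % 3) + 81 * (a₄ % 3) + 243 * (a₅ % 3)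

theorem vec_code (a₀ a₁ a₂ a₃ a₄ a₅ : ℕ) :
    vec (code a₀ a₁ a₂ a₃ a₄ a₅) = ![(a₀ : ZMod 3), a₁, a₂, a₃, a₄, a₅] := by
  have h : ∀ (m a : ℕ), m % 3 = a % 3 → (m : ZMod 3) = a := fun m a =>
    (ZMod.natCast_eq_natCast_iff' m a 3).mpr
  ext i
  fin_cases i <;> refine h _ _ ?_ <;> norm_num [code] <;> omega

theorem vec_eq (n : ℕ) : vec n = ![((n : ℕ) : ZMod 3), (n / 3 : ℕ), (n / 9 : ℕ), (n / 27 : ℕ),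
    (n / 81 : ℕ), (n / 243 : ℕ)] := by
  ext i
  fin_cases i <;> simp [vec]

/-- The code of `s • vec n + t • 1`. -/
def affCode (s t n : ℕ) : ℕ :=
  code (s * n + t) (s * (n / 3) + t) (s * (n / 9) + t) (s * (n / 27) + t) (s * (n / 81) + t)
    (s * (n / 243) + t)

theorem vec_affCode (s t n : ℕ) : vec (affCode s t n) = s • vec n + t • 1 := by
  rw [affCode, vec_code, vec_eq]
  ext i
  fin_cases i <;> simp

/-- The multiplicity of a form given by its code. -/
def multN (n : ℕ) : ℕ :=
  (7 - (duals.filter fun y => Nat.beq (dotN (pack n) (packRev y)) 0).length) / 3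

theorem mult_vec (n : ℕ) : mult (vec n) = multN n := by
  unfold mult multN
  congr 3
  refine List.filter_congr fun y _ => ?_
  rw [Bool.eq_iff_iff, Nat.beq_eq, dotN_pack_eq_zero, decide_eq_true_iff]

theorem sum_vec_of_mem_duals {y : ℕ} (hy : y ∈ duals) : ∑ i, vec y i = 0 :=
  sum_vec_of_sumTest ((List.all_eq_true.mp (by decide : duals.all sumTest = true)) y hy)

theorem mult_neg (c : Fin 6 → ZMod 3) : mult (-c) = mult c := by
  simp [mult]

/-- The vectors in `duals` have coordinate sum zero. -/
theorem mult_add_one (c : Fin 6 → ZMod 3) : mult (c + 1) = mult c := by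
  unfold mult
  congr 3
  refine List.filter_congr fun y hy => ?_
  rw [add_dotProduct, one_dotProduct, sum_vec_of_mem_duals hy, add_zero]

theorem weight_neg (m : ℕ) (a : ZMod 3) : weight m (-a) = weight m a := by
  simp [weight]

/-- The codes of the representatives of a form. -/
def orbitCodes (n : ℕ) : List ℕ :=
  [affCode 1 0 n, affCode 1 1 n, affCode 1 2 n, affCode 2 0 n, affCode 2 1 n, affCode 2 2 n]

/-- Together with `mem_orbitCodes`: the 63 forms represent the vectors of nonzero multiplicity up to
sign and constants, each six times. -/
theorem nodup_orbitCodes : (forms.flatMap fun v => orbitCodes v.1).Nodup := by decide +kernel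

theorem multN_forms : ∀ v ∈ forms, multN v.1 = bif v.2 then 2 else 1 := by decide +kernel

theorem mem_orbitCodes : ∀ n < 729, multN n = 0 ∨ n ∈ forms.flatMap fun v => orbitCodes v.1 := by
  decide +kernel

namespace IsLabelling

variable {κ : (Fin 6 → ZMod 3) → ZMod 3}

theorem sum_weight_orbitCodes (h : IsLabelling κ) {η : Fin 6 → ZMod 3} (hη : ∑ i, η i = 0) (n : ℕ) :
    ((orbitCodes n).map fun m => weight (mult (vec m)) (κ (vec m) + vec m ⬝ᵥ η)).sum =
      6 * weight (mult (vec n)) (κ (vec n) + vec n ⬝ᵥ η) := by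
  set g : (Fin 6 → ZMod 3) → ℕ := fun c => weight (mult c) (κ c + c ⬝ᵥ η)
  have h1 : ∀ c, g (c + 1) = g c := fun c => by
    simp only [g]
    rw [mult_add_one, h.add_one, add_dotProduct, one_dotProduct, hη, add_zero]
  have h2 : ∀ c, g (-c) = g c := fun c => by
    simp only [g]
    rw [mult_neg, h.neg, neg_dotProduct, ← neg_add, weight_neg]
  have e1 : ∀ c : Fin 6 → ZMod 3, 2 • c = -c := fun c => by
    have : ∀ a : ZMod 3, 2 • a = -a := by decide
    exact funext fun i => this (c i)
  have e2 : ∀ c : Fin 6 → ZMod 3, g (c + 2 • 1) = g c := fun c => by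
    rw [two_nsmul, ← add_assoc, h1, h1]
  simp only [orbitCodes, List.map_cons, List.map_nil, List.sum_cons, List.sum_nil, vec_affCode]
  change g _ + (g _ + (g _ + (g _ + (g _ + (g _ + 0))))) = 6 * g _
  simp only [zero_smul, add_zero, one_smul, e2, h1]
  simp only [e1, h2]
  ring

theorem zeros_eq (h : IsLabelling κ) {η : Fin 6 → ZMod 3} (hη : ∑ i, η i = 0) :
    zeros κ forms η = 16 ∨ zeros κ forms η = 25 := by
  have hs : ∑ c, weight (mult c) (κ c + c ⬝ᵥ η) = 6 * zeros κ forms η := by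
    rw [sum_vec, ← sum_subset (s₁ := (forms.flatMap fun v => orbitCodes v.1).toFinset.filter (· < 729))
      (by
        intro n hn
        rw [mem_filter] at hn
        exact mem_range.mpr hn.2)
      (by
        intro n hn hn'
        rw [mem_range] at hn
        rw [mem_filter, List.mem_toFinset, not_and] at hn'
        rcases mem_orbitCodes n hn with h0 | h0
        · rw [mult_vec, h0]
          rfl
        · exact absurd hn (hn' h0)), filter_true_of_mem (by
        intro n hn
        rw [List.mem_toFinset, List.mem_flatMap] at hn
        obtain ⟨v, -, hn⟩ := hn
        simp only [orbitCodes, List.mem_cons, List.not_mem_nil, or_false] at hn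
        rcases hn with rfl | rfl | rfl | rfl | rfl | rfl <;> (unfold affCode code; omega)),
      List.sum_toFinset _ nodup_orbitCodes, List.map_flatMap, List.flatMap, List.sum_flatten, List.map_map]
    simp only [Function.comp_def, h.sum_weight_orbitCodes hη]
    rw [List.sum_map_mul_left, zeros]
    refine congrArg (fun l => 6 * List.sum l) (List.map_congr_left fun v hv => ?_)
    rw [mult_vec, multN_forms v hv]
    cases v.2 <;> rfl
  have := h.sum_weight η hη
  omega

/-- Adding a functional to the labels only translates the argument η. -/
theorem add_dotProduct (h : IsLabelling κ) {ζ : Fin 6 → ZMod 3} (hζ : ∑ i, ζ i = 0) :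
    IsLabelling fun c => κ c + c ⬝ᵥ ζ where
  neg c := by rw [h.neg, neg_dotProduct, neg_add]
  add_one c := by rw [h.add_one, _root_.add_dotProduct, one_dotProduct, hζ, add_zero]
  sum_weight η hη := by
    have := h.sum_weight (ζ + η) (by simp [sum_add_distrib, hζ, hη])
    simpa only [dotProduct_add, ← add_assoc] using this

theorem neg_label (h : IsLabelling κ) : IsLabelling fun c => -κ c where
  neg c := by rw [h.neg]
  add_one c := by rw [h.add_one]
  sum_weight η hη := by
    have := h.sum_weight (-η) (by simp [hη])
    have e : ∀ c : Fin 6 → ZMod 3, weight (mult c) (-κ c + c ⬝ᵥ η) =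
        weight (mult c) (κ c + c ⬝ᵥ -η) := fun c => by
      rw [← weight_neg, neg_add, neg_neg, dotProduct_neg]
    simpa only [e] using this

theorem comp (h : IsLabelling κ) (σ : Equiv.Perm (Fin 6)) (hσ : ∀ c, mult (c ∘ σ) = mult c) :
    IsLabelling fun c => κ (c ∘ σ) where
  neg c := h.neg (c ∘ σ)
  add_one c := h.add_one (c ∘ σ)
  sum_weight η hη := by
    have := h.sum_weight (η ∘ σ) (by simpa using (Equiv.sum_comp σ η).trans hη)
    have e : ∑ c : Fin 6 → ZMod 3, weight (mult c) (κ (c ∘ σ) + c ⬝ᵥ η) =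
        ∑ c, weight (mult c) (κ c + c ⬝ᵥ (η ∘ σ)) := by
      rw [← Equiv.sum_comp (Equiv.arrowCongr σ.symm (Equiv.refl (ZMod 3)))
        fun c => weight (mult c) (κ c + c ⬝ᵥ (η ∘ σ))]
      refine sum_congr rfl fun c _ => ?_
      change _ = weight (mult (c ∘ σ)) (κ (c ∘ σ) + (c ∘ σ) ⬝ᵥ (η ∘ σ))
      rw [hσ, comp_equiv_dotProduct_comp_equiv]
    rw [e]
    exact this

end IsLabelling

end Array140

namespace Array140

theorem agree_iff {κ : (Fin 6 → ZMod 3) → ZMod 3} : ∀ {F : List (ℕ × Bool)} {l : List ℕ},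
    Agree κ F l ↔ ∀ i < F.length, i < l.length →
      ((l.getD i 0 : ℕ) : ZMod 3) = κ (vec (F.getD i (0, false)).1)
  | [], _ => by simp [Agree]
  | _ :: _, [] => by simp [Agree]
  | v :: F, k :: ks => by
    rw [Agree, agree_iff]
    constructor
    · rintro ⟨h0, h⟩ (_ | i) hi hi'
      · exact h0
      · exact h i (Nat.lt_of_succ_lt_succ hi) (Nat.lt_of_succ_lt_succ hi')
    · intro h
      exact ⟨h 0 (Nat.succ_pos _) (Nat.succ_pos _), fun i hi hi' =>
        h (i + 1) (Nat.succ_lt_succ hi) (Nat.succ_lt_succ hi')⟩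

/-- The list occurs as the list of the first labels of a labelling. -/
def Occurs (l : List ℕ) : Prop := ∃ κ, IsLabelling κ ∧ Agree κ forms l

/-- Addition of a multiple of a linear functional to the labels. -/
def shift (z m : ℕ) (l : List ℕ) : List ℕ :=
  List.zipWith (fun v k => (k + m * dotN v.1 (packRev z)) % 3) packedForms l

theorem packed_forms : packed forms = packedForms := by decide +kernel

theorem agree_zipWith {κ : (Fin 6 → ZMod 3) → ZMod 3} (z m : ℕ) : ∀ {F : List (ℕ × Bool)}
    {l : List ℕ}, Agree κ F l → Agree (fun c => κ c + c ⬝ᵥ (m • vec z)) F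
      (List.zipWith (fun v k => (k + m * dotN v.1 (packRev z)) % 3) (packed F) l)
  | [], _, _ => trivial
  | _ :: _, [], _ => trivial
  | v :: F, k :: ks, h => by
    refine ⟨?_, agree_zipWith z m h.2⟩
    rw [ZMod.natCast_mod, Nat.cast_add, Nat.cast_mul, dotN_pack, h.1]
    simp only [dotProduct_smul]
    rw [nsmul_eq_mul]

theorem Occurs.shift {z : ℕ} (hz : sumTest z = true) (m : ℕ) {l : List ℕ} (h : Occurs l) :
    Occurs (shift z m l) := by
  obtain ⟨κ, hκ, hl⟩ := h
  refine ⟨_, hκ.add_dotProduct (ζ := m • vec z) ?_, ?_⟩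
  · simp [← mul_sum, sum_vec_of_sumTest hz]
  · rw [Array140.shift, ← packed_forms]
    exact agree_zipWith z m hl

/-- Negation of the labels. -/
def negate (l : List ℕ) : List ℕ := l.map fun k => 2 * k % 3

theorem agree_negate {κ : (Fin 6 → ZMod 3) → ZMod 3} : ∀ {F : List (ℕ × Bool)} {l : List ℕ},
    Agree κ F l → Agree (fun c => -κ c) F (negate l)
  | [], _, _ => trivial
  | _ :: _, [], _ => trivial
  | v :: F, k :: ks, h => by
    refine ⟨?_, agree_negate h.2⟩
    have : ∀ a : ZMod 3, 2 * a = -a := by decide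
    rw [ZMod.natCast_mod, Nat.cast_mul, h.1]
    exact this _

theorem Occurs.negate {l : List ℕ} (h : Occurs l) : Occurs (negate l) := by
  obtain ⟨κ, hκ, hl⟩ := h
  exact ⟨_, hκ.neg_label, agree_negate hl⟩

/-- A permutation of the labels, up to sign. -/
def permute (tab : List (ℕ × ℕ × ℕ)) (l : List ℕ) : List ℕ :=
  tab.map fun p => p.2.1 * l.getD p.1 0 % 3

theorem IsLabelling.smul_add {κ : (Fin 6 → ZMod 3) → ZMod 3} (h : IsLabelling κ) {s : ℕ}
    (hs : s = 1 ∨ s = 2) (t : ℕ) (c : Fin 6 → ZMod 3) : κ (s • c + t • 1) = s * κ c := by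
  have ht : ∀ c, κ (c + t • 1) = κ c := fun c => by
    induction t with
    | zero => rw [zero_smul, add_zero]
    | succ t ih => rw [succ_nsmul, ← add_assoc, h.add_one, ih]
  rw [ht]
  rcases hs with rfl | rfl
  · simp
  · have h2 : ∀ a : ZMod 3, 2 • a = -a := by decide
    rw [show 2 • c = -c from funext fun i => h2 (c i), h.neg, ← h2, nsmul_eq_mul]

/-- An entry (i', a, t) of the table expresses the permuted form as a times form i' plus t times the
all-one vector, so its label is a times that of form i'. -/
theorem Occurs.permute {l : List ℕ} (h : Occurs l) {tab : List (ℕ × ℕ × ℕ)}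
    (σ : Equiv.Perm (Fin 6)) (hσ : ∀ c : Fin 6 → ZMod 3, mult (c ∘ σ) = mult c)
    (ht : ∀ i < tab.length, (tab.getD i 0).1 < l.length ∧ (tab.getD i 0).1 < forms.length ∧
      ((tab.getD i 0).2.1 = 1 ∨ (tab.getD i 0).2.1 = 2) ∧
      vec (forms.getD i (0, false)).1 ∘ σ =
        vec (affCode (tab.getD i 0).2.1 (tab.getD i 0).2.2 (forms.getD (tab.getD i 0).1 (0, false)).1)) :
    Occurs (permute tab l) := by
  obtain ⟨κ, hκ, hl⟩ := h
  rw [agree_iff] at hl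
  refine ⟨_, hκ.comp σ hσ, agree_iff.mpr fun i _ hi' => ?_⟩
  rw [Array140.permute, List.length_map] at hi'
  obtain ⟨h1, h2, h3, h4⟩ := ht i hi'
  rw [h4, vec_affCode, hκ.smul_add h3, ← hl _ h2 h1, Array140.permute, List.getD_eq_getElem _ _
    (by simpa using hi'), List.getElem_map, ← List.getD_eq_getElem _ 0 hi', ZMod.natCast_mod,
    Nat.cast_mul]

/-- The rotation of the first three coordinates. -/
def rot : Equiv.Perm (Fin 6) := ⟨![1, 2, 0, 3, 4, 5], ![2, 0, 1, 3, 4, 5], by decide, by decide⟩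

/-- The exchange of the first three coordinates with the last three. -/
def swap : Equiv.Perm (Fin 6) := ⟨![3, 4, 5, 0, 1, 2], ![3, 4, 5, 0, 1, 2], by decide, by decide⟩

theorem vec_comp_rot (n : ℕ) :
    vec n ∘ rot = vec (code (n / 3) (n / 9) n (n / 27) (n / 81) (n / 243)) := by
  rw [vec_code, vec_eq]
  ext i
  fin_cases i <;> rfl

theorem vec_comp_swap (n : ℕ) :
    vec n ∘ swap = vec (code (n / 27) (n / 81) (n / 243) n (n / 3) (n / 9)) := by
  rw [vec_code, vec_eq]
  ext i
  fin_cases i <;> rfl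

/-- The rotation is a symmetry of `duals` up to sign; the effect on multiplicities is checked on all
codes. -/
theorem mult_comp_rot (c : Fin 6 → ZMod 3) : mult (c ∘ rot) = mult c := by
  obtain ⟨n, hn, rfl⟩ := exists_vec_eq c
  rw [vec_comp_rot, mult_vec, mult_vec]
  revert n
  decide +kernel

theorem mult_comp_swap (c : Fin 6 → ZMod 3) : mult (c ∘ swap) = mult c := by
  obtain ⟨n, hn, rfl⟩ := exists_vec_eq c
  rw [vec_comp_swap, mult_vec, mult_vec]
  revert n
  decide +kernel

theorem Occurs.rot {l : List ℕ} (h : Occurs l) (hl : l.length = 15) :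
    Occurs (Array140.permute rotTable l) := by
  refine h.permute Array140.rot mult_comp_rot ?_
  simp only [vec_comp_rot, hl]
  have : ∀ i < rotTable.length, (rotTable.getD i 0).1 < 15 ∧ (rotTable.getD i 0).1 < forms.length ∧
      ((rotTable.getD i 0).2.1 = 1 ∨ (rotTable.getD i 0).2.1 = 2) ∧
      (fun n => code (n / 3) (n / 9) n (n / 27) (n / 81) (n / 243)) (forms.getD i (0, false)).1 =
        affCode (rotTable.getD i 0).2.1 (rotTable.getD i 0).2.2
          (forms.getD (rotTable.getD i 0).1 (0, false)).1 := by
    decide +kernel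
  exact fun i hi => ⟨(this i hi).1, (this i hi).2.1, (this i hi).2.2.1,
    congrArg vec (this i hi).2.2.2⟩

theorem Occurs.swap {l : List ℕ} (h : Occurs l) (hl : l.length = 15) :
    Occurs (Array140.permute swapTable l) := by
  refine h.permute Array140.swap mult_comp_swap ?_
  simp only [vec_comp_swap, hl]
  have : ∀ i < swapTable.length, (swapTable.getD i 0).1 < 15 ∧ (swapTable.getD i 0).1 < forms.length ∧
      ((swapTable.getD i 0).2.1 = 1 ∨ (swapTable.getD i 0).2.1 = 2) ∧
      (fun n => code (n / 27) (n / 81) (n / 243) n (n / 3) (n / 9)) (forms.getD i (0, false)).1 =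
        affCode (swapTable.getD i 0).2.1 (swapTable.getD i 0).2.2
          (forms.getD (swapTable.getD i 0).1 (0, false)).1 := by
    decide +kernel
  exact fun i hi => ⟨(this i hi).1, (this i hi).2.1, (this i hi).2.2.1,
    congrArg vec (this i hi).2.2.2⟩

/-- Subtraction of the linear functional with the same first four labels. -/
def normalize (l : List ℕ) : List ℕ :=
  shift 684 (2 * l.getD 0 0) (shift 489 (2 * l.getD 1 0) (shift 99 (2 * l.getD 2 0)
    (shift 534 (2 * l.getD 3 0) l)))

theorem Occurs.normalize {l : List ℕ} (h : Occurs l) : Occurs (normalize l) :=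
  (((h.shift (by decide) _).shift (by decide) _).shift (by decide) _).shift (by decide) _

/-- The images of a list of labels under the symmetries. -/
def images (l : List ℕ) : List (List ℕ) :=
  [l, permute rotTable l, permute rotTable (permute rotTable l)].flatMap fun l =>
    [permute swapTable l, permute rotTable (permute swapTable l),
      permute rotTable (permute rotTable (permute swapTable l))].flatMap fun l =>
    [l, permute swapTable l].flatMap fun l => [l, negate l]

theorem occurs_of_mem_images {l m : List ℕ} (h : Occurs l) (hl : l.length = 15) (hm : m ∈ images l) :
    Occurs m := by
  have hr : ∀ l, Occurs l ∧ l.length = 15 →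
      Occurs (permute rotTable l) ∧ (permute rotTable l).length = 15 := fun l h =>
    ⟨h.1.rot h.2, by rw [permute, List.length_map]; rfl⟩
  have hs : ∀ l, Occurs l ∧ l.length = 15 →
      Occurs (permute swapTable l) ∧ (permute swapTable l).length = 15 := fun l h =>
    ⟨h.1.swap h.2, by rw [permute, List.length_map]; rfl⟩
  simp only [images, List.mem_flatMap, List.mem_cons, List.not_mem_nil, or_false] at hm
  obtain ⟨l₁, h₁, l₂, h₂, l₃, h₃, h₄⟩ := hm
  have o₁ : Occurs l₁ ∧ l₁.length = 15 := by
    rcases h₁ with rfl | rfl | rfl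
    exacts [⟨h, hl⟩, hr _ ⟨h, hl⟩, hr _ (hr _ ⟨h, hl⟩)]
  have o₂ : Occurs l₂ ∧ l₂.length = 15 := by
    rcases h₂ with rfl | rfl | rfl
    exacts [hs _ o₁, hr _ (hs _ o₁), hr _ (hr _ (hs _ o₁))]
  have o₃ : Occurs l₃ ∧ l₃.length = 15 := by
    rcases h₃ with rfl | rfl
    exacts [o₂, hs _ o₂]
  rcases h₄ with rfl | rfl
  exacts [o₃.1, o₃.1.negate]

/-- The labels of the first hyperplane are equivalent to those of a representative. -/
def isKnown (l : List ℕ) : Bool :=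
  Nat.beq l.length 15 && (images l).any fun m => reps.any fun r => normalize m == r

theorem check_firstTree : check isKnown packedForms firstTree (rules.drop 4) [0, 0, 0, 0] = true := by
  decide +kernel

/-- The sixteenth label is 0, and the goal is never satisfied: every branch ends in a cut. -/
theorem check_trees : (reps.zip [treeOne, treeTwo, treeThree, treeFour]).all (fun p =>
    check (fun _ => false) packedForms p.2 (rules.drop 16) (0 :: p.1.reverse)) = true := by
  decide +kernel

/-- Adding functionals makes the first four labels zero. The first search then reaches leaves whose
fifteen labels become those of a representative after a symmetry and another normalisation. -/
theorem exists_rep_occurs {κ : (Fin 6 → ZMod 3) → ZMod 3} (h : IsLabelling κ) :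
    ∃ r ∈ reps, Occurs r := by
  have h0 : Occurs [0, 0, 0, 0] := by
    obtain ⟨a, ha, h1⟩ := exists_agree_append (κ := κ) (F := forms) (ks := []) trivial
    obtain ⟨b, hb, h2⟩ := exists_agree_append h1
    obtain ⟨c, hc, h3⟩ := exists_agree_append h2
    obtain ⟨d, hd, h4⟩ := exists_agree_append h3
    have e : ∀ a < 3, ∀ b < 3, ∀ c < 3, ∀ d < 3, normalize [a, b, c, d] = [0, 0, 0, 0] := by
      decide +kernel
    rw [← e a ha b hb c hc d hd]
    exact Occurs.normalize ⟨κ, h, h4⟩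
  obtain ⟨κ', h', ha⟩ := h0
  obtain ⟨l, hl, hg⟩ := exists_of_check (F := forms) (fun η => h'.zeros_eq)
    (ks := [0, 0, 0, 0]) (packed_forms ▸ check_firstTree) ha
  simp only [isKnown, Bool.and_eq_true, Nat.beq_eq, List.any_eq_true, beq_iff_eq] at hg
  obtain ⟨hlen, m, hm, r, hr, rfl⟩ := hg
  exact ⟨_, hr, (occurs_of_mem_images ⟨κ', h', hl⟩ hlen hm).normalize⟩

theorem not_isLabelling (κ : (Fin 6 → ZMod 3) → ZMod 3) : ¬IsLabelling κ := by
  intro h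
  obtain ⟨r, hr, κ₁, h₁, ha₁⟩ := exists_rep_occurs h
  have hlen : r.length = 15 := (by decide : ∀ r ∈ reps, r.length = 15) r hr
  -- The first fifteen forms vanish at the all-one vector, which has code 364, and the sixteenth
  -- does not. Adding a multiple of this functional makes the sixteenth label zero without changing
  -- the others.
  obtain ⟨m, hm3, hm⟩ : ∃ m : ℕ, m < 3 ∧ κ₁ (vec (forms.getD 15 (0, false)).1) +
      m * (vec (forms.getD 15 (0, false)).1 ⬝ᵥ vec 364) = 0 := by
    rw [show vec (forms.getD 15 (0, false)).1 ⬝ᵥ vec 364 = 2 by decide]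
    have : ∀ k : ZMod 3, ∃ m : ℕ, m < 3 ∧ k + m * 2 = 0 := by decide
    exact this _
  have e : ∀ r ∈ reps, ∀ m < 3, shift 364 m r = r := by decide +kernel
  have ha₂ := agree_zipWith 364 m ha₁
  rw [packed_forms] at ha₂
  change Agree _ forms (shift 364 m r) at ha₂
  rw [e r hr m hm3] at ha₂
  have h₂ : IsLabelling fun c => κ₁ c + c ⬝ᵥ (m • vec 364) :=
    h₁.add_dotProduct (by simp [← mul_sum, sum_vec_of_sumTest (y := 364) (by decide)])
  have ha₃ : Agree (fun c => κ₁ c + c ⬝ᵥ (m • vec 364)) forms (r ++ [0]) := by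
    rw [agree_iff] at ha₂ ⊢
    intro i hi hi'
    rw [List.length_append, List.length_singleton, hlen] at hi'
    rcases Nat.lt_or_ge i 15 with h15 | h15
    · rw [List.getD_append _ _ _ _ (by omega)]
      exact ha₂ i hi (by omega)
    · obtain rfl : i = 15 := by omega
      rw [List.getD_append_right _ _ _ _ (by omega), hlen]
      rw [dotProduct_smul, nsmul_eq_mul, hm]
      rfl
  obtain ⟨i, hi, rfl⟩ := List.mem_iff_getElem.mp hr
  have hi4 : i < [treeOne, treeTwo, treeThree, treeFour].length := hi
  have hc := List.all_eq_true.mp check_trees (reps[i], [treeOne, treeTwo, treeThree, treeFour][i])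
    (List.mem_iff_getElem.mpr ⟨i, by rw [List.length_zip]; exact lt_min hi hi4, List.getElem_zip⟩)
  obtain ⟨-, -, hf⟩ := exists_of_check (F := forms) (fun η => h₂.zeros_eq) (packed_forms ▸ hc)
    (by rw [List.reverse_cons, List.reverse_reverse]; exact ha₃)
  exact Bool.false_ne_true hf

end Array140

/-! ### The antipodal quotient and the functionals through a point -/

namespace Array140

/-- The antipodal quotient of the array `{140, 126, 20, 1; 1, 10, 126, 140}`. -/
abbrev quotientArray : IntersectionArray := ⟨[140, 126], [1, 30]⟩

variable {V : Type*} [AddCommGroup V] [Module (ZMod 3) V] [Fintype V] {d : V → ℕ}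

omit [Module (ZMod 3) V] in
theorem card_eq (h : TranslationDistance quotientArray d) :
    Fintype.card V = 3 ^ 6 ∧ #{v | d v = 1} = 140 := by
  have h1 : #{v | d v = 1} = 140 := h.card_one
  have h2 := h.card_class_mul 1
  have h3 := h.card_eq_sum
  have h0 := h.card_class_zero
  simp only [IntersectionArray.bNum, IntersectionArray.cNum, h1] at h2
  norm_num at h2
  simp only [sum_range_succ, range_zero, sum_empty, List.length_cons, List.length_nil, h0, h1] at h3
  norm_num
  omega

/-- The eigenvalues are 5 and -22, that is, 50 or 32 zeros in the connection set. -/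
theorem kerSum_cases (h : TranslationDistance quotientArray d) (f : Module.Dual (ZMod 3) V)
    (hf : f ≠ 0) : kerSum {v | d v = 1} f = 10 ∨ kerSum {v | d v = 1} f = -44 := by
  set S : Finset V := {v | d v = 1} with hS
  have hSc : #S = 140 := (card_eq h).2
  have hlt : #{s ∈ S | f s = 0} < #S := by
    refine card_lt_card (filter_ssubset.mpr ?_)
    by_contra! hall
    exact hf (h.dual_eq_zero (by decide) fun s hs => hall s (by simpa [hS] using hs))
  obtain ⟨θ, h1, hrec⟩ := h.exists_eigenvalue (fun a s => h.smul_of_ternary a s) f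
  have e1 := hrec 1
  have e2 := hrec 2
  rw [← hS] at h1
  have hk := kerSum_eq S f
  rw [hSc] at hk
  simp only [List.length_cons, List.length_nil, sum_range_succ, range_zero, sum_empty,
    IntersectionArray.stepNum, IntersectionArray.aNum, IntersectionArray.bNum,
    IntersectionArray.cNum, h.kerSum_class_zero, ← hS, h1] at e1 e2
  norm_num at e1 e2
  push_cast at h1 hk
  have h5 : 2 * ((θ - 140) * ((θ - 5) * (θ + 22))) = 0 := by
    linear_combination 30 * e2 + (θ - 110) * e1
  simp only [mul_eq_zero, sub_eq_zero, OfNat.ofNat_ne_zero, false_or] at h5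
  rcases h5 with h5 | h5 | h5 <;> omega

/-- The number of vectors of the connection set in a coset of the line of `s`. -/
def lineCount (d : V → ℕ) (s v : V) : ℕ := #{k : ZMod 3 | d (k • s + v) = 1}

/-- The functionals with the smaller eigenvalue that vanish at `s`. -/
noncomputable def localDuals (d : V → ℕ) (s : V) : Finset (Module.Dual (ZMod 3) V) :=
  {f ∈ dualSlice ![s] 0 | kerSum {v | d v = 1} f = -44}

theorem mem_localDuals {s : V} {f : Module.Dual (ZMod 3) V} :
    f ∈ localDuals d s ↔ f s = 0 ∧ kerSum {v | d v = 1} f = -44 := by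
  simp [localDuals]

/-- On the slice `kerSum` takes the values 10 and -44 = 10 - 54, apart from 280 = 10 + 270 at zero.
Its sum is also determined by the vectors of the connection set in the span, so the two counts
determine each other. -/
theorem card_filter_dualSlice (h : TranslationDistance quotientArray d) {s : V} {n : ℕ} {x : Fin n → V}
    (hx : LinearIndependent (ZMod 3) (Fin.cons s x : Fin (n + 1) → V)) :
    54 * #{f ∈ localDuals d s | ∀ i, f (x i) = 0} * 3 ^ (n + 1) +
      2 * 729 * ∑ c : Fin n → ZMod 3, lineCount d s (∑ i, c i • x i) =
      270 * 3 ^ (n + 1) + 10 * 729 := by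
  classical
  have h1 := sum_dualSlice_kerSum_class hx d 1
  have hc := card_dualSlice_mul hx (0 : Fin (n + 1) → ZMod 3)
  rw [(card_eq h).1, Fintype.card_fin] at hc
  have hα : #{t : Fin (n + 1) → ZMod 3 | d (∑ i, t i • (Fin.cons s x : Fin (n + 1) → V) i) = 1} =
      ∑ c : Fin n → ZMod 3, lineCount d s (∑ i, c i • x i) := by
    rw [card_filter, ← (Fin.consEquiv fun _ => ZMod 3).sum_comp, Fintype.sum_prod_type, sum_comm]
    refine sum_congr rfl fun c _ => ?_
    rw [lineCount, card_filter]
    refine sum_congr rfl fun k _ => ?_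
    simp only [Fin.consEquiv_apply, Fin.sum_univ_succ, Fin.cons_zero, Fin.cons_succ]
  rw [hα] at h1
  have hf : ({f ∈ localDuals d s | ∀ i, f (x i) = 0} : Finset _) =
      {f ∈ dualSlice (Fin.cons s x : Fin (n + 1) → V) (0 : Fin (n + 1) → ZMod 3) | kerSum {v | d v = 1} f = -44} := by
    ext f
    simp only [mem_filter, mem_localDuals, mem_dualSlice, Fin.forall_fin_succ, Fin.cons_zero,
      Fin.cons_succ, Pi.zero_apply]
    tauto
  rw [hf]
  set Φ := dualSlice (Fin.cons s x : Fin (n + 1) → V) (0 : Fin (n + 1) → ZMod 3) with hΦ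
  have h0 : (0 : Module.Dual (ZMod 3) V) ∈ Φ := by simp [hΦ]
  have hsum : ∑ f ∈ Φ, kerSum ({v | d v = 1} : Finset V) f =
      ∑ f ∈ Φ, (10 - (if kerSum ({v | d v = 1} : Finset V) f = -44 then 54 else 0) +
        if f = 0 then (270 : ℤ) else 0) := by
    refine sum_congr rfl fun f _ => ?_
    by_cases hf0 : f = 0
    · rw [hf0, kerSum_zero, (card_eq h).2]
      norm_num
    · rcases kerSum_cases h f hf0 with hk | hk <;> rw [hk] <;> simp [hf0]
  rw [sum_add_distrib, sum_sub_distrib, sum_const, ← sum_filter, sum_const, sum_ite_eq' Φ 0,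
    if_pos h0, h1] at hsum
  set N := #{f ∈ Φ | kerSum ({v | d v = 1} : Finset V) f = -44}
  set W := ∑ c : Fin n → ZMod 3, lineCount d s (∑ i, c i • x i)
  simp only [nsmul_eq_mul] at hsum
  have h2 : (#Φ : ℤ) * (2 * W) + 54 * N = #Φ * 10 + 270 := by linarith
  have h3 : #Φ * (2 * W) + 54 * N = #Φ * 10 + 270 := by exact_mod_cast h2
  calc _ = (#Φ * (2 * W) + 54 * N) * 3 ^ (n + 1) := by
        rw [show (729 : ℕ) = #Φ * 3 ^ (n + 1) by rw [hc]; norm_num]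
        ring
    _ = _ := by
        rw [h3, show (729 : ℕ) = #Φ * 3 ^ (n + 1) by rw [hc]; norm_num]
        ring

theorem lineCount_neg (h : TranslationDistance quotientArray d) (s v : V) :
    lineCount d s (-v) = lineCount d s v := by
  unfold lineCount
  refine card_bij (fun k _ => -k) (fun k hk => ?_) (fun k _ k' _ h => neg_injective h)
    fun k hk => ⟨-k, ?_, neg_neg k⟩ <;>
  · simp only [mem_filter, mem_univ, true_and] at hk ⊢
    rw [← hk, ← h.neg]
    congr 1
    module

theorem lineCount_zero (h : TranslationDistance quotientArray d) {s : V} (hs : d s = 1) :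
    lineCount d s 0 = 2 := by
  have : ({k : ZMod 3 | d (k • s + 0) = 1} : Finset (ZMod 3)) = {1, -1} := by
    ext k
    have h3 : ∀ k : ZMod 3, k = 0 ∨ k = 1 ∨ k = -1 := by decide
    have h01 : (0 : ZMod 3) ≠ 1 := by decide
    have h02 : (0 : ZMod 3) ≠ -1 := by decide
    simp only [add_zero, mem_filter, mem_univ, true_and, mem_insert, mem_singleton]
    rcases h3 k with rfl | rfl | rfl
    · simp [h.map_zero, h01, h02]
    · simp [hs]
    · simp [h.neg, hs]
  rw [lineCount, this]
  decide

omit [Module (ZMod 3) V] in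
theorem ne_zero_of_one (h : TranslationDistance quotientArray d) {s : V} (hs : d s = 1) : s ≠ 0 := by
  rintro rfl
  rw [h.map_zero] at hs
  omega

theorem card_localDuals (h : TranslationDistance quotientArray d) {s : V} (hs : d s = 1) :
    #(localDuals d s) = 32 := by
  have h1 := card_filter_dualSlice h (s := s) (x := Fin.elim0) (by
    exact LinearIndependent.of_subsingleton (ι := Fin 1) 0 (ne_zero_of_one h hs))
  simp [lineCount_zero h hs] at h1
  omega

/-- The case of a plane through s. It converts knowledge of the functionals into the number of
vectors in each coset, which is at most two. -/
theorem card_filter_localDuals (h : TranslationDistance quotientArray d) {s v : V} (hs : d s = 1)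
    (hv : ∀ k : ZMod 3, v ≠ k • s) : #{f ∈ localDuals d s | f v = 0} + 6 * lineCount d s v = 14 := by
  have h1 := card_filter_dualSlice h (s := s) (x := ![v]) (by
    rw [linearIndependent_finCons]
    refine ⟨LinearIndependent.of_subsingleton 0 fun h0 => hv 0 (by simpa using h0), fun hm => ?_⟩
    rw [show Set.range ![v] = {v} by simp, Submodule.mem_span_singleton] at hm
    obtain ⟨a, ha⟩ := hm
    have ha0 : a ≠ 0 := by
      rintro rfl
      exact ne_zero_of_one h hs (by rw [← ha, zero_smul])
    exact hv a⁻¹ (by rw [← ha, inv_smul_smul₀ ha0]))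
  rw [← (Equiv.funUnique (Fin 1) (ZMod 3)).symm.sum_comp] at h1
  have h3 : ∀ F : ZMod 3 → ℕ, ∑ k, F k = F 0 + F 1 + F (-1) := fun F => Fin.sum_univ_three F
  rw [h3] at h1
  simp only [Fin.sum_univ_one, Equiv.funUnique_symm_apply, uniqueElim_const, Matrix.cons_val_fin_one, zero_smul,
    one_smul, neg_smul, lineCount_neg h, lineCount_zero h hs, forall_const] at h1
  omega

theorem card_filter_localDuals_two (h : TranslationDistance quotientArray d) {s u v : V} (hs : d s = 1)
    (hx : LinearIndependent (ZMod 3) ![s, u, v]) : #{f ∈ localDuals d s | f u = 0 ∧ f v = 0} +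
      2 * (lineCount d s u + lineCount d s v + lineCount d s (u + v) + lineCount d s (u - v)) = 8 := by
  have h1 := card_filter_dualSlice h (s := s) (x := ![u, v]) hx
  rw [← (finTwoArrowEquiv (ZMod 3)).symm.sum_comp, Fintype.sum_prod_type] at h1
  have h3 : ∀ F : ZMod 3 → ℕ, ∑ k, F k = F 0 + F 1 + F (-1) := fun F => Fin.sum_univ_three F
  simp only [h3] at h1
  simp only [Fin.sum_univ_two, finTwoArrowEquiv_symm_apply, Matrix.cons_val_zero,
    Matrix.cons_val_one, zero_smul, one_smul, neg_smul, zero_add, add_zero,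
    Fin.forall_fin_two, lineCount_zero h hs] at h1
  rw [lineCount_neg h, lineCount_neg h, show -u + v = -(u - v) by abel, lineCount_neg h,
    show -u + -v = -(u + v) by abel, lineCount_neg h, ← sub_eq_add_neg] at h1
  omega

end Array140

/-! ### Local systems and their uniqueness -/

namespace Array140

/-- The properties of the values at six collinear triples of the functionals in `localDuals`. -/
structure IsLocalSystem (Y : Finset (Fin 6 → ZMod 3)) : Prop where
  sum_eq : ∀ y ∈ Y, ∑ i, y i = 0
  neg_mem : ∀ y ∈ Y, -y ∈ Y
  unique_zero : ∀ y ∈ Y, ∀ i j, y i = 0 → y j = 0 → i = j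
  card : #Y = 32
  card_zero : ∀ i, #{y ∈ Y | y i = 0} = 2
  card_eq : ∀ i j, i ≠ j → #{y ∈ Y | y i = y j} = 14

/-- The vectors without zeros and with sum zero. -/
def fullVectors : Finset (Fin 6 → ZMod 3) := {y | ∑ i, y i = 0 ∧ ∀ i, y i ≠ 0}

/-- The vector with entries `0` at `i`, `-1` at `j` and `1` elsewhere. -/
def zeroVector (i j : Fin 6) : Fin 6 → ZMod 3 := fun k => if k = i then 0 else if k = j then -1 else 1

/-- The codes of the vectors without zeros and with sum zero. -/
def fullCodes : List ℕ :=
  [364, 697, 643, 481, 691, 637, 475, 619, 457, 403, 715, 728, 395, 449, 611, 401, 455, 617, 473, 635, 689, 377]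

theorem forall_of_forall_cons {P : (Fin 6 → ZMod 3) → Prop}
    (h : ∀ a b c d e f, P ![a, b, c, d, e, f]) (y : Fin 6 → ZMod 3) : P y := by
  have : y = ![y 0, y 1, y 2, y 3, y 4, y 5] := by
    funext i
    fin_cases i <;> rfl
  rw [this]
  exact h _ _ _ _ _ _

theorem fullVectors_eq : fullVectors = (fullCodes.map vec).toFinset := by
  have h1 : ∀ n ∈ fullCodes, ∑ i, vec n i = 0 ∧ ∀ i, vec n i ≠ 0 := by decide +kernel
  have h2 : ∀ y : Fin 6 → ZMod 3, (∀ i, y i ≠ 0) → ∑ i, y i = 0 → y ∈ fullCodes.map vec :=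
    forall_of_forall_cons (by decide +kernel)
  ext y
  simp only [fullVectors, mem_filter, mem_univ, true_and, List.mem_toFinset]
  refine ⟨fun h => h2 y h.2 h.1, fun h => ?_⟩
  obtain ⟨n, hn, rfl⟩ := List.mem_map.mp h
  exact h1 n hn

/-- Two constant vectors and the 20 vectors with three entries of each sign. -/
theorem card_fullVectors : #fullVectors = 22 := by
  rw [fullVectors_eq]
  decide +kernel

theorem card_filter_fullVectors : ∀ k l, k ≠ l → #{y ∈ fullVectors | y k = y l} = 10 := by
  rw [fullVectors_eq]
  decide +kernel

/-- Five signs with sum zero modulo 3 contain one or four entries -1. -/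
theorem exists_eq_zeroVector : ∀ y : Fin 6 → ZMod 3, ∀ i, y i = 0 → (∀ j, y j = 0 → j = i) →
    ∑ i, y i = 0 → ∃ j, j ≠ i ∧ (y = zeroVector i j ∨ -y = zeroVector i j) :=
  forall_of_forall_cons (by decide +kernel)

/-- The ternary digits of 715 are 1, 1, 1, 2, 2, 2. -/
theorem eq_of_monotone : ∀ y ∈ fullVectors, (∀ i j, i ≤ j → (y i).val ≤ (y j).val) →
    y = 1 ∨ y = -1 ∨ y = vec 715 := by
  rw [fullVectors_eq]
  decide +kernel

theorem zeroVector_comp (i j : Fin 6) (σ : Equiv.Perm (Fin 6)) :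
    zeroVector i j ∘ σ = zeroVector (σ.symm i) (σ.symm j) := by
  funext k
  simp [zeroVector, Equiv.eq_symm_apply]

theorem ne_neg_self {y : Fin 6 → ZMod 3} {i : Fin 6} (hi : y i ≠ 0) : y ≠ -y := by
  have h3 : ∀ a : ZMod 3, a ≠ 0 → a ≠ -a := by decide
  exact fun h => h3 _ hi (congrFun h i)

/-- Whether the pair `i`, `j` avoids `k` and `l`. -/
def avoid (k l i j : ℕ) : ℕ :=
  bif Nat.beq i k || Nat.beq i l || Nat.beq j k || Nat.beq j l then 0 else 1

/-- The four possibilities for the map of the zeros to the exceptional values. -/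
def exceptionalMaps : List (List ℕ) :=
  [[1, 2, 0, 4, 5, 3], [2, 0, 1, 4, 5, 3], [1, 2, 0, 5, 3, 4], [2, 0, 1, 5, 3, 4]]

/-- The test whether the map `0 ↦ a, …, 5 ↦ f` avoids the given pairs with the right frequency. -/
def avoidTest (ps : List (ℕ × ℕ)) (a b c d e f : ℕ) : Bool :=
  ps.all fun q => Nat.beq (avoid q.1 q.2 0 a + avoid q.1 q.2 1 b + avoid q.1 q.2 2 c +
    avoid q.1 q.2 3 d + avoid q.1 q.2 4 e + avoid q.1 q.2 5 f)
    (bif Nat.beq (q.1 / 3) (q.2 / 3) then 3 else 2)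

/-- The pair (4, 5) gives a condition that does not depend on the images of 4 and 5, and the pairs
with 5 do not depend on the image of 5; this prunes the enumeration. -/
theorem mem_exceptionalMaps : ∀ a ∈ [1, 2, 3, 4, 5], ∀ b ∈ [0, 2, 3, 4, 5], ∀ c ∈ [0, 1, 3, 4, 5],
    ∀ d ∈ [0, 1, 2, 4, 5], avoidTest [(4, 5)] a b c d 0 0 = true →
    ∀ e ∈ [0, 1, 2, 3, 5], avoidTest [(0, 5), (1, 5), (2, 5), (3, 5)] a b c d e 0 = true →
    ∀ f ∈ [0, 1, 2, 3, 4], avoidTest [(0, 1), (0, 2), (1, 2), (3, 4), (0, 3), (0, 4), (1, 3),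
      (1, 4), (2, 3), (2, 4)] a b c d e f = true → [a, b, c, d, e, f] ∈ exceptionalMaps := by
  decide +kernel

theorem avoid_eq (i j k l : Fin 6) (hkl : k ≠ l) (hij : j ≠ i) :
    (if zeroVector i j k = zeroVector i j l then 1 else 0) = avoid k l i j := by
  have : ∀ i j k l : Fin 6, k ≠ l → j ≠ i →
      (if zeroVector i j k = zeroVector i j l then 1 else 0) = avoid k l i j := by decide +kernel
  exact this i j k l hkl hij

/-- Four indices remain outside {i, j}, hence 4·3 ordered pairs. -/
theorem sum_avoid (i j : Fin 6) (hij : j ≠ i) :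
    ∑ q : Fin 6 × Fin 6 with q.1 ≠ q.2, avoid q.1 q.2 i j = 12 := by
  have : ∀ i j : Fin 6, j ≠ i → ∑ q : Fin 6 × Fin 6 with q.1 ≠ q.2, avoid q.1 q.2 i j = 12 := by
    decide +kernel
  exact this i j hij

theorem mem_fullVectors {y : Fin 6 → ZMod 3} :
    y ∈ fullVectors ↔ ∑ i, y i = 0 ∧ ∀ i, y i ≠ 0 := by
  simp [fullVectors]

theorem neg_mem_fullVectors {y : Fin 6 → ZMod 3} (hy : y ∈ fullVectors) : -y ∈ fullVectors := by
  rw [mem_fullVectors] at hy ⊢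
  simpa using hy

namespace IsLocalSystem

variable {Y : Finset (Fin 6 → ZMod 3)}

theorem comp (h : IsLocalSystem Y) (σ : Equiv.Perm (Fin 6)) :
    IsLocalSystem (Y.image fun y => y ∘ σ) := by
  have hinj : Function.Injective fun y : Fin 6 → ZMod 3 => y ∘ σ := σ.surjective.injective_comp_right
  refine ⟨?_, ?_, ?_, ?_, fun i => ?_, fun i j hij => ?_⟩
  · rw [forall_mem_image]
    exact fun y hy => (Equiv.sum_comp σ y).trans (h.sum_eq y hy)
  · rw [forall_mem_image]
    exact fun y hy => mem_image_of_mem _ (h.neg_mem y hy)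
  · rw [forall_mem_image]
    exact fun y hy i j hi hj => σ.injective (h.unique_zero y hy _ _ hi hj)
  · rw [card_image_of_injective _ hinj, h.card]
  · rw [filter_image, card_image_of_injective _ hinj]
    exact h.card_zero (σ i)
  · rw [filter_image, card_image_of_injective _ hinj]
    exact h.card_eq _ _ (σ.injective.ne hij)

theorem exists_zeroVector_mem (h : IsLocalSystem Y) (i : Fin 6) :
    ∃ j, j ≠ i ∧ ({y ∈ Y | y i = 0} : Finset _) = {zeroVector i j, -zeroVector i j} := by
  obtain ⟨y, hy⟩ : ({y ∈ Y | y i = 0} : Finset _).Nonempty := card_pos.mp (by rw [h.card_zero]; omega)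
  rw [mem_filter] at hy
  have key : ∃ j, j ≠ i ∧ zeroVector i j ∈ Y := by
    obtain ⟨j, hj, e⟩ := exists_eq_zeroVector y i hy.2
      (fun j hj => h.unique_zero y hy.1 j i hj hy.2) (h.sum_eq y hy.1)
    refine ⟨j, hj, ?_⟩
    rcases e with e | e
    · rw [← e]
      exact hy.1
    · rw [← e]
      exact h.neg_mem y hy.1
  obtain ⟨j, hj, hm⟩ := key
  have h0 : zeroVector i j i = 0 := by simp [zeroVector]
  have hj0 : zeroVector i j j ≠ 0 := by simp [zeroVector, hj]
  refine ⟨j, hj, (eq_of_subset_of_card_le ?_ ?_).symm⟩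
  · intro y hy
    rw [mem_insert, mem_singleton] at hy
    rw [mem_filter]
    rcases hy with rfl | rfl
    · exact ⟨hm, h0⟩
    · exact ⟨h.neg_mem _ hm, by simp [h0]⟩
  · rw [h.card_zero, card_pair (ne_neg_self hj0)]

/-- Every vector has at most one zero, and the position of the zero partitions the rest. -/
theorem card_filter_zero (h : IsLocalSystem Y) (P : (Fin 6 → ZMod 3) → Prop) [DecidablePred P] :
    #{y ∈ Y | P y} = #{y ∈ Y | P y ∧ ∀ i, y i ≠ 0} + ∑ i, #{y ∈ Y | P y ∧ y i = 0} := by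
  rw [← card_biUnion]
  · rw [← card_union_of_disjoint]
    · congr 1
      ext y
      simp only [mem_union, mem_filter, mem_biUnion, mem_univ, true_and]
      constructor
      · rintro ⟨hy, hP⟩
        by_cases h0 : ∀ i, y i ≠ 0
        · exact Or.inl ⟨hy, hP, h0⟩
        · push Not at h0
          obtain ⟨i, hi⟩ := h0
          exact Or.inr ⟨i, hy, hP, hi⟩
      · rintro (hy | ⟨i, hy⟩)
        · exact ⟨hy.1, hy.2.1⟩
        · exact ⟨hy.1, hy.2.1⟩
    · rw [disjoint_left]
      intro y hy hy'
      simp only [mem_filter, mem_biUnion, mem_univ, true_and] at hy hy'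
      obtain ⟨i, hi⟩ := hy'
      exact hy.2.2 i hi.2.2
  · intro i _ j _ hij
    rw [Function.onFun, disjoint_left]
    intro y hy hy'
    rw [mem_filter] at hy hy'
    exact hij (h.unique_zero y hy.1 i j hy.2.2 hy'.2.2)

theorem card_filter_full (h : IsLocalSystem Y) : #{y ∈ Y | ∀ i, y i ≠ 0} = 20 := by
  have h1 := h.card_filter_zero fun _ => True
  simp only [true_and, filter_true, h.card, h.card_zero] at h1
  simp at h1
  simpa using (by omega : #{y ∈ Y | ∀ i, ¬y i = 0} = 20)

/-- Only 20 of the 22 vectors without zeros belong to the system; one pair ±m is missing. -/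
theorem exists_missing (h : IsLocalSystem Y) :
    ∃ m ∈ fullVectors, m ∉ Y := by
  by_contra! hall
  have h1 : fullVectors ⊆ ({y ∈ Y | ∀ i, y i ≠ 0} : Finset _) := fun y hy =>
    mem_filter.mpr ⟨hall y hy, (mem_fullVectors.mp hy).2⟩
  have h2 := card_le_card h1
  rw [h.card_filter_full, card_fullVectors] at h2
  omega

theorem filter_full_eq (h : IsLocalSystem Y) {m : Fin 6 → ZMod 3} (hm : m ∈ fullVectors)
    (hmY : m ∉ Y) : ({y ∈ Y | ∀ i, y i ≠ 0} : Finset _) = fullVectors \ {m, -m} := by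
  have hne : m ≠ -m := ne_neg_self ((mem_fullVectors.mp hm).2 0)
  refine eq_of_subset_of_card_le (fun y hy => ?_) ?_
  · rw [mem_filter] at hy
    rw [mem_sdiff, mem_fullVectors, mem_insert, mem_singleton]
    refine ⟨⟨h.sum_eq y hy.1, hy.2⟩, ?_⟩
    rintro (rfl | rfl)
    · exact hmY hy.1
    · exact hmY (by simpa using h.neg_mem _ hy.1)
  · have hsub : ({m, -m} : Finset _) ⊆ fullVectors := by
      intro y hy
      rw [mem_insert, mem_singleton] at hy
      rcases hy with rfl | rfl
      exacts [hm, neg_mem_fullVectors hm]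
    rw [h.card_filter_full, card_sdiff_of_subset hsub, card_fullVectors, card_pair hne]

/-- Of the 14 vectors with equal entries at k and l, ten have no zero, or eight if m_k = m_l. The
others are the vectors ± with zero at i whose exceptional position also avoids k and l. -/
theorem sum_avoid_eq (h : IsLocalSystem Y) {m : Fin 6 → ZMod 3} (hm : m ∈ fullVectors)
    (hmY : m ∉ Y) {j : Fin 6 → Fin 6} (hj : ∀ i, j i ≠ i)
    (hjY : ∀ i, ({y ∈ Y | y i = 0} : Finset _) = {zeroVector i (j i), -zeroVector i (j i)})
    {k l : Fin 6} (hkl : k ≠ l) :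
    ∑ i : Fin 6, avoid k l i (j i) = if m k = m l then 3 else 2 := by
  have hne : m ≠ -m := ne_neg_self ((mem_fullVectors.mp hm).2 0)
  have h1 := h.card_filter_zero fun y => y k = y l
  have h2 : #{y ∈ Y | y k = y l ∧ ∀ i, y i ≠ 0} + (if m k = m l then 2 else 0) = 10 := by
    have e : ({y ∈ Y | y k = y l ∧ ∀ i, y i ≠ 0} : Finset _) =
        {y ∈ fullVectors | y k = y l} \ {y ∈ ({m, -m} : Finset _) | y k = y l} := by
      have := congrArg (fun s => ({y ∈ s | y k = y l} : Finset _)) (h.filter_full_eq hm hmY)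
      simp only [filter_filter] at this
      rw [filter_congr fun y _ => and_comm, this]
      ext y
      simp only [mem_filter, mem_sdiff]
      exact ⟨fun h => ⟨⟨h.1.1, h.2⟩, fun h' => h.1.2 h'.1⟩,
        fun h => ⟨⟨h.1.1, fun h' => h.2 ⟨h', h.1.2⟩⟩, h.1.2⟩⟩
    have hsub : ({y ∈ ({m, -m} : Finset _) | y k = y l} : Finset _) ⊆ {y ∈ fullVectors | y k = y l} := by
      refine filter_subset_filter _ fun y hy => ?_
      rw [mem_insert, mem_singleton] at hy
      rcases hy with rfl | rfl
      exacts [hm, neg_mem_fullVectors hm]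
    have hc := card_le_card hsub
    rw [e, card_sdiff_of_subset hsub]
    rw [card_filter_fullVectors k l hkl] at hc ⊢
    have : #({y ∈ ({m, -m} : Finset _) | y k = y l} : Finset _) = if m k = m l then 2 else 0 := by
      split_ifs with hkl'
      · rw [filter_true_of_mem (by simp [hkl']), card_pair hne]
      · rw [filter_false_of_mem (by simp [hkl']), card_empty]
    omega
  have h3 : ∀ i, #{y ∈ Y | y k = y l ∧ y i = 0} = 2 * avoid k l i (j i) := fun i => by
    have := congrArg (fun s => #{y ∈ s | y k = y l}) (hjY i)
    simp only [filter_filter] at this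
    rw [filter_congr fun y _ => and_comm, this, ← avoid_eq _ _ _ _ hkl (hj i)]
    have hji : zeroVector i (j i) (j i) ≠ 0 := by simp [zeroVector, hj i]
    split_ifs with hkl'
    · rw [filter_true_of_mem (by simp [hkl']), card_pair (ne_neg_self hji)]
    · rw [filter_false_of_mem (by simp [hkl']), card_empty]
  rw [h.card_eq k l hkl, sum_congr rfl fun i _ => h3 i, ← mul_sum] at h1
  split_ifs at h2 ⊢ <;> omega

/-- If the constant vectors were missing, all 30 ordered pairs would be avoided three times, in
total 90, but the six pairs {i, j i} account for only 6·12 = 72. -/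
theorem one_mem (h : IsLocalSystem Y) : 1 ∈ Y := by
  by_contra h1
  choose j hj hjY using h.exists_zeroVector_mem
  have hm : (1 : Fin 6 → ZMod 3) ∈ fullVectors := by
    rw [mem_fullVectors]
    decide
  have h2 : ∑ q : Fin 6 × Fin 6 with q.1 ≠ q.2, ∑ i : Fin 6, avoid q.1 q.2 i (j i) = 90 := by
    rw [sum_congr rfl fun q hq => h.sum_avoid_eq hm h1 hj hjY (mem_filter.mp hq).2]
    simp only [Pi.one_apply, if_true, sum_const]
    decide
  rw [sum_comm, sum_congr rfl fun i _ => sum_avoid i (j i) (hj i)] at h2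
  simp at h2

/-- The signed vectors of `duals`. -/
def signedDuals : Finset (Fin 6 → ZMod 3) :=
  (duals.map vec ++ duals.map fun y => -vec y).toFinset

theorem vec_eq_zeroVector : ∀ i : Fin 6, vec (duals.getD i 0) =
    zeroVector i ((![1, 2, 0, 4, 5, 3] : Fin 6 → Fin 6) i) := by decide +kernel

theorem nodup_signedDuals : (duals.map vec ++ duals.map fun y => -vec y).Nodup := by decide +kernel

theorem eq_signedDuals (h : IsLocalSystem Y) (hm : vec 715 ∉ Y)
    (hz : ∀ i, zeroVector i ((![1, 2, 0, 4, 5, 3] : Fin 6 → Fin 6) i) ∈ Y) : Y = signedDuals := by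
  have hm' : vec 715 ∈ fullVectors := by
    rw [mem_fullVectors]
    decide
  have hY : ∀ y ∈ duals, vec y ∈ Y := by
    intro y hy
    have hsplit : ∀ y ∈ duals, (∃ i : Fin 6, y = duals.getD i 0) ∨
        ((∑ i, vec y i = 0) ∧ ∀ i, vec y i ≠ 0) ∧ vec y ≠ vec 715 ∧ vec y ≠ -vec 715 := by
      decide +kernel
    rcases hsplit y hy with ⟨i, rfl⟩ | ⟨h1, h2, h3⟩
    · rw [vec_eq_zeroVector]
      exact hz i
    · have : vec y ∈ fullVectors \ {vec 715, -vec 715} := by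
        rw [mem_sdiff, mem_fullVectors, mem_insert, mem_singleton]
        exact ⟨h1, fun h4 => h4.elim h2 h3⟩
      rw [← h.filter_full_eq hm' hm, mem_filter] at this
      exact this.1
  refine (eq_of_subset_of_card_le (fun y hy => ?_) ?_).symm
  · rw [signedDuals, List.mem_toFinset, List.mem_append, List.mem_map, List.mem_map] at hy
    rcases hy with ⟨n, hn, rfl⟩ | ⟨n, hn, rfl⟩
    · exact hY n hn
    · exact h.neg_mem _ (hY n hn)
  · rw [h.card, signedDuals, List.toFinset_card_of_nodup nodup_signedDuals]
    rfl

theorem card_filter_signedDuals (c : Fin 6 → ZMod 3) : #{y ∈ signedDuals | c ⬝ᵥ y = 0} =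
    2 * (duals.filter fun y => c ⬝ᵥ vec y = 0).length := by
  have e : ({y ∈ signedDuals | c ⬝ᵥ y = 0} : Finset _) =
      ((duals.map vec ++ duals.map fun y => -vec y).filter fun y => c ⬝ᵥ y = 0).toFinset := by
    rw [List.toFinset_filter, signedDuals]
    simp only [decide_eq_true_eq]
  rw [e, List.toFinset_card_of_nodup (nodup_signedDuals.filter _),
    List.filter_append, List.length_append, List.filter_map, List.filter_map, List.length_map,
    List.length_map, two_mul]
  congr 3
  funext y
  simp

/-- Up to a permutation of the coordinates there is only one local system. -/
theorem exists_perm (h : IsLocalSystem Y) :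
    ∃ σ : Equiv.Perm (Fin 6), Y.image (fun y => y ∘ σ) = signedDuals := by
  have hmem : ∀ (Y : Finset (Fin 6 → ZMod 3)) (σ : Equiv.Perm (Fin 6)) (y : Fin 6 → ZMod 3),
      y ∈ Y.image (fun y => y ∘ σ) ↔ y ∘ σ.symm ∈ Y := by
    intro Y σ y
    rw [mem_image]
    constructor
    · rintro ⟨z, hz, rfl⟩
      rwa [Function.comp_assoc, Equiv.self_comp_symm, Function.comp_id]
    · intro hy
      exact ⟨_, hy, by rw [Function.comp_assoc, Equiv.symm_comp_self, Function.comp_id]⟩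
  obtain ⟨m, hm, hmY⟩ := h.exists_missing
  -- Sorting the coordinates by the missing vector brings it to the form 1, 1, 1, 2, 2, 2, as
  -- constant vectors are not missing.
  set σ := Tuple.sort fun i => (m i).val
  have hmono : Monotone fun i => (m (σ i)).val := Tuple.monotone_sort fun i => (m i).val
  have hmσ : m ∘ σ ∈ fullVectors := by
    rw [mem_fullVectors] at hm ⊢
    exact ⟨(Equiv.sum_comp σ m).trans hm.1, fun i => hm.2 _⟩
  have hσY : m ∘ σ ∉ Y.image fun y => y ∘ σ := by
    rw [hmem, Function.comp_assoc, Equiv.self_comp_symm, Function.comp_id]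
    exact hmY
  have hσ := h.comp σ
  have hm₀ : vec 715 ∉ Y.image fun y => y ∘ σ := by
    rcases eq_of_monotone _ hmσ fun i j hij => hmono hij with e | e | e
    · exact absurd hσ.one_mem (e ▸ hσY)
    · exact absurd (hσ.neg_mem _ hσ.one_mem) (e ▸ hσY)
    · exact e ▸ hσY
  clear_value σ
  clear hσY hmσ hmono
  set Z := Y.image fun y => y ∘ σ with hZ
  have hm' : vec 715 ∈ fullVectors := by
    rw [mem_fullVectors]
    decide
  choose j hj hjZ using hσ.exists_zeroVector_mem
  have hjm : ∀ i, zeroVector i (j i) ∈ Z := fun i => by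
    have : zeroVector i (j i) ∈ ({y ∈ Z | y i = 0} : Finset _) := by
      rw [hjZ]
      exact mem_insert_self _ _
    exact (mem_filter.mp this).1
  have H : ∀ k l : Fin 6, k ≠ l → avoid k l 0 (j 0) + avoid k l 1 (j 1) + avoid k l 2 (j 2) +
      avoid k l 3 (j 3) + avoid k l 4 (j 4) + avoid k l 5 (j 5) =
      bif Nat.beq (k / 3) (l / 3) then 3 else 2 := by
    intro k l hkl
    have h1 := hσ.sum_avoid_eq hm' hm₀ hj hjZ hkl
    rw [Fin.sum_univ_six] at h1
    have h2 : ∀ k l : Fin 6, (if vec 715 k = vec 715 l then 3 else 2) =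
      bif Nat.beq (k / 3) (l / 3) then 3 else 2 := by decide
    exact h1.trans (h2 k l)
  have hjl : ∀ i k : Fin 6, k ≠ i → (k : ℕ) ∈ (List.range 6).erase i := by decide
  have hjl : ∀ i : Fin 6, (j i : ℕ) ∈ (List.range 6).erase i := fun i => hjl i (j i) (hj i)
  have hex := mem_exceptionalMaps _ (hjl 0) _ (hjl 1) _ (hjl 2) _ (hjl 3) (by
      simp only [avoidTest, List.all_cons, List.all_nil, Bool.and_true, Nat.beq_eq]
      exact H 4 5 (by decide)) _ (hjl 4) (by
      simp only [avoidTest, List.all_cons, List.all_nil, Bool.and_true, Bool.and_eq_true, Nat.beq_eq]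
      exact ⟨H 0 5 (by decide), H 1 5 (by decide), H 2 5 (by decide), H 3 5 (by decide)⟩)
    _ (hjl 5) (by
      simp only [avoidTest, List.all_cons, List.all_nil, Bool.and_true, Bool.and_eq_true, Nat.beq_eq]
      exact ⟨H 0 1 (by decide), H 0 2 (by decide), H 1 2 (by decide), H 3 4 (by decide),
        H 0 3 (by decide), H 0 4 (by decide), H 1 3 (by decide), H 1 4 (by decide),
        H 2 3 (by decide), H 2 4 (by decide)⟩)
  -- The map from zeros to exceptional positions is a 3-cycle on each block. A transposition inside
  -- a block reverses its cycle and fixes the missing vector.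
  have key : ∃ τ : Equiv.Perm (Fin 6), vec 715 ∘ τ = vec 715 ∧
      ∀ i, j (τ i) = τ ((![1, 2, 0, 4, 5, 3] : Fin 6 → Fin 6) i) := by
    have hj' : ∀ l ∈ exceptionalMaps, [(j 0 : ℕ), j 1, j 2, j 3, j 4, j 5] = l →
        j = fun i : Fin 6 => Fin.ofNat 6 (l.getD i 0) := by
      rintro l - rfl
      funext i
      fin_cases i <;> simp
    have hτ : ∀ l ∈ exceptionalMaps, ∃ τ ∈ ([1, Equiv.swap 0 1, Equiv.swap 3 4,
        Equiv.swap 0 1 * Equiv.swap 3 4] : List (Equiv.Perm (Fin 6))), vec 715 ∘ τ = vec 715 ∧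
        ∀ i, Fin.ofNat 6 (l.getD (τ i) 0) = τ ((![1, 2, 0, 4, 5, 3] : Fin 6 → Fin 6) i) := by
      decide +kernel
    obtain ⟨τ, -, h1, h2⟩ := hτ _ hex
    refine ⟨τ, h1, fun i => ?_⟩
    rw [← h2]
    exact congrFun (hj' _ hex rfl) (τ i)
  obtain ⟨τ, h1, h2⟩ := key
  refine ⟨σ * τ, ?_⟩
  have hZτ : Y.image (fun y => y ∘ (σ * τ : Equiv.Perm (Fin 6))) = Z.image fun y => y ∘ τ := by
    rw [hZ, image_image]
    rfl
  rw [hZτ]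
  refine (hσ.comp τ).eq_signedDuals ?_ fun i => ?_
  · rw [hmem, ← h1, Function.comp_assoc, Equiv.self_comp_symm, Function.comp_id]
    exact hm₀
  · rw [hmem, zeroVector_comp, Equiv.symm_symm, ← h2]
    exact hjm _

end IsLocalSystem

end Array140

/-! ### The six collinear triples in the antipodal quotient -/

namespace Array140

section Relations

/-- The sum of the squares of the numbers of equal values. -/
theorem sum_card_sq {α ι : Type*} (Y : Finset α) (I : Finset ι) (t : ι → α → ZMod 3) :
    ∑ f ∈ Y, ∑ a, #{i ∈ I | t i f = a} ^ 2 = ∑ i ∈ I, ∑ j ∈ I, #{f ∈ Y | t i f = t j f} := by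
  have h1 : ∀ f ∈ Y, ∑ a, #{i ∈ I | t i f = a} ^ 2 =
      ∑ i ∈ I, ∑ j ∈ I, if t i f = t j f then 1 else 0 := fun f _ => by
    have : ∀ a, #{i ∈ I | t i f = a} ^ 2 =
        ∑ i ∈ I, ∑ j ∈ I, if t i f = a then (if t j f = a then 1 else 0) else 0 := fun a => by
      rw [sq, card_filter, sum_mul_sum]
      refine sum_congr rfl fun i _ => sum_congr rfl fun j _ => ?_
      split_ifs <;> rfl
    rw [sum_congr rfl fun a _ => this a, sum_comm]
    refine sum_congr rfl fun i _ => ?_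
    rw [sum_comm]
    refine sum_congr rfl fun j _ => ?_
    rw [sum_ite_eq, if_pos (mem_univ _)]
    simp only [eq_comm]
  rw [sum_congr rfl h1, sum_comm]
  refine sum_congr rfl fun i _ => ?_
  rw [sum_comm]
  refine sum_congr rfl fun j _ => ?_
  rw [card_filter]

/-- Here z, p, q are the numbers of values 0, 1, 2 among m values with sum zero. For small m this
leaves so few cases that the sum of squares is a function of z. -/
theorem sum_sq_of_dvd {m z p q : ℕ} (hm : z + p + q = m) (hz : z ≤ 1) (h3 : 3 ∣ p + 2 * q) :
    (m = 1 → z = 1) ∧ (m = 2 → z ^ 2 + p ^ 2 + q ^ 2 = 2) ∧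
      (m = 3 → z ^ 2 + p ^ 2 + q ^ 2 + 6 * z = 9) ∧ (m = 4 → z ^ 2 + p ^ 2 + q ^ 2 = 8 + 2 * z) ∧
      (m = 5 → z ^ 2 + p ^ 2 + q ^ 2 + 8 * z = 17) := by
  by_cases h6 : m ≤ 5
  · have hp : p ≤ 5 := by omega
    have hq : q ≤ 5 := by omega
    clear h6
    subst hm
    interval_cases z <;> interval_cases p <;> interval_cases q <;> revert h3 <;> decide
  · omega

/-- No proper subset of the six collinear triples satisfies a relation. -/
theorem card_ne_of_relation {α : Type*} {Y : Finset α} {I : Finset (Fin 6)} {t : Fin 6 → α → ZMod 3}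
    (hY : #Y = 32) (hsum : ∀ f ∈ Y, ∑ i ∈ I, t i f = 0)
    (hzero : ∀ f ∈ Y, ∀ i ∈ I, ∀ j ∈ I, t i f = 0 → t j f = 0 → i = j)
    (hcard : ∀ i ∈ I, #{f ∈ Y | t i f = 0} = 2)
    (heq : ∀ i ∈ I, ∀ j ∈ I, i ≠ j → #{f ∈ Y | t i f = t j f} = 14) (hI : I.Nonempty) : #I = 6 := by
  have hle : #I ≤ 6 := (card_le_univ I).trans (by simp)
  have hpos : 0 < #I := card_pos.mpr hI
  have hZ : ∑ f ∈ Y, #{i ∈ I | t i f = 0} = 2 * #I := by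
    simp only [card_filter]
    rw [sum_comm]
    simp only [← card_filter]
    rw [sum_congr rfl hcard, sum_const, smul_eq_mul, mul_comm]
  have hQ : ∑ f ∈ Y, ∑ a, #{i ∈ I | t i f = a} ^ 2 = 32 * #I + 14 * (#I * (#I - 1)) := by
    rw [sum_card_sq]
    have : ∀ i ∈ I, ∑ j ∈ I, #{f ∈ Y | t i f = t j f} = 32 + 14 * (#I - 1) := fun i hi => by
      rw [← add_sum_erase _ _ hi, sum_congr rfl fun j hj => heq i hi j (mem_of_mem_erase hj)
        (ne_of_mem_erase hj).symm, sum_const, card_erase_of_mem hi]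
      simp [hY, mul_comm]
    rw [sum_congr rfl this, sum_const, smul_eq_mul]
    ring
  have hpt : ∀ f ∈ Y, (#I = 1 → #{i ∈ I | t i f = 0} = 1) ∧
      (#I = 2 → ∑ a, #{i ∈ I | t i f = a} ^ 2 = 2) ∧
      (#I = 3 → ∑ a, #{i ∈ I | t i f = a} ^ 2 + 6 * #{i ∈ I | t i f = 0} = 9) ∧
      (#I = 4 → ∑ a, #{i ∈ I | t i f = a} ^ 2 = 8 + 2 * #{i ∈ I | t i f = 0}) ∧
      (#I = 5 → ∑ a, #{i ∈ I | t i f = a} ^ 2 + 8 * #{i ∈ I | t i f = 0} = 17) := by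
    intro f hf
    have h3 : ∀ F : ZMod 3 → ℕ, ∑ a, F a = F 0 + F 1 + F 2 := fun F => Fin.sum_univ_three F
    rw [h3]
    refine sum_sq_of_dvd ?_ ?_ ?_
    · rw [← h3 fun a => #{i ∈ I | t i f = a}]
      exact (card_eq_sum_card_fiberwise fun _ _ => mem_coe.mpr (mem_univ _)).symm
    · rw [card_le_one]
      intro i hi j hj
      rw [mem_filter] at hi hj
      exact hzero f hf i hi.1 j hj.1 hi.2 hj.2
    · have h1 := hsum f hf
      rw [← sum_fiberwise_of_maps_to (t := univ) (g := fun i => t i f) fun _ _ => mem_univ _] at h1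
      have h2 : ∀ a : ZMod 3, ∑ i ∈ I with t i f = a, t i f = #{i ∈ I | t i f = a} * a := fun a => by
        rw [sum_congr rfl fun i hi => (mem_filter.mp hi).2, sum_const, nsmul_eq_mul]
      rw [sum_congr rfl fun a _ => h2 a] at h1
      rw [show ∀ F : ZMod 3 → ZMod 3, ∑ a, F a = F 0 + F 1 + F 2 from
        fun F => Fin.sum_univ_three F] at h1
      rw [← ZMod.natCast_eq_zero_iff]
      push_cast
      rw [← h1]
      ring
  -- Summing the pointwise identities over the 32 functionals contradicts the moments `hZ` and `hQ`
  -- in each of the five sizes.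
  by_contra h6
  have hcases : #I = 1 ∨ #I = 2 ∨ #I = 3 ∨ #I = 4 ∨ #I = 5 := by omega
  rcases hcases with h | h | h | h | h <;> rw [h] at hZ hQ
  · have := sum_congr rfl fun f hf => (hpt f hf).1 h
    rw [hZ, sum_const, hY] at this
    norm_num at this
  · have := sum_congr rfl fun f hf => (hpt f hf).2.1 h
    rw [hQ, sum_const, hY] at this
    norm_num at this
  · have := sum_congr rfl fun f hf => (hpt f hf).2.2.1 h
    rw [sum_add_distrib, ← mul_sum, hZ, hQ, sum_const, hY] at this
    norm_num at this
  · have := sum_congr rfl fun f hf => (hpt f hf).2.2.2.1 h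
    rw [sum_add_distrib, ← mul_sum, hZ, hQ, sum_const, hY] at this
    norm_num at this
  · have := sum_congr rfl fun f hf => (hpt f hf).2.2.2.2 h
    rw [sum_add_distrib, ← mul_sum, hZ, hQ, sum_const, hY] at this
    norm_num at this

end Relations

variable {V : Type*} [AddCommGroup V] [Module (ZMod 3) V] [Fintype V] {d : V → ℕ} {s : V}

omit [Fintype V] in
theorem lineCount_eq (v : V) : lineCount d s v = (if d v = 1 then 1 else 0) +
    (if d (s + v) = 1 then 1 else 0) + if d (v - s) = 1 then 1 else 0 := by
  have h3 : ∀ F : ZMod 3 → ℕ, ∑ k, F k = F 0 + F 1 + F (-1) := fun F => Fin.sum_univ_three F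
  rw [lineCount, card_filter, h3, zero_smul, zero_add, one_smul, neg_one_smul, neg_add_eq_sub]

/-- The coset contains u and s + u, and at most two vectors are possible, so s - u is not in the
connection set. -/
theorem lineCount_of_mem_triples (h : TranslationDistance quotientArray d) (hs : d s = 1) {u : V}
    (hu : u ∈ triples d s) : lineCount d s u = 2 ∧ d (s - u) ≠ 1 := by
  have h1 := card_filter_localDuals h hs (ne_smul_of_mem_triples h hu)
  have h2 := lineCount_eq (d := d) (s := s) u
  obtain ⟨hu1, hu2, -⟩ := mem_triples.mp hu
  rw [if_pos hu1, if_pos hu2] at h2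
  rw [← h.neg (s - u), neg_sub]
  split_ifs at h2 with h3
  · omega
  · exact ⟨h2, h3⟩

/-- The cosets of u and v alone contribute 2·(2 + 2) = 8 to the identity for three dimensions. So no
functional of the system vanishes at both, and the cosets of u + v and u - v contain nothing. -/
theorem card_of_mem_triples (h : TranslationDistance quotientArray d) (hs : d s = 1) {u v : V}
    (hu : u ∈ triples d s) (hv : v ∈ triples d s) (huv : u ≠ v) (huv' : u ≠ -s - v) :
    (∀ f ∈ localDuals d s, f u = 0 → f v ≠ 0) ∧ #{f ∈ localDuals d s | f u = f v} = 14 ∧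
      #{f ∈ localDuals d s | f u = -f v} = 14 := by
  have hx := linearIndependent_of_mem_triples h hs (fun u hu => (lineCount_of_mem_triples h hs hu).2)
    hu hv huv huv'
  have h1 := card_filter_localDuals_two h hs hx
  rw [(lineCount_of_mem_triples h hs hu).1, (lineCount_of_mem_triples h hs hv).1] at h1
  have hne : ∀ (b k : ZMod 3), u + b • v ≠ k • s := fun b k hk => by
    have := Fintype.linearIndependent_iff.mp hx ![-k, 1, b] (by
      simp only [Fin.sum_univ_three, Matrix.cons_val_zero, Matrix.cons_val_one, Matrix.cons_val]
      rw [one_smul, add_assoc, hk]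
      module) 1
    simp at this
  refine ⟨fun f hf hfu hfv => ?_, ?_, ?_⟩
  · have : 0 < #{f ∈ localDuals d s | f u = 0 ∧ f v = 0} :=
      card_pos.mpr ⟨f, mem_filter.mpr ⟨hf, hfu, hfv⟩⟩
    omega
  · have h2 := card_filter_localDuals h hs (v := u - v) fun k => by
      have := hne (-1) k
      rwa [neg_one_smul, ← sub_eq_add_neg] at this
    simp only [map_sub, sub_eq_zero] at h2
    omega
  · have h2 := card_filter_localDuals h hs (v := u + v) fun k => by
      have := hne 1 k
      rwa [one_smul] at this
    simp only [map_add, add_eq_zero_iff_eq_neg] at h2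
    omega

theorem card_zero_of_mem_triples (h : TranslationDistance quotientArray d) (hs : d s = 1) {u : V}
    (hu : u ∈ triples d s) : #{f ∈ localDuals d s | f u = 0} = 2 := by
  have := card_filter_localDuals h hs (ne_smul_of_mem_triples h hu)
  rw [(lineCount_of_mem_triples h hs hu).1] at this
  omega

/-- The values c i · f (x i) over the support of c satisfy the assumptions of `card_ne_of_relation`;
signs do not matter since both f u = f v and f u = -f v have 14 solutions. -/
theorem ne_zero_of_relation (h : TranslationDistance quotientArray d) (hs : d s = 1)
    {x : Fin 6 → V} (hx : IsTransversal s (triples d s) x) {c : Fin 6 → ZMod 3} {k : ZMod 3}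
    (hc : ∑ i, c i • x i = k • s) (hc0 : c ≠ 0) (i : Fin 6) : c i ≠ 0 := by
  have h6 := card_ne_of_relation (Y := localDuals d s) (I := {i | c i ≠ 0})
    (t := fun i f => c i * f (x i)) (card_localDuals h hs) (fun f hf => ?_)
    (fun f hf i hi j hj hfi hfj => ?_) (fun i hi => ?_) (fun i hi j hj hij => ?_) ?_
  · have := (card_eq_iff_eq_univ _).mp (h6.trans (by simp : 6 = Fintype.card (Fin 6)))
    have hi := mem_univ i
    rw [← this, mem_filter] at hi
    exact hi.2
  · have h1 := congrArg f hc
    rw [map_sum, map_smul, (mem_localDuals.mp hf).1, smul_zero] at h1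
    simp only [map_smul, smul_eq_mul] at h1
    rw [sum_filter]
    refine Eq.trans ?_ h1
    refine sum_congr rfl fun i _ => ?_
    split_ifs with hi
    · rfl
    · rw [not_not.mp hi, zero_mul]
  · by_contra hij
    rw [mem_filter] at hi hj
    exact (card_of_mem_triples h hs (hx.mem i) (hx.mem j) (hx.injective.ne hij) (hx.ne i j)).1 f hf
      ((mul_eq_zero.mp hfi).resolve_left hi.2) ((mul_eq_zero.mp hfj).resolve_left hj.2)
  · rw [mem_filter] at hi
    simp only [mul_eq_zero, hi.2, false_or]
    exact card_zero_of_mem_triples h hs (hx.mem i)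
  · rw [mem_filter] at hi hj
    have h1 := card_of_mem_triples h hs (hx.mem i) (hx.mem j) (hx.injective.ne hij) (hx.ne i j)
    have h2 : ∀ a b : ZMod 3, a ≠ 0 → b ≠ 0 →
        (∀ x y, a * x = b * y ↔ x = y) ∨ ∀ x y, a * x = b * y ↔ x = -y := by decide
    rcases h2 _ _ hi.2 hj.2 with h2 | h2
    · simp only [h2]
      exact h1.2.1
    · simp only [h2]
      exact h1.2.2
  · obtain ⟨i, hi⟩ := Function.ne_iff.mp hc0
    exact ⟨i, by simpa using hi⟩

theorem finrank_eq (h : TranslationDistance quotientArray d) : Module.finrank (ZMod 3) V = 6 := by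
  have h1 := Module.card_eq_pow_finrank (K := ZMod 3) (V := V)
  rw [(card_eq h).1, ZMod.card] at h1
  exact (Nat.pow_right_injective (by omega : 2 ≤ 3) h1).symm

/-- The values at the six collinear triples of the functionals in `localDuals`. -/
noncomputable def localValues (d : V → ℕ) (s : V) (x : Fin 6 → V) : Finset (Fin 6 → ZMod 3) :=
  (localDuals d s).image fun f i => f (x i)

theorem injOn_localDuals (h : TranslationDistance quotientArray d) (hs : d s = 1) {x : Fin 6 → V}
    (hrel : ∀ (c : Fin 6 → ZMod 3) (k : ZMod 3), ∑ i, c i • x i = k • s → ∀ i, c i = c 0) :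
    Set.InjOn (fun (f : Module.Dual (ZMod 3) V) (i : Fin 6) => f (x i)) (localDuals d s) := by
  intro f hf g hg hfg
  rw [mem_coe, mem_localDuals] at hf hg
  have hli := linearIndependent_of_relation (ne_zero_of_one h hs) hrel
  have hfin := finrank_eq h
  refine (basisOfLinearIndependentOfCardEqFinrank hli (by rw [hfin, Fintype.card_fin])).ext
    fun i => ?_
  rw [coe_basisOfLinearIndependentOfCardEqFinrank]
  refine Fin.cases ?_ (fun i => ?_) i
  · rw [Fin.cons_zero, hf.1, hg.1]
  · rw [Fin.cons_succ]
    exact congrFun hfg _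

theorem isLocalSystem_localValues (h : TranslationDistance quotientArray d) (hs : d s = 1)
    {x : Fin 6 → V} (hx : IsTransversal s (triples d s) x) {a : ZMod 3} (hsum : ∑ i, x i = a • s)
    (hrel : ∀ (c : Fin 6 → ZMod 3) (k : ZMod 3), ∑ i, c i • x i = k • s → ∀ i, c i = c 0) :
    IsLocalSystem (localValues d s x) := by
  have hinj := injOn_localDuals h hs hrel
  have hcard : ∀ (P : (Fin 6 → ZMod 3) → Prop) [DecidablePred P],
      #{y ∈ localValues d s x | P y} = #{f ∈ localDuals d s | P fun i => f (x i)} := fun P _ => by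
    rw [localValues, filter_image, card_image_of_injOn]
    exact hinj.mono (coe_subset.mpr (filter_subset _ _))
  refine ⟨?_, ?_, ?_, ?_, fun i => ?_, fun i j hij => ?_⟩
  · rw [localValues, forall_mem_image]
    intro f hf
    rw [← map_sum, hsum, map_smul, (mem_localDuals.mp hf).1, smul_zero]
  · rw [localValues, forall_mem_image]
    intro f hf
    refine mem_image.mpr ⟨-f, ?_, rfl⟩
    rw [mem_localDuals] at hf ⊢
    exact ⟨by rw [LinearMap.neg_apply, hf.1, neg_zero], by rw [kerSum_neg, hf.2]⟩
  · rw [localValues, forall_mem_image]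
    intro f hf i j hi hj
    by_contra hij
    exact (card_of_mem_triples h hs (hx.mem i) (hx.mem j) (hx.injective.ne hij) (hx.ne i j)).1 f hf
      hi hj
  · rw [localValues, card_image_of_injOn hinj, card_localDuals h hs]
  · rw [hcard]
    exact card_zero_of_mem_triples h hs (hx.mem i)
  · rw [hcard]
    exact (card_of_mem_triples h hs (hx.mem i) (hx.mem j) (hx.injective.ne hij) (hx.ne i j)).2.1

/-- A vector of the connection set and six collinear triples through it that determine the
numbers of vectors of the connection set in the cosets of its line. -/
theorem exists_frame (h : TranslationDistance quotientArray d) :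
    ∃ (s : V) (x : Fin 6 → V), d s = 1 ∧ ∑ i, x i = 0 ∧
      (∀ (c : Fin 6 → ZMod 3) (k : ZMod 3), ∑ i, c i • x i = k • s → ∀ i, c i = c 0) ∧
      ∀ c : Fin 6 → ZMod 3, (∃ i, c i ≠ c 0) → lineCount d s (∑ i, c i • x i) = mult c := by
  obtain ⟨s, hs⟩ : ∃ s, d s = 1 := by
    obtain ⟨s, hs⟩ := card_pos.mp (by rw [(card_eq h).2]; omega : 0 < #{v | d v = 1})
    exact ⟨s, by simpa using hs⟩
  have hT : #(triples d s) = 12 := by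
    have := card_triples h hs
    change _ = 13 at this
    omega
  obtain ⟨x, hx, ⟨a, ha⟩, hrel⟩ := exists_sum_eq_smul (ne_zero_of_one h hs) hT
    (fun u hu => neg_sub_mem_triples h hu) (fun u hu => ne_neg_sub_of_mem_triples h hu) (card_eq h).1
    fun x hx c k hc hc0 => ne_zero_of_relation h hs hx hc hc0
  obtain ⟨σ, hσ⟩ := (isLocalSystem_localValues h hs hx ha hrel).exists_perm
  -- Shifting one vector by a multiple of s makes the sum exactly zero without changing the cosets.
  let x' : Fin 6 → V := fun i => x (σ i) - (if i = 0 then a else 0) • s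
  have hlin : ∀ c : Fin 6 → ZMod 3, ∑ i, c i • x' i = ∑ i, c i • x (σ i) - (c 0 * a) • s := fun c => by
    simp only [x', smul_sub, sum_sub_distrib, smul_smul, ← sum_smul]
    simp
  have hσsum : ∀ c : Fin 6 → ZMod 3, ∑ i, c i • x (σ i) = ∑ i, c (σ.symm i) • x i := fun c => by
    rw [← Equiv.sum_comp σ fun i => c (σ.symm i) • x i]
    simp
  have hrel' : ∀ (c : Fin 6 → ZMod 3) (k : ZMod 3), ∑ i, c i • x' i = k • s → ∀ i, c i = c 0 := by
    intro c k hck i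
    rw [hlin, sub_eq_iff_eq_add, ← add_smul, hσsum] at hck
    have h1 := hrel _ _ hck
    have h2 := h1 (σ i)
    have h3 := h1 (σ 0)
    rw [Equiv.symm_apply_apply] at h2 h3
    rw [h2, h3]
  refine ⟨s, x', hs, ?_, hrel', fun c hc => ?_⟩
  · have := hlin 1
    simp only [Pi.one_apply, one_smul, one_mul] at this
    rw [this, Equiv.sum_comp σ x, ha, sub_self]
  · obtain ⟨i, hi⟩ := hc
    have h1 := card_filter_localDuals h hs (v := ∑ i, c i • x' i) fun k hk => hi (hrel' c k hk i)
    have h2 : #{f ∈ localDuals d s | f (∑ i, c i • x' i) = 0} =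
        2 * (duals.filter fun y => c ⬝ᵥ vec y = 0).length := by
      have hinj : Function.Injective fun y : Fin 6 → ZMod 3 => y ∘ σ :=
        σ.surjective.injective_comp_right
      rw [← IsLocalSystem.card_filter_signedDuals, ← hσ, filter_image,
        card_image_of_injective _ hinj, localValues, filter_image,
        card_image_of_injOn ((injOn_localDuals h hs hrel).mono (coe_subset.mpr (filter_subset _ _)))]
      congr 1
      refine filter_congr fun f hf => ?_
      rw [hlin, map_sub, map_smul, (mem_localDuals.mp hf).1, smul_zero, sub_zero, map_sum]
      simp only [map_smul, smul_eq_mul, dotProduct, Function.comp_apply]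
    rw [mult]
    omega

end Array140

/-! ### The labelling given by the connection set -/

namespace Array140

variable {V : Type*} [AddCommGroup V] [Module (ZMod 3) V] {d : V → ℕ} {s : V}

/-- The positions of the connection set in a coset of the line of `s`. -/
def linePositions (d : V → ℕ) (s v : V) : Finset (ZMod 3) := {k | d (k • s + v) = 1}

/-- The single position, or the missing one if there are two. -/
def lineLabel (d : V → ℕ) (s : V) (x : Fin 6 → V) (c : Fin 6 → ZMod 3) : ZMod 3 :=
  (if mult c = 2 then -1 else 1) * ∑ k ∈ linePositions d s (∑ i, c i • x i), k

/-- The three elements of F_3 have sum zero, so minus the sum of two positions is the missing one.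
-/
theorem weight_card (A : Finset (ZMod 3)) (hA : #A ≤ 2) (t : ZMod 3) :
    weight #A ((if #A = 2 then -1 else 1) * ∑ k ∈ A, k + t) = if -t ∈ A then 1 else 0 := by
  have : ∀ A : Finset (ZMod 3), #A ≤ 2 → ∀ t : ZMod 3,
      weight #A ((if #A = 2 then -1 else 1) * ∑ k ∈ A, k + t) = if -t ∈ A then 1 else 0 := by
    decide +kernel
  exact this A hA t

theorem mult_eq_zero {c : Fin 6 → ZMod 3} (hc : ∀ i, c i = c 0) : mult c = 0 := by
  have h1 : (duals.filter fun y => c ⬝ᵥ vec y = 0) = duals := by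
    rw [List.filter_eq_self]
    intro y hy
    have : c ⬝ᵥ vec y = c 0 * ∑ i, vec y i := by
      rw [mul_sum]
      exact sum_congr rfl fun i _ => by rw [hc i]
    rw [this, sum_vec_of_mem_duals hy, mul_zero]
    simp
  rw [mult, h1]
  decide

theorem mult_le_two (c : Fin 6 → ZMod 3) : mult c ≤ 2 := by
  unfold mult
  omega

variable [Fintype V]

theorem weight_lineLabel (h : TranslationDistance quotientArray d) {x : Fin 6 → V}
    (hsum : ∑ i, x i = 0)
    (hmult : ∀ c : Fin 6 → ZMod 3, (∃ i, c i ≠ c 0) → lineCount d s (∑ i, c i • x i) = mult c)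
    {η : Fin 6 → ZMod 3} (hη : ∑ i, η i = 0) (c : Fin 6 → ZMod 3) :
    weight (mult c) (lineLabel d s x c + c ⬝ᵥ η) =
      if d (-(c ⬝ᵥ η) • s + ∑ i, c i • x i) = 1 then 1 else 0 := by
  by_cases hc : ∀ i, c i = c 0
  · have h1 : c ⬝ᵥ η = 0 := by
      have : c ⬝ᵥ η = c 0 * ∑ i, η i := by
        rw [mul_sum]
        exact sum_congr rfl fun i _ => by rw [hc i]
      rw [this, hη, mul_zero]
    have h2 : ∑ i, c i • x i = 0 := by
      rw [sum_congr rfl fun i _ => by rw [hc i], ← smul_sum, hsum, smul_zero]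
    rw [mult_eq_zero hc, h1, h2, neg_zero, zero_smul, add_zero, add_zero,
      h.map_zero]
    rfl
  · push Not at hc
    have h1 : #(linePositions d s (∑ i, c i • x i)) = mult c := hmult c hc
    have h2 := weight_card _ (h1.trans_le (mult_le_two c)) (c ⬝ᵥ η)
    rw [h1] at h2
    rw [lineLabel, h2]
    simp [linePositions]

theorem sum_weight_lineLabel (h : TranslationDistance quotientArray d) (hs : d s = 1)
    {x : Fin 6 → V} (hsum : ∑ i, x i = 0)
    (hrel : ∀ (c : Fin 6 → ZMod 3) (k : ZMod 3), ∑ i, c i • x i = k • s → ∀ i, c i = c 0)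
    (hmult : ∀ c : Fin 6 → ZMod 3, (∃ i, c i ≠ c 0) → lineCount d s (∑ i, c i • x i) = mult c)
    {η : Fin 6 → ZMod 3} (hη : ∑ i, η i = 0) :
    ∑ c, weight (mult c) (lineLabel d s x c + c ⬝ᵥ η) = 96 ∨
      ∑ c, weight (mult c) (lineLabel d s x c + c ⬝ᵥ η) = 150 := by
  classical
  have hs0 := ne_zero_of_one h hs
  obtain ⟨f, hfs, hfx⟩ := exists_dual_of_sum_eq_zero hs0 (a := 0) (by rw [hsum, zero_smul]) hrel
    (y := η) (e := 1) (by rw [hη, zero_mul])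
  have hf0 : f ≠ 0 := by
    rintro rfl
    simp at hfs
  -- The vector of the coset of c that lies in ker f, where f s = 1 and f (x i) = η i.
  set g : (Fin 6 → ZMod 3) → V := fun c => -(c ⬝ᵥ η) • s + ∑ i, c i • x i with hg
  have hgf : ∀ c, f (g c) = 0 := fun c => by
    simp [hg, hfs, hfx, dotProduct]
  have hsurj : ∀ v, f v = 0 → ∃ c, g c = v := by
    intro v hv
    set b := basisOfLinearIndependentOfCardEqFinrank (linearIndependent_of_relation hs0 hrel)
      (by rw [finrank_eq h, Fintype.card_fin]) with hb
    have h1 := b.sum_repr v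
    rw [hb, coe_basisOfLinearIndependentOfCardEqFinrank, ← hb, Fin.sum_univ_succ] at h1
    simp only [Fin.cons_zero, Fin.cons_succ] at h1
    have h2 := congrArg f h1
    rw [hv, map_add, map_smul, hfs, map_sum, smul_eq_mul, mul_one] at h2
    simp only [map_smul, hfx, smul_eq_mul] at h2
    refine ⟨Fin.snoc (fun i : Fin 5 => b.repr v i.succ) 0, ?_⟩
    simp only [hg, dotProduct]
    rw [Fin.sum_univ_castSucc (n := 5), Fin.sum_univ_castSucc (n := 5)]
    simp only [Fin.snoc_castSucc, Fin.snoc_last, zero_smul, zero_mul, add_zero]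
    rw [← eq_neg_of_add_eq_zero_left h2]
    exact h1
  have hker : ∀ c c', g c = g c' → ∀ i, c i - c' i = c 0 - c' 0 := by
    intro c c' hcc
    refine hrel (fun i => c i - c' i) (c ⬝ᵥ η - c' ⬝ᵥ η) ?_
    simp only [hg] at hcc
    simp only [sub_smul, sum_sub_distrib]
    rw [neg_smul, neg_smul, neg_add_eq_sub, neg_add_eq_sub, sub_eq_sub_iff_sub_eq_sub] at hcc
    exact hcc
  have hshift : ∀ c (t : ZMod 3), g (fun i => c i + t) = g c := fun c t => by
    have h1 : (fun i => c i + t) ⬝ᵥ η = c ⬝ᵥ η := by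
      simp only [dotProduct, add_mul, sum_add_distrib, ← mul_sum, hη, mul_zero, add_zero]
    simp only [hg]
    rw [h1]
    simp only [add_smul, sum_add_distrib, ← smul_sum, hsum, smul_zero, add_zero]
  -- The map g is three-to-one onto ker f, because c is determined up to constants. The 32 or 50
  -- zeros of f become 96 or 150.
  have hcount : ∑ c, weight (mult c) (lineLabel d s x c + c ⬝ᵥ η) =
      3 * #{v ∈ ({v | d v = 1} : Finset V) | f v = 0} := by
    rw [sum_congr rfl fun c _ => weight_lineLabel h hsum hmult hη c, ← card_filter,
      card_eq_sum_card_fiberwise (f := g) (t := ({v ∈ ({v | d v = 1} : Finset V) | f v = 0}))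
        (by
          intro c hc
          simp only [coe_filter, mem_univ, true_and, Set.mem_ofPred_eq, mem_filter] at hc ⊢
          exact ⟨hc, hgf c⟩)]
    rw [sum_congr rfl (g := fun _ => 3), sum_const, smul_eq_mul, mul_comm]
    intro v hv
    simp only [mem_filter, mem_univ, true_and] at hv
    obtain ⟨c₀, rfl⟩ := hsurj v hv.2
    have : ({c ∈ ({c | d (-(c ⬝ᵥ η) • s + ∑ i, c i • x i) = 1} : Finset (Fin 6 → ZMod 3)) |
        g c = g c₀} : Finset _) = univ.image fun (t : ZMod 3) i => c₀ i + t := by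
      ext c
      simp only [mem_filter, mem_univ, true_and, mem_image]
      constructor
      · rintro ⟨-, hc⟩
        refine ⟨c 0 - c₀ 0, funext fun i => ?_⟩
        rw [← hker c c₀ hc i]
        ring
      · rintro ⟨t, rfl⟩
        have := hshift c₀ t
        refine ⟨?_, this⟩
        change d (g _) = 1
        rw [this]
        exact hv.1
    rw [this, card_image_of_injective _ fun t t' htt => add_left_cancel (congrFun htt 0)]
    rfl
  have hk := kerSum_eq ({v | d v = 1} : Finset V) f
  rw [(card_eq h).2] at hk
  rw [hcount]
  push_cast at hk
  rcases kerSum_cases h f hf0 with h1 | h1 <;> omega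

theorem isLabelling_lineLabel (h : TranslationDistance quotientArray d) (hs : d s = 1)
    {x : Fin 6 → V} (hsum : ∑ i, x i = 0)
    (hrel : ∀ (c : Fin 6 → ZMod 3) (k : ZMod 3), ∑ i, c i • x i = k • s → ∀ i, c i = c 0)
    (hmult : ∀ c : Fin 6 → ZMod 3, (∃ i, c i ≠ c 0) → lineCount d s (∑ i, c i • x i) = mult c) :
    IsLabelling (lineLabel d s x) where
  neg c := by
    have h1 : linePositions d s (∑ i, (-c) i • x i) =
        (linePositions d s (∑ i, c i • x i)).map (Equiv.neg _).toEmbedding := by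
      ext k
      rw [mem_map_equiv]
      simp only [linePositions, mem_filter, mem_univ, true_and, Equiv.neg_symm, Equiv.neg_apply,
        Pi.neg_apply, neg_smul, sum_neg_distrib]
      rw [← h.neg, neg_add, neg_neg]
    rw [lineLabel, lineLabel, mult_neg, h1, sum_map, ← mul_neg, ← sum_neg_distrib]
    rfl
  add_one c := by
    have h1 : ∑ i, (c + 1) i • x i = ∑ i, c i • x i := by
      simp only [Pi.add_apply, Pi.one_apply, add_smul, one_smul, sum_add_distrib, hsum, add_zero]
    rw [lineLabel, lineLabel, mult_add_one, h1]
  sum_weight _ hη := sum_weight_lineLabel h hs hsum hrel hmult hη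

theorem not_translationDistance (h : TranslationDistance quotientArray d) : False := by
  obtain ⟨s, x, hs, hsum, hrel, hmult⟩ := exists_frame h
  exact not_isLabelling _ (isLabelling_lineLabel h hs hsum hrel hmult)

end Array140

/-! ### Passage to the antipodal quotient -/

namespace Array140

/-- The distance in the antipodal quotient. -/
def foldDist : ℕ → ℕ
  | 0 => 0
  | 1 => 1
  | 2 => 2
  | 3 => 1
  | _ => 0

theorem foldDist_eq_one {n : ℕ} : foldDist n = 1 ↔ n = 1 ∨ n = 3 := by
  rcases n with _ | _ | _ | _ | n <;> simp [foldDist]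

theorem foldDist_eq_two {n : ℕ} : foldDist n = 2 ↔ n = 2 := by
  rcases n with _ | _ | _ | _ | n <;> simp [foldDist]

theorem foldDist_le (n : ℕ) : foldDist n ≤ 2 := by
  rcases n with _ | _ | _ | _ | n <;> simp [foldDist]

theorem foldDist_eq_zero {n : ℕ} (hn : n ≤ 4) : foldDist n = 0 ↔ n = 0 ∨ n = 4 := by
  rcases n with _ | _ | _ | _ | n <;> simp [foldDist]
  omega

/-- The distance-regular array with an antipodal quotient of order `3 ^ 6`. -/
abbrev coverArray : IntersectionArray := ⟨[140, 126, 20, 1], [1, 10, 126, 140]⟩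

variable {V : Type*} [AddCommGroup V] [Fintype V] {d : V → ℕ} {z : V}

theorem card_classes (h : TranslationDistance coverArray d) :
    Fintype.card V = 3 ^ 7 ∧ #{v | d v = 1} = 140 ∧ #{v | d v = 2} = 1764 ∧ #{v | d v = 4} = 2 := by
  have h1 : #{v | d v = 1} = 140 := h.card_one
  have h2 := h.card_class_mul 1
  have h3 := h.card_class_mul 2
  have h4 := h.card_class_mul 3
  have h5 := h.card_eq_sum
  have h0 := h.card_class_zero
  simp only [IntersectionArray.bNum, IntersectionArray.cNum, h1] at h2 h3 h4
  norm_num at h2 h3 h4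
  simp only [sum_range_succ, range_zero, sum_empty, List.length_cons, List.length_nil, h0, h1] at h5
  norm_num
  omega

/-- Since c_4 = 140 = b_0, all neighbours of an antipode of 0 are at distance three. -/
theorem add_antipode (h : TranslationDistance coverArray d) (hz : d z = 4) {s : V} (hs : d s = 1) :
    d (z + s) = 3 := by
  have h1 := h.card_c z
  rw [hz] at h1
  have h2 : ({s | d s = 1 ∧ d (z + s) + 1 = 4} : Finset V) = ({s | d s = 1} : Finset V) := by
    refine eq_of_subset_of_card_le (fun s hs => ?_) ?_
    · rw [mem_filter] at hs ⊢
      exact ⟨hs.1, hs.2.1⟩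
    · rw [(card_classes h).2.1, h1]
      rfl
  have h3 : s ∈ ({s | d s = 1 ∧ d (z + s) + 1 = 4} : Finset V) := by
    rw [h2]
    simpa using hs
  rw [mem_filter] at h3
  omega

variable [Module (ZMod 3) V]

theorem eq_antipode (h : TranslationDistance coverArray d) (hz : d z = 4) {v : V} (hv : d v = 4) :
    v = z ∨ v = -z := by
  classical
  have hne : z ≠ -z := fun h0 => by
    have h1 := neg_sub_self_eq z
    rw [← h0, sub_self] at h1
    rw [← h1, h.map_zero] at hz
    omega
  have h1 : ({z, -z} : Finset V) = ({v | d v = 4} : Finset V) := by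
    refine eq_of_subset_of_card_le (fun v hv => ?_) ?_
    · rw [mem_insert, mem_singleton] at hv
      rcases hv with rfl | rfl
      · simpa using hz
      · simpa [h.neg] using hz
    · rw [(card_classes h).2.2.2, card_pair hne]
  have h2 : v ∈ ({z, -z} : Finset V) := by
    rw [h1]
    simpa using hv
  simpa using h2

/-- Since b_3 = 1, a vector at distance three has a neighbour at distance four, and this is z or -z.
-/
theorem exists_of_three (h : TranslationDistance coverArray d) (hz : d z = 4) {v : V}
    (hv : d v = 3) : ∃ s, d s = 1 ∧ (v = z + s ∨ v = -z + s) := by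
  have h1 := h.card_b v
  rw [hv] at h1
  obtain ⟨s, hs⟩ := card_pos.mp (h1 ▸ (by decide : 0 < coverArray.bNum 3))
  rw [mem_filter] at hs
  refine ⟨-s, by rw [h.neg, hs.2.1], ?_⟩
  rcases eq_antipode h hz hs.2.2 with h2 | h2
  · exact Or.inl (by rw [← h2]; abel)
  · exact Or.inr (by rw [← h2]; abel)

theorem foldDist_add (h : TranslationDistance coverArray d) (hz : d z = 4) (v : V) :
    foldDist (d (v + z)) = foldDist (d v) := by
  have hz' : d (-z) = 4 := by rw [h.neg, hz]
  have h2z : z + z = -z := by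
    rw [← neg_sub_self_eq (-z)]
    abel
  have key : ∀ v, d v ≠ 2 → foldDist (d (v + z)) = foldDist (d v) := by
    intro v hv
    have hle : d v ≤ 4 := h.le v
    have hcases : d v = 0 ∨ d v = 1 ∨ d v = 3 ∨ d v = 4 := by omega
    rcases hcases with h0 | h0 | h0 | h0
    · rw [(h.eq_zero_iff v).mp h0, zero_add, h.map_zero, hz]
      rfl
    · rw [add_comm, add_antipode h hz h0, h0]
      rfl
    · obtain ⟨s, hs, rfl | rfl⟩ := exists_of_three h hz h0
      · rw [h0, add_right_comm, h2z, add_antipode h hz' hs]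
      · rw [h0, neg_add_eq_sub, sub_add_cancel, hs]
        rfl
    · rcases eq_antipode h hz h0 with rfl | rfl
      · rw [h2z, h.neg]
      · rw [neg_add_cancel, h.map_zero, h0]
        rfl
  -- The classes other than distance two are handled by `key`. If v + z left distance two, then so
  -- would v + 2z and, after one more step, v itself.
  by_cases hv : d v = 2
  · by_contra hne
    have h1 : d (v + z) ≠ 2 := fun h2 => hne (by rw [h2, hv])
    have h2 := key _ h1
    have h3 : d (v + z + z) ≠ 2 := fun h3 => by
      rw [h3] at h2
      exact h1 (foldDist_eq_two.mp h2.symm)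
    have h4 := key _ h3
    rw [add_assoc (v + z), h2z, add_neg_cancel_right] at h4
    exact hne (by rw [← h2, h4])
  · exact key v hv

theorem foldDist_add_smul (h : TranslationDistance coverArray d) (hz : d z = 4) (v : V)
    (k : ZMod 3) : foldDist (d (v + k • z)) = foldDist (d v) := by
  have h3 : ∀ k : ZMod 3, k = 0 ∨ k = 1 ∨ k = -1 := by decide
  rcases h3 k with rfl | rfl | rfl
  · rw [zero_smul, add_zero]
  · rw [one_smul, foldDist_add h hz]
  · rw [neg_one_smul, foldDist_add h (by rw [h.neg, hz])]

/-- The antipodal quotient of a cover is distance-regular. -/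
theorem exists_translationDistance_quotient (h : TranslationDistance coverArray d) (hz : d z = 4)
    {U : Submodule (ZMod 3) V} (hU : U = Submodule.span (ZMod 3) {z}) [Fintype (V ⧸ U)] :
    ∃ d' : V ⧸ U → ℕ, TranslationDistance quotientArray d' := by
  classical
  have hz' : d (-z) = 4 := by rw [h.neg, hz]
  have hmk : ∀ v w : V, U.mkQ v = U.mkQ w → ∃ k : ZMod 3, v = w + k • z := by
    intro v w hvw
    rw [Submodule.mkQ_apply, Submodule.mkQ_apply, Submodule.Quotient.eq, hU,
      Submodule.mem_span_singleton] at hvw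
    obtain ⟨k, hk⟩ := hvw
    exact ⟨k, by rw [hk]; abel⟩
  have hmkz : U.mkQ z = 0 := by
    rw [Submodule.mkQ_apply, Submodule.Quotient.mk_eq_zero, hU]
    exact Submodule.mem_span_singleton_self z
  have hsurj : ∀ q : V ⧸ U, ∃ v, U.mkQ v = q := U.mkQ_surjective
  choose r hr using hsurj
  let d' : V ⧸ U → ℕ := fun q => foldDist (d (r q))
  have hd' : ∀ v, d' (U.mkQ v) = foldDist (d v) := fun v => by
    obtain ⟨k, hk⟩ := hmk _ _ (hr (U.mkQ v))
    simp only [d']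
    rw [hk, foldDist_add_smul h hz]
  have hd0 : ∀ q, d' q = 0 ↔ q = 0 := fun q => by
    obtain ⟨v, rfl⟩ := U.mkQ_surjective q
    rw [hd', foldDist_eq_zero (h.le v)]
    constructor
    · rintro (h0 | h0)
      · rw [(h.eq_zero_iff v).mp h0, map_zero]
      · rcases eq_antipode h hz h0 with rfl | rfl
        · exact hmkz
        · rw [map_neg, hmkz, neg_zero]
    · intro h0
      obtain ⟨k, hk⟩ := hmk v 0 (by rw [h0, map_zero])
      have h1 := foldDist_add_smul h hz 0 k
      rw [← hk, h.map_zero] at h1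
      exact (foldDist_eq_zero (h.le v)).mp h1
  -- Connection vectors of the cover lie in different cosets, as s + z and s - z are at distance
  -- three. A coset with folded distance one contains one of them.
  have hcard : ∀ (P : V ⧸ U → Prop) [DecidablePred P],
      #{q | d' q = 1 ∧ P q} = #{t | d t = 1 ∧ P (U.mkQ t)} := by
    intro P _
    symm
    refine card_bij (fun t _ => U.mkQ t) (fun t ht => ?_) (fun t ht t' ht' htt => ?_) fun q hq => ?_
    · rw [mem_filter] at ht ⊢
      exact ⟨mem_univ _, by rw [hd', ht.2.1]; rfl, ht.2.2⟩
    · rw [mem_filter] at ht ht'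
      obtain ⟨k, hk⟩ := hmk _ _ htt
      have h3 : ∀ k : ZMod 3, k = 0 ∨ k = 1 ∨ k = -1 := by decide
      rcases h3 k with rfl | rfl | rfl
      · rw [hk, zero_smul, add_zero]
      · have h1 := add_antipode h hz ht'.2.1
        rw [one_smul, add_comm] at hk
        rw [← hk, ht.2.1] at h1
        omega
      · have h1 := add_antipode h hz' ht'.2.1
        rw [neg_one_smul, add_comm] at hk
        rw [← hk, ht.2.1] at h1
        omega
    · rw [mem_filter] at hq
      obtain ⟨v, rfl⟩ := U.mkQ_surjective q
      rw [hd', foldDist_eq_one] at hq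
      rcases hq.2.1 with h1 | h1
      · exact ⟨v, mem_filter.mpr ⟨mem_univ _, h1, hq.2.2⟩, rfl⟩
      · obtain ⟨s, hs, hv⟩ := exists_of_three h hz h1
        have hvs : U.mkQ v = U.mkQ s := by
          rcases hv with rfl | rfl
          · rw [map_add, hmkz, zero_add]
          · rw [map_add, map_neg, hmkz, neg_zero, zero_add]
        exact ⟨s, mem_filter.mpr ⟨mem_univ _, hs, hvs ▸ hq.2.2⟩, hvs.symm⟩
  have hrep : ∀ q, ∃ v, U.mkQ v = q ∧ (d v = 0 ∨ d v = 1 ∨ d v = 2) := by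
    intro q
    obtain ⟨v, rfl⟩ := U.mkQ_surjective q
    have hv : d v ≤ 4 := h.le v
    by_cases h0 : d v ≤ 2
    · exact ⟨v, rfl, by omega⟩
    by_cases h3 : d v = 3
    · obtain ⟨s, hs, rfl | rfl⟩ := exists_of_three h hz h3
      · exact ⟨s, by rw [map_add, hmkz, zero_add], by omega⟩
      · exact ⟨s, by rw [map_add, map_neg, hmkz, neg_zero, zero_add], by omega⟩
    · refine ⟨0, ?_, Or.inl h.map_zero⟩
      rw [map_zero, eq_comm, ← hd0, hd', show d v = 4 by omega]
      rfl
  have f0 : foldDist 0 = 0 := rfl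
  have f1 : foldDist 1 = 1 := rfl
  have f2 : foldDist 2 = 2 := rfl
  have hle : ∀ q, d' q ≤ 2 := fun q => foldDist_le _
  refine ⟨d', ⟨hd0, fun q => ?_, hle, ?_, fun v s hs => ?_, fun q => ?_, fun q => ?_⟩⟩
  · obtain ⟨v, rfl⟩ := U.mkQ_surjective q
    rw [← map_neg, hd', hd', h.neg]
  · obtain ⟨v, hv⟩ := card_pos.mp (by rw [(card_classes h).2.2.1]; omega : 0 < #{v | d v = 2})
    have hv : d v = 2 := by simpa using hv
    exact ⟨U.mkQ v, by rw [hd', hv]; rfl⟩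
  · by_cases h0 : d' v = 0
    · rw [(hd0 v).mp h0, zero_add, hs]
      omega
    · have := hle (v + s)
      omega
  · obtain ⟨v, rfl, hv⟩ := hrep q
    rw [hcard fun q => d' (U.mkQ v + q) = d' (U.mkQ v) + 1]
    simp only [← map_add, hd']
    have hb := h.card_b v
    rcases hv with h0 | h0 | h0 <;> rw [h0] at hb ⊢ <;> simp only [f0, f1, f2]
    · rw [(h.eq_zero_iff v).mp h0]
      simp only [zero_add, foldDist_eq_one]
      rw [filter_congr fun t _ => show (d t = 1 ∧ (d t = 1 ∨ d t = 3)) ↔ d t = 1 by tauto]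
      exact (card_classes h).2.1
    · simp only [one_add_one_eq_two, foldDist_eq_two]
      exact hb
    · rw [filter_false_of_mem fun t _ ht => by have := foldDist_le (d (v + t)); omega]
      rfl
  · obtain ⟨v, rfl, hv⟩ := hrep q
    rw [hcard fun q => d' (U.mkQ v + q) + 1 = d' (U.mkQ v)]
    simp only [← map_add, hd']
    have hb := h.card_b v
    have hc := h.card_c v
    rcases hv with h0 | h0 | h0 <;> rw [h0] at hb hc ⊢ <;> simp only [f0, f1, f2]
    · rw [filter_false_of_mem fun t _ ht => by omega]
      rfl
    · rw [filter_congr fun t _ => show (d t = 1 ∧ foldDist (d (v + t)) + 1 = 1) ↔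
        d t = 1 ∧ d (v + t) + 1 = 1 from and_congr_right fun ht => ?_]
      · exact hc
      · rw [Nat.add_eq_right, Nat.add_eq_right, foldDist_eq_zero (h.le _)]
        have := h.add_le v t ht
        omega
    -- Neighbours at distance one in the quotient come from distances 1 and 3 in the cover: 10 + 20
    -- = 30.
    · rw [filter_congr fun t _ => show (d t = 1 ∧ foldDist (d (v + t)) + 1 = 2) ↔
        (d t = 1 ∧ d (v + t) = 3) ∨ (d t = 1 ∧ d (v + t) + 1 = 2) by
          rw [show foldDist (d (v + t)) + 1 = 2 ↔ foldDist (d (v + t)) = 1 by omega,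
            foldDist_eq_one]
          omega, filter_or, card_union_of_disjoint, hb, hc]
      · rfl
      · rw [disjoint_left]
        intro t ht ht'
        rw [mem_filter] at ht ht'
        omega

end Array140

theorem noTranslationDistance_140_126_20_1 :
    NoTranslationDistance ⟨[140, 126, 20, 1], [1, 10, 126, 140]⟩ := by
  intro p hp V _ _ hV d h
  obtain rfl : p = 3 := TranslationDistance.eq_of_card_eq_prime_pow hp Nat.prime_three
    (by norm_num) hV (Array140.card_classes h).1
  let _ : Module (ZMod 3) V := AddCommGroup.zmodModule hV
  obtain ⟨z, hz⟩ := h.exists_eq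
  have : Fintype (V ⧸ Submodule.span (ZMod 3) {z}) := Fintype.ofFinite _
  obtain ⟨d', h'⟩ := Array140.exists_translationDistance_quotient h hz rfl
  exact Array140.not_translationDistance h'

end DRG

/-! ### Assembly of the fourteen arrays -/

namespace DRG

theorem noTranslationDistance_of_mem_openArrays {A : IntersectionArray} (hA : A ∈ openArrays) :
    NoTranslationDistance A := by
  simp only [openArrays, List.mem_cons, List.not_mem_nil, or_false] at hA
  rcases hA with rfl | rfl | rfl | rfl | rfl | rfl | rfl | rfl | rfl | rfl | rfl | rfl | rfl | rfl
  · exact noTranslationDistance_140_126_20_1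
  · exact noTranslationDistance_22_16_5
  · exact noTranslationDistance_25_24_3
  · exact noTranslationDistance_26_24_19
  · exact noTranslationDistance_32_28_9
  · exact noTranslationDistance_36_28_4
  · exact noTranslationDistance_42_30_12
  · exact noTranslationDistance_44_36_5
  · exact noTranslationDistance_48_35_9
  · exact noTranslationDistance_52_42_16
  · exact noTranslationDistance_56_42_20
  · exact noTranslationDistance_63_48_10
  · exact noTranslationDistance_80_63_11
  · exact noTranslationDistance_104_66_8

end DRG

theorem mainTheorem1 (A : DRG.IntersectionArray) (hA : A ∈ DRG.openArrays) :
    (∀ (p : ℕ), p.Prime → ∀ (V : Type*) [AddCommGroup V] [Finite V],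
      (∀ x : V, p • x = 0) →
      ∀ S : Set V, (∀ s ∈ S, -s ∈ S) → (0 : V) ∉ S →
        ¬ DRG.IsDistanceRegularWith (SimpleGraph.addCayley S) A) ∧
    (∀ (F : Type*) [Field F] [Finite F] [DecidableEq F] (n : ℕ)
      (C : AddSubgroup (Fin n → F)),
        ¬ DRG.IsDistanceRegularWith (DRG.cosetGraph C) A) ∧
    (∀ (F : Type*) [Field F] [Finite F] [DecidableEq F] (n : ℕ)
      (C : AddSubgroup (Fin n → F)),
        ¬ DRG.IsCompletelyRegularWith (DRG.hammingGraph n F) (C : Set (Fin n → F)) A) := by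
  have hb : A.b ≠ [] ∧ A.cNum 1 = 1 := by
    simp only [DRG.openArrays, List.mem_cons, List.not_mem_nil, or_false] at hA
    rcases hA with rfl | rfl | rfl | rfl | rfl | rfl | rfl | rfl | rfl | rfl | rfl | rfl | rfl | rfl
      <;> exact ⟨by simp, rfl⟩
  exact ⟨fun p hp V _ _ hV S _ _ => DRG.not_isDistanceRegularWith_addCayley
      (DRG.noTranslationDistance_of_mem_openArrays hA) hp hV S,
    fun F _ _ _ n C => DRG.not_isDistanceRegularWith_cosetGraph
      (DRG.noTranslationDistance_of_mem_openArrays hA) C,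
    fun F _ _ _ n C => DRG.not_isCompletelyRegularWith_hammingGraph hb.1 hb.2
      (DRG.noTranslationDistance_of_mem_openArrays hA) C⟩
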